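/- Setting. Let $\mathcal G$ be a numerably proper topological groupoid with object space $Z$ (that is, there is a continuous left-invariant family of Radon probability measures on the fibres of the range map $r$, supported in a closed set on which $r$ is proper), let $\mathrm F$ be a $\mathbb Z$-graded multiplicative $\mathcal G$-equivariant cohomology theory on pairs of $\mathcal G$-spaces, and let $X$, $Y$ be $\mathcal G$-spaces. All spaces are paracompact Hausdorff and all vector bundles are real and of bounded rank. For a $\mathcal G$-map $M\to X$, $\mathrm F^*_X(M)=\varinjlim_A \mathrm F^*(M,M\setminus A)$, where $A$ runs through the open $\mathcal G$-invariant subsets whose closure maps properly to $X$. An $\mathrm F$-orientation of a $\mathcal G$-vector bundle $V$ over $M$ is a class in $\mathrm F_M^{\dim V}(|V|)$ all of whose pull-backs induce Thom isomorphisms $\tau$; we write $|V|$ and $\pi_V$ for the total space and the bundle projection. A bundle over $M$ is called subtrivial if it is a direct summand of $E^M$ for some $\mathrm F$-oriented $\mathcal G$-vector bundle $E$ over $Z$, where $E^M$ denotes the pull-back of $E$ to $M$. An $\mathrm F$-oriented normally non-singular map $f=(V,E,\hat f)$ from $M$ to $Y$ consists of an $\mathrm F$-oriented subtrivial $\mathcal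 G$-vector bundle $V$ over $M$, an $\mathrm F$-oriented $\mathcal G$-vector bundle $E$ over $Z$, and an equivariant open embedding $\hat f\colon |V|\hookrightarrow |E^Y|$. It is a special normally non-singular submersion if $V=0$ with its canonical orientation. Its lifting along an $\mathrm F$-oriented $E_+$ over $Z$ is $(V\oplus E_+^M,E\oplus E_+,\hat f\times_Z\mathrm{id})$. Two such maps are equivalent if they have isotopic liftings (up to isomorphism). A correspondence from $X$ to $Y$ is a quadruple $(M,b,f,\xi)$ with a $\mathcal G$-space $M$, a $\mathcal G$-map $b\colon M\to X$, an $\mathrm F$-oriented normally non-singular map $f$ from $M$ to $Y$, and $\xi\in \mathrm F^*_X(M)$. A bordism is a quadruple $(W,b,f,\xi)$ of the same kind with $f=(V,E,\hat f)$ a normally non-singular map from $W$ to $Y\times[0,1]$, such that there are subsets $\partial_jW\subseteq W$ with $\hat f^{-1}(|E^Y|\times\{j\})=\pi_V^{-1}(\partial_jW)$ for $j=0,1$; its restrictions to $\partial_0W$ and $\partial_1W$ are called bordant. The Thom modification of $(M,b,f,\xi)$ along an $\mathrm F$-oriented subtrivial $\mathcal G$-vector bundle $V$ over $M$ is $(|V|,b\circ\pi_V,f\circ\pi_V,\tau_V(\xi))$.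 Here $\pi_V$ is viewed as the normally non-singular map $(\pi_V^*V^\perp,E_2,|V\oplus V^\perp|\cong|E_2^M|)$ for an oriented complement $V\oplus V^\perp\cong E_2^M$; composites are composites of $\mathrm F$-oriented normally non-singular maps. Equivalence of correspondences is the equivalence relation generated by isomorphism, equivalence of normally non-singular maps, bordism, and Thom modification. A correspondence or a bordism is special if its map $f$ is a special normally non-singular submersion. Special correspondences are, up to isomorphism, quadruples $(E,M,b,\xi)$ with $E$ an $\mathrm F$-oriented $\mathcal G$-vector bundle over $Z$ and $M\subseteq|E^Y|$ open. For an $\mathrm F$-oriented $\mathcal G$-vector bundle $U$ over $Z$, the Thom modification of $\Psi=(E,M,b,\xi)$ by $U$ is the special correspondence $\Psi^U=(E\oplus U,\,M\times_Z|U|,\,b\circ\pi_{U^M},\,\tau_{U^M}(\xi))$. Two special correspondences are specially bordant if they are the two boundaries of one special bordism. Theorem. (1) Every correspondence from $X$ to $Y$ is equivalent to a special correspondence. (2) Two special correspondences $\Psi_1$, $\Psi_2$ from $X$ to $Y$ are equivalent if and only if there are $\mathrm F$-oriented $\mathcal G$-vector bundles $U_1$, $U_2$ over $Z$ such that $\Psi_1^{U_1}$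 and $\Psi_2^{U_2}$ are specially bordant. -/

import Mathlib

open Topology Set

universe u v

namespace NNSCorr

noncomputable section

/-! ## Topological groupoids, `G`-spaces and `G`-maps -/

/-- A topological groupoid with paracompact Hausdorff spaces of objects and of arrows.  An arrow
`g` goes from `s g` to `r g`; `mul g h` is defined when `s g = r h`. -/
structure TopGroupoid where
  Obj : Type u
  Arr : Type u
  [topObj : TopologicalSpace Obj]
  [t2Obj : T2Space Obj]
  [paraObj : ParacompactSpace Obj]
  [topArr : TopologicalSpace Arr]
  [t2Arr : T2Space Arr]
  [paraArr : ParacompactSpace Arr]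
  r : Arr → Obj
  s : Arr → Obj
  one : Obj → Arr
  inv : Arr → Arr
  mul : (g h : Arr) → s g = r h → Arr
  continuous_r : Continuous r
  continuous_s : Continuous s
  continuous_one : Continuous one
  continuous_inv : Continuous inv
  continuous_mul : Continuous fun p : {p : Arr × Arr // s p.1 = r p.2} => mul p.1.1 p.1.2 p.2
  r_one : ∀ z, r (one z) = z
  s_one : ∀ z, s (one z) = z
  r_inv : ∀ g, r (inv g) = s g
  s_inv : ∀ g, s (inv g) = r g
  r_mul : ∀ g h e, r (mul g h e) = r g
  s_mul : ∀ g h e, s (mul g h e) = s h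
  one_mul : ∀ g, mul (one (r g)) g (s_one _) = g
  mul_one : ∀ g, mul g (one (s g)) (r_one _).symm = g
  inv_mul : ∀ g, mul (inv g) g (s_inv g) = one (s g)
  mul_inv : ∀ g, mul g (inv g) (r_inv g).symm = one (r g)
  mul_assoc : ∀ g h k (e₁ : s g = r h) (e₂ : s h = r k),
    mul (mul g h e₁) k ((s_mul g h e₁).trans e₂) = mul g (mul h k e₂) (e₁.trans (r_mul h k e₂).symm)

attribute [instance] TopGroupoid.topObj TopGroupoid.t2Obj TopGroupoid.paraObj
  TopGroupoid.topArr TopGroupoid.t2Arr TopGroupoid.paraArr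

/-- `G` is numerably proper: there is a continuous left-invariant family of Radon probability
measures `μ z` on the fibres of the range map whose supports all lie in one closed set `K` on which
the range map is proper.  As the sets `K ∩ r⁻¹(z)` are compact, the measures are given as positive
normalised linear functionals on continuous functions (Riesz).  A Haar system multiplied by a
cut-off function is such a family. -/
def TopGroupoid.NumerablyProper (G : TopGroupoid.{u}) : Prop :=
  ∃ (μ : G.Obj → C(G.Arr, ℝ) →ₗ[ℝ] ℝ) (K : Set G.Arr),
    IsClosed K ∧ IsProperMap (fun g : K => G.r g) ∧
    (∀ z φ, (∀ g, 0 ≤ φ g) → 0 ≤ μ z φ) ∧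
    (∀ z, μ z 1 = 1) ∧
    (∀ z φ, (∀ g ∈ K, G.r g = z → φ g = 0) → μ z φ = 0) ∧
    (∀ φ, Continuous fun z => μ z φ) ∧
    (∀ (g : G.Arr) (φ ψ : C(G.Arr, ℝ)), (∀ h (e : G.s g = G.r h), φ (G.mul g h e) = ψ h) →
      μ (G.r g) φ = μ (G.s g) ψ)

/-- A `G`-space: a paracompact Hausdorff space with an anchor map and a continuous action. -/
structure GSpace (G : TopGroupoid.{u}) where
  carrier : Type u
  [top : TopologicalSpace carrier]
  [t2 : T2Space carrier]
  [para : ParacompactSpace carrier]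
  anchor : carrier → G.Obj
  continuous_anchor : Continuous anchor
  act : (g : G.Arr) → (x : carrier) → G.s g = anchor x → carrier
  anchor_act : ∀ g x e, anchor (act g x e) = G.r g
  one_act : ∀ x, act (G.one (anchor x)) x (G.s_one _) = x
  mul_act : ∀ g h x (e₁ : G.s g = G.r h) (e₂ : G.s h = anchor x),
    act (G.mul g h e₁) x ((G.s_mul g h e₁).trans e₂) =
      act g (act h x e₂) (e₁.trans (anchor_act h x e₂).symm)
  continuous_act : Continuous fun p : {p : G.Arr × carrier // G.s p.1 = anchor p.2} =>
    act p.1.1 p.1.2 p.2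

variable {G : TopGroupoid.{u}}

instance : CoeSort (GSpace G) (Type u) := ⟨GSpace.carrier⟩

attribute [instance] GSpace.top GSpace.t2 GSpace.para

/-- A `G`-map: a continuous equivariant map. -/
structure GMap (X Y : GSpace G) where
  toFun : X → Y
  continuous : Continuous toFun
  anchor_map : ∀ x, Y.anchor (toFun x) = X.anchor x
  map_act : ∀ g x (e : G.s g = X.anchor x),
    toFun (X.act g x e) = Y.act g (toFun x) (e.trans (anchor_map x).symm)

instance (X Y : GSpace G) : CoeFun (GMap X Y) (fun _ => X → Y) := ⟨GMap.toFun⟩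

def GMap.id (X : GSpace G) : GMap X X where
  toFun x := x
  continuous := continuous_id
  anchor_map _ := rfl
  map_act _ _ _ := rfl

def GMap.comp {X Y W : GSpace G} (f : GMap Y W) (g : GMap X Y) : GMap X W where
  toFun x := f (g x)
  continuous := f.continuous.comp g.continuous
  anchor_map x := (f.anchor_map _).trans (g.anchor_map x)
  map_act a x e := by rw [g.map_act, f.map_act]

/-- The object space as a `G`-space. -/
def GSpace.base (G : TopGroupoid.{u}) : GSpace G where
  carrier := G.Obj
  anchor z := z
  continuous_anchor := continuous_id
  act g _ _ := G.r g
  anchor_act _ _ _ := rfl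
  one_act z := G.r_one z
  mul_act g h _ e _ := G.r_mul g h e
  continuous_act := G.continuous_r.comp (continuous_fst.comp continuous_subtype_val)

def GSpace.IsInvariant (X : GSpace G) (A : Set X) : Prop :=
  ∀ g x e, x ∈ A → X.act g x e ∈ A

/-- Closed `G`-invariant subsets. -/
structure ClosedInv (X : GSpace G) where
  carrier : Set X
  closed : IsClosed carrier
  inv : X.IsInvariant carrier

namespace ClosedInv

def empty (X : GSpace G) : ClosedInv X := ⟨∅, isClosed_empty, fun _ _ _ h => h.elim⟩

def union {X : GSpace G} (A B : ClosedInv X) : ClosedInv X :=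
  ⟨A.carrier ∪ B.carrier, A.closed.union B.closed,
    fun g x e h => h.imp (A.inv g x e) (B.inv g x e)⟩

def preimage {X Y : GSpace G} (f : GMap X Y) (B : ClosedInv Y) : ClosedInv X :=
  ⟨f ⁻¹' B.carrier, B.closed.preimage f.continuous, fun g x e h => by
    simp only [mem_preimage] at h ⊢
    rw [f.map_act]
    exact B.inv _ _ _ h⟩

/-- A closed invariant subset as a `G`-space. -/
def toGSpace {X : GSpace G} (A : ClosedInv X) : GSpace G where
  carrier := A.carrier
  para := A.closed.isClosedEmbedding_subtypeVal.paracompactSpace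
  anchor x := X.anchor x.1
  continuous_anchor := X.continuous_anchor.comp continuous_subtype_val
  act g x e := ⟨X.act g x.1 e, A.inv g x.1 e x.2⟩
  anchor_act g x e := X.anchor_act g x.1 e
  one_act x := Subtype.ext (X.one_act x.1)
  mul_act g h x e₁ e₂ := Subtype.ext (X.mul_act g h x.1 e₁ e₂)
  continuous_act := by
    refine Continuous.subtype_mk ?_ _
    exact X.continuous_act.comp (f := fun p : {p : G.Arr × A.carrier // G.s p.1 = X.anchor p.2.1} =>
      (⟨(p.1.1, p.1.2.1), p.2⟩ : {p : G.Arr × X // G.s p.1 = X.anchor p.2}))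
      (by fun_prop)

def incl {X : GSpace G} (A : ClosedInv X) : GMap A.toGSpace X where
  toFun x := x.1
  continuous := continuous_subtype_val
  anchor_map _ := rfl
  map_act _ _ _ := rfl

def restrict {X Y : GSpace G} (f : GMap X Y) (A : ClosedInv X) (B : ClosedInv Y)
    (h : MapsTo f A.carrier B.carrier) : GMap A.toGSpace B.toGSpace where
  toFun x := ⟨f x.1, h x.2⟩
  continuous := (f.continuous.comp continuous_subtype_val).subtype_mk _
  anchor_map x := f.anchor_map x.1
  map_act g x e := Subtype.ext (f.map_act g x.1 e)

end ClosedInv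

/-! ## Multiplicative cohomology theories -/

/-- A `ℤ`-graded multiplicative `G`-equivariant cohomology theory on pairs `(X, A)`, where `A` is a
closed invariant subset of the `G`-space `X`.  `coh X A` is the total group `⨁ₙ Fⁿ(X, A)` and
`deg X A n` its homogeneous part of degree `n`. -/
structure CohTheory (G : TopGroupoid.{u}) where
  coh : (X : GSpace G) → ClosedInv X → Type v
  [grp : ∀ X A, AddCommGroup (coh X A)]
  deg : ∀ X A, ℤ → AddSubgroup (coh X A)
  internal : ∀ X A, DirectSum.IsInternal (deg X A)
  -- functoriality
  map : ∀ {X Y : GSpace G} {A : ClosedInv X} {B : ClosedInv Y} (f : GMap X Y),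
    MapsTo f A.carrier B.carrier → (coh Y B →+ coh X A)
  map_deg : ∀ {X Y : GSpace G} {A : ClosedInv X} {B : ClosedInv Y} (f : GMap X Y)
    (h : MapsTo f A.carrier B.carrier) (n : ℤ), ∀ a ∈ deg Y B n, map f h a ∈ deg X A n
  map_id : ∀ {X : GSpace G} {A : ClosedInv X} (h : MapsTo (GMap.id X) A.carrier A.carrier)
    (a : coh X A), map (GMap.id X) h a = a
  map_comp : ∀ {X Y W : GSpace G} {A : ClosedInv X} {B : ClosedInv Y} {C : ClosedInv W}
    (f : GMap X Y) (g : GMap Y W) (hf : MapsTo f A.carrier B.carrier)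
    (hg : MapsTo g B.carrier C.carrier) (hgf : MapsTo (g.comp f) A.carrier C.carrier)
    (c : coh W C), map (g.comp f) hgf c = map f hf (map g hg c)
  -- homotopy invariance
  homotopy : ∀ {X Y : GSpace G} {A : ClosedInv X} {B : ClosedInv Y}
    (H : unitInterval → GMap X Y) (hH : ∀ t, MapsTo (H t) A.carrier B.carrier),
    Continuous (fun p : X × unitInterval => H p.2 p.1) → ∀ b, map (H 0) (hH 0) b = map (H 1) (hH 1) b
  -- the long exact sequence of a pair
  delta : ∀ {X : GSpace G} (A : ClosedInv X),
    coh A.toGSpace (ClosedInv.empty _) →+ coh X A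
  delta_deg : ∀ {X : GSpace G} (A : ClosedInv X) (n : ℤ), ∀ a ∈ deg _ _ n,
    delta A a ∈ deg X A (n + 1)
  delta_nat : ∀ {X Y : GSpace G} (A : ClosedInv X) (B : ClosedInv Y) (f : GMap X Y)
    (h : MapsTo f A.carrier B.carrier) (b : coh B.toGSpace (ClosedInv.empty _)),
    map f h (delta B b) = delta A (map (A := ClosedInv.empty _)
      (ClosedInv.restrict f A B h) (fun _ hx => hx.elim) b)
  exact_rel : ∀ {X : GSpace G} (A : ClosedInv X), Function.Exact
    (map (A := ClosedInv.empty X) (B := A) (GMap.id X) (fun _ hx => hx.elim))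
    (map (A := ClosedInv.empty _) (B := ClosedInv.empty X) A.incl (fun _ hx => hx.elim))
  exact_abs : ∀ {X : GSpace G} (A : ClosedInv X), Function.Exact
    (map (A := ClosedInv.empty _) (B := ClosedInv.empty X) A.incl (fun _ hx => hx.elim))
    (delta A)
  exact_sub : ∀ {X : GSpace G} (A : ClosedInv X), Function.Exact
    (delta A)
    (map (A := ClosedInv.empty X) (B := A) (GMap.id X) (fun _ hx => hx.elim))
  -- excision: removing the open set `Cᶜ`, whose closure lies in the interior of `A`
  excision : ∀ {X : GSpace G} (A C : ClosedInv X), closure C.carrierᶜ ⊆ interior A.carrier →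
    Function.Bijective (map (A := A.preimage C.incl) (B := A) C.incl (fun _ hx => hx))
  -- products
  one : ∀ X : GSpace G, coh X (ClosedInv.empty X)
  one_deg : ∀ X, one X ∈ deg X _ 0
  map_one : ∀ {X Y : GSpace G} (f : GMap X Y)
    (h : MapsTo f (ClosedInv.empty X).carrier (ClosedInv.empty Y).carrier), map f h (one Y) = one X
  cup : ∀ {X : GSpace G} {A B : ClosedInv X}, coh X A →+ coh X B →+ coh X (A.union B)
  cup_deg : ∀ {X : GSpace G} {A B : ClosedInv X} (m n : ℤ), ∀ a ∈ deg X A m, ∀ b ∈ deg X B n,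
    cup a b ∈ deg X (A.union B) (m + n)
  map_cup : ∀ {X Y : GSpace G} {A B : ClosedInv X} {A' B' : ClosedInv Y} (f : GMap X Y)
    (hA : MapsTo f A.carrier A'.carrier) (hB : MapsTo f B.carrier B'.carrier)
    (h : MapsTo f (A.union B).carrier (A'.union B').carrier) (a : coh Y A') (b : coh Y B'),
    map f h (cup a b) = cup (map f hA a) (map f hB b)
  cup_assoc : ∀ {X : GSpace G} {A B C : ClosedInv X}
    (h : MapsTo (GMap.id X) (A.union (B.union C)).carrier ((A.union B).union C).carrier)
    (a : coh X A) (b : coh X B) (c : coh X C),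
    map (GMap.id X) h (cup (cup a b) c) = cup a (cup b c)
  cup_comm : ∀ {X : GSpace G} {A B : ClosedInv X}
    (h : MapsTo (GMap.id X) (A.union B).carrier (B.union A).carrier) (m n : ℤ),
    ∀ a ∈ deg X A m, ∀ b ∈ deg X B n,
    cup a b = (m * n).negOnePow • map (GMap.id X) h (cup b a)
  one_cup : ∀ {X : GSpace G} {A : ClosedInv X}
    (h : MapsTo (GMap.id X) A.carrier ((ClosedInv.empty X).union A).carrier) (a : coh X A),
    map (GMap.id X) h (cup (one X) a) = a
  delta_cup : ∀ {X : GSpace G} (A : ClosedInv X)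
    (h : MapsTo (GMap.id X) A.carrier (A.union (ClosedInv.empty X)).carrier)
    (h' : MapsTo (GMap.id A.toGSpace) (ClosedInv.empty _).carrier
      ((ClosedInv.empty A.toGSpace).union (ClosedInv.empty A.toGSpace)).carrier)
    (a : coh A.toGSpace (ClosedInv.empty _)) (b : coh X (ClosedInv.empty X)),
    delta A (map (GMap.id _) h' (cup a (map (A := ClosedInv.empty _) A.incl (fun _ hx => hx.elim) b)))
      = map (GMap.id X) h (cup (delta A a) b)

attribute [instance] CohTheory.grp

/-! ## Cohomology with `X`-compact support -/

/-- Open invariant subsets of `M` whose closure is `X`-compact, that is, maps properly to `X`. -/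
structure RelCpt {M X : GSpace G} (b : GMap M X) where
  carrier : Set M
  isOpen : IsOpen carrier
  inv : M.IsInvariant carrier
  proper : IsProperMap fun m : closure carrier => b m

theorem act_inv_act (X : GSpace G) (g : G.Arr) (x : X) (e : G.s g = X.anchor x) :
    X.act (G.inv g) (X.act g x e) ((G.s_inv g).trans (X.anchor_act g x e).symm) = x := by
  have h := X.mul_act (G.inv g) g x (G.s_inv g) e
  rw [← h]
  have h1 : ∀ (k : G.Arr) (hk : G.s k = X.anchor x), k = G.one (X.anchor x) → X.act k x hk = x := by
    intro k hk hk'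
    subst hk'
    exact X.one_act x
  apply h1
  rw [G.inv_mul, e]

namespace RelCpt

variable {M X : GSpace G} {b : GMap M X}

instance : Preorder (RelCpt b) := Preorder.lift RelCpt.carrier

/-- The complement, a closed invariant subset. -/
def compl (A : RelCpt b) : ClosedInv M :=
  ⟨A.carrierᶜ, A.isOpen.isClosed_compl, fun g x e hx hgx => hx (by
    have := A.inv (G.inv g) _ ((G.s_inv g).trans (M.anchor_act g x e).symm) hgx
    rwa [act_inv_act] at this)⟩

theorem compl_mono {A B : RelCpt b} (h : A ≤ B) :
    MapsTo (GMap.id M) B.compl.carrier A.compl.carrier :=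
  fun _ hx hx' => hx (h hx')

end RelCpt

variable (F : CohTheory.{u, v} G)

/-- The structure map `F(M, M ∖ A) → F(M, M ∖ B)` for `A ⊆ B`. -/
def CohTheory.trans {M X : GSpace G} {b : GMap M X} (A B : RelCpt b) (h : A ≤ B) :
    F.coh M A.compl →+ F.coh M B.compl :=
  F.map (GMap.id M) (RelCpt.compl_mono h)

open Classical in
/-- `F_X(M)`, the `F`-cohomology of `M` with `X`-compact support with respect to `b : M → X`: the
inductive limit of `F(M, M ∖ A)` over the open invariant `A` with `X`-compact closure. -/
def CohTheory.CohC {M X : GSpace G} (b : GMap M X) : Type (max u v) :=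
  AddCommGroup.DirectLimit (fun A : RelCpt b => F.coh M A.compl) (F.trans)

open Classical in
instance {M X : GSpace G} (b : GMap M X) : AddCommGroup (F.CohC b) :=
  inferInstanceAs (AddCommGroup (AddCommGroup.DirectLimit _ _))

open Classical in
/-- The canonical map `F(M, M ∖ A) → F_X(M)`. -/
def CohTheory.of {M X : GSpace G} {b : GMap M X} (A : RelCpt b) :
    F.coh M A.compl →+ F.CohC b :=
  AddCommGroup.DirectLimit.of (fun A : RelCpt b => F.coh M A.compl) (F.trans) A

open Classical in
/-- The universal property of the inductive limit. -/
def CohTheory.lift {M X : GSpace G} {b : GMap M X} {P : Type*} [AddCommGroup P]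
    (φ : ∀ A : RelCpt b, F.coh M A.compl →+ P)
    (hφ : ∀ A B h x, φ B (F.trans A B h x) = φ A x) : F.CohC b →+ P :=
  AddCommGroup.DirectLimit.lift _ _ P φ hφ

theorem CohTheory.of_trans {M X : GSpace G} {b : GMap M X} (A B : RelCpt b) (h : A ≤ B)
    (x : F.coh M A.compl) : F.of B (F.trans A B h x) = F.of A x := by
  classical
  exact AddCommGroup.DirectLimit.of_f (G := fun A : RelCpt b => F.coh M A.compl) (f := F.trans) h x

@[simp]
theorem CohTheory.lift_of {M X : GSpace G} {b : GMap M X} {P : Type*} [AddCommGroup P]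
    (φ : ∀ A : RelCpt b, F.coh M A.compl →+ P)
    (hφ : ∀ A B h x, φ B (F.trans A B h x) = φ A x) (A : RelCpt b) (x : F.coh M A.compl) :
    F.lift φ hφ (F.of A x) = φ A x := by
  classical
  exact AddCommGroup.DirectLimit.lift_of P φ hφ A x

theorem CohTheory.hom_ext {M X : GSpace G} {b : GMap M X} {P : Type*} [AddCommGroup P]
    {φ ψ : F.CohC b →+ P} (h : ∀ A x, φ (F.of A x) = ψ (F.of A x)) : φ = ψ := by
  classical
  exact AddCommGroup.DirectLimit.hom_ext P (fun A => AddMonoidHom.ext (h A))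

theorem CohTheory.trans_refl {M X : GSpace G} {b : GMap M X} (A : RelCpt b)
    (x : F.coh M A.compl) : F.trans A A le_rfl x = x :=
  F.map_id _ x

/-- Homogeneous elements of `F_X(M)` of degree `n`. -/
def CohTheory.IsDeg {M X : GSpace G} {b : GMap M X} (n : ℤ) (ξ : F.CohC b) : Prop :=
  ∃ (A : RelCpt b) (a : F.coh M A.compl), a ∈ F.deg M A.compl n ∧ ξ = F.of A a

/-! ### Pull-back -/

/-- A commuting square from `p : P → N` to `q : Q → M` such that `P → N × Q` is a closed embedding.
Both Cartesian squares, and closed embeddings `P → Q` over `N = M`, are of this form. -/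
structure Sq {P N Q M : GSpace G} (p : GMap P N) (q : GMap Q M) where
  base : GMap N M
  top : GMap P Q
  comm : ∀ x, base (p x) = q (top x)
  closedEmb : IsClosedEmbedding fun x => (p x, top x)

/-- For a square as above, the preimage of an `M`-compact subset of `Q` is `N`-compact. -/
def RelCpt.pull {P N Q M : GSpace G} {p : GMap P N} {q : GMap Q M} (σ : Sq p q) (A : RelCpt q) :
    RelCpt p where
  carrier := σ.top ⁻¹' A.carrier
  isOpen := A.isOpen.preimage σ.top.continuous
  inv g x e h := by
    simp only [mem_preimage] at h ⊢
    rw [σ.top.map_act]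
    exact A.inv _ _ _ h
  proper := by
    set K := closure (σ.top ⁻¹' A.carrier) with hK
    have hsub : ∀ x : K, σ.top x ∈ closure A.carrier := fun x =>
      map_mem_closure σ.top.continuous x.2 (fun y hy => hy)
    have h1 : IsProperMap (fun x : K => (p x, σ.top x)) :=
      (σ.closedEmb.comp isClosed_closure.isClosedEmbedding_subtypeVal).isProperMap
    have h2 : IsProperMap (fun x : K => ((p x, ⟨σ.top x, hsub x⟩) : N × closure A.carrier)) := by
      refine isProperMap_of_comp_of_inj (g := Prod.map _root_.id Subtype.val) ?_ ?_ h1 ?_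
      · exact (p.continuous.comp continuous_subtype_val).prodMk
          ((σ.top.continuous.comp continuous_subtype_val).subtype_mk _)
      · fun_prop
      · exact Function.injective_id.prodMap Subtype.val_injective
    have h3 := ((isProperMap_id (X := N)).prodMap A.proper).comp h2
    refine isProperMap_of_comp_of_inj (g := fun n => (n, σ.base n))
      (p.continuous.comp continuous_subtype_val) (continuous_id.prodMk σ.base.continuous) ?_
      (fun a b h => congrArg Prod.fst h)
    have h4 : ((fun n => (n, σ.base n)) ∘ fun x : K => p x) =
        Prod.map _root_.id (fun m : closure A.carrier => q m) ∘
          fun x : K => ((p x, ⟨σ.top x, hsub x⟩) : N × closure A.carrier) :=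
      funext fun x => Prod.ext rfl (σ.comm x)
    rw [h4]
    exact h3

/-- The pull-back map `F_M(Q) → F_N(P)` along a square. -/
def CohTheory.pull {P N Q M : GSpace G} {p : GMap P N} {q : GMap Q M} (σ : Sq p q) :
    F.CohC q →+ F.CohC p :=
  F.lift (fun A => (F.of (A.pull σ)).comp (F.map σ.top (fun _ hx => hx))) (by
    intro A B h x
    have hAB : A.pull σ ≤ B.pull σ := fun y hy => h hy
    simp only [AddMonoidHom.comp_apply]
    rw [← F.of_trans (A.pull σ) (B.pull σ) hAB]
    have hm : MapsTo σ.top (B.pull σ).compl.carrier A.compl.carrier := fun y hy hy' => hy (h hy')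
    exact congrArg (F.of (B.pull σ)) ((F.map_comp σ.top (GMap.id Q) (fun _ hx => hx)
      (RelCpt.compl_mono h) hm x).symm.trans
      (F.map_comp (GMap.id P) σ.top (RelCpt.compl_mono hAB) (fun _ hx => hx) hm x)))

/-- The square given by a closed embedding of spaces over `X`. -/
def Sq.ofClosed {P Q X : GSpace G} (p : GMap P X) (q : GMap Q X) (φ : GMap P Q)
    (hφ : IsClosedEmbedding φ) (h : ∀ x, p x = q (φ x)) : Sq p q where
  base := GMap.id X
  top := φ
  comm := h
  closedEmb := by
    refine .of_continuous_injective_isClosedMap (p.continuous.prodMk φ.continuous)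
      (fun a b hab => hφ.injective (congrArg Prod.snd hab)) ?_
    intro C hC
    have : (fun x => (p x, φ x)) '' C = {y | y.1 = q y.2} ∩ Prod.snd ⁻¹' (φ '' C) := by
      ext ⟨y, z⟩
      simp only [mem_image, Prod.mk.injEq, mem_inter_iff, mem_ofPred_eq, mem_preimage]
      constructor
      · rintro ⟨x, hx, rfl, rfl⟩
        exact ⟨h x, x, hx, rfl⟩
      · rintro ⟨h1, x, hx, rfl⟩
        exact ⟨x, hx, (h x).trans h1.symm, rfl⟩
    rw [this]
    exact (isClosed_eq continuous_fst (q.continuous.comp continuous_snd)).inter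
      ((hφ.isClosedMap C hC).preimage continuous_snd)

/-! ### Products -/

/-- If `A ⊆ Q` is relatively `X`-compact and `B ⊆ P` relatively `Q`-compact, then `p⁻¹(A) ∩ B` is
relatively `X`-compact. -/
def RelCpt.mul {P Q X : GSpace G} {p : GMap P Q} {b : GMap Q X} {c : GMap P X}
    (hc : ∀ x, c x = b (p x)) (A : RelCpt b) (B : RelCpt p) : RelCpt c where
  carrier := p ⁻¹' A.carrier ∩ B.carrier
  isOpen := (A.isOpen.preimage p.continuous).inter B.isOpen
  inv g x e h := by
    refine ⟨?_, B.inv _ _ _ h.2⟩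
    have := A.inv g (p x) (e.trans (p.anchor_map x).symm) h.1
    simp only [mem_preimage]
    rwa [p.map_act]
  proper := by
    set K := closure (p ⁻¹' A.carrier ∩ B.carrier) with hK
    have hA : ∀ x : K, p x ∈ closure A.carrier := fun x =>
      map_mem_closure p.continuous x.2 (fun y hy => hy.1)
    have hB : K ⊆ closure B.carrier := closure_mono inter_subset_right
    have h1 : IsProperMap (Set.inclusion hB) :=
      isProperMap_of_comp_of_inj (g := Subtype.val) (continuous_inclusion hB)
        continuous_subtype_val isClosed_closure.isProperMap_subtypeVal Subtype.val_injective
    have h2 : IsProperMap (fun x : K => p x) := B.proper.comp h1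
    have h3 : IsProperMap (fun x : K => (⟨p x, hA x⟩ : closure A.carrier)) :=
      isProperMap_of_comp_of_inj (g := Subtype.val)
        ((p.continuous.comp continuous_subtype_val).subtype_mk _) continuous_subtype_val h2
        Subtype.val_injective
    have h4 := A.proper.comp h3
    have : (fun x : K => c x) = fun x : K => b (p x) := funext fun x => hc x
    rw [this]
    exact h4

/-- The product `F_X(Q) × F_Q(P) → F_X(P)`, `(x, t) ↦ p^*(x) · t`, for `p : P → Q`, `b : Q → X` and
`c = b ∘ p`, on representatives. -/
def CohTheory.mulRep {P Q X : GSpace G} {p : GMap P Q} {b : GMap Q X} {c : GMap P X}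
    (hc : ∀ x, c x = b (p x)) (A : RelCpt b) (B : RelCpt p) :
    F.coh Q A.compl →+ F.coh P B.compl →+ F.CohC c :=
  (AddMonoidHom.compHom ((F.of (RelCpt.mul hc A B)).comp
    (F.map (A := (RelCpt.mul hc A B).compl) (B := (A.compl.preimage p).union B.compl) (GMap.id P)
      (fun _ hx => (not_and_or.mp hx))))).comp
    (F.cup.comp (F.map (A := A.compl.preimage p) p (fun _ hx => hx)))

theorem CohTheory.mulRep_trans {P Q X : GSpace G} {p : GMap P Q} {b : GMap Q X} {c : GMap P X}
    (hc : ∀ x, c x = b (p x)) (A A' : RelCpt b) (B B' : RelCpt p) (hA : A ≤ A') (hB : B ≤ B')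
    (x : F.coh Q A.compl) (t : F.coh P B.compl) :
    F.mulRep hc A' B' (F.trans A A' hA x) (F.trans B B' hB t) = F.mulRep hc A B x t := by
  have hAB : RelCpt.mul hc A B ≤ RelCpt.mul hc A' B' := fun y hy => ⟨hA hy.1, hB hy.2⟩
  have hm : MapsTo (GMap.id P) ((A'.compl.preimage p).union B'.compl).carrier
      ((A.compl.preimage p).union B.compl).carrier := fun y hy =>
    hy.imp (fun h h' => h (hA h')) (fun h h' => h (hB h'))
  have hp : MapsTo (GMap.id P) (A'.compl.preimage p).carrier (A.compl.preimage p).carrier :=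
    fun y hy hy' => hy (hA hy')
  have hpA : MapsTo p (A'.compl.preimage p).carrier A.compl.carrier := fun y hy hy' => hy (hA hy')
  have h1 : F.map (A := A'.compl.preimage p) p (fun _ hx => hx) (F.trans A A' hA x) =
      F.map (GMap.id P) hp (F.map (A := A.compl.preimage p) p (fun _ hx => hx) x) :=
    (F.map_comp p (GMap.id Q) _ (RelCpt.compl_mono hA) hpA x).symm.trans
      (F.map_comp (GMap.id P) p hp _ hpA x)
  simp only [mulRep, AddMonoidHom.comp_apply, AddMonoidHom.compHom_apply_apply]
  rw [← F.of_trans _ _ hAB, h1]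
  unfold CohTheory.trans
  rw [← F.map_cup (GMap.id P) hp (RelCpt.compl_mono hB) hm]
  have hf : MapsTo (GMap.id P) (RelCpt.mul hc A' B').compl.carrier
      ((A.compl.preimage p).union B.compl).carrier := fun y hy =>
    not_and_or.mp fun h => hy ⟨hA h.1, hB h.2⟩
  exact congrArg (F.of _) ((F.map_comp (GMap.id P) (GMap.id P) _ hm hf _).symm.trans
    (F.map_comp (GMap.id P) (GMap.id P) (RelCpt.compl_mono hAB) _ hf _))

/-- The product `F_Q(P) × F_X(Q) → F_X(P)`, `(t, x) ↦ p^*(x) · t`.  If `t` is the orientation class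
of a vector bundle with bundle projection `p`, then `x ↦ p^*(x) · t` is the Thom map. -/
def CohTheory.thom {P Q X : GSpace G} {p : GMap P Q} {b : GMap Q X} {c : GMap P X}
    (hc : ∀ x, c x = b (p x)) : F.CohC p →+ F.CohC b →+ F.CohC c :=
  F.lift (fun B => AddMonoidHom.flip (F.lift (fun A => F.mulRep hc A B) (by
      intro A A' h x
      ext t
      conv_lhs => rw [← F.trans_refl B t]
      exact F.mulRep_trans hc A A' B B h le_rfl x t))) (by
    intro B B' h t
    refine F.hom_ext fun A x => ?_
    simp only [AddMonoidHom.flip_apply, CohTheory.lift_of]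
    conv_lhs => rw [← F.trans_refl A x]
    exact F.mulRep_trans hc A A B B' le_rfl h x t)

/-! ## `G`-vector bundles and orientations -/

/-- A (real, locally trivial, finite-dimensional) `G`-vector bundle over `M`.  The rank is locally
constant; every arrow of `G` acts by linear maps between fibres. -/
structure GVB (M : GSpace G) where
  tot : GSpace G
  proj : GMap tot M
  [acg : ∀ x : M, AddCommGroup {v : tot // proj v = x}]
  [mod : ∀ x : M, Module ℝ {v : tot // proj v = x}]
  linear_act : ∀ g x (e : G.s g = M.anchor x), IsLinearMap ℝ
    (fun v : {v : tot // proj v = x} =>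
      (⟨tot.act g v.1 (e.trans ((congrArg M.anchor v.2).symm.trans (proj.anchor_map v.1))), by
        rw [proj.map_act]; congr 1; exact v.2⟩ : {v : tot // proj v = M.act g x e}))
  locally_trivial : ∀ x : M, ∃ U : Set M, IsOpen U ∧ x ∈ U ∧ ∃ (n : ℕ)
    (h : {v : tot // proj v ∈ U} ≃ₜ U × (Fin n → ℝ)),
    (∀ v, ((h v).1 : M) = proj v.1) ∧
    ∀ (y : M) (hy : y ∈ U), IsLinearMap ℝ
      (fun v : {v : tot // proj v = y} => (h ⟨v.1, by rw [v.2]; exact hy⟩).2)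

attribute [instance] GVB.acg GVB.mod

/-- The fibre of a vector bundle. -/
abbrev GVB.Fibre {M : GSpace G} (V : GVB M) (x : M) : Type u := {v : V.tot // V.proj v = x}

/-- A Cartesian square of vector bundles: it identifies `V'` with the pull-back of `V` along
`base : N → M`. -/
structure VBSq {N M : GSpace G} (V' : GVB N) (V : GVB M) extends Sq V'.proj V.proj where
  surj : ∀ n v, base n = V.proj v → ∃ v', V'.proj v' = n ∧ top v' = v
  linear : ∀ n, IsLinearMap ℝ (fun v : V'.Fibre n =>
    (⟨top v.1, (comm v.1).symm.trans (congrArg base v.2)⟩ : V.Fibre (base n)))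

/-- Data that identify the vector bundle `S` with the direct sum `V₁ ⊕ V₂`: the two coordinate
projections, which identify the total space of `S` with the fibre product of those of `V₁` and
`V₂`. -/
structure VBSum {M : GSpace G} (S V₁ V₂ : GVB M) where
  fst : GMap S.tot V₁.tot
  snd : GMap S.tot V₂.tot
  proj_fst : ∀ v, V₁.proj (fst v) = S.proj v
  proj_snd : ∀ v, V₂.proj (snd v) = S.proj v
  closedEmb : IsClosedEmbedding fun v => (fst v, snd v)
  surj : ∀ v₁ v₂, V₁.proj v₁ = V₂.proj v₂ → ∃ v, fst v = v₁ ∧ snd v = v₂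
  linear_fst : ∀ x, IsLinearMap ℝ (fun v : S.Fibre x =>
    (⟨fst v.1, (proj_fst v.1).trans v.2⟩ : V₁.Fibre x))
  linear_snd : ∀ x, IsLinearMap ℝ (fun v : S.Fibre x =>
    (⟨snd v.1, (proj_snd v.1).trans v.2⟩ : V₂.Fibre x))

/-- The total space of `V₁ ⊕ V₂`, as a bundle over the total space of `V₁`, is the pull-back of
`V₂`. -/
def VBSum.sq {M : GSpace G} {S V₁ V₂ : GVB M} (σ : VBSum S V₁ V₂) : Sq σ.fst V₂.proj where
  base := V₁.proj
  top := σ.snd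
  comm v := (σ.proj_fst v).trans (σ.proj_snd v).symm
  closedEmb := σ.closedEmb

/-- The product `τ₁ · τ₂` of classes on `V₁` and `V₂` as a class on `V₁ ⊕ V₂`. -/
def CohTheory.sumClass {M : GSpace G} {S V₁ V₂ : GVB M} (σ : VBSum S V₁ V₂)
    (τ₁ : F.CohC V₁.proj) (τ₂ : F.CohC V₂.proj) : F.CohC S.proj :=
  F.thom (fun v => (σ.proj_fst v).symm) (F.pull σ.sq τ₂) τ₁

/-- `τ ∈ F_M(|V|)` is an `F`-orientation (Thom class) of `V`: it has degree `dim V` (on all parts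
where the rank is constant), and for every `G`-map `N → M` the pull-back of `τ` to the pull-back
`V'` of `V` induces Thom isomorphisms `F_X(N) ≅ F_X(|V'|)` for all `N → X`. -/
def CohTheory.IsOrientation {M : GSpace G} (V : GVB M) (τ : F.CohC V.proj) : Prop :=
  (∀ (N : GSpace G) (V' : GVB N) (σ : VBSq V' V) (d : ℕ),
    (∀ n, Module.finrank ℝ (V'.Fibre n) = d) → F.IsDeg d (F.pull σ.toSq τ)) ∧
  (∀ (N : GSpace G) (V' : GVB N) (σ : VBSq V' V) (X : GSpace G) (c : GMap N X),
    Function.Bijective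
      (F.thom (p := V'.proj) (b := c) (c := c.comp V'.proj) (fun _ => rfl) (F.pull σ.toSq τ)))

/-- An `F`-oriented `G`-vector bundle whose fibre dimensions are bounded. -/
structure OVB (M : GSpace G) extends GVB M where
  orient : F.CohC proj
  isOrientation : F.IsOrientation toGVB orient
  bounded : ∃ n : ℕ, ∀ x, Module.finrank ℝ (toGVB.Fibre x) ≤ n

variable {F}

/-- An identification of `V'` with the pull-back of the `F`-oriented bundle `V`. -/
structure OSq {N M : GSpace G} (V' : OVB F N) (V : OVB F M) extends VBSq V'.toGVB V.toGVB where
  orient_eq : V'.orient = F.pull toSq V.orient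

/-- An identification of `S` with the direct sum of the `F`-oriented bundles `V₁` and `V₂`. -/
structure OSum {M : GSpace G} (S V₁ V₂ : OVB F M) extends VBSum S.toGVB V₁.toGVB V₂.toGVB where
  orient_eq : S.orient = F.sumClass toVBSum V₁.orient V₂.orient

variable (F)

/-- `V` is subtrivial: a direct summand in the pull-back `T` of an `F`-oriented vector bundle of
bounded rank over the object space. -/
def CohTheory.IsSubtrivial {M : GSpace G} (V : GVB M) : Prop :=
  ∃ (E : OVB F (GSpace.base G)) (T W : GVB M), Nonempty (VBSq T E.toGVB) ∧ Nonempty (VBSum T V W)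

/-- `V` is the zero bundle with its canonical orientation, the class of the unit element
of `F(|V|) = F(M)`. -/
def OVB.IsZero {F : CohTheory.{u, v} G} {M : GSpace G} (V : OVB F M) : Prop :=
  (∀ x, Subsingleton (V.Fibre x)) ∧
  ∃ A : RelCpt V.proj, ∃ hA : A.carrier = univ,
    V.orient = F.of A (F.map (A := A.compl) (B := ClosedInv.empty _) (GMap.id V.tot)
      (fun x hx => (hx (hA ▸ mem_univ x)).elim) (F.one V.tot))

/-! ## Normally non-singular maps and correspondences -/

/-- The space `|E^Y| = |E| ×_Z Y` for a bundle `E` over the object space `Z`. -/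
abbrev FibProd (E : GVB (GSpace.base G)) (Y : GSpace G) : Type u :=
  {p : E.tot × Y // E.tot.anchor p.1 = Y.anchor p.2}

/-- A pair of `G`-maps to `|E|` and `Y` as a map to `|E^Y|`. -/
def toFibProd {P : GSpace G} {E : GVB (GSpace.base G)} {Y : GSpace G} (fE : GMap P E.tot)
    (fY : GMap P Y) (v : P) : FibProd E Y :=
  ⟨(fE v, fY v), (fE.anchor_map v).trans (fY.anchor_map v).symm⟩

/-- An equivariant open embedding `|V| → |E^Y|`, given by its components. -/
structure OpenEmb {M : GSpace G} (V : GVB M) (E : GVB (GSpace.base G)) (Y : GSpace G) where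
  toE : GMap V.tot E.tot
  toY : GMap V.tot Y
  isOpenEmbedding : IsOpenEmbedding (toFibProd toE toY)

/-- An isotopy of open embeddings `|V| → |E^Y|`. -/
def OpenEmb.Isotopic {M : GSpace G} {V : GVB M} {E : GVB (GSpace.base G)} {Y : GSpace G}
    (f₀ f₁ : OpenEmb V E Y) : Prop :=
  ∃ H : unitInterval → OpenEmb V E Y, H 0 = f₀ ∧ H 1 = f₁ ∧
    IsOpenEmbedding fun p : V.tot × unitInterval =>
      ((toFibProd (H p.2).toE (H p.2).toY p.1, p.2) : FibProd E Y × unitInterval)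

/-- An `F`-oriented normally non-singular `G`-map `(V, E, f̂)` from `M` to `Y`. -/
structure NNSMap (M Y : GSpace G) where
  V : OVB F M
  subtrivial : F.IsSubtrivial V.toGVB
  E : OVB F (GSpace.base G)
  emb : OpenEmb V.toGVB E.toGVB Y

variable {F}

/-- `f'` is the lifting `(V ⊕ E₊^M, E ⊕ E₊, f̂ × id)` of `f = (V, E, f̂)` along the `F`-oriented
vector bundle `E₊` over the object space; `T` is `E₊^M`. -/
structure NNSMap.Lifting {M Y : GSpace G} (f f' : NNSMap F M Y) where
  Eplus : OVB F (GSpace.base G)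
  T : OVB F M
  sqT : OSq T Eplus
  sumV : OSum f'.V f.V T
  sumE : OSum f'.E f.E Eplus
  emb_fst : ∀ v, sumE.fst (f'.emb.toE v) = f.emb.toE (sumV.fst v)
  emb_snd : ∀ v, sumE.snd (f'.emb.toE v) = sqT.top (sumV.snd v)
  emb_Y : ∀ v, f'.emb.toY v = f.emb.toY (sumV.fst v)

variable (F)

/-- A correspondence `(M, b, f, ξ)` from `X` to `Y`. -/
structure Corr (X Y : GSpace G) where
  M : GSpace G
  b : GMap M X
  f : NNSMap F M Y
  ξ : F.CohC b

/-- A bordism of correspondences `(W, b, (V, E, f̂), ξ)` from `X` to `Y`; the open embedding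
`f̂ : |V| → |E^Y| × [0,1]` has the components `toE`, `toY` and `toI`. -/
structure Bordism (X Y : GSpace G) where
  W : GSpace G
  b : GMap W X
  V : OVB F W
  subtrivial : F.IsSubtrivial V.toGVB
  E : OVB F (GSpace.base G)
  toE : GMap V.tot E.tot
  toY : GMap V.tot Y
  toI : V.tot → unitInterval
  toI_act : ∀ g v e, toI (V.tot.act g v e) = toI v
  isOpenEmbedding : IsOpenEmbedding fun v =>
    ((toFibProd toE toY v, toI v) : FibProd E.toGVB Y × unitInterval)
  bd₀ : Set W
  bd₁ : Set W
  toI_eq_zero : ∀ v, toI v = 0 ↔ V.proj v ∈ bd₀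
  toI_eq_one : ∀ v, toI v = 1 ↔ V.proj v ∈ bd₁
  ξ : F.CohC b

variable {F} {X Y : GSpace G}

/-- The correspondence `Ψ` is (isomorphic to) the restriction of the bordism `B` to the part `S` of
its boundary. -/
structure Bordism.Restricts (B : Bordism F X Y) (S : Set B.W) (Ψ : Corr F X Y) where
  i : GMap Ψ.M B.W
  closedEmb : IsClosedEmbedding i
  range_eq : range i = S
  b_eq : ∀ x, Ψ.b x = B.b (i x)
  sqV : OSq Ψ.f.V B.V
  sqV_base : sqV.base = i
  sqE : OSq Ψ.f.E B.E
  emb_E : ∀ v, sqE.top (Ψ.f.emb.toE v) = B.toE (sqV.top v)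
  emb_Y : ∀ v, Ψ.f.emb.toY v = B.toY (sqV.top v)
  ξ_eq : Ψ.ξ = F.pull (Sq.ofClosed Ψ.b B.b i closedEmb b_eq) B.ξ

/-- An isomorphism of correspondences. -/
structure Corr.Iso (Ψ Ψ' : Corr F X Y) where
  i : GMap Ψ.M Ψ'.M
  homeo : IsHomeomorph i
  b_eq : ∀ x, Ψ.b x = Ψ'.b (i x)
  sqV : OSq Ψ.f.V Ψ'.f.V
  sqV_base : sqV.base = i
  sqE : OSq Ψ.f.E Ψ'.f.E
  emb_E : ∀ v, sqE.top (Ψ.f.emb.toE v) = Ψ'.f.emb.toE (sqV.top v)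
  emb_Y : ∀ v, Ψ.f.emb.toY v = Ψ'.f.emb.toY (sqV.top v)
  ξ_eq : Ψ.ξ = F.pull (Sq.ofClosed Ψ.b Ψ'.b i homeo.isClosedEmbedding b_eq) Ψ'.ξ

/-- `Ψ₀` and `Ψ₁` are bordant. -/
def Corr.Bordant (Ψ₀ Ψ₁ : Corr F X Y) : Prop :=
  ∃ B : Bordism F X Y, Nonempty (B.Restricts B.bd₀ Ψ₀) ∧ Nonempty (B.Restricts B.bd₁ Ψ₁)

/-- `Ψ'` is the Thom modification `(|U|, b ∘ π, f ∘ π, τ_U(ξ))` of `Ψ = (M, b, (V, E, f̂), ξ)` along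
the `F`-oriented subtrivial bundle `U` over `M` with bundle projection `π`.

The bundle projection is turned into a normally non-singular map by a complement `U ⊕ C ≅ T`, where
`T` is the pull-back to `M` of an `F`-oriented bundle `E₂` over the object space; it is
`(π^*C, E₂, U ×_M C ≅ T → E₂)`.  Its composite with `f` is `(π^*C ⊕ π^*V, E₂ ⊕ E, T ×_M f̂)`; the
equivalence class of this composite does not depend on the choices.  The rank of `E₂` is taken even,
which is no restriction because `C` and `E₂` may be replaced by `C ⊕ T` and `E₂ ⊕ E₂`; then the
orientation of the composite does not depend on the order of the summands and needs no signs. -/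
structure Corr.ThomMod (Ψ Ψ' : Corr F X Y) where
  U : OVB F Ψ.M
  C : OVB F Ψ.M
  T : OVB F Ψ.M
  E₂ : OVB F (GSpace.base G)
  even : ∀ z, Even (Module.finrank ℝ (E₂.Fibre z))
  sqT : OSq T E₂
  sumT : OSum T U C
  -- the middle space is `|U|`
  i : GMap Ψ'.M U.tot
  homeo : IsHomeomorph i
  b_eq : ∀ x, Ψ'.b x = Ψ.b.comp U.proj (i x)
  -- the bundle is `π^*C ⊕ π^*V`
  piC : OVB F Ψ'.M
  piV : OVB F Ψ'.M
  sqC : OSq piC C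
  sqC_base : sqC.base = U.proj.comp i
  sqV : OSq piV Ψ.f.V
  sqV_base : sqV.base = U.proj.comp i
  sumV : OSum Ψ'.f.V piC piV
  sumE : OSum Ψ'.f.E E₂ Ψ.f.E
  -- the open embedding
  emb_fst : ∀ (v : Ψ'.f.V.tot) (t : T.tot), sumT.fst t = i (Ψ'.f.V.proj v) →
    sumT.snd t = sqC.top (sumV.fst v) → sumE.fst (Ψ'.f.emb.toE v) = sqT.top t
  emb_snd : ∀ v, sumE.snd (Ψ'.f.emb.toE v) = Ψ.f.emb.toE (sqV.top (sumV.snd v))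
  emb_Y : ∀ v, Ψ'.f.emb.toY v = Ψ.f.emb.toY (sqV.top (sumV.snd v))
  -- the Thom isomorphism
  ξ_eq : Ψ'.ξ = F.pull (Sq.ofClosed Ψ'.b (Ψ.b.comp U.proj) i homeo.isClosedEmbedding b_eq)
    (F.thom (fun _ => rfl) U.orient Ψ.ξ)

/-- The elementary relations: isomorphism, equivalence of normally non-singular maps (isotopy and
lifting), bordism, and Thom modification. -/
inductive Corr.Step : Corr F X Y → Corr F X Y → Prop
  | iso {Ψ Ψ' : Corr F X Y} (h : Nonempty (Ψ.Iso Ψ')) : Step Ψ Ψ'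
  | isotopy (M : GSpace G) (b : GMap M X) (V : OVB F M) (hV : F.IsSubtrivial V.toGVB)
      (E : OVB F (GSpace.base G)) (f₀ f₁ : OpenEmb V.toGVB E.toGVB Y) (h : f₀.Isotopic f₁)
      (ξ : F.CohC b) : Step ⟨M, b, ⟨V, hV, E, f₀⟩, ξ⟩ ⟨M, b, ⟨V, hV, E, f₁⟩, ξ⟩
  | lifting (M : GSpace G) (b : GMap M X) (f f' : NNSMap F M Y) (h : Nonempty (f.Lifting f'))
      (ξ : F.CohC b) : Step ⟨M, b, f, ξ⟩ ⟨M, b, f', ξ⟩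
  | bordism {Ψ Ψ' : Corr F X Y} (h : Ψ.Bordant Ψ') : Step Ψ Ψ'
  | thom {Ψ Ψ' : Corr F X Y} (h : Nonempty (Ψ.ThomMod Ψ')) : Step Ψ Ψ'

/-- Equivalence of correspondences. -/
def Corr.Equivalent : Corr F X Y → Corr F X Y → Prop := Relation.EqvGen Corr.Step

/-! ## Special correspondences -/

/-- A correspondence is special if its forward map is a special normally non-singular
submersion, that is, `V = 0`. -/
def Corr.IsSpecial (Ψ : Corr F X Y) : Prop := Ψ.f.V.IsZero

def Bordism.IsSpecial (B : Bordism F X Y) : Prop := B.V.IsZero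

/-- `Ψ₀` and `Ψ₁` are specially bordant. -/
def Corr.SpeciallyBordant (Ψ₀ Ψ₁ : Corr F X Y) : Prop :=
  ∃ B : Bordism F X Y, B.IsSpecial ∧
    Nonempty (B.Restricts B.bd₀ Ψ₀) ∧ Nonempty (B.Restricts B.bd₁ Ψ₁)

/-- `Ψ'` is (isomorphic to) the Thom modification `(E ⊕ U, M ×_Z |U|, b ∘ π, τ_U(ξ))` of the special
correspondence `Ψ = (E, M, b, ξ)` by the `F`-oriented vector bundle `U` over the object space `Z`;
`UM` is the pull-back of `U` to `M`, with total space `M ×_Z |U|`. -/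
structure Corr.SpecialThomMod (Ψ : Corr F X Y) (U : OVB F (GSpace.base G)) (Ψ' : Corr F X Y) where
  special : Ψ'.IsSpecial
  UM : OVB F Ψ.M
  sqU : OSq UM U
  i : GMap Ψ'.M UM.tot
  homeo : IsHomeomorph i
  b_eq : ∀ x, Ψ'.b x = Ψ.b.comp UM.proj (i x)
  sumE : OSum Ψ'.f.E Ψ.f.E U
  emb_fst : ∀ (v' : Ψ'.f.V.tot) (v : Ψ.f.V.tot), Ψ.f.V.proj v = UM.proj (i (Ψ'.f.V.proj v')) →
    sumE.fst (Ψ'.f.emb.toE v') = Ψ.f.emb.toE v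
  emb_snd : ∀ v', sumE.snd (Ψ'.f.emb.toE v') = sqU.top (i (Ψ'.f.V.proj v'))
  emb_Y : ∀ (v' : Ψ'.f.V.tot) (v : Ψ.f.V.tot), Ψ.f.V.proj v = UM.proj (i (Ψ'.f.V.proj v')) →
    Ψ'.f.emb.toY v' = Ψ.f.emb.toY v
  ξ_eq : Ψ'.ξ = F.pull (Sq.ofClosed Ψ'.b (Ψ.b.comp UM.proj) i homeo.isClosedEmbedding b_eq)
    (F.thom (fun _ => rfl) UM.orient Ψ.ξ)

end

end NNSCorr

namespace NNSCorr

noncomputable section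

/-! ## Paracompactness of spaces with a locally finite closed cover -/

/-! Everything rests on one special correspondence attached to `Ψ = (M, b, (V, E, f̂), ξ)`, namely
`Ψ.spec`: its middle space is `|V|`, seen through `f̂` as an open subset of `|E^Y|`, its map to `X`
is `b ∘ π_V`, and its class is `τ_V(ξ)`.

Part (1) is `Corr.equivalent_spec`. By two-out-of-three for orientations there is an oriented bundle
`C` with `C ⊕ V ≅ T`, where `T` is pulled back from an even-dimensional oriented bundle `E₂` over
`Z`. The Thom modification of `Ψ` along `V` has middle space `|V|`, and the total space of its
normal bundle is `|C ⊕ V ⊕ V|`: one copy of `V` is the base, the other is fed into `f̂`. The lifting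
of `Ψ.spec` along `E₂` has the same total space with the two copies of `V` in exchanged roles.
Rotation in `V ⊕ V` is an isotopy between the two. The quarter turn is `(v, w) ↦ (w, -v)`, so the
exchange brings in the antipodal map of `V`; `CohTheory.sumClass_negSwap` shows that this sign
cancels the one from permuting `C` and `V`, so the orientations match.

For "only if" in (2), call two special correspondences related (`SC.Approx`) if suitable Thom
modifications of them are specially bordant. Under `spec` every elementary step becomes such a
relation (`Corr.Step.approx`): isomorphisms, isotopies and bordisms yield special bordisms, whereas
liftings and Thom modifications yield Thom modifications by bundles over `Z`. For a Thom
modification along `U` with `U ⊕ C = T` this is because `U ⊕ C ⊕ V = T ⊕ V`, which is `|V| ×_Z |E₂|`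
(`Corr.ThomMod.modOf`).

What remains is transitivity of `SC.Approx`. Thom modifications compose and are unique up to
isomorphism (`SC.ModOf.trans`, `SC.ModOf.iso`), and doubled bundles can be exchanged without signs
because their orientation classes are even. Special bordism is itself transitive (`SC.HBord.trans`):
special bordisms are open in `|E^Y| × [0,1]`, so two with a common end are joined by a constant
stretch in the middle, and the class on the result comes from a Mayer–Vietoris argument
(`CohTheory.exists_glue`).

For "if", a special Thom modification by `U` is `spec` of the lifting along `U`, so (1) applies to
it (`Corr.SpecialThomMod.equivalent`).

Two technical themes recur. New total spaces and glued spaces have to be shown paracompact. Degrees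
of orientations make sense only where ranks are constant; because ranks are bounded, finitely many
open and closed pieces suffice, and the axioms give additivity for these. -/

/-- A space in which every open cover has a locally finite closed refinement is paracompact. -/
theorem paracompactSpace_of_closed_refinement {X : Type u} [TopologicalSpace X]
    (H : ∀ (α : Type u) (s : α → Set X), (∀ a, IsOpen (s a)) → ⋃ a, s a = univ →
      ∃ (β : Type u) (t : β → Set X), (∀ b, IsClosed (t b)) ∧ ⋃ b, t b = univ ∧
        LocallyFinite t ∧ ∀ b, ∃ a, t b ⊆ s a) : ParacompactSpace X := by
  refine ⟨fun α s ho hc => ?_⟩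
  obtain ⟨β, C, hCc, hCu, hCf, hCs⟩ := H α s ho hc
  choose U hU hUf using hCf
  obtain ⟨γ, D, hDc, hDu, hDf, hDs⟩ := H X (fun x => interior (U x)) (fun x => isOpen_interior)
    (eq_univ_of_forall fun x => mem_iUnion.2 ⟨x, mem_interior_iff_mem_nhds.2 (hU x)⟩)
  choose f hf using hCs
  -- Michael's expansion: `V b` removes from the space all members of the second cover `D` that miss
  -- `C b`. It is open because `D` is locally finite and closed, and it contains `C b`.
  let V : β → Set X := fun b => (⋃ d : {d : γ // Disjoint (D d) (C b)}, D d)ᶜ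
  have hVo : ∀ b, IsOpen (V b) := fun b =>
    ((hDf.comp_injective Subtype.val_injective).isClosed_iUnion fun d => hDc d.1).isOpen_compl
  have hCV : ∀ b, C b ⊆ V b := fun b x hx hx' => by
    obtain ⟨d, hd⟩ := mem_iUnion.1 hx'
    exact disjoint_left.1 d.2 hd hx
  refine ⟨β, fun b => V b ∩ s (f b), fun b => (hVo b).inter (ho _), ?_, ?_, fun b =>
    ⟨f b, inter_subset_right⟩⟩
  · refine eq_univ_of_forall fun x => ?_
    obtain ⟨b, hb⟩ := mem_iUnion.1 (hCu ▸ mem_univ x)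
    exact mem_iUnion.2 ⟨b, hCV b hb, hf b hb⟩
  · intro x
    obtain ⟨N, hN, hNf⟩ := hDf x
    -- A member of `D` that meets `V b` was not removed, hence meets `C b`; each `D d` lies in a
    -- neighbourhood that meets only finitely many `C b`.
    have key : ∀ d, {b | (V b ∩ D d).Nonempty}.Finite := fun d => by
      obtain ⟨y, hy⟩ := hDs d
      refine (hUf y).subset fun b hb => ?_
      obtain ⟨z, hz, hzd⟩ := hb
      by_contra hne
      refine hz (mem_iUnion.2 ⟨⟨d, ?_⟩, hzd⟩)
      refine disjoint_left.2 fun w hw hw' => hne ⟨w, hw', interior_subset (hy hw)⟩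
    refine ⟨N, hN, (hNf.biUnion fun d _ => key d).subset fun b hb => ?_⟩
    obtain ⟨y, hy, hyN⟩ := hb
    obtain ⟨d, hd⟩ := mem_iUnion.1 (hDu ▸ mem_univ y)
    exact mem_biUnion (show d ∈ {d | (D d ∩ N).Nonempty} from ⟨y, hd, hyN⟩) ⟨y, hy.1, hd⟩

/-- A space with a locally finite closed cover by paracompact Hausdorff subspaces is paracompact. -/
theorem paracompactSpace_of_locallyFinite_closed {X : Type u} [TopologicalSpace X] [T2Space X]
    {ι : Type u} (K : ι → Set X) (hK : ∀ i, IsClosed (K i)) (hf : LocallyFinite K)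
    (hu : ⋃ i, K i = univ) (hp : ∀ i, ParacompactSpace (K i)) : ParacompactSpace X := by
  refine paracompactSpace_of_closed_refinement fun α s ho hc => ?_
  have h : ∀ i, ∃ t : α → Set (K i), (∀ a, IsClosed (t a)) ∧ ⋃ a, t a = univ ∧ LocallyFinite t ∧
      ∀ a, t a ⊆ Subtype.val ⁻¹' s a := fun i => by
    have := hp i
    obtain ⟨w, hw, hwu, hwf, hws⟩ := precise_refinement (fun a => (Subtype.val : K i → X) ⁻¹' s a)
      (fun a => (ho a).preimage continuous_subtype_val)
      (eq_univ_of_forall fun x => by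
        obtain ⟨a, ha⟩ := mem_iUnion.1 (hc ▸ mem_univ x.1)
        exact mem_iUnion.2 ⟨a, ha⟩)
    obtain ⟨t, htu, htc, hts⟩ := exists_iUnion_eq_closed_subset hw (fun x => hwf.point_finite x) hwu
    exact ⟨t, htc, htu, hwf.subset hts, fun a => (hts a).trans (hws a)⟩
  choose t htc htu htf hts using h
  refine ⟨ι × α, fun p => Subtype.val '' t p.1 p.2, fun p =>
    (hK p.1).isClosedEmbedding_subtypeVal.isClosedMap _ (htc _ _), ?_, ?_, fun p =>
    ⟨p.2, image_subset_iff.2 (hts _ _)⟩⟩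
  · refine eq_univ_of_forall fun x => ?_
    obtain ⟨i, hi⟩ := mem_iUnion.1 (hu ▸ mem_univ x)
    obtain ⟨a, ha⟩ := mem_iUnion.1 ((htu i) ▸ mem_univ (⟨x, hi⟩ : K i))
    exact mem_iUnion.2 ⟨(i, a), ⟨x, hi⟩, ha, rfl⟩
  · intro x
    obtain ⟨N, hN, hNf⟩ := hf x
    have key : ∀ i, ∃ O ∈ 𝓝 x, {a | ((Subtype.val '' t i a : Set X) ∩ O).Nonempty}.Finite := by
      intro i
      by_cases hx : x ∈ K i
      · obtain ⟨O, hO, hOf⟩ := htf i ⟨x, hx⟩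
        rw [nhds_subtype_eq_comap, Filter.mem_comap] at hO
        obtain ⟨O', hO', hsub⟩ := hO
        refine ⟨O', hO', hOf.subset ?_⟩
        rintro a ⟨y, ⟨z, hz, rfl⟩, hy⟩
        exact ⟨z, hz, hsub hy⟩
      · refine ⟨(K i)ᶜ, (hK i).isOpen_compl.mem_nhds hx, ?_⟩
        convert finite_empty
        refine eq_empty_of_forall_notMem ?_
        rintro a ⟨y, ⟨z, hz, rfl⟩, hy⟩
        exact hy z.2
    choose O hO hOf using key
    refine ⟨N ∩ ⋂ i ∈ hNf.toFinset, O i, Filter.inter_mem hN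
      ((Filter.biInter_finset_mem _).2 fun i _ => hO i), ?_⟩
    refine (hNf.biUnion fun i _ => (hOf i).image (fun a => (i, a))).subset ?_
    rintro ⟨i, a⟩ ⟨y, hy, hyN, hyO⟩
    have hi : i ∈ {i | (K i ∩ N).Nonempty} := by
      obtain ⟨z, hz, rfl⟩ := hy
      exact ⟨z, z.2, hyN⟩
    exact mem_biUnion hi ⟨a, ⟨y, hy, mem_iInter₂.1 hyO i (hNf.mem_toFinset.2 hi)⟩, rfl⟩

theorem paracompactSpace_of_union {X : Type u} [TopologicalSpace X] [T2Space X] {A B : Set X}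
    (hA : IsClosed A) (hB : IsClosed B) (hAB : A ∪ B = univ) [ParacompactSpace A]
    [ParacompactSpace B] : ParacompactSpace X := by
  refine paracompactSpace_of_locallyFinite_closed (ι := ULift.{u} Bool)
    (fun i => cond i.down A B) ?_ (locallyFinite_of_finite _) ?_ ?_
  · rintro ⟨_ | _⟩ <;> assumption
  · refine eq_univ_of_forall fun x => mem_iUnion.2 ?_
    rcases hAB ▸ mem_univ x with h | h
    · exact ⟨⟨true⟩, h⟩
    · exact ⟨⟨false⟩, h⟩
  · rintro ⟨_ | _⟩ <;> assumption

/-- The shells `k ≤ ‖x‖ ≤ k + 1` form a locally finite closed cover, and each is closed in the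
product of `X` with a compact ball. -/
theorem paracompactSpace_prod_pi {X : Type u} [TopologicalSpace X] [T2Space X] [ParacompactSpace X]
    (n : ℕ) : ParacompactSpace (X × (Fin n → ℝ)) := by
  have hn : Continuous fun p : X × (Fin n → ℝ) => ‖p.2‖ := by fun_prop
  have hc : ∀ k : ULift.{u} ℕ,
      IsClosed {p : X × (Fin n → ℝ) | ↑k.down ≤ ‖p.2‖ ∧ ‖p.2‖ ≤ k.down + 1} := fun k =>
    (isClosed_le continuous_const hn).inter (isClosed_le hn continuous_const)
  refine paracompactSpace_of_locallyFinite_closed (ι := ULift.{u} ℕ)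
    (fun k => {p | ↑k.down ≤ ‖p.2‖ ∧ ‖p.2‖ ≤ k.down + 1}) hc ?_ ?_ ?_
  · intro p
    refine ⟨{q | ‖q.2‖ < ‖p.2‖ + 1}, (isOpen_lt (by fun_prop) continuous_const).mem_nhds
      (by simp), ?_⟩
    refine ((finite_le_nat ⌈‖p.2‖ + 1⌉₊).preimage ULift.down_injective.injOn).subset ?_
    rintro k ⟨q, hq, hq'⟩
    simp only [mem_ofPred_eq] at hq'
    exact Nat.cast_le (α := ℝ).1 ((hq.1.trans hq'.le).trans (Nat.le_ceil _))
  · refine eq_univ_of_forall fun p => mem_iUnion.2 ⟨⟨⌊‖p.2‖⌋₊⟩, Nat.floor_le (norm_nonneg _), ?_⟩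
    exact (Nat.lt_floor_add_one _).le
  · intro k
    set e : {p : X × (Fin n → ℝ) | ↑k.down ≤ ‖p.2‖ ∧ ‖p.2‖ ≤ k.down + 1} →
      X × Metric.closedBall (0 : Fin n → ℝ) (k.down + 1) :=
        fun p => (p.1.1, ⟨p.1.2, by simpa using p.2.2⟩)
    have : CompactSpace (Metric.closedBall (0 : Fin n → ℝ) (k.down + 1)) :=
      isCompact_iff_compactSpace.1 (isCompact_closedBall _ _)
    have he : IsClosedEmbedding e := by
      have h : IsClosedEmbedding (Prod.map _root_.id Subtype.val ∘ e) := by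
        have : (Prod.map _root_.id Subtype.val ∘ e) = Subtype.val := rfl
        rw [this]
        exact (hc k).isClosedEmbedding_subtypeVal
      exact IsClosedEmbedding.of_comp_iff (IsClosedEmbedding.id.prodMap
        Metric.isClosed_closedBall.isClosedEmbedding_subtypeVal) |>.1 h
    exact he.paracompactSpace

/-- The total space of a locally trivial bundle of finite-dimensional vector spaces over a
paracompact Hausdorff space is paracompact. -/
theorem paracompactSpace_of_locally_trivial {P N : Type u} [TopologicalSpace P] [T2Space P]
    [TopologicalSpace N] [T2Space N] [ParacompactSpace N] (p : P → N) (hp : Continuous p)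
    (H : ∀ x : N, ∃ U : Set N, IsOpen U ∧ x ∈ U ∧ ∃ (n : ℕ)
      (h : {v : P // p v ∈ U} ≃ₜ U × (Fin n → ℝ)), ∀ v, ((h v).1 : N) = p v.1) :
    ParacompactSpace P := by
  choose U hU hxU n h hh using H
  obtain ⟨w, hw, hwu, hwf, hws⟩ := precise_refinement U hU
    (eq_univ_of_forall fun x => mem_iUnion.2 ⟨x, hxU x⟩)
  obtain ⟨K, hKu, hKc, hKs⟩ := exists_iUnion_eq_closed_subset hw (fun x => hwf.point_finite x) hwu
  refine paracompactSpace_of_locallyFinite_closed (fun x => p ⁻¹' K x)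
    (fun x => (hKc x).preimage hp) ?_ ?_ fun x => ?_
  · exact (hwf.subset hKs).preimage_continuous hp
  · rw [← preimage_iUnion, hKu, preimage_univ]
  · have hKU : K x ⊆ U x := (hKs x).trans (hws x)
    have : ParacompactSpace (K x) := (hKc x).isClosedEmbedding_subtypeVal.paracompactSpace
    have := paracompactSpace_prod_pi (X := K x) (n x)
    have key : ∀ v : p ⁻¹' K x, ((h x ⟨v.1, hKU v.2⟩).1 : N) ∈ K x := fun v => by
      rw [hh]; exact v.2
    let e : (p ⁻¹' K x) ≃ₜ K x × (Fin (n x) → ℝ) :=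
      { toFun v := (⟨(h x ⟨v.1, hKU v.2⟩).1, key v⟩, (h x ⟨v.1, hKU v.2⟩).2)
        invFun q := ⟨((h x).symm (⟨q.1.1, hKU q.1.2⟩, q.2)).1, by
          rw [mem_preimage, ← hh]; simp⟩
        left_inv v := by simp
        right_inv q := by simp
        continuous_toFun := by fun_prop
        continuous_invFun := by fun_prop }
    exact e.paracompactSpace_iff.2 this

end

end NNSCorr

namespace NNSCorr

noncomputable section

variable {G : TopGroupoid.{u}}

/-! ## Elementary properties of `G`-maps and of relatively compact subsets -/

@[ext]
theorem GMap.ext {X Y : GSpace G} {f g : GMap X Y} (h : ∀ x, f x = g x) : f = g := by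
  cases f; cases g
  congr
  exact funext h

@[simp]
theorem GMap.comp_apply {X Y W : GSpace G} (f : GMap Y W) (g : GMap X Y) (x : X) :
    f.comp g x = f (g x) := rfl

theorem GSpace.act_congr (X : GSpace G) (g : G.Arr) {x y : X} (h : x = y) (e : G.s g = X.anchor x) :
    X.act g x e = X.act g y (e.trans (congrArg X.anchor h)) := by
  subst h; rfl

/-- A map into `P` is a `G`-map if its composites with two jointly injective and inducing `G`-maps
are. -/
def GMap.ofJoint {R P A B : GSpace G} {f₁ : GMap P A} {f₂ : GMap P B}
    (hf : IsEmbedding fun x => (f₁ x, f₂ x)) (k : R → P) (a : GMap R A) (b : GMap R B)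
    (ha : ∀ r, f₁ (k r) = a r) (hb : ∀ r, f₂ (k r) = b r) : GMap R P where
  toFun := k
  continuous := hf.isInducing.continuous_iff.2 (by
    have : (fun x => (f₁ x, f₂ x)) ∘ k = fun r => (a r, b r) :=
      funext fun r => Prod.ext (ha r) (hb r)
    rw [this]
    exact a.continuous.prodMk b.continuous)
  anchor_map r := by rw [← f₁.anchor_map, ha, a.anchor_map]
  map_act g r e := hf.injective (by
    have e' : G.s g = P.anchor (k r) := by rw [← f₁.anchor_map, ha, a.anchor_map]; exact e
    refine Prod.ext ?_ ?_
    · change f₁ (k _) = f₁ (P.act g (k r) e')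
      rw [ha, f₁.map_act, a.map_act]
      exact A.act_congr g (ha r).symm _
    · change f₂ (k _) = f₂ (P.act g (k r) e')
      rw [hb, f₂.map_act, b.map_act]
      exact B.act_congr g (hb r).symm _)

theorem IsProperMap.restrict_closed {A B : Type*} [TopologicalSpace A] [TopologicalSpace B]
    {f : A → B} {K L : Set A} (hK : IsProperMap fun x : K => f x) (hL : IsClosed L) (h : L ⊆ K) :
    IsProperMap fun x : L => f x :=
  hK.comp (g := fun x : K => f x) (f := Set.inclusion h)
    (isProperMap_of_comp_of_inj (g := Subtype.val) (continuous_inclusion h) continuous_subtype_val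
      hL.isProperMap_subtypeVal Subtype.val_injective)

/-- Continuity, closedness and compactness of fibres can be checked on two closed pieces. This makes
the system of supports directed, on which all computations in the inductive limit depend. -/
theorem isProperMap_union {A B : Type*} [TopologicalSpace A] [TopologicalSpace B]
    {f : A → B} {K L : Set A} (hKc : IsClosed K) (hLc : IsClosed L)
    (hK : IsProperMap fun x : K => f x) (hL : IsProperMap fun x : L => f x) :
    IsProperMap fun x : (K ∪ L : Set A) => f x := by
  have hsub : ∀ (C : Set A) (D : Set (K ∪ L : Set A)),
      (fun x : C => f x) '' (Subtype.val ⁻¹' (Subtype.val '' D)) = f '' (C ∩ Subtype.val '' D) := by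
    intro C D
    ext y
    constructor
    · rintro ⟨x, hx, rfl⟩
      exact ⟨x.1, ⟨x.2, hx⟩, rfl⟩
    · rintro ⟨x, ⟨hx, hx'⟩, rfl⟩
      exact ⟨⟨x, hx⟩, hx', rfl⟩
  rw [isProperMap_iff_isClosedMap_and_compact_fibers] at hK hL ⊢
  refine ⟨?_, ?_, ?_⟩
  · have hKf : ContinuousOn f K := continuousOn_iff_continuous_domRestrict.2 hK.1
    have hLf : ContinuousOn f L := continuousOn_iff_continuous_domRestrict.2 hL.1
    exact continuousOn_iff_continuous_domRestrict.1 (hKf.union_of_isClosed hLf hKc hLc)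
  · intro D hD
    have hD' : IsClosed (Subtype.val '' D : Set A) :=
      (hKc.union hLc).isClosedEmbedding_subtypeVal.isClosedMap _ hD
    have h1 := hK.2.1 _ (hD'.preimage continuous_subtype_val)
    have h2 := hL.2.1 _ (hD'.preimage continuous_subtype_val)
    rw [hsub] at h1 h2
    have : (fun x : (K ∪ L : Set A) => f x) '' D =
        f '' (K ∩ Subtype.val '' D) ∪ f '' (L ∩ Subtype.val '' D) := by
      rw [← image_union, ← union_inter_distrib_right]
      ext y
      constructor
      · rintro ⟨x, hx, rfl⟩
        exact ⟨x.1, ⟨x.2, x, hx, rfl⟩, rfl⟩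
      · rintro ⟨x, ⟨_, x', hx', rfl⟩, rfl⟩
        exact ⟨x', hx', rfl⟩
    rw [this]
    exact h1.union h2
  · intro y
    rw [Subtype.isCompact_iff]
    have h1 := Subtype.isCompact_iff.1 (hK.2.2 y)
    have h2 := Subtype.isCompact_iff.1 (hL.2.2 y)
    convert h1.union h2 using 1
    ext x
    simp only [mem_image, mem_preimage, mem_singleton_iff, Subtype.exists, mem_union,
      exists_and_right, exists_eq_right, exists_prop]
    tauto

namespace RelCpt

variable {M X : GSpace G} {b : GMap M X}

/-- A closed subset that contains an open invariant set `A` and is proper over `X`. -/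
def ofSubset (A : Set M) (ho : IsOpen A) (hi : M.IsInvariant A) (K : Set M) (hK : IsClosed K)
    (hAK : A ⊆ K) (hp : IsProperMap fun m : K => b m) : RelCpt b :=
  ⟨A, ho, hi, IsProperMap.restrict_closed hp isClosed_closure (closure_minimal hAK hK)⟩

def bot (b : GMap M X) : RelCpt b :=
  ofSubset ∅ isOpen_empty (fun _ _ _ h => h.elim) ∅ isClosed_empty subset_rfl (by
    have : IsEmpty (∅ : Set M) := inferInstance
    rw [isProperMap_iff_isClosedMap_and_compact_fibers]
    refine ⟨continuous_of_discreteTopology, fun s _ => ?_, fun y => ?_⟩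
    · rw [Set.eq_empty_of_isEmpty s, image_empty]; exact isClosed_empty
    · rw [Set.eq_empty_of_isEmpty (_ ⁻¹' _)]; exact isCompact_empty)

def sup (A B : RelCpt b) : RelCpt b :=
  ofSubset (A.carrier ∪ B.carrier) (A.isOpen.union B.isOpen)
    (fun g x e h => h.imp (A.inv g x e) (B.inv g x e)) (closure A.carrier ∪ closure B.carrier)
    (isClosed_closure.union isClosed_closure) (union_subset_union subset_closure subset_closure)
    (isProperMap_union isClosed_closure isClosed_closure A.proper B.proper)

theorem le_sup_left (A B : RelCpt b) : A ≤ A.sup B := fun _ h => Or.inl h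
theorem le_sup_right (A B : RelCpt b) : B ≤ A.sup B := fun _ h => Or.inr h

instance : IsDirected (RelCpt b) (· ≤ ·) := ⟨fun A B => ⟨A.sup B, le_sup_left A B, le_sup_right A B⟩⟩
instance : IsDirectedOrder (RelCpt b) := inferInstance
instance : Nonempty (RelCpt b) := ⟨bot b⟩

end RelCpt

/-! ## The calculus of classes with relatively compact support -/

variable (F : CohTheory.{u, v} G)

theorem CohTheory.map_congr {X Y : GSpace G} {A : ClosedInv X} {B : ClosedInv Y} {f g : GMap X Y}
    (h : ∀ x, f x = g x) (hf : MapsTo f A.carrier B.carrier) (a : F.coh Y B) :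
    F.map f hf a = F.map g (fun x hx => by rw [← h]; exact hf hx) a := by
  obtain rfl := GMap.ext h
  rfl

theorem CohTheory.map_map {X Y W : GSpace G} {A : ClosedInv X} {B : ClosedInv Y} {C : ClosedInv W}
    (f : GMap X Y) (g : GMap Y W) (hf : MapsTo f A.carrier B.carrier)
    (hg : MapsTo g B.carrier C.carrier) (c : F.coh W C) :
    F.map f hf (F.map g hg c) = F.map (g.comp f) (fun _ hx => hg (hf hx)) c :=
  (F.map_comp f g hf hg _ c).symm

/-- Two composites of pull-back maps agree if the underlying maps do. -/
theorem CohTheory.map_map_eq {X Y Y' W : GSpace G} {A : ClosedInv X} {B : ClosedInv Y}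
    {B' : ClosedInv Y'} {C : ClosedInv W} {f : GMap X Y} {g : GMap Y W} {f' : GMap X Y'}
    {g' : GMap Y' W} {hf : MapsTo f A.carrier B.carrier} {hg : MapsTo g B.carrier C.carrier}
    {hf' : MapsTo f' A.carrier B'.carrier} {hg' : MapsTo g' B'.carrier C.carrier} (c : F.coh W C)
    (h : ∀ x, g (f x) = g' (f' x)) : F.map f hf (F.map g hg c) = F.map f' hf' (F.map g' hg' c) := by
  rw [F.map_map, F.map_map]
  exact F.map_congr h _ c

theorem CohTheory.map_eq_map_map {X Y W : GSpace G} {A : ClosedInv X} {B : ClosedInv Y}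
    {C : ClosedInv W} {f : GMap X Y} {g : GMap Y W} {k : GMap X W}
    {hf : MapsTo f A.carrier B.carrier} {hg : MapsTo g B.carrier C.carrier}
    {hk : MapsTo k A.carrier C.carrier} (c : F.coh W C) (h : ∀ x, k x = g (f x)) :
    F.map k hk c = F.map f hf (F.map g hg c) := by
  rw [F.map_map]
  exact F.map_congr h _ c

theorem CohTheory.map_eq_self {X : GSpace G} {A : ClosedInv X} {f : GMap X X} (h : ∀ x, f x = x)
    (hf : MapsTo f A.carrier A.carrier) (a : F.coh X A) : F.map f hf a = a := by
  obtain rfl : f = GMap.id X := GMap.ext h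
  exact F.map_id _ a

theorem CohTheory.exists_of {M X : GSpace G} {b : GMap M X} (ξ : F.CohC b) :
    ∃ A a, ξ = F.of (b := b) A a := by
  classical
  exact AddCommGroup.DirectLimit.induction_on (C := fun ξ : F.CohC b => ∃ A a, ξ = F.of A a) ξ
    fun A a => ⟨A, a, rfl⟩

/-- Directedness of the supports is used here: a class dies in the limit only if it already dies on
some larger support. -/
theorem CohTheory.of_eq_zero {M X : GSpace G} {b : GMap M X} (A : RelCpt b) (a : F.coh M A.compl)
    (h : F.of A a = 0) : ∃ B, ∃ hAB : A ≤ B, F.trans A B hAB a = 0 := by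
  classical
  have : DirectedSystem (fun A : RelCpt b => F.coh M A.compl) fun A B h => F.trans A B h :=
    { map_self A x := F.trans_refl A x
      map_map A B C hAB hBC x := by
        unfold CohTheory.trans
        rw [F.map_map]
        exact F.map_congr (fun _ => rfl) _ x }
  exact AddCommGroup.DirectLimit.of.zero_exact (f := fun A B h => F.trans A B h) A a h

theorem CohTheory.of_map_id {M X : GSpace G} {b : GMap M X} (A B : RelCpt b)
    (h : MapsTo (GMap.id M) B.compl.carrier A.compl.carrier) (a : F.coh M A.compl) :
    F.of B (F.map (GMap.id M) h a) = F.of A a :=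
  F.of_trans A B (fun x hx => by_contra fun hx' => h (show x ∈ B.compl.carrier from hx') hx) a

/-! ### Pull-back of classes with compact support -/

/-- A `G`-map along which classes with compact support may be pulled back. -/
def Pullable {P N Q M : GSpace G} (p : GMap P N) (q : GMap Q M) (f : GMap P Q) : Prop :=
  ∀ A : RelCpt q, IsProperMap fun x : closure (f ⁻¹' A.carrier) => p x

section Pull

variable {P N Q M R L : GSpace G} {p : GMap P N} {q : GMap Q M} {r : GMap R L}

/-- The preimage of a relatively compact subset. -/
def RelCpt.pre {f : GMap P Q} (hf : Pullable p q f) (A : RelCpt q) : RelCpt p where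
  carrier := f ⁻¹' A.carrier
  isOpen := A.isOpen.preimage f.continuous
  inv g x e h := by
    simp only [mem_preimage] at h ⊢
    rw [f.map_act]
    exact A.inv _ _ _ h
  proper := hf A

theorem RelCpt.mapsTo_pre {f : GMap P Q} (hf : Pullable p q f) (A : RelCpt q) :
    MapsTo f (A.pre hf).compl.carrier A.compl.carrier := fun _ hx => hx

/-- The pull-back along a map `f : P → Q`. -/
def CohTheory.pullG {f : GMap P Q} (hf : Pullable p q f) : F.CohC q →+ F.CohC p :=
  F.lift (fun A => (F.of (A.pre hf)).comp (F.map f (A.mapsTo_pre hf))) (by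
    intro A B h x
    simp only [AddMonoidHom.comp_apply]
    rw [← F.of_trans (A.pre hf) (B.pre hf) (fun y hy => h hy)]
    exact congrArg (F.of (B.pre hf)) (F.map_map_eq _ fun _ => rfl))

theorem CohTheory.pullG_of {f : GMap P Q} (hf : Pullable p q f) (A : RelCpt q)
    (a : F.coh Q A.compl) :
    F.pullG hf (F.of A a) = F.of (A.pre hf) (F.map f (A.mapsTo_pre hf) a) := F.lift_of _ _ _ _

theorem Sq.pullable (σ : Sq p q) : Pullable p q σ.top := fun A => (A.pull σ).proper

/-- Only the upper map of a square and the condition on supports enter the pull-back. Passing to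
`pullG` allows composites that do not come with a square. -/
theorem CohTheory.pull_eq_pullG (σ : Sq p q) : F.pull σ = F.pullG σ.pullable := rfl

theorem Pullable.comp {f : GMap P Q} {g : GMap Q R} (hg : Pullable q r g) (hf : Pullable p q f) :
    Pullable p r (g.comp f) := fun A => hf (A.pre hg)

theorem CohTheory.pullG_congr {f g : GMap P Q} (hf : Pullable p q f) (hg : Pullable p q g)
    (h : ∀ x, f x = g x) (ξ : F.CohC q) : F.pullG hf ξ = F.pullG hg ξ := by
  obtain rfl := GMap.ext h
  rfl

theorem CohTheory.pullG_comp {f : GMap P Q} {g : GMap Q R} {k : GMap P R} (hf : Pullable p q f)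
    (hg : Pullable q r g) (hk : Pullable p r k) (h : ∀ x, k x = g (f x)) (ξ : F.CohC r) :
    F.pullG hf (F.pullG hg ξ) = F.pullG hk ξ := by
  obtain rfl : k = g.comp f := GMap.ext h
  obtain ⟨A, a, rfl⟩ := F.exists_of ξ
  rw [F.pullG_of, F.pullG_of, F.pullG_of, F.map_map]
  rfl

theorem CohTheory.pullG_eq_self {f : GMap P P} (hf : Pullable p p f) (h : ∀ x, f x = x)
    (ξ : F.CohC p) : F.pullG hf ξ = ξ := by
  obtain rfl : f = GMap.id P := GMap.ext h
  obtain ⟨A, a, rfl⟩ := F.exists_of ξ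
  rw [F.pullG_of]
  exact F.of_map_id A (A.pre hf) _ a

/-- If `q ∘ f = j ∘ p` is proper on a closed set, then so is `p`, by cancellation of `j` into a
Hausdorff space. -/
theorem pullable_of_isProperMap {f : GMap P Q} (hf : IsProperMap f) {j : GMap N M}
    (h : ∀ x, q (f x) = j (p x)) : Pullable p q f := by
  intro A
  have hsub : ∀ x : closure (f ⁻¹' A.carrier), f x ∈ closure A.carrier := fun x =>
    map_mem_closure f.continuous x.2 (fun y hy => hy)
  have h1 : IsProperMap (fun x : closure (f ⁻¹' A.carrier) => f x) :=
    hf.comp isClosed_closure.isProperMap_subtypeVal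
  have h2 : IsProperMap (fun x : closure (f ⁻¹' A.carrier) =>
      (⟨f x, hsub x⟩ : closure A.carrier)) :=
    isProperMap_of_comp_of_inj (g := Subtype.val)
      ((f.continuous.comp continuous_subtype_val).subtype_mk _) continuous_subtype_val h1
      Subtype.val_injective
  have h3 := A.proper.comp h2
  have h4 : ((fun m : closure A.carrier => q m) ∘ fun x : closure (f ⁻¹' A.carrier) =>
      (⟨f x, hsub x⟩ : closure A.carrier)) =
      j ∘ fun x : closure (f ⁻¹' A.carrier) => p x := funext fun x => h x
  rw [h4] at h3
  exact isProperMap_of_comp_of_t2 (p.continuous.comp continuous_subtype_val) j.continuous h3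

theorem pullable_of_embedding {f : GMap P Q} {j : GMap N M}
    (hf : IsClosedEmbedding fun x => (p x, f x)) (h : ∀ x, q (f x) = j (p x)) : Pullable p q f :=
  Sq.pullable ⟨j, f, fun x => (h x).symm, hf⟩

end Pull

/-! ### Cup products with prescribed support -/

/-- The product of two classes, with the support condition weakened. -/
def CohTheory.cupTo {X : GSpace G} {A B D : ClosedInv X}
    (h : MapsTo (GMap.id X) D.carrier (A.union B).carrier) (a : F.coh X A) (b : F.coh X B) :
    F.coh X D :=
  F.map (GMap.id X) h (F.cup a b)

section cupTo

variable {X Y : GSpace G} {A B C D : ClosedInv X}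

theorem CohTheory.map_cupTo {A B D : ClosedInv Y} {A' B' D' : ClosedInv X} {f : GMap X Y}
    (h : MapsTo (GMap.id Y) D.carrier (A.union B).carrier)
    (h' : MapsTo (GMap.id X) D'.carrier (A'.union B').carrier)
    (hA : MapsTo f A'.carrier A.carrier) (hB : MapsTo f B'.carrier B.carrier)
    (hD : MapsTo f D'.carrier D.carrier) (a : F.coh Y A) (b : F.coh Y B) :
    F.map f hD (F.cupTo h a b) = F.cupTo h' (F.map f hA a) (F.map f hB b) := by
  unfold CohTheory.cupTo
  rw [← F.map_cup f hA hB (fun x hx => hx.imp (fun h => hA h) (fun h => hB h))]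
  exact F.map_map_eq _ fun _ => rfl

theorem CohTheory.cupTo_map {A' B' D : ClosedInv X}
    {h : MapsTo (GMap.id X) D.carrier (A.union B).carrier}
    (h' : MapsTo (GMap.id X) D.carrier (A'.union B').carrier)
    {hA : MapsTo (GMap.id X) A.carrier A'.carrier} {hB : MapsTo (GMap.id X) B.carrier B'.carrier}
    (a : F.coh X A') (b : F.coh X B') :
    F.cupTo h (F.map (GMap.id X) hA a) (F.map (GMap.id X) hB b) = F.cupTo h' a b := by
  have hD : MapsTo (GMap.id X) D.carrier D.carrier := fun _ h => h
  rw [← F.map_cupTo h' h hA hB hD, F.map_id]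

theorem CohTheory.cupTo_map_left {A' D : ClosedInv X}
    {h : MapsTo (GMap.id X) D.carrier (A.union B).carrier}
    (h' : MapsTo (GMap.id X) D.carrier (A'.union B).carrier)
    {hA : MapsTo (GMap.id X) A.carrier A'.carrier} (a : F.coh X A') (b : F.coh X B) :
    F.cupTo h (F.map (GMap.id X) hA a) b = F.cupTo h' a b := by
  have hB : MapsTo (GMap.id X) B.carrier B.carrier := fun _ h => h
  have := F.cupTo_map (h := h) h' (hA := hA) (hB := hB) a b
  rwa [F.map_id] at this

theorem CohTheory.cupTo_map_right {B' D : ClosedInv X}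
    {h : MapsTo (GMap.id X) D.carrier (A.union B).carrier}
    (h' : MapsTo (GMap.id X) D.carrier (A.union B').carrier)
    {hB : MapsTo (GMap.id X) B.carrier B'.carrier} (a : F.coh X A) (b : F.coh X B') :
    F.cupTo h a (F.map (GMap.id X) hB b) = F.cupTo h' a b := by
  have hA : MapsTo (GMap.id X) A.carrier A.carrier := fun _ h => h
  have := F.cupTo_map (h := h) h' (hA := hA) (hB := hB) a b
  rwa [F.map_id] at this

theorem CohTheory.cupTo_assoc {AB BC D : ClosedInv X}
    {hAB : MapsTo (GMap.id X) AB.carrier (A.union B).carrier}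
    {hBC : MapsTo (GMap.id X) BC.carrier (B.union C).carrier}
    {h : MapsTo (GMap.id X) D.carrier (AB.union C).carrier}
    {h' : MapsTo (GMap.id X) D.carrier (A.union BC).carrier} (a : F.coh X A) (b : F.coh X B)
    (c : F.coh X C) : F.cupTo h (F.cupTo hAB a b) c = F.cupTo h' a (F.cupTo hBC b c) := by
  have k1 : MapsTo (GMap.id X) D.carrier ((A.union B).union C).carrier := fun x hx =>
    (h hx).imp (fun h => hAB h) (fun h => h)
  have k2 : MapsTo (GMap.id X) D.carrier (A.union (B.union C)).carrier := fun x hx =>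
    (h' hx).imp (fun h => h) (fun h => hBC h)
  have k3 : MapsTo (GMap.id X) (A.union (B.union C)).carrier ((A.union B).union C).carrier :=
    fun x hx => or_assoc.2 hx
  refine (F.cupTo_map_left (h := h) k1 (F.cup a b) c).trans
    (Eq.trans ?_ (F.cupTo_map_right (h := h') k2 a (F.cup b c)).symm)
  unfold CohTheory.cupTo
  rw [← F.cup_assoc k3 a b c, F.map_map]
  exact F.map_congr (fun _ => rfl) _ _

/-- Additive properties may be checked on homogeneous elements. -/
theorem CohTheory.deg_induction {motive : F.coh X A → Prop} (a : F.coh X A)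
    (h : ∀ n, ∀ a ∈ F.deg X A n, motive a) (h0 : motive 0)
    (hadd : ∀ a b, motive a → motive b → motive (a + b)) : motive a := by
  obtain ⟨x, rfl⟩ := (F.internal X A).2 a
  induction x using DirectSum.induction_on with
  | zero => rwa [map_zero]
  | of n a => rw [DirectSum.coeAddMonoidHom_of]; exact h n _ a.2
  | add x y hx hy => rw [map_add]; exact hadd _ _ hx hy

/-- The sign `(-1)^(mn)` is trivial for every `m` when `n` is even, so `a` need not be homogeneous:
both sides are additive in it. -/
theorem CohTheory.cupTo_comm_of_even {D : ClosedInv X}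
    {h : MapsTo (GMap.id X) D.carrier (A.union B).carrier}
    (h' : MapsTo (GMap.id X) D.carrier (B.union A).carrier) (a : F.coh X A) {n : ℤ}
    (hn : Even n) (b : F.coh X B) (hb : b ∈ F.deg X B n) : F.cupTo h a b = F.cupTo h' b a := by
  have hcomm : MapsTo (GMap.id X) (A.union B).carrier (B.union A).carrier := fun x hx => hx.symm
  have key : F.cup a b = F.map (GMap.id X) hcomm (F.cup b a) := by
    refine F.deg_induction (motive := fun a => F.cup a b = F.map (GMap.id X) hcomm (F.cup b a)) a
      (fun m a ha => ?_) ?_ ?_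
    · rw [F.cup_comm hcomm m n a ha b hb, Int.negOnePow_even _ (hn.mul_left m), one_smul]
    · simp
    · intro a a' h h'
      simp [h, h']
  unfold CohTheory.cupTo
  rw [key, F.map_map]
  exact F.map_congr (fun _ => rfl) _ _

end cupTo

/-! ### Thom maps: naturality and associativity -/

section Thom

variable {P Q R X : GSpace G}

theorem ClosedInv.mapsTo_preimage (p : GMap P Q) (A : ClosedInv Q) :
    MapsTo p (A.preimage p).carrier A.carrier := fun _ hx => hx

theorem RelCpt.mapsTo_mul {p : GMap P Q} {b : GMap Q X} {c : GMap P X} (hc : ∀ x, c x = b (p x))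
    (A : RelCpt b) (B : RelCpt p) : MapsTo (GMap.id P) (RelCpt.mul hc A B).compl.carrier
      ((A.compl.preimage p).union B.compl).carrier := fun _ hx => not_and_or.mp hx

theorem CohTheory.thom_of {p : GMap P Q} {b : GMap Q X} {c : GMap P X} (hc : ∀ x, c x = b (p x))
    (B : RelCpt p) (t : F.coh P B.compl) (A : RelCpt b) (x : F.coh Q A.compl) :
    F.thom hc (F.of B t) (F.of A x) = F.of (RelCpt.mul hc A B)
      (F.cupTo (RelCpt.mapsTo_mul hc A B) (F.map p (ClosedInv.mapsTo_preimage p A.compl) x) t) := by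
  unfold CohTheory.thom
  rw [F.lift_of, AddMonoidHom.flip_apply, F.lift_of]
  rfl

/-- Naturality of products. -/
theorem CohTheory.pullG_thom {p : GMap P Q} {b : GMap Q X} {c : GMap P X}
    {hc : ∀ x, c x = b (p x)} {P' Q' X' : GSpace G} {p' : GMap P' Q'} {b' : GMap Q' X'}
    {c' : GMap P' X'} {hc' : ∀ x, c' x = b' (p' x)} {f : GMap P' P} {g : GMap Q' Q}
    (hp : Pullable p' p f) (hb : Pullable b' b g)
    (hcc : Pullable c' c f) (hfg : ∀ x, p (f x) = g (p' x)) (t : F.CohC p) (ξ : F.CohC b) :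
    F.pullG hcc (F.thom hc t ξ) = F.thom hc' (F.pullG hp t) (F.pullG hb ξ) := by
  obtain ⟨B, t, rfl⟩ := F.exists_of t
  obtain ⟨A, x, rfl⟩ := F.exists_of ξ
  have hle : (RelCpt.mul hc A B).pre hcc ≤ RelCpt.mul hc' (A.pre hb) (B.pre hp) := by
    rintro y ⟨h1, h2⟩
    refine ⟨?_, h2⟩
    change g (p' y) ∈ A.carrier
    rw [← hfg]
    exact h1
  have h1 : MapsTo f ((A.pre hb).compl.preimage p').carrier (A.compl.preimage p).carrier := by
    intro y hy
    change p (f y) ∈ A.compl.carrier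
    rw [hfg]; exact hy
  have h2 : MapsTo f (RelCpt.mul hc' (A.pre hb) (B.pre hp)).compl.carrier
      (RelCpt.mul hc A B).compl.carrier := fun y hy hy' => hy (hle hy')
  rw [F.thom_of, F.pullG_of, F.pullG_of, F.pullG_of, F.thom_of, ← F.of_trans _ _ hle]
  unfold CohTheory.trans
  rw [F.map_map]
  refine congrArg _ (Eq.trans (F.map_cupTo _ (RelCpt.mapsTo_mul hc' (A.pre hb) (B.pre hp)) h1
    (B.mapsTo_pre hp) h2 _ _) ?_)
  exact congrArg (fun z => F.cupTo (RelCpt.mapsTo_mul hc' (A.pre hb) (B.pre hp)) z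
    (F.map f (B.mapsTo_pre hp) t)) (F.map_map_eq x hfg)

/-- Associativity of products. -/
theorem CohTheory.thom_thom {p : GMap P Q} {q : GMap Q R} {b : GMap R X} {qp : GMap P R}
    {bq : GMap Q X} {c : GMap P X} (h₁ : ∀ x, qp x = q (p x)) (h₂ : ∀ x, bq x = b (q x))
    (h₃ : ∀ x, c x = bq (p x)) (h₄ : ∀ x, c x = b (qp x)) (t : F.CohC p) (s : F.CohC q)
    (ξ : F.CohC b) : F.thom h₃ t (F.thom h₂ s ξ) = F.thom h₄ (F.thom h₁ t s) ξ := by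
  obtain ⟨C, t, rfl⟩ := F.exists_of t
  obtain ⟨B, s, rfl⟩ := F.exists_of s
  obtain ⟨A, x, rfl⟩ := F.exists_of ξ
  rw [F.thom_of, F.thom_of, F.thom_of, F.thom_of]
  -- Both triple products live over the same set, but the two descriptions are related only through
  -- the pointwise equation `h₁`; hence an explicit comparison of supports.
  have hle : RelCpt.mul h₃ (RelCpt.mul h₂ A B) C ≤ RelCpt.mul h₄ A (RelCpt.mul h₁ B C) := by
    rintro y ⟨⟨hA, hB⟩, hC⟩
    refine ⟨?_, hB, hC⟩
    change qp y ∈ A.carrier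
    rw [h₁]; exact hA
  have hge : RelCpt.mul h₄ A (RelCpt.mul h₁ B C) ≤ RelCpt.mul h₃ (RelCpt.mul h₂ A B) C := by
    rintro y ⟨hA, hB, hC⟩
    refine ⟨⟨?_, hB⟩, hC⟩
    change q (p y) ∈ A.carrier
    rw [← h₁]; exact hA
  rw [← F.of_trans _ _ hle]
  unfold CohTheory.trans
  congr 1
  have k1 : MapsTo p (A.compl.preimage qp).carrier (A.compl.preimage q).carrier := by
    intro y hy
    change q (p y) ∈ A.compl.carrier
    rw [← h₁]; exact hy
  have k2 : MapsTo (GMap.id P) ((RelCpt.mul h₂ A B).compl.preimage p).carrier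
      ((A.compl.preimage qp).union (B.compl.preimage p)).carrier := by
    intro y hy
    rcases RelCpt.mapsTo_mul h₂ A B hy with h | h
    · refine Or.inl ?_
      change qp y ∈ A.compl.carrier
      rw [h₁]; exact h
    · exact Or.inr h
  have k3 : MapsTo (GMap.id P) (RelCpt.mul h₄ A (RelCpt.mul h₁ B C)).compl.carrier
      (RelCpt.mul h₃ (RelCpt.mul h₂ A B) C).compl.carrier := RelCpt.compl_mono hle
  have k4 : MapsTo (GMap.id P) (RelCpt.mul h₄ A (RelCpt.mul h₁ B C)).compl.carrier
      (((RelCpt.mul h₂ A B).compl.preimage p).union C.compl).carrier := fun y hy =>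
    RelCpt.mapsTo_mul h₃ _ C (k3 hy)
  rw [F.map_cupTo (D := (RelCpt.mul h₂ A B).compl) (RelCpt.mapsTo_mul h₂ A B) k2 k1
    (ClosedInv.mapsTo_preimage p B.compl) (ClosedInv.mapsTo_preimage p _)]
  have k5 : MapsTo (GMap.id P) ((RelCpt.mul h₂ A B).compl.preimage p).carrier
      ((RelCpt.mul h₂ A B).compl.preimage p).carrier := fun _ h => h
  have k6 : MapsTo (GMap.id P) C.compl.carrier C.compl.carrier := fun _ h => h
  rw [F.map_cupTo _ k4 k5 k6, F.map_id, F.map_id]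
  refine (F.cupTo_assoc (hBC := RelCpt.mapsTo_mul h₁ B C)
    (h' := RelCpt.mapsTo_mul h₄ A (RelCpt.mul h₁ B C)) _ _ _).trans ?_
  congr 1
  rw [F.map_map]
  exact F.map_congr (fun y => (h₁ y).symm) _ _

end Thom

end

end NNSCorr

namespace NNSCorr

noncomputable section

variable {G : TopGroupoid.{u}} (F : CohTheory.{u, v} G)

/-! ## Degrees -/

section Degree

variable {X Y : GSpace G} {A : ClosedInv X} {B : ClosedInv Y}

/-- The homogeneous component of degree `n`. -/
def CohTheory.dcomp (n : ℤ) : F.coh X A →+ F.coh X A :=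
  (F.deg X A n).subtype.comp ((DFinsupp.evalAddMonoidHom n).comp
    (AddEquiv.ofBijective _ (F.internal X A)).symm.toAddMonoidHom)

theorem CohTheory.dcomp_mem (n : ℤ) (a : F.coh X A) : F.dcomp n a ∈ F.deg X A n :=
  Subtype.property _

theorem CohTheory.dcomp_of_mem {n : ℤ} {a : F.coh X A} (ha : a ∈ F.deg X A n) (m : ℤ) :
    F.dcomp m a = if m = n then a else 0 := by
  have h : (AddEquiv.ofBijective _ (F.internal X A)).symm a =
      DirectSum.of (fun n => F.deg X A n) n ⟨a, ha⟩ := by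
    rw [AddEquiv.symm_apply_eq]
    exact (DirectSum.coeAddMonoidHom_of (F.deg X A) n ⟨a, ha⟩).symm
  change (((AddEquiv.ofBijective _ (F.internal X A)).symm a) m : F.coh X A) = _
  rw [h]
  split_ifs with hm
  · subst hm
    rw [DirectSum.of_eq_same]
  · rw [DirectSum.of_eq_of_ne _ _ _ hm]
    rfl

theorem CohTheory.exists_sum_dcomp (a : F.coh X A) : ∃ s : Finset ℤ, a = ∑ n ∈ s, F.dcomp n a := by
  classical
  refine ⟨DFinsupp.support ((AddEquiv.ofBijective _ (F.internal X A)).symm a), ?_⟩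
  conv_lhs => rw [← (AddEquiv.ofBijective _ (F.internal X A)).apply_symm_apply a]
  generalize hx : (AddEquiv.ofBijective _ (F.internal X A)).symm a = x
  rw [← DirectSum.sum_support_of x, map_sum]
  refine Finset.sum_congr (by rw [DirectSum.sum_support_of]) fun n _ => ?_
  refine (DirectSum.coeAddMonoidHom_of (F.deg X A) n _).trans ?_
  change (x n : F.coh X A) = (((AddEquiv.ofBijective _ (F.internal X A)).symm a) n : F.coh X A)
  rw [hx]

/-- A degree-preserving homomorphism commutes with homogeneous components. -/
theorem CohTheory.dcomp_comm (φ : F.coh Y B →+ F.coh X A) (d : ℤ)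
    (hφ : ∀ n, ∀ b ∈ F.deg Y B n, φ b ∈ F.deg X A (n + d)) (n : ℤ) (b : F.coh Y B) :
    F.dcomp (n + d) (φ b) = φ (F.dcomp n b) := by
  refine F.deg_induction (motive := fun b => F.dcomp (n + d) (φ b) = φ (F.dcomp n b)) b
    (fun m b hb => ?_) (by simp) (fun a b ha hb => by simp [ha, hb])
  rw [F.dcomp_of_mem hb, F.dcomp_of_mem (hφ m b hb)]
  by_cases h : n = m <;> simp [h]

theorem CohTheory.dcomp_map (f : GMap X Y) (h : MapsTo f A.carrier B.carrier) (n : ℤ)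
    (b : F.coh Y B) : F.dcomp n (F.map f h b) = F.map f h (F.dcomp n b) := by
  have := F.dcomp_comm (F.map f h) 0 (fun n b hb => by
    rw [add_zero]; exact F.map_deg f h n b hb) n b
  rwa [add_zero] at this

end Degree

/-! ### Degrees and commutativity in the limit -/

section DegreeC

variable {P N Q M X : GSpace G} {p : GMap P N} {q : GMap Q M}

/-- The homogeneous component of degree `n` of a class with compact support. -/
def CohTheory.comp (n : ℤ) : F.CohC p →+ F.CohC p :=
  F.lift (fun A => (F.of A).comp (F.dcomp n)) (by
    intro A B h x
    simp only [AddMonoidHom.comp_apply]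
    rw [← F.of_trans A B h]
    unfold CohTheory.trans
    rw [F.dcomp_map])

theorem CohTheory.comp_of (n : ℤ) (A : RelCpt p) (a : F.coh P A.compl) :
    F.comp n (F.of A a) = F.of A (F.dcomp n a) := F.lift_of _ _ _ _

theorem CohTheory.isDeg_iff {n : ℤ} {ξ : F.CohC p} : F.IsDeg n ξ ↔ F.comp n ξ = ξ := by
  constructor
  · rintro ⟨A, a, ha, rfl⟩
    rw [F.comp_of, F.dcomp_of_mem ha, if_pos rfl]
  · intro h
    obtain ⟨A, a, rfl⟩ := F.exists_of ξ
    refine ⟨A, F.dcomp n a, F.dcomp_mem n a, ?_⟩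
    rw [← F.comp_of, h]

theorem CohTheory.comp_of_isDeg {n m : ℤ} {ξ : F.CohC p} (h : F.IsDeg n ξ) (hm : m ≠ n) :
    F.comp m ξ = 0 := by
  obtain ⟨A, a, ha, rfl⟩ := h
  rw [F.comp_of, F.dcomp_of_mem ha, if_neg hm, map_zero]

theorem CohTheory.comp_pullG {f : GMap P Q} (hf : Pullable p q f) (n : ℤ) (ξ : F.CohC q) :
    F.comp n (F.pullG hf ξ) = F.pullG hf (F.comp n ξ) := by
  obtain ⟨A, a, rfl⟩ := F.exists_of ξ
  rw [F.pullG_of, F.comp_of, F.comp_of, F.pullG_of, F.dcomp_map]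

/-- Multiplication by a homogeneous representative of `t` shifts degrees by `d`, and a map that
shifts degrees commutes with taking components. -/
theorem CohTheory.comp_thom {p : GMap P Q} {b : GMap Q X} {c : GMap P X} (hc : ∀ x, c x = b (p x))
    {d : ℤ} {t : F.CohC p} (ht : F.IsDeg d t) (n : ℤ) (ξ : F.CohC b) :
    F.comp (n + d) (F.thom hc t ξ) = F.thom hc t (F.comp n ξ) := by
  obtain ⟨B, t, ht, rfl⟩ := ht
  obtain ⟨A, x, rfl⟩ := F.exists_of ξ
  rw [F.thom_of, F.comp_of, F.comp_of, F.thom_of]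
  let φ : F.coh Q A.compl →+ F.coh P (RelCpt.mul hc A B).compl :=
    (F.map (GMap.id P) (RelCpt.mapsTo_mul hc A B)).comp
      ((F.cup.flip t).comp (F.map p (ClosedInv.mapsTo_preimage p A.compl)))
  exact congrArg _ (F.dcomp_comm φ d (fun n x hx => F.map_deg _ _ _ _
    (F.cup_deg _ _ _ (F.map_deg _ _ _ _ hx) _ ht)) n x)

theorem CohTheory.isDeg_thom {p : GMap P Q} {b : GMap Q X} {c : GMap P X}
    (hc : ∀ x, c x = b (p x)) {n d : ℤ} {t : F.CohC p} (ht : F.IsDeg d t) {ξ : F.CohC b}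
    (hξ : F.IsDeg n ξ) : F.IsDeg (n + d) (F.thom hc t ξ) := by
  rw [F.isDeg_iff] at hξ ⊢
  rw [F.comp_thom hc ht, hξ]

/-- Classes whose homogeneous components all have even degree. -/
def CohTheory.IsEven (ξ : F.CohC p) : Prop := ∀ n, ¬ Even n → F.comp n ξ = 0

/-- Odd components of a representative need not vanish; they vanish only in the limit. Dropping them
there leaves a sum of representatives of even degree, to which graded commutativity applies. -/
theorem CohTheory.IsEven.exists_sum {ξ : F.CohC p} (h : F.IsEven ξ) :
    ∃ (A : RelCpt p) (a : F.coh P A.compl) (s : Finset ℤ), (∀ n ∈ s, Even n) ∧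
      ξ = ∑ n ∈ s, F.of A (F.dcomp n a) := by
  classical
  obtain ⟨A, a, rfl⟩ := F.exists_of ξ
  obtain ⟨s, hs⟩ := F.exists_sum_dcomp a
  refine ⟨A, a, s.filter (Even ·), fun n hn => (Finset.mem_filter.1 hn).2, ?_⟩
  conv_lhs => rw [hs]
  have h0 : ∑ n ∈ s with ¬ Even n, F.of A (F.dcomp n a) = 0 := Finset.sum_eq_zero fun n hn => by
    rw [← F.comp_of]
    exact h n (Finset.mem_filter.1 hn).2
  rw [map_sum, ← Finset.sum_filter_add_sum_filter_not s (Even ·), h0, add_zero]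

/-- Even classes commute with all others. -/
theorem CohTheory.thom_comm {P Q₁ Q₂ M : GSpace G} {f₁ : GMap P Q₁} {f₂ : GMap P Q₂}
    {q₁ : GMap Q₁ M} {q₂ : GMap Q₂ M} {c : GMap P M} (hc₁ : ∀ x, c x = q₁ (f₁ x))
    (hc₂ : ∀ x, c x = q₂ (f₂ x)) (h₁ : Pullable f₁ q₂ f₂) (h₂ : Pullable f₂ q₁ f₁)
    (ξ : F.CohC q₁) {t : F.CohC q₂} (ht : F.IsEven t) :
    F.thom hc₁ (F.pullG h₁ t) ξ = F.thom hc₂ (F.pullG h₂ ξ) t := by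
  obtain ⟨B, b, s, hs, rfl⟩ := ht.exists_sum
  simp only [map_sum, AddMonoidHom.finsetSum_apply]
  refine Finset.sum_congr rfl fun n hn => ?_
  obtain ⟨A, x, rfl⟩ := F.exists_of ξ
  have hb := F.dcomp_mem n b
  generalize F.dcomp n b = b at hb
  rw [F.pullG_of, F.pullG_of, F.thom_of, F.thom_of]
  have hle : RelCpt.mul hc₁ A (B.pre h₁) ≤ RelCpt.mul hc₂ B (A.pre h₂) := fun y hy => ⟨hy.2, hy.1⟩
  have k1 : MapsTo (GMap.id P) (RelCpt.mul hc₂ B (A.pre h₂)).compl.carrier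
    (RelCpt.mul hc₁ A (B.pre h₁)).compl.carrier := RelCpt.compl_mono hle
  have k2 : MapsTo (GMap.id P) (RelCpt.mul hc₂ B (A.pre h₂)).compl.carrier
    ((A.pre h₂).compl.union (B.compl.preimage f₂)).carrier := fun y hy =>
    (RelCpt.mapsTo_mul hc₂ B (A.pre h₂) hy).symm
  rw [← F.of_trans _ _ hle]
  refine congrArg _ (Eq.trans ?_ (F.cupTo_comm_of_even (h := k2)
    (RelCpt.mapsTo_mul hc₂ B (A.pre h₂)) _ (hs n hn) _
    (F.map_deg f₂ (ClosedInv.mapsTo_preimage f₂ B.compl) n b hb)))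
  have k3 : MapsTo (GMap.id P) (A.pre h₂).compl.carrier (A.compl.preimage f₁).carrier :=
    fun _ h => h
  have k4 : MapsTo (GMap.id P) (B.compl.preimage f₂).carrier (B.pre h₁).compl.carrier :=
    fun _ h => h
  unfold CohTheory.trans
  rw [F.map_cupTo _ k2 k3 k4, F.map_map, F.map_map]
  congr 1

end DegreeC

/-! ## The unit class -/

section Unit

variable {P Q X : GSpace G}

/-- The unit class of a proper map. -/
def CohTheory.unitClass {p : GMap P Q} (A : RelCpt p) (hA : A.carrier = univ) : F.CohC p :=
  F.of A (F.map (A := A.compl) (B := ClosedInv.empty _) (GMap.id P)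
      (fun x hx => (hx (hA ▸ mem_univ x)).elim) (F.one P))

theorem RelCpt.isProperMap {p : GMap P Q} (A : RelCpt p) (hA : A.carrier = univ) :
    IsProperMap p := by
  have h := A.proper
  rw [hA, closure_univ] at h
  exact h.comp (f := fun x => (⟨x, mem_univ x⟩ : (univ : Set P)))
    (Homeomorph.Set.univ P).symm.isProperMap

def RelCpt.top {p : GMap P Q} (hp : IsProperMap p) : RelCpt p :=
  ⟨univ, isOpen_univ, fun _ _ _ _ => trivial, hp.comp isClosed_closure.isProperMap_subtypeVal⟩

theorem CohTheory.unitClass_eq {p : GMap P Q} (A B : RelCpt p) (hA : A.carrier = univ)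
    (hB : B.carrier = univ) : F.unitClass A hA = F.unitClass B hB := by
  obtain rfl : A = B := by
    cases A; cases B
    congr
    exact hA.trans hB.symm
  rfl

theorem CohTheory.pullG_unitClass {P' Q' : GSpace G} {p : GMap P Q} {p' : GMap P' Q'}
    {f : GMap P' P} (hf : Pullable p' p f) (A : RelCpt p) (hA : A.carrier = univ)
    (A' : RelCpt p') (hA' : A'.carrier = univ) :
    F.pullG hf (F.unitClass A hA) = F.unitClass A' hA' := by
  have h : (A.pre hf).carrier = univ := by
    change f ⁻¹' A.carrier = univ
    rw [hA, preimage_univ]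
  rw [F.unitClass_eq A' (A.pre hf) hA' h]
  have k : MapsTo (GMap.id P) A.compl.carrier (ClosedInv.empty P).carrier :=
    fun x hx => (hx (hA ▸ mem_univ x)).elim
  have k' : MapsTo (GMap.id P') (A.pre hf).compl.carrier (ClosedInv.empty P').carrier :=
    fun x hx => (hx (h ▸ mem_univ x)).elim
  have k'' : MapsTo f (ClosedInv.empty P').carrier (ClosedInv.empty P).carrier :=
    fun x hx => hx.elim
  have h1 : F.unitClass A hA = F.of A (F.map (GMap.id P) k (F.one P)) := rfl
  have h2 : F.unitClass _ h = F.of (A.pre hf) (F.map (GMap.id P') k' (F.one P')) := rfl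
  rw [h1, h2, F.pullG_of, ← F.map_one f k'']
  exact congrArg _ (F.map_map_eq _ fun _ => rfl)

/-- The product with the unit class is the pull-back. -/
theorem CohTheory.thom_unitClass {p : GMap P Q} {b : GMap Q X} {c : GMap P X}
    (hc : ∀ x, c x = b (p x)) (A : RelCpt p) (hA : A.carrier = univ) (h : Pullable c b p)
    (ξ : F.CohC b) : F.thom hc (F.unitClass A hA) ξ = F.pullG h ξ := by
  obtain ⟨B, x, rfl⟩ := F.exists_of ξ
  have k : MapsTo (GMap.id P) A.compl.carrier (ClosedInv.empty P).carrier :=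
    fun x hx => (hx (hA ▸ mem_univ x)).elim
  have h1 : F.unitClass A hA = F.of A (F.map (GMap.id P) k (F.one P)) := rfl
  rw [h1, F.thom_of, F.pullG_of]
  have hle : RelCpt.mul hc B A ≤ B.pre h := fun _ hy => hy.1
  have k1 : MapsTo (GMap.id P) (B.pre h).compl.carrier (B.pre h).compl.carrier := fun _ h => h
  have k3 : MapsTo (GMap.id P) (B.pre h).compl.carrier
      ((B.compl.preimage p).union (ClosedInv.empty P)).carrier := fun _ h => Or.inl h
  have k4 : MapsTo (GMap.id P) (B.pre h).compl.carrier
      ((ClosedInv.empty P).union (B.compl.preimage p)).carrier := fun _ h => Or.inr h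
  have k5 : MapsTo (GMap.id P) (B.compl.preimage p).carrier (B.compl.preimage p).carrier :=
    fun _ h => h
  have k6 : MapsTo (GMap.id P) (ClosedInv.empty P).carrier (ClosedInv.empty P).carrier :=
    fun _ h => h
  have k7 : MapsTo (GMap.id P) (RelCpt.mul hc B A).compl.carrier
      ((B.compl.preimage p).union (ClosedInv.empty P)).carrier := fun y hy =>
    (RelCpt.mapsTo_mul hc B A hy).imp_right fun h => k h
  have k8 : MapsTo (GMap.id P) (B.compl.preimage p).carrier
      ((ClosedInv.empty P).union (B.compl.preimage p)).carrier := fun _ h => Or.inr h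
  rw [← F.of_trans _ _ hle, F.cupTo_map_right k7]
  unfold CohTheory.trans
  rw [F.map_cupTo _ k3 k5 k6, F.map_id, F.map_id,
    F.cupTo_comm_of_even k4 _ Even.zero _ (F.one_deg P)]
  exact congrArg _ (F.one_cup k8 _)

end Unit

/-! ## Homotopy invariance -/

section Homotopy

variable {P N Q M : GSpace G} {p : GMap P N} {q : GMap Q M}

/-- Pointwise conditions on supports are not enough for a homotopy. The axiom concerns a fixed pair,
so one support `B` has to contain the preimages of `A` for all times at once. -/
theorem CohTheory.pullG_homotopy (H : unitInterval → GMap P Q)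
    (hH : Continuous fun x : P × unitInterval => H x.2 x.1)
    (hB : ∀ A : RelCpt q, ∃ B : RelCpt p, ∀ t, H t ⁻¹' A.carrier ⊆ B.carrier)
    (h₀ : Pullable p q (H 0)) (h₁ : Pullable p q (H 1)) (ξ : F.CohC q) :
    F.pullG h₀ ξ = F.pullG h₁ ξ := by
  obtain ⟨A, a, rfl⟩ := F.exists_of ξ
  obtain ⟨B, hB⟩ := hB A
  have h : ∀ t, MapsTo (H t) B.compl.carrier A.compl.carrier := fun t x hx hx' => hx (hB t hx')
  have hle₀ : A.pre h₀ ≤ B := hB 0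
  have hle₁ : A.pre h₁ ≤ B := hB 1
  rw [F.pullG_of, F.pullG_of, ← F.of_trans _ _ hle₀, ← F.of_trans _ _ hle₁]
  unfold CohTheory.trans
  rw [F.map_map, F.map_map]
  exact congrArg _ (F.homotopy H h hH a)

/-- A continuous family of automorphisms over the base induces the same map on classes with compact
support. -/
theorem CohTheory.pullG_isotopy (H K : unitInterval → GMap P P)
    (hH : Continuous fun x : P × unitInterval => H x.2 x.1)
    (hK : Continuous fun x : P × unitInterval => K x.2 x.1)
    (hKH : ∀ t x, K t (H t x) = x) (hp : ∀ t x, p (K t x) = p x)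
    (h₀ : Pullable p p (H 0)) (h₁ : Pullable p p (H 1)) (ξ : F.CohC p) :
    F.pullG h₀ ξ = F.pullG h₁ ξ := by
  refine F.pullG_homotopy H hH (fun A => ?_) h₀ h₁ ξ
  -- All preimages `H t ⁻¹' A` lie in the image of `closure A × [0,1]` under the inverse family.
  -- Since `K` preserves fibres of `p` and the interval is compact, this image is closed and proper
  -- over the base.
  let φ : closure A.carrier × unitInterval → P := fun x => K x.2 x.1
  have hφ : Continuous φ := hK.comp (by fun_prop : Continuous
    fun x : closure A.carrier × unitInterval => ((x.1 : P), x.2))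
  have hpφ : IsProperMap (p ∘ φ) := by
    have : p ∘ φ = (fun m : closure A.carrier => p m) ∘ Prod.fst := funext fun x => hp _ _
    rw [this]
    exact A.proper.comp isProperMap_fst_of_compactSpace
  have hφp : IsProperMap φ := isProperMap_of_comp_of_t2 hφ p.continuous hpφ
  refine ⟨RelCpt.ofSubset (⋃ t, H t ⁻¹' A.carrier)
    (isOpen_iUnion fun t => A.isOpen.preimage (H t).continuous) ?_ (range φ)
    hφp.isClosedMap.isClosed_range ?_ ?_, fun t => subset_iUnion (fun t => H t ⁻¹' A.carrier) t⟩
  · intro g x e hx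
    obtain ⟨t, ht⟩ := mem_iUnion.1 hx
    refine mem_iUnion.2 ⟨t, ?_⟩
    simp only [mem_preimage] at ht ⊢
    rw [(H t).map_act]
    exact A.inv _ _ _ ht
  · intro x hx
    obtain ⟨t, ht⟩ := mem_iUnion.1 hx
    exact ⟨(⟨H t x, subset_closure ht⟩, t), hKH t x⟩
  · refine isProperMap_of_comp_of_surj (f := rangeFactorization φ)
      (hφ.subtype_mk _) (p.continuous.comp continuous_subtype_val) hpφ rangeFactorization_surjective

end Homotopy

end

end NNSCorr

namespace NNSCorr

noncomputable section

variable {G : TopGroupoid.{u}} (F : CohTheory.{u, v} G)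

/-! ## The exact sequence of a triple -/

section Triple

variable {X Y : GSpace G}

/-- The corestriction of a `G`-map to a closed invariant subset. -/
def ClosedInv.cod (A : ClosedInv X) (f : GMap Y X) (h : ∀ y, f y ∈ A.carrier) :
    GMap Y A.toGSpace where
  toFun y := ⟨f y, h y⟩
  continuous := f.continuous.subtype_mk _
  anchor_map y := f.anchor_map y
  map_act g y e := Subtype.ext (f.map_act g y e)

theorem ClosedInv.mapsTo_incl (A B : ClosedInv X) :
    MapsTo A.incl (B.preimage A.incl).carrier B.carrier := fun _ h => h

theorem ClosedInv.mapsTo_empty {A : ClosedInv Y} (f : GMap X Y) :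
    MapsTo f (ClosedInv.empty X).carrier A.carrier := fun _ h => h.elim

/-- Restriction to a closed invariant subset. -/
def CohTheory.res (A Q : ClosedInv X) : F.coh X Q →+ F.coh A.toGSpace (Q.preimage A.incl) :=
  F.map A.incl (A.mapsTo_incl Q)

/-- Inclusion of the whole space induces isomorphisms, so exactness of the sequence of the pair
leaves no room for a relative class. -/
theorem CohTheory.eq_zero_of_univ (A : ClosedInv X) (hA : ∀ x, x ∈ A.carrier) (a : F.coh X A) :
    a = 0 := by
  let k : GMap X A.toGSpace := A.cod (GMap.id X) hA
  have hsurj : ∀ b : F.coh A.toGSpace (ClosedInv.empty _),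
      F.map (A := ClosedInv.empty _) A.incl (ClosedInv.mapsTo_empty _)
        (F.map k (ClosedInv.mapsTo_empty (A := ClosedInv.empty _) k) b) = b := fun b => by
    rw [F.map_map]
    exact F.map_eq_self (fun _ => rfl) _ b
  have hinj : ∀ x : F.coh X (ClosedInv.empty _),
      F.map (A := ClosedInv.empty _) A.incl (ClosedInv.mapsTo_empty _) x = 0 → x = 0 := by
    intro x hx
    have h : F.map k (ClosedInv.mapsTo_empty (A := ClosedInv.empty _) k)
      (F.map (A := ClosedInv.empty _) A.incl (ClosedInv.mapsTo_empty _) x) = x := by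
      rw [F.map_map]
      exact F.map_eq_self (fun _ => rfl) _ x
    rw [← h, hx, map_zero]
  have h1 := (F.exact_rel A).apply_apply_eq_zero a
  obtain ⟨b, rfl⟩ := (F.exact_sub A a).1 (hinj _ h1)
  exact (F.exact_abs A b).2 ⟨_, hsurj b⟩

variable {T Q : ClosedInv X}

/-- The boundary map of a triple. -/
def CohTheory.tdelta (T Q : ClosedInv X) : F.coh T.toGSpace (Q.preimage T.incl) →+ F.coh X T :=
  (F.delta T).comp (F.map (GMap.id _) (ClosedInv.mapsTo_empty _))

theorem CohTheory.tdelta_res (a : F.coh X Q) : F.tdelta T Q (F.res T Q a) = 0 := by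
  have h : F.map (GMap.id T.toGSpace) (ClosedInv.mapsTo_empty _) (F.res T Q a) =
      F.map (A := ClosedInv.empty _) (B := ClosedInv.empty X) T.incl (fun _ hx => hx.elim)
        (F.map (GMap.id X) (ClosedInv.mapsTo_empty _) a) := F.map_map_eq _ fun _ => rfl
  change F.delta T _ = 0
  rw [h]
  exact (F.exact_abs T).apply_apply_eq_zero _

/-- The composite factors through the group of the pair `(T, T)`, which is zero. -/
theorem CohTheory.res_map_id (h : MapsTo (GMap.id X) Q.carrier T.carrier) (t : F.coh X T) :
    F.res T Q (F.map (GMap.id X) h t) = 0 := by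
  have h1 : MapsTo (GMap.id T.toGSpace) (Q.preimage T.incl).carrier (T.preimage T.incl).carrier :=
    fun _ hx => h hx
  have h2 : F.res T Q (F.map (GMap.id X) h t) = F.map (GMap.id _) h1 (F.res T T t) :=
    F.map_map_eq _ fun _ => rfl
  rw [h2, F.eq_zero_of_univ (T.preimage T.incl) (fun x => x.2) (F.res T T t), map_zero]

/-- The identification of `Q ⊆ T` with `Q ⊆ X`. -/
def ClosedInv.lower (T Q : ClosedInv X) : GMap (Q.preimage T.incl).toGSpace Q.toGSpace :=
  ClosedInv.restrict T.incl (Q.preimage T.incl) Q (T.mapsTo_incl Q)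

def ClosedInv.raise {T Q : ClosedInv X} (h : Q.carrier ⊆ T.carrier) :
    GMap Q.toGSpace (Q.preimage T.incl).toGSpace :=
  (Q.preimage T.incl).cod (T.cod Q.incl fun x => h x.2) fun x => x.2

theorem CohTheory.res_delta (q : F.coh Q.toGSpace (ClosedInv.empty _)) :
    F.res T Q (F.delta Q q) =
      F.delta (Q.preimage T.incl) (F.map (T.lower Q) (ClosedInv.mapsTo_empty _) q) :=
  F.delta_nat _ _ _ _ _

theorem CohTheory.map_lower_raise (h : Q.carrier ⊆ T.carrier)
    (q : F.coh (Q.preimage T.incl).toGSpace (ClosedInv.empty _)) :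
    F.map (T.lower Q) (ClosedInv.mapsTo_empty (A := ClosedInv.empty _) _)
      (F.map (ClosedInv.raise h) (ClosedInv.mapsTo_empty _) q) = q := by
  rw [F.map_map]
  exact F.map_eq_self (fun _ => rfl) _ q

/-- Exactness of the sequence of the triple `Q ⊆ T ⊆ X` at `F(X, Q)`. An absolute lift `t` of the
class exists first; its relative error comes from `F(Q)`, and that element extends to `T`, so a
boundary term corrects `t`. -/
theorem CohTheory.exists_of_res_eq_zero (h : MapsTo (GMap.id X) Q.carrier T.carrier)
    (a : F.coh X Q) (ha : F.res T Q a = 0) : ∃ t, F.map (GMap.id X) h t = a := by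
  have e1 : F.map (A := ClosedInv.empty _) (B := ClosedInv.empty X) T.incl (fun _ hx => hx.elim)
      (F.map (GMap.id X) (ClosedInv.mapsTo_empty _) a) = 0 := by
    have : F.map (GMap.id T.toGSpace) (ClosedInv.mapsTo_empty _) (F.res T Q a) =
        F.map (A := ClosedInv.empty _) (B := ClosedInv.empty X) T.incl (fun _ hx => hx.elim)
          (F.map (GMap.id X) (ClosedInv.mapsTo_empty _) a) := F.map_map_eq _ fun _ => rfl
    rw [← this, ha, map_zero]
  obtain ⟨t, ht⟩ := (F.exact_rel T _).1 e1
  have e2 : F.map (GMap.id X) (ClosedInv.mapsTo_empty _) (a - F.map (GMap.id X) h t) = 0 := by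
    have : F.map (GMap.id X) (ClosedInv.mapsTo_empty _) (F.map (GMap.id X) h t) =
        F.map (A := ClosedInv.empty X) (B := T) (GMap.id X) (fun _ hx => hx.elim) t := by
      rw [F.map_map]; rfl
    rw [map_sub, this, ht, sub_self]
  obtain ⟨q, hq⟩ := (F.exact_sub Q _).1 e2
  have e3 : F.delta (Q.preimage T.incl) (F.map (T.lower Q) (ClosedInv.mapsTo_empty _) q) = 0 := by
    rw [← F.res_delta, hq, map_sub, ha, F.res_map_id, sub_zero]
  obtain ⟨s, hs⟩ := (F.exact_abs _ _).1 e3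
  refine ⟨t + F.delta T s, ?_⟩
  have e4 : F.map (GMap.id X) h (F.delta T s) = F.delta Q q := by
    rw [F.delta_nat]
    congr 1
    have e5 : q = F.map (ClosedInv.raise h) (ClosedInv.mapsTo_empty (A := ClosedInv.empty _) _)
        (F.map (T.lower Q) (ClosedInv.mapsTo_empty _) q) := by
      rw [F.map_map]
      exact (F.map_eq_self (fun _ => rfl) _ q).symm
    rw [e5, ← hs]
    exact F.map_eq_map_map _ fun _ => rfl
  rw [map_add, e4, hq]
  abel

/-- Exactness of the sequence of the triple at `F(T, Q)`. The boundary condition extends the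
absolute class from `T` to `X`; the extension vanishes on `Q` and lifts to `F(X, Q)`, up to an error
coming from `F(Q)`. -/
theorem CohTheory.exists_res_eq (h : Q.carrier ⊆ T.carrier)
    (c : F.coh T.toGSpace (Q.preimage T.incl)) (hc : F.tdelta T Q c = 0) :
    ∃ a, F.res T Q a = c := by
  obtain ⟨y, hy⟩ := (F.exact_abs T _).1 hc
  have e1 : F.map (A := ClosedInv.empty _) (B := ClosedInv.empty X) Q.incl (fun _ hx => hx.elim)
      y = 0 := by
    have e2 : F.map (A := ClosedInv.empty _) (B := ClosedInv.empty X) Q.incl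
        (fun _ hx => hx.elim) y = F.map (T.cod Q.incl fun x => h x.2)
        (ClosedInv.mapsTo_empty (A := ClosedInv.empty _) _) (F.map (A := ClosedInv.empty _)
          (B := ClosedInv.empty X) T.incl (fun _ hx => hx.elim) y) :=
      F.map_eq_map_map _ fun _ => rfl
    have k : MapsTo (T.cod Q.incl fun x => h x.2) (Q.preimage Q.incl).carrier
      (Q.preimage T.incl).carrier := fun _ hx => hx
    have e3 : F.map (T.cod Q.incl fun x => h x.2) (ClosedInv.mapsTo_empty (A := ClosedInv.empty _) _)
        (F.map (GMap.id T.toGSpace) (ClosedInv.mapsTo_empty _) c) =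
        F.map (GMap.id _) (ClosedInv.mapsTo_empty _) (F.map _ k c) := F.map_map_eq _ fun _ => rfl
    rw [e2, hy, e3, F.eq_zero_of_univ (Q.preimage Q.incl) (fun x => x.2) (F.map _ k c), map_zero]
  obtain ⟨a, ha⟩ := (F.exact_rel Q _).1 e1
  have e4 : F.map (GMap.id T.toGSpace) (ClosedInv.mapsTo_empty _) (c - F.res T Q a) = 0 := by
    have : F.map (GMap.id T.toGSpace) (ClosedInv.mapsTo_empty _) (F.res T Q a) =
        F.map (A := ClosedInv.empty _) (B := ClosedInv.empty X) T.incl (fun _ hx => hx.elim)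
          (F.map (A := ClosedInv.empty X) (B := Q) (GMap.id X) (fun _ hx => hx.elim) a) :=
      F.map_map_eq _ fun _ => rfl
    rw [map_sub, this, ha, hy, sub_self]
  obtain ⟨q, hq⟩ := (F.exact_sub (Q.preimage T.incl) _).1 e4
  refine ⟨a + F.delta Q (F.map (ClosedInv.raise h) (ClosedInv.mapsTo_empty _) q), ?_⟩
  rw [map_add, F.res_delta, F.map_lower_raise, hq]
  abel

/-- Naturality of the boundary map of a triple for restriction to a subspace. -/
theorem CohTheory.res_tdelta (A : ClosedInv X) (c : F.coh T.toGSpace (Q.preimage T.incl))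
    (h : MapsTo (ClosedInv.restrict A.incl (T.preimage A.incl) T (A.mapsTo_incl T))
      ((Q.preimage A.incl).preimage (T.preimage A.incl).incl).carrier (Q.preimage T.incl).carrier) :
    F.res A T (F.tdelta T Q c) = F.tdelta (T.preimage A.incl) (Q.preimage A.incl)
      (F.map (ClosedInv.restrict A.incl (T.preimage A.incl) T (A.mapsTo_incl T)) h c) := by
  refine (F.delta_nat (T.preimage A.incl) T A.incl (A.mapsTo_incl T) _).trans ?_
  exact congrArg (F.delta _) (F.map_map_eq _ fun _ => rfl)

theorem CohTheory.res_bijective {A C : ClosedInv X}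
    (h : closure C.carrierᶜ ⊆ interior A.carrier) : Function.Bijective (F.res C A) :=
  F.excision A C h

end Triple

/-! ## Mayer–Vietoris gluing -/

section Glue

variable {X : GSpace G}

def ClosedInv.inter (A B : ClosedInv X) : ClosedInv X :=
  ⟨A.carrier ∩ B.carrier, A.closed.inter B.closed,
    fun g x e h => ⟨A.inv g x e h.1, B.inv g x e h.2⟩⟩

/-- Away from the neighbourhood `K` of `B`, a space covered by `B` and `Q` lies in the interior of
`Q`. This is the hypothesis of excision, in the form needed to discard everything outside `K`. -/
theorem closure_compl_preimage_subset {S X : Type*} [TopologicalSpace S] [TopologicalSpace X]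
    {s : S → X} (hs : Continuous s) {B Q K : Set X} (hB : IsClosed B) (hS : ∀ x, s x ∈ B ∪ Q)
    (hBK : B ⊆ interior K) : closure (s ⁻¹' K)ᶜ ⊆ interior (s ⁻¹' Q) := by
  have h1 : closure (s ⁻¹' K)ᶜ ⊆ s ⁻¹' Bᶜ := by
    have h2 : (s ⁻¹' K)ᶜ ⊆ s ⁻¹' (interior K)ᶜ := fun x hx hx' =>
      hx (interior_subset (s := K) hx')
    exact (closure_minimal h2 (isOpen_interior.isClosed_compl.preimage hs)).trans
      fun x hx hx' => hx (hBK hx')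
  exact h1.trans (interior_maximal (fun x hx => (hS x).resolve_left hx)
    (hB.isOpen_compl.preimage hs))

/-- Gluing of classes along a collar: `K` is a neighbourhood of `B` that is squeezed into `B` by a
deformation that respects `A` and `Q`. -/
theorem CohTheory.exists_glue (A B Q K : ClosedInv X)
    (hAB : closure A.carrierᶜ ⊆ interior B.carrier) (hBK : B.carrier ⊆ interior K.carrier)
    (H : unitInterval → GMap K.toGSpace K.toGSpace)
    (hH : Continuous fun x : K.toGSpace × unitInterval => H x.2 x.1)
    (hH0 : ∀ x, H 0 x = x) (hH1 : ∀ x, (H 1 x).1 ∈ B.carrier)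
    (hHB : ∀ t x, x.1 ∈ B.carrier → H t x = x)
    (hHQ : ∀ t x, x.1 ∈ Q.carrier → (H t x).1 ∈ Q.carrier)
    (hHA : ∀ t x, x.1 ∈ A.carrier → (H t x).1 ∈ A.carrier)
    (a : F.coh A.toGSpace (Q.preimage A.incl)) (b : F.coh B.toGSpace (Q.preimage B.incl))
    (hA : MapsTo (A.cod (A.inter B).incl fun x => x.2.1) (Q.preimage (A.inter B).incl).carrier
      (Q.preimage A.incl).carrier)
    (hB : MapsTo (B.cod (A.inter B).incl fun x => x.2.2) (Q.preimage (A.inter B).incl).carrier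
      (Q.preimage B.incl).carrier)
    (hab : F.map _ hA a = F.map _ hB b) : ∃ c, F.res A Q c = a ∧ F.res B Q c = b := by
  have hBK' : B.carrier ⊆ K.carrier := hBK.trans interior_subset
  let T := B.union Q
  -- the extension of `b` to `T`
  obtain ⟨b', hb'⟩ : ∃ b' : F.coh T.toGSpace (Q.preimage T.incl), ∀ (h : MapsTo
      (T.cod B.incl fun x => Or.inl x.2) (Q.preimage B.incl).carrier (Q.preimage T.incl).carrier),
      F.map _ h b' = b := by
    let KT := K.preimage T.incl
    let QT := Q.preimage T.incl
    have hexc := (F.res_bijective (A := QT) (C := KT) (closure_compl_preimage_subset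
      (s := fun x : T.toGSpace => x.1) continuous_subtype_val B.closed (fun x => x.2) hBK)).2
    let κ : GMap KT.toGSpace K.toGSpace := K.cod (T.incl.comp KT.incl) fun x => x.2
    -- The end of the deformation retracts `K` onto `B`. Excision says that a class on `(T, Q)` is a
    -- class on the part of `T` in `K`, so the retraction extends `b`.
    let ρ : GMap KT.toGSpace B.toGSpace := B.cod (K.incl.comp ((H 1).comp κ)) fun x => hH1 _
    have hρ : MapsTo ρ (QT.preimage KT.incl).carrier (Q.preimage B.incl).carrier := fun x hx =>
      hHQ 1 (κ x) hx
    obtain ⟨b', hb'⟩ := hexc (F.map ρ hρ b)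
    refine ⟨b', fun h => ?_⟩
    let ι : GMap B.toGSpace KT.toGSpace :=
      KT.cod (T.cod B.incl fun x => Or.inl x.2) fun x => hBK' x.2
    have hι : MapsTo ι (Q.preimage B.incl).carrier (QT.preimage KT.incl).carrier := fun _ hx => hx
    have e : F.map _ h b' = F.map ι hι (F.res KT QT b') := by
      exact F.map_eq_map_map _ fun _ => rfl
    rw [e, hb', F.map_map]
    refine F.map_eq_self (fun x => Subtype.ext ?_) _ b
    exact congrArg (fun z : K.toGSpace => z.1) (hHB 1 (κ (ι x)) x.2)
  let TA := T.preimage A.incl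
  let QA := Q.preimage A.incl
  -- classes on `A ∩ T` are determined by their restriction to `A ∩ B`
  let δ : GMap (A.inter B).toGSpace TA.toGSpace :=
    TA.cod (A.cod (A.inter B).incl fun x => x.2.1) fun x => Or.inl x.2.2
  have hδ : MapsTo δ (Q.preimage (A.inter B).incl).carrier (QA.preimage TA.incl).carrier :=
    fun _ hx => hx
  have hinj : ∀ x : F.coh TA.toGSpace (QA.preimage TA.incl), F.map δ hδ x = 0 → x = 0 := by
    intro x hx
    let KT := (K.preimage A.incl).preimage TA.incl
    let QT := QA.preimage TA.incl
    have hexc := (F.res_bijective (A := QT) (C := KT) (closure_compl_preimage_subset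
      (s := fun x : TA.toGSpace => x.1.1)
      (A.incl.comp TA.incl).continuous B.closed (fun x => x.2) hBK)).1
    refine (map_eq_zero_iff _ hexc).1 ?_
    let κ : GMap KT.toGSpace K.toGSpace := K.cod (A.incl.comp (TA.incl.comp KT.incl)) fun x => x.2
    -- The deformation stays inside `A ∩ T`: it preserves `A`, fixes `B` pointwise and maps `Q ∩ K`
    -- into `Q`.
    let H' : unitInterval → GMap KT.toGSpace KT.toGSpace := fun t =>
      KT.cod (TA.cod (A.cod (K.incl.comp ((H t).comp κ)) fun x => hHA t _ x.1.1.2) fun x => by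
        rcases x.1.2 with h | h
        · refine Or.inl ?_
          change (H t (κ x)).1 ∈ B.carrier
          rw [hHB t _ h]; exact h
        · exact Or.inr (hHQ t (κ x) h)) fun x => (H t (κ x)).2
    have hH' : Continuous fun x : KT.toGSpace × unitInterval => H' x.2 x.1 := by
      refine Continuous.subtype_mk (p := (· ∈ KT.carrier)) (Continuous.subtype_mk
        (p := (· ∈ TA.carrier)) (Continuous.subtype_mk (p := (· ∈ A.carrier)) ?_ _) _) _
      refine K.incl.continuous.comp (hH.comp (f := fun x : KT.toGSpace × unitInterval =>
        (κ x.1, x.2)) ?_)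
      exact (κ.continuous.comp continuous_fst).prodMk continuous_snd
    have hHm : ∀ t, MapsTo (H' t) (QT.preimage KT.incl).carrier (QT.preimage KT.incl).carrier :=
      fun t x hx => hHQ t (κ x) hx
    have h0 := F.homotopy H' hHm hH' (F.res KT QT x)
    rw [F.map_eq_self (f := H' 0) (fun x => by
      refine Subtype.ext (Subtype.ext (Subtype.ext ?_))
      exact congrArg (fun z : K.toGSpace => z.1) (hH0 (κ x)))] at h0
    rw [h0]
    let ρ : GMap KT.toGSpace (A.inter B).toGSpace :=
      (A.inter B).cod (K.incl.comp ((H 1).comp κ)) fun x => ⟨hHA 1 _ x.1.1.2, hH1 _⟩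
    have hρ : MapsTo ρ (QT.preimage KT.incl).carrier (Q.preimage (A.inter B).incl).carrier :=
      fun x hx => hHQ 1 (κ x) hx
    have e : F.map (H' 1) (hHm 1) (F.res KT QT x) = F.map ρ hρ (F.map δ hδ x) :=
      F.map_map_eq _ fun _ => rfl
    rw [e, hx, map_zero]
  -- This excision identifies `F(X, T)` with `F(A, A ∩ T)`. Both the obstruction to extending `b'`
  -- and the final correction live in this group.
  have hexcA := F.res_bijective (A := T) (C := A)
    (hAB.trans (interior_mono subset_union_left))
  have k1 : MapsTo (ClosedInv.restrict A.incl TA T (A.mapsTo_incl T)) (QA.preimage TA.incl).carrier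
      (Q.preimage T.incl).carrier := fun _ hx => hx
  have k2 : MapsTo (T.cod B.incl fun x => Or.inl x.2) (Q.preimage B.incl).carrier
    (Q.preimage T.incl).carrier := fun _ hx => hx
  have e1 : F.map _ k1 b' = F.res TA QA a := by
    refine sub_eq_zero.1 (hinj _ ?_)
    rw [map_sub, sub_eq_zero]
    refine Eq.trans (b := F.map _ hB b) ?_ ?_
    · rw [← hb' k2]
      exact F.map_map_eq _ fun _ => rfl
    · rw [← hab]
      exact F.map_eq_map_map _ fun _ => rfl
  have hQT : Q.carrier ⊆ T.carrier := fun _ h => Or.inr h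
  have hQT' : MapsTo (GMap.id X) Q.carrier T.carrier := hQT
  -- The obstruction to extending `b'` is detected on `A`, where `b'` agrees with the restriction of
  -- `a` and therefore extends.
  obtain ⟨y, hy⟩ := F.exists_res_eq hQT b' (by
    refine (map_eq_zero_iff _ hexcA.1).1 ?_
    rw [F.res_tdelta A b' k1, e1, F.tdelta_res])
  have e2 : F.res TA QA (F.res A Q y - a) = 0 := by
    rw [map_sub, ← e1, ← hy, sub_eq_zero]
    exact F.map_map_eq _ fun _ => rfl
  have k3 : MapsTo (GMap.id A.toGSpace) QA.carrier TA.carrier := fun _ hx => hQT hx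
  obtain ⟨z, hz⟩ := F.exists_of_res_eq_zero k3 _ e2
  -- The error of `y` on `A` comes from a class in `F(X, T)`. Subtracting that class does not affect
  -- the restriction to `B ⊆ T`.
  obtain ⟨z', rfl⟩ := hexcA.2 z
  refine ⟨y - F.map (GMap.id X) hQT' z', ?_, ?_⟩
  · have : F.res A Q (F.map (GMap.id X) hQT' z') = F.map (GMap.id A.toGSpace) k3 (F.res A T z') :=
      F.map_map_eq _ fun _ => rfl
    rw [map_sub, this, hz, sub_sub_cancel]
  · have e3 : F.res B Q y = b := by
      rw [← hb' k2, ← hy]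
      exact F.map_eq_map_map _ fun _ => rfl
    have k4 : MapsTo (T.cod B.incl fun x => Or.inl x.2) (Q.preimage B.incl).carrier
      (Q.preimage T.incl).carrier := fun _ hx => hx
    have e4 : F.res B Q (F.map (GMap.id X) hQT' z') =
        F.map _ k4 (F.res T Q (F.map (GMap.id X) hQT' z')) := by
      exact F.map_eq_map_map _ fun _ => rfl
    rw [map_sub, e3, e4, F.res_map_id, map_zero, sub_zero]

end Glue

/-! ## Decomposition into open and closed pieces -/

section Clopen

variable {X : GSpace G}

/-- Additivity for two complementary open and closed parts, from excision. The restriction to `T = C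
∪ Q` vanishes, so the class lifts to `F(X, T)`; by excision this group is seen on `C'`, where `T`
and `Q` have the same trace. -/
theorem CohTheory.eq_zero_of_clopen (C C' Q : ClosedInv X)
    (hu : ∀ x, x ∈ C.carrier ∨ x ∈ C'.carrier) (hd : ∀ x, x ∈ C.carrier → x ∉ C'.carrier)
    (a : F.coh X Q) (h : F.res C Q a = 0) (h' : F.res C' Q a = 0) : a = 0 := by
  have hC : C.carrierᶜ = C'.carrier := by
    ext x; exact ⟨fun hx => (hu x).resolve_left hx, fun hx hx' => hd x hx' hx⟩
  have hC' : C'.carrierᶜ = C.carrier := by rw [← hC, compl_compl]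
  have hCo : IsOpen C.carrier := by rw [← hC']; exact C'.closed.isOpen_compl
  let T := C.union Q
  have hres : F.res T Q a = 0 := by
    let CT := C.preimage T.incl
    have hexc := (F.res_bijective (A := Q.preimage T.incl) (C := CT) (closure_compl_preimage_subset
      (s := fun x : T.toGSpace => x.1) continuous_subtype_val C.closed (fun x => x.2)
      hCo.interior_eq.symm.subset)).1
    refine (map_eq_zero_iff _ hexc).1 ?_
    have k : MapsTo (T.lower C) ((Q.preimage T.incl).preimage CT.incl).carrier
      (Q.preimage C.incl).carrier := fun _ h => h
    have e : F.res CT (Q.preimage T.incl) (F.res T Q a) = F.map (T.lower C) k (F.res C Q a) :=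
      F.map_map_eq _ fun _ => rfl
    rw [e, h, map_zero]
  have hQT : MapsTo (GMap.id X) Q.carrier T.carrier := fun _ h => Or.inr h
  obtain ⟨t, rfl⟩ := F.exists_of_res_eq_zero hQT a hres
  have hexc := (F.res_bijective (A := T) (C := C') (by
    rw [hC', C.closed.closure_eq]
    exact interior_maximal subset_union_left hCo)).1
  suffices F.res C' T t = 0 by rw [(map_eq_zero_iff _ hexc).1 this, map_zero]
  have k1 : MapsTo (GMap.id C'.toGSpace) (Q.preimage C'.incl).carrier
    (T.preimage C'.incl).carrier := fun _ h => Or.inr h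
  have k2 : MapsTo (GMap.id C'.toGSpace) (T.preimage C'.incl).carrier
    (Q.preimage C'.incl).carrier := fun x hx => hx.resolve_left fun hx' => hd _ hx' x.2
  have e1 : F.map _ k1 (F.res C' T t) = 0 := by
    rw [← h']
    exact F.map_map_eq _ fun _ => rfl
  have e2 : F.map _ k2 (F.map _ k1 (F.res C' T t)) = F.res C' T t := by
    rw [F.map_map]
    exact F.map_eq_self (fun _ => rfl) _ _
  rw [← e2, e1, map_zero]

/-- The part of `X` where an invariant locally constant function takes values in `S`. -/
def piece (ρ : X → ℕ) (hρ : Continuous ρ) (hi : ∀ g x e, ρ (X.act g x e) = ρ x) (S : Set ℕ) :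
    ClosedInv X :=
  ⟨ρ ⁻¹' S, (isClosed_discrete S).preimage hρ, fun g x e h => by
    rwa [mem_preimage, hi]⟩

/-- Induction on the number of values, splitting off the top value. The axioms yield only finite
additivity, which is why ranks have to be bounded. -/
theorem CohTheory.eq_zero_of_pieces (n : ℕ) : ∀ {X : GSpace G} (Q : ClosedInv X) (a : F.coh X Q)
    (ρ : X → ℕ) (hρ : Continuous ρ) (hi : ∀ g x e, ρ (X.act g x e) = ρ x), (∀ x, ρ x < n) →
    (∀ d, F.res (piece ρ hρ hi {d}) Q a = 0) → a = 0 := by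
  induction n with
  | zero =>
    intro X Q a ρ hρ hi hn h
    exact (F.eq_zero_of_univ Q (fun x => absurd (hn x) (Nat.not_lt_zero _)) a)
  | succ n ih =>
    intro X Q a ρ hρ hi hn h
    refine F.eq_zero_of_clopen (piece ρ hρ hi {n}) (piece ρ hρ hi {k | k < n}) Q (fun x => ?_)
      (fun x hx => ?_) a (h n) ?_
    · rcases (Nat.lt_succ_iff.1 (hn x)).eq_or_lt with h | h
      · exact Or.inl h
      · exact Or.inr h
    · intro hx'
      exact (show ρ x < n from hx').ne hx
    · set L := piece ρ hρ hi {k | k < n}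
      refine ih (Q.preimage L.incl) _ (fun x => ρ x.1) (hρ.comp continuous_subtype_val)
        (fun g x e => hi g x.1 e) (fun x => x.2) fun d => ?_
      set R := piece (X := L.toGSpace) (fun x => ρ x.1) (hρ.comp continuous_subtype_val)
        (fun g x e => hi g x.1 e) {d}
      let κ : GMap R.toGSpace (piece ρ hρ hi {d}).toGSpace :=
        (piece ρ hρ hi {d}).cod (L.incl.comp R.incl) fun x => x.2
      have hκ : MapsTo κ ((Q.preimage L.incl).preimage R.incl).carrier
        (Q.preimage (piece ρ hρ hi {d}).incl).carrier := fun _ h => h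
      have e : F.res R (Q.preimage L.incl) (F.res L Q a) =
          F.map κ hκ (F.res (piece ρ hρ hi {d}) Q a) := F.map_map_eq _ fun _ => rfl
      rw [e, h d, map_zero]

theorem pullable_incl {P N : GSpace G} (p : GMap P N) (A : ClosedInv P) :
    Pullable (p.comp A.incl) p A.incl :=
  pullable_of_isProperMap A.closed.isProperMap_subtypeVal (j := GMap.id N) fun _ => rfl

/-- A class with compact support vanishes if its restrictions to finitely many open and closed
pieces do. -/
theorem CohTheory.cohC_eq_zero_of_pieces {P N : GSpace G} {p : GMap P N} (n : ℕ) (ρ : P → ℕ)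
    (hρ : Continuous ρ) (hi : ∀ g x e, ρ (P.act g x e) = ρ x) (hn : ∀ x, ρ x < n) (ξ : F.CohC p)
    (h : ∀ d, F.pullG (pullable_incl p (piece ρ hρ hi {d})) ξ = 0) : ξ = 0 := by
  classical
  obtain ⟨A, a, rfl⟩ := F.exists_of ξ
  have key : ∀ d, ∃ B : RelCpt p, ∃ hAB : A ≤ B,
      F.res (piece ρ hρ hi {d}) B.compl (F.trans A B hAB a) = 0 := by
    intro d
    set C := piece ρ hρ hi {d} with hC
    have hCo : IsOpen C.carrier := (isOpen_discrete {d}).preimage hρ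
    have h1 := h d
    rw [F.pullG_of] at h1
    obtain ⟨B, hB, hB0⟩ := F.of_eq_zero _ _ h1
    have hcl : IsClosedEmbedding (Subtype.val : C.carrier → P) :=
      C.closed.isClosedEmbedding_subtypeVal
    have hclo : closure (Subtype.val '' B.carrier : Set P) = Subtype.val '' closure B.carrier :=
      hcl.closure_image_eq _
    -- The vanishing on the piece is witnessed by a support `B` inside the piece. The piece is open
    -- and closed, so `B` is also an admissible support in `P`.
    let B' : RelCpt p := RelCpt.ofSubset (Subtype.val '' B.carrier : Set P)
      (hCo.isOpenMap_subtype_val _ B.isOpen) (by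
        rintro g x e ⟨y, hy, rfl⟩
        exact ⟨_, B.inv g y e hy, rfl⟩) (Subtype.val '' closure B.carrier)
      (hcl.isClosedMap _ isClosed_closure) (image_mono subset_closure) (by
        let e : closure B.carrier → (Subtype.val '' closure B.carrier : Set P) :=
          fun x => ⟨x.1.1, x.1, x.2, rfl⟩
        refine isProperMap_of_comp_of_surj (f := e) ?_ (p.continuous.comp continuous_subtype_val)
          B.proper ?_
        · exact Continuous.subtype_mk (C.incl.continuous.comp continuous_subtype_val) _
        · rintro ⟨_, x, hx, rfl⟩
          exact ⟨⟨x, hx⟩, rfl⟩)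
    refine ⟨A.sup B', RelCpt.le_sup_left _ _, ?_⟩
    have k : MapsTo (GMap.id C.toGSpace) ((A.sup B').compl.preimage C.incl).carrier
        B.compl.carrier := fun x hx hx' => hx (Or.inr ⟨x, hx', rfl⟩)
    have e : F.res C (A.sup B').compl (F.trans A _ (RelCpt.le_sup_left _ _) a) =
        F.map (GMap.id _) k (F.trans _ B hB (F.map C.incl (A.mapsTo_pre (pullable_incl p C)) a)) := by
      unfold CohTheory.trans
      rw [F.map_map]
      exact F.map_map_eq _ fun _ => rfl
    rw [e, hB0, map_zero]
  choose B hAB hB using key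
  -- Finitely many values occur, so one support dominates all the witnesses; from there on the
  -- statement is about an ordinary pair.
  obtain ⟨M, hM⟩ := Finset.exists_le ((Finset.range n).image B ∪ {A})
  have hAM : A ≤ M := hM A (by simp)
  rw [← F.of_trans A M hAM, F.eq_zero_of_pieces n _ (F.trans A M hAM a) ρ hρ hi hn fun d => ?_,
    map_zero]
  by_cases hd : d < n
  · have hBM : B d ≤ M := hM (B d) (by
      simp only [Finset.mem_union, Finset.mem_image, Finset.mem_range]
      exact Or.inl ⟨d, hd, rfl⟩)
    set C := piece ρ hρ hi {d}
    have k : MapsTo (GMap.id C.toGSpace) (M.compl.preimage C.incl).carrier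
        ((B d).compl.preimage C.incl).carrier := fun x hx hx' => hx (hBM hx')
    have e : F.res C M.compl (F.trans A M hAM a) =
        F.map (GMap.id _) k (F.res C (B d).compl (F.trans A (B d) (hAB d) a)) := by
      unfold CohTheory.trans CohTheory.res
      have k1 : MapsTo C.incl (M.compl.preimage C.incl).carrier A.compl.carrier :=
        fun x hx hx' => hx (hAM hx')
      have k2 : MapsTo C.incl ((B d).compl.preimage C.incl).carrier A.compl.carrier :=
        fun x hx hx' => hx (hAB d hx')
      refine (F.map_eq_map_map (hk := k1) a fun _ => rfl).symm.trans
        ((F.map_eq_map_map (hg := k2) a fun _ => rfl).trans (congrArg _ ?_))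
      exact F.map_eq_map_map a fun _ => rfl
    rw [e, hB d, map_zero]
  · refine F.eq_zero_of_univ _ (fun x => ?_) _
    have : ρ x.1 = d := x.2
    exact absurd (this ▸ hn x.1) hd

/-- Here the map of bases points the other way: properness over `N` is composed from properness of
`f`, of `q` on the support, and of `j`. -/
theorem pullable_of_isProperMap' {P N Q M : GSpace G} {p : GMap P N} {q : GMap Q M} {f : GMap P Q}
    (hf : IsProperMap f) {j : GMap M N} (hj : IsProperMap j) (h : ∀ x, p x = j (q (f x))) :
    Pullable p q f := by
  intro A
  have hsub : ∀ x : closure (f ⁻¹' A.carrier), f x ∈ closure A.carrier := fun x =>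
    map_mem_closure f.continuous x.2 (fun y hy => hy)
  have h2 : IsProperMap (fun x : closure (f ⁻¹' A.carrier) =>
      (⟨f x, hsub x⟩ : closure A.carrier)) :=
    isProperMap_of_comp_of_inj (g := Subtype.val)
      ((f.continuous.comp continuous_subtype_val).subtype_mk _) continuous_subtype_val
      (hf.comp isClosed_closure.isProperMap_subtypeVal) Subtype.val_injective
  have h3 := hj.comp (A.proper.comp h2)
  have h4 : (fun x : closure (f ⁻¹' A.carrier) => p x) = j ∘ ((fun m : closure A.carrier => q m) ∘
      fun x : closure (f ⁻¹' A.carrier) => (⟨f x, hsub x⟩ : closure A.carrier)) :=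
    funext fun x => h x
  rw [h4]
  exact h3

/-- The inverse of a bijective proper `G`-map. -/
def GMap.symm {X Y : GSpace G} (f : GMap X Y) (hf : IsHomeomorph f) : GMap Y X where
  toFun := (hf.homeomorph f).symm
  continuous := (hf.homeomorph f).symm.continuous
  anchor_map y := by
    rw [← f.anchor_map]
    exact congrArg Y.anchor ((hf.homeomorph f).apply_symm_apply y)
  map_act g y e := by
    have h : f ((hf.homeomorph f).symm y) = y := (hf.homeomorph f).apply_symm_apply y
    refine (hf.homeomorph f).injective ?_
    refine ((hf.homeomorph f).apply_symm_apply _).trans ?_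
    refine Eq.trans ?_ (f.map_act g _ _).symm
    exact Y.act_congr g h.symm e

@[simp]
theorem GMap.apply_symm {X Y : GSpace G} (f : GMap X Y) (hf : IsHomeomorph f) (y : Y) :
    f (f.symm hf y) = y := (hf.homeomorph f).apply_symm_apply y

@[simp]
theorem GMap.symm_apply {X Y : GSpace G} (f : GMap X Y) (hf : IsHomeomorph f) (x : X) :
    f.symm hf (f x) = x := (hf.homeomorph f).symm_apply_apply x

theorem GMap.isHomeomorph_symm {X Y : GSpace G} (f : GMap X Y) (hf : IsHomeomorph f) :
    IsHomeomorph (f.symm hf) := (hf.homeomorph f).symm.isHomeomorph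

theorem isHomeomorph_of_inverse {A B : Type*} [TopologicalSpace A] [TopologicalSpace B] {f : A → B}
    {g : B → A} (hf : Continuous f) (hg : Continuous g) (h₁ : ∀ x, g (f x) = x)
    (h₂ : ∀ y, f (g y) = y) : IsHomeomorph f :=
  (Homeomorph.mk ⟨f, g, h₁, h₂⟩ hf hg).isHomeomorph

/-- A variant of `cohC_eq_zero_of_pieces` for pieces given up to isomorphism. -/
theorem CohTheory.cohC_eq_zero_of_embeddings {P N : GSpace G} {p : GMap P N} (n : ℕ) (ρ : P → ℕ)
    (hρ : Continuous ρ) (hi : ∀ g x e, ρ (P.act g x e) = ρ x) (hn : ∀ x, ρ x < n) (ξ : F.CohC p)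
    (h : ∀ d, ∃ (P' N' : GSpace G) (p' : GMap P' N') (f : GMap P' P) (j : GMap N' N)
      (hf : Pullable p' p f), IsClosedEmbedding f ∧ range f = ρ ⁻¹' {d} ∧ IsProperMap j ∧
      (∀ x, p (f x) = j (p' x)) ∧ F.pullG hf ξ = 0) : ξ = 0 := by
  refine F.cohC_eq_zero_of_pieces n ρ hρ hi hn ξ fun d => ?_
  obtain ⟨P', N', p', f, j, hf, hcl, hr, hj, hpf, h0⟩ := h d
  set C := piece ρ hρ hi {d}
  let f' : GMap P' C.toGSpace := C.cod f fun x => by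
    change f x ∈ ρ ⁻¹' {d}
    rw [← hr]; exact mem_range_self x
  have hf' : IsHomeomorph f' := by
    refine isHomeomorph_iff_continuous_isClosedMap_bijective.2 ⟨f'.continuous, ?_, ?_, ?_⟩
    · intro s hs
      have : f' '' s = Subtype.val ⁻¹' (f '' s) := by
        ext x
        constructor
        · rintro ⟨y, hy, rfl⟩
          exact ⟨y, hy, rfl⟩
        · rintro ⟨y, hy, h⟩
          exact ⟨y, hy, Subtype.ext h⟩
      rw [this]
      exact (hcl.isClosedMap s hs).preimage continuous_subtype_val
    · intro x y hxy
      exact hcl.injective (congrArg Subtype.val hxy)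
    · intro x
      have : x.1 ∈ range f := by rw [hr]; exact x.2
      obtain ⟨y, hy⟩ := this
      exact ⟨y, Subtype.ext hy⟩
  let g := f'.symm hf'
  have hfg : ∀ x, f (g x) = x.1 := fun x => congrArg Subtype.val (f'.apply_symm hf' x)
  have hg : Pullable (p.comp C.incl) p' g := pullable_of_isProperMap'
    (f'.isHomeomorph_symm hf').isProperMap hj fun x => by
      rw [← hpf, hfg]; rfl
  rw [← F.pullG_comp hg hf (pullable_incl p C) (fun x => (hfg x).symm), h0, map_zero]

end Clopen

end

end NNSCorr

namespace NNSCorr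

noncomputable section

variable {G : TopGroupoid.{u}}

/-! ## Vector bundles: local trivialisations, fibrewise operations, rank -/

namespace GVB

variable {M : GSpace G} (V : GVB M)

/-- A local trivialisation. -/
structure Triv where
  U : Set M
  isOpen : IsOpen U
  n : ℕ
  h : {v : V.tot // V.proj v ∈ U} ≃ₜ U × (Fin n → ℝ)
  fst : ∀ v, ((h v).1 : M) = V.proj v.1
  linear : ∀ (y : M) (hy : y ∈ U), IsLinearMap ℝ
      (fun v : V.Fibre y => (h ⟨v.1, by rw [v.2]; exact hy⟩).2)

theorem exists_triv (x : M) : ∃ τ : V.Triv, x ∈ τ.U := by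
  obtain ⟨U, hU, hx, n, h, h1, h2⟩ := V.locally_trivial x
  exact ⟨⟨U, hU, n, h, h1, h2⟩, hx⟩

variable {V}

namespace Triv

variable (τ : V.Triv)

theorem proj_symm (x : τ.U) (w : Fin τ.n → ℝ) : V.proj (τ.h.symm (x, w)).1 = x := by
  rw [← τ.fst, Homeomorph.apply_symm_apply]

theorem apply_eq (v : {v : V.tot // V.proj v ∈ τ.U}) :
    τ.h v = (⟨V.proj v.1, v.2⟩, (τ.h v).2) := Prod.ext (Subtype.ext (τ.fst v)) rfl

theorem eq_symm (v : {v : V.tot // V.proj v ∈ τ.U}) :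
    v.1 = (τ.h.symm (⟨V.proj v.1, v.2⟩, (τ.h v).2)).1 := by
  rw [← τ.apply_eq, Homeomorph.symm_apply_apply]

/-- A local trivialisation on a fibre. -/
def fibre (y : M) (hy : y ∈ τ.U) : V.Fibre y ≃ₗ[ℝ] (Fin τ.n → ℝ) :=
  LinearEquiv.ofBijective (IsLinearMap.mk' _ (τ.linear y hy)) ⟨fun v w h => by
    have hv := τ.eq_symm ⟨v.1, by rw [v.2]; exact hy⟩
    have hw := τ.eq_symm ⟨w.1, by rw [w.2]; exact hy⟩
    have h' : (τ.h ⟨v.1, by rw [v.2]; exact hy⟩).2 = (τ.h ⟨w.1, by rw [w.2]; exact hy⟩).2 := h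
    refine Subtype.ext (hv.trans (Eq.trans ?_ hw.symm))
    have e : (⟨V.proj v.1, by rw [v.2]; exact hy⟩ : τ.U) = ⟨V.proj w.1, by rw [w.2]; exact hy⟩ :=
      Subtype.ext (v.2.trans w.2.symm)
    rw [h', e], fun w => by
    refine ⟨⟨(τ.h.symm (⟨y, hy⟩, w)).1, τ.proj_symm ⟨y, hy⟩ w⟩, ?_⟩
    change (τ.h (τ.h.symm (⟨y, hy⟩, w))).2 = w
    rw [Homeomorph.apply_symm_apply]⟩

theorem val_eq_symm (y : M) (hy : y ∈ τ.U) (v : V.Fibre y) :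
    v.1 = (τ.h.symm (⟨y, hy⟩, τ.fibre y hy v)).1 := by
  obtain ⟨v, rfl⟩ := v
  exact τ.eq_symm ⟨v, hy⟩

end Triv

variable (V)

instance (x : M) : Module.Finite ℝ (V.Fibre x) := by
  obtain ⟨τ, hτ⟩ := V.exists_triv x
  exact Module.Finite.equiv (τ.fibre x hτ).symm

/-- The rank. -/
def rank (x : M) : ℕ := Module.finrank ℝ (V.Fibre x)

theorem continuous_rank : Continuous V.rank := by
  rw [continuous_def]
  intro s _
  rw [isOpen_iff_mem_nhds]
  intro x hx
  obtain ⟨τ, hτ⟩ := V.exists_triv x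
  have key : ∀ y ∈ τ.U, V.rank y = τ.n := fun y hy => by
    rw [rank, (τ.fibre y hy).finrank_eq, Module.finrank_fin_fun]
  refine Filter.mem_of_superset (τ.isOpen.mem_nhds hτ) fun y hy => ?_
  rw [mem_preimage, key y hy, ← key x hτ]
  exact hx

/-- The action of an arrow on a fibre. -/
def actFibre (g : G.Arr) (x : M) (e : G.s g = M.anchor x) : V.Fibre x →ₗ[ℝ] V.Fibre (M.act g x e) :=
  IsLinearMap.mk' _ (V.linear_act g x e)

theorem actFibre_val (g : G.Arr) (x : M) (e : G.s g = M.anchor x) (v : V.Fibre x) :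
    (V.actFibre g x e v).1 = V.tot.act g v.1
      (e.trans ((congrArg M.anchor v.2).symm.trans (V.proj.anchor_map v.1))) := rfl

theorem act_act_inv (X : GSpace G) (g : G.Arr) (x : X) (e : G.s (G.inv g) = X.anchor x) :
    X.act g (X.act (G.inv g) x e) ((G.r_inv g).symm.trans (X.anchor_act _ x e).symm) = x := by
  rw [← X.mul_act g (G.inv g) x (G.r_inv g).symm e]
  have h1 : ∀ (k : G.Arr) (hk : G.s k = X.anchor x), k = G.one (X.anchor x) → X.act k x hk = x := by
    intro k hk hk'
    subst hk'
    exact X.one_act x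
  apply h1
  rw [G.mul_inv, ← e, G.s_inv]

theorem rank_act (g : G.Arr) (x : M) (e : G.s g = M.anchor x) :
    V.rank (M.act g x e) = V.rank x := by
  refine (LinearEquiv.ofBijective (V.actFibre g x e) ⟨fun v w h => ?_, fun w => ?_⟩).finrank_eq.symm
  · have h' := congrArg Subtype.val h
    rw [actFibre_val, actFibre_val] at h'
    have ev : G.s g = V.tot.anchor v.1 := by rw [← V.proj.anchor_map, v.2]; exact e
    have ew : G.s g = V.tot.anchor w.1 := by rw [← V.proj.anchor_map, w.2]; exact e
    refine Subtype.ext ?_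
    rw [← act_inv_act V.tot g v.1 ev, ← act_inv_act V.tot g w.1 ew]
    exact V.tot.act_congr _ h' _
  · have ew : G.s (G.inv g) = V.tot.anchor w.1 := by
      rw [G.s_inv, ← V.proj.anchor_map, w.2, M.anchor_act]
    refine ⟨⟨V.tot.act (G.inv g) w.1 ew, ?_⟩, Subtype.ext ?_⟩
    · rw [V.proj.map_act]
      refine (M.act_congr (G.inv g) w.2 _).trans ?_
      exact act_inv_act M g x e
    · rw [actFibre_val]
      exact act_act_inv V.tot g w.1 ew

/-- The fibrewise linear combination `a v + b w`. -/
def lin (a b : ℝ) (v w : V.tot) (h : V.proj v = V.proj w) : V.tot :=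
  (a • (⟨v, h⟩ : V.Fibre (V.proj w)) + b • ⟨w, rfl⟩ : V.Fibre (V.proj w)).1

theorem lin_eq (a b : ℝ) {x : M} (v w : V.Fibre x) (h : V.proj v.1 = V.proj w.1) :
    V.lin a b v.1 w.1 h = (a • v + b • w : V.Fibre x).1 := by
  obtain ⟨w, rfl⟩ := w
  rfl

theorem proj_lin (a b : ℝ) (v w : V.tot) (h : V.proj v = V.proj w) :
    V.proj (V.lin a b v w h) = V.proj w :=
  (a • (⟨v, h⟩ : V.Fibre (V.proj w)) + b • ⟨w, rfl⟩ : V.Fibre (V.proj w)).2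

theorem lin_congr {a b a' b' : ℝ} {v w v' w' : V.tot} (h : V.proj v = V.proj w) (ha : a = a')
    (hb : b = b') (hv : v = v') (hw : w = w') :
    V.lin a b v w h = V.lin a' b' v' w' (by rw [← hv, ← hw, h]) := by
  subst ha hb hv hw; rfl

/-- Multiplication of coefficient matrices; with it, rotations in `V ⊕ V` are inverted by reversing
the angle. -/
theorem lin_lin (a b c d e f : ℝ) (v w : V.tot) (h : V.proj v = V.proj w)
    (h' : V.proj (V.lin a b v w h) = V.proj (V.lin c d v w h)) :
    V.lin e f (V.lin a b v w h) (V.lin c d v w h) h' =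
      V.lin (e * a + f * c) (e * b + f * d) v w h := by
  let v' : V.Fibre (V.proj w) := ⟨v, h⟩
  let w' : V.Fibre (V.proj w) := ⟨w, rfl⟩
  refine (V.lin_eq e f (a • v' + b • w') (c • v' + d • w') h').trans
    (congrArg Subtype.val ?_)
  module

theorem lin_one_zero (v w : V.tot) (h : V.proj v = V.proj w) : V.lin 1 0 v w h = v := by
  refine (V.lin_eq 1 0 (x := V.proj w) ⟨v, h⟩ ⟨w, rfl⟩ h).trans ?_
  rw [one_smul, zero_smul, add_zero]

theorem lin_zero_one (v w : V.tot) (h : V.proj v = V.proj w) : V.lin 0 1 v w h = w := by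
  refine (V.lin_eq 0 1 (x := V.proj w) ⟨v, h⟩ ⟨w, rfl⟩ h).trans ?_
  rw [one_smul, zero_smul, zero_add]

theorem lin_act (a b : ℝ) (v w : V.tot) (h : V.proj v = V.proj w) (g : G.Arr)
    (ev : G.s g = V.tot.anchor v) (ew : G.s g = V.tot.anchor w)
    (e : G.s g = V.tot.anchor (V.lin a b v w h))
    (h' : V.proj (V.tot.act g v ev) = V.proj (V.tot.act g w ew)) :
    V.lin a b (V.tot.act g v ev) (V.tot.act g w ew) h' = V.tot.act g (V.lin a b v w h) e := by
  have ex : G.s g = M.anchor (V.proj w) := by rw [V.proj.anchor_map]; exact ew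
  let v' : V.Fibre (V.proj w) := ⟨v, h⟩
  let w' : V.Fibre (V.proj w) := ⟨w, rfl⟩
  have key := congrArg Subtype.val ((V.actFibre g _ ex).map_add (a • v') (b • w'))
  rw [map_smul, map_smul] at key
  exact (V.lin_eq a b (V.actFibre g _ ex v') (V.actFibre g _ ex w') h').trans key.symm

theorem continuous_lin {S : Type*} [TopologicalSpace S] {a b : S → ℝ} {v w : S → V.tot}
    (ha : Continuous a) (hb : Continuous b) (hv : Continuous v) (hw : Continuous w)
    (h : ∀ s, V.proj (v s) = V.proj (w s)) :
    Continuous fun s => V.lin (a s) (b s) (v s) (w s) (h s) := by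
  rw [continuous_iff_continuousAt]
  intro s
  obtain ⟨τ, hτ⟩ := V.exists_triv (V.proj (w s))
  let O : Set S := {s | V.proj (w s) ∈ τ.U}
  have hO : IsOpen O := τ.isOpen.preimage (V.proj.continuous.comp hw)
  have key : Continuous fun s : O => V.lin (a s) (b s) (v s) (w s) (h s) := by
    have e : (fun s : O => V.lin (a s) (b s) (v s) (w s) (h s)) = fun s : O =>
        (τ.h.symm (⟨V.proj (w s), s.2⟩, a s • (τ.h ⟨v s, by rw [h]; exact s.2⟩).2 +
          b s • (τ.h ⟨w s, s.2⟩).2)).1 := by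
      funext s
      refine (τ.val_eq_symm _ s.2 _).trans ?_
      rw [map_add, map_smul, map_smul]
      rfl
    rw [e]
    have h1 : Continuous fun s : O => (⟨w s, s.2⟩ : {v : V.tot // V.proj v ∈ τ.U}) :=
      (hw.comp continuous_subtype_val).subtype_mk _
    have h2 : Continuous fun s : O =>
        (⟨v s, by rw [h]; exact s.2⟩ : {v : V.tot // V.proj v ∈ τ.U}) :=
      (hv.comp continuous_subtype_val).subtype_mk _
    refine continuous_subtype_val.comp (τ.h.symm.continuous.comp (Continuous.prodMk ?_ ?_))
    · exact (V.proj.continuous.comp (hw.comp continuous_subtype_val)).subtype_mk _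
    · exact ((ha.comp continuous_subtype_val).smul
        (continuous_snd.comp (τ.h.continuous.comp h2))).add
        ((hb.comp continuous_subtype_val).smul (continuous_snd.comp (τ.h.continuous.comp h1)))
  exact (continuousOn_iff_continuous_domRestrict.2 key).continuousAt (hO.mem_nhds hτ)

/-- A fibrewise linear combination of two `G`-maps into `|V|`. -/
def linMap {R : GSpace G} (a b : ℝ) (f g : GMap R V.tot) (h : ∀ r, V.proj (f r) = V.proj (g r)) :
    GMap R V.tot where
  toFun r := V.lin a b (f r) (g r) (h r)
  continuous := V.continuous_lin continuous_const continuous_const f.continuous g.continuous h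
  anchor_map r := by rw [← V.proj.anchor_map, proj_lin, V.proj.anchor_map, g.anchor_map]
  map_act k r e := by
    have ev : G.s k = V.tot.anchor (f r) := by rw [f.anchor_map]; exact e
    have ew : G.s k = V.tot.anchor (g r) := by rw [g.anchor_map]; exact e
    have hvw : V.proj (V.tot.act k (f r) ev) = V.proj (V.tot.act k (g r) ew) := by
      rw [V.proj.map_act, V.proj.map_act]; exact M.act_congr k (h r) _
    refine (V.lin_congr _ rfl rfl (f.map_act k r e) (g.map_act k r e)).trans ?_
    exact V.lin_act a b (f r) (g r) (h r) k ev ew _ hvw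

/-- The zero section. -/
def zero : GMap M V.tot where
  toFun x := (0 : V.Fibre x).1
  continuous := by
    rw [continuous_iff_continuousAt]
    intro x
    obtain ⟨τ, hτ⟩ := V.exists_triv x
    have key : Continuous fun y : τ.U => (0 : V.Fibre y).1 := by
      have e : (fun y : τ.U => (0 : V.Fibre y).1) = fun y : τ.U => (τ.h.symm (y, 0)).1 := by
        funext y
        refine (τ.val_eq_symm _ y.2 0).trans ?_
        rw [map_zero]
      rw [e]
      exact continuous_subtype_val.comp (τ.h.symm.continuous.comp
        (continuous_id.prodMk continuous_const))
    exact (continuousOn_iff_continuous_domRestrict.2 key).continuousAt (τ.isOpen.mem_nhds hτ)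
  anchor_map x := by rw [← V.proj.anchor_map]; exact congrArg _ (0 : V.Fibre x).2
  map_act g x e := (congrArg Subtype.val (V.actFibre g x e).map_zero).symm

@[simp]
theorem proj_zero (x : M) : V.proj (V.zero x) = x := (0 : V.Fibre x).2

end GVB

/-! ## Constructions of vector bundles -/

/-- The fibre product of two `G`-maps. -/
def GSpace.fib {N Q M : GSpace G} (f : GMap N M) (q : GMap Q M)
    (hp : ParacompactSpace {x : N × Q // f x.1 = q x.2}) : GSpace G where
  carrier := {x : N × Q // f x.1 = q x.2}
  para := hp
  anchor x := N.anchor x.1.1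
  continuous_anchor := N.continuous_anchor.comp (continuous_fst.comp continuous_subtype_val)
  act g x e := ⟨(N.act g x.1.1 e, Q.act g x.1.2 (by
    rw [← q.anchor_map, ← x.2, f.anchor_map]; exact e)), by
      rw [f.map_act, q.map_act]; exact M.act_congr g x.2 _⟩
  anchor_act g x e := N.anchor_act g _ _
  one_act x := Subtype.ext (Prod.ext (N.one_act _) (by
    have h : Q.anchor x.1.2 = N.anchor x.1.1 := by rw [← q.anchor_map, ← x.2, f.anchor_map]
    have key : ∀ z (hz : z = Q.anchor x.1.2) (e : G.s (G.one z) = Q.anchor x.1.2),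
        Q.act (G.one z) x.1.2 e = x.1.2 := by
      rintro z rfl e
      exact Q.one_act _
    exact key _ h.symm _))
  mul_act g h x e₁ e₂ := Subtype.ext (Prod.ext (N.mul_act g h _ e₁ e₂) (Q.mul_act g h _ e₁ _))
  continuous_act := by
    refine Continuous.subtype_mk (Continuous.prodMk ?_ ?_) _
    · exact N.continuous_act.comp (f := fun p : {p : G.Arr × {x : N × Q // f x.1 = q x.2} //
        G.s p.1 = N.anchor p.2.1.1} =>
        (⟨(p.1.1, p.1.2.1.1), p.2⟩ : {p : G.Arr × N // G.s p.1 = N.anchor p.2})) (by fun_prop)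
    · exact Q.continuous_act.comp (f := fun p : {p : G.Arr × {x : N × Q // f x.1 = q x.2} //
        G.s p.1 = N.anchor p.2.1.1} =>
        (⟨(p.1.1, p.1.2.1.2), by
          rw [← q.anchor_map, ← p.1.2.2, f.anchor_map]; exact p.2⟩ :
            {p : G.Arr × Q // G.s p.1 = Q.anchor p.2})) (by fun_prop)

section fib

variable {N Q M : GSpace G} {f : GMap N M} {q : GMap Q M}
  {hp : ParacompactSpace {x : N × Q // f x.1 = q x.2}}

def GSpace.fibFst (f : GMap N M) (q : GMap Q M)
    (hp : ParacompactSpace {x : N × Q // f x.1 = q x.2}) : GMap (GSpace.fib f q hp) N where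
  toFun x := x.1.1
  continuous := continuous_fst.comp continuous_subtype_val
  anchor_map _ := rfl
  map_act _ _ _ := rfl

def GSpace.fibSnd (f : GMap N M) (q : GMap Q M)
    (hp : ParacompactSpace {x : N × Q // f x.1 = q x.2}) : GMap (GSpace.fib f q hp) Q where
  toFun x := x.1.2
  continuous := continuous_snd.comp continuous_subtype_val
  anchor_map x := by
    change Q.anchor x.1.2 = N.anchor x.1.1
    rw [← q.anchor_map, ← x.2, f.anchor_map]
  map_act _ _ _ := rfl

theorem isClosed_fib (f : GMap N M) (q : GMap Q M) : IsClosed {x : N × Q | f x.1 = q x.2} :=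
  isClosed_eq (f.continuous.comp continuous_fst) (q.continuous.comp continuous_snd)

theorem GSpace.isClosedEmbedding_fib : IsClosedEmbedding
    fun x => (GSpace.fibFst f q hp x, GSpace.fibSnd f q hp x) :=
  (isClosed_fib f q).isClosedEmbedding_subtypeVal

end fib

section transport

variable {α β : Type*} (e : α ≃ β) [AddCommGroup β] [Module ℝ β]

/-- The vector space structure transported along a bijection. -/
@[reducible]
def transportModule : @Module ℝ α _ e.addCommGroup.toAddCommMonoid :=
  letI := e.addCommGroup
  { smul := fun c x => e.symm (c • e x)
    one_smul := fun x => e.injective (by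
      change e (e.symm _) = _
      rw [e.apply_symm_apply, one_smul])
    mul_smul := fun a b x => e.injective (by
      change e (e.symm _) = e (e.symm (a • e (e.symm _)))
      simp only [e.apply_symm_apply, mul_smul])
    smul_zero := fun a => e.injective (by
      change e (e.symm (a • e (e.symm 0))) = e (e.symm 0)
      simp only [e.apply_symm_apply, smul_zero])
    smul_add := fun a x y => e.injective (by
      change e (e.symm (a • e (e.symm _))) = e (e.symm (e (e.symm _) + e (e.symm _)))
      simp only [e.apply_symm_apply]
      exact smul_add _ _ _)
    add_smul := fun a b x => e.injective (by
      change e (e.symm _) = e (e.symm (e (e.symm _) + e (e.symm _)))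
      simp only [e.apply_symm_apply, add_smul])
    zero_smul := fun x => e.injective (by
      change e (e.symm _) = e (e.symm 0)
      rw [zero_smul]) }

/-- The bijection as a linear equivalence. -/
def transportLin : @LinearEquiv ℝ ℝ _ _ (RingHom.id ℝ) (RingHom.id ℝ) _ _ α β
    e.addCommGroup.toAddCommMonoid _ (transportModule e) _ :=
  letI := e.addCommGroup
  letI := transportModule e
  { e with
    map_add' := fun _ _ => e.apply_symm_apply _
    map_smul' := fun _ _ => e.apply_symm_apply _ }

end transport

namespace GVB

variable {N M : GSpace G}

/-- Local trivialisations of a pull-back. -/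
def Triv.pullHomeo {V : GVB M} (τ : V.Triv) {P N : Type u} [TopologicalSpace P]
    [TopologicalSpace N] (f : N → M) (hf : Continuous f) (p : P → N) (t : P → V.tot)
    (he : IsEmbedding fun x => (p x, t x)) (hc : ∀ x, f (p x) = V.proj (t x))
    (hs : ∀ n v, f n = V.proj v → ∃ x, p x = n ∧ t x = v) :
    {v : P // p v ∈ f ⁻¹' τ.U} ≃ₜ (f ⁻¹' τ.U) × (Fin τ.n → ℝ) :=
  have hp : Continuous p := continuous_fst.comp he.continuous
  have ht : Continuous t := continuous_snd.comp he.continuous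
  have ex : ∀ x : (f ⁻¹' τ.U) × (Fin τ.n → ℝ), ∃ y : P, p y = x.1 ∧
      t y = (τ.h.symm (⟨f x.1, x.1.2⟩, x.2)).1 := fun x =>
    hs x.1 _ (τ.proj_symm ⟨f x.1, x.1.2⟩ x.2).symm
  { toFun v := (⟨p v.1, v.2⟩, (τ.h ⟨t v.1, by rw [← hc]; exact v.2⟩).2)
    invFun x := ⟨(ex x).choose, by rw [(ex x).choose_spec.1]; exact x.1.2⟩
    left_inv v := by
      refine Subtype.ext (he.injective (Prod.ext ?_ ?_))
      · exact (ex _).choose_spec.1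
      · refine (ex _).choose_spec.2.trans ?_
        have h := τ.eq_symm ⟨t v.1, by rw [← hc]; exact v.2⟩
        refine Eq.trans ?_ h.symm
        have e : (⟨f (p v.1), v.2⟩ : τ.U) = ⟨V.proj (t v.1), by rw [← hc]; exact v.2⟩ :=
          Subtype.ext (hc _)
        simp only [e]
    right_inv x := by
      refine Prod.ext (Subtype.ext (ex x).choose_spec.1) ?_
      have h : (⟨t (ex x).choose, by rw [← hc, (ex x).choose_spec.1]; exact x.1.2⟩ :
          {v : V.tot // V.proj v ∈ τ.U}) = τ.h.symm (⟨f x.1, x.1.2⟩, x.2) :=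
        Subtype.ext (ex x).choose_spec.2
      simp only [h, Homeomorph.apply_symm_apply]
    continuous_toFun := by
      refine Continuous.prodMk ((hp.comp continuous_subtype_val).subtype_mk _) ?_
      exact continuous_snd.comp (τ.h.continuous.comp
        ((ht.comp continuous_subtype_val).subtype_mk _))
    continuous_invFun := by
      refine Continuous.subtype_mk (he.isInducing.continuous_iff.2 ?_) _
      have e : (fun x => (p x, t x)) ∘ (fun x => (ex x).choose) = fun x =>
          ((x.1 : N), (τ.h.symm (⟨f x.1, x.1.2⟩, x.2)).1) :=
        funext fun x => Prod.ext (ex x).choose_spec.1 (ex x).choose_spec.2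
      rw [e]
      refine Continuous.prodMk (by fun_prop) (continuous_subtype_val.comp
        (τ.h.symm.continuous.comp (Continuous.prodMk ?_ (by fun_prop))))
      exact Continuous.subtype_mk (by fun_prop) _ }

/-- The fibre product inherits local trivialisations over `N`, so the criterion for locally trivial
spaces applies with base `N`. All bundle constructions obtain paracompactness from here. -/
theorem paracompactSpace_fib (V : GVB M) (f : GMap N M) :
    ParacompactSpace {x : N × V.tot // f x.1 = V.proj x.2} := by
  refine paracompactSpace_of_locally_trivial (fun x => x.1.1) (by fun_prop) fun x => ?_
  obtain ⟨τ, hτ⟩ := V.exists_triv (f x)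
  exact ⟨f ⁻¹' τ.U, τ.isOpen.preimage f.continuous, hτ, τ.n, τ.pullHomeo f f.continuous
    (fun x : {x : N × V.tot // f x.1 = V.proj x.2} => x.1.1) (fun x => x.1.2)
    IsEmbedding.subtypeVal (fun x => x.2) (fun n v h => ⟨⟨(n, v), h⟩, rfl, rfl⟩), fun v => rfl⟩

section ofCart

variable {P : GSpace G} {p : GMap P N} (V : GVB M) (σ : Sq p V.proj)
  (hs : ∀ n v, σ.base n = V.proj v → ∃ x, p x = n ∧ σ.top x = v)

def cartEquiv (n : N) : {x : P // p x = n} ≃ V.Fibre (σ.base n) :=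
  Equiv.ofBijective (fun x => ⟨σ.top x.1, by rw [← σ.comm, x.2]⟩)
    ⟨fun x y h => Subtype.ext (σ.closedEmb.injective (Prod.ext (x.2.trans y.2.symm)
      (congrArg Subtype.val h))), fun v => by
      obtain ⟨x, hx, hx'⟩ := hs n v.1 v.2.symm
      exact ⟨⟨x, hx⟩, Subtype.ext hx'⟩⟩

/-- A space that completes a Cartesian square is a vector bundle. -/
def ofCart : GVB N where
  tot := P
  proj := p
  acg n := (V.cartEquiv σ hs n).addCommGroup
  mod n := transportModule (V.cartEquiv σ hs n)
  linear_act g n e := by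
    let _ : ∀ n, AddCommGroup {x : P // p x = n} := fun n => (V.cartEquiv σ hs n).addCommGroup
    let _ : ∀ n, Module ℝ {x : P // p x = n} := fun n => transportModule (V.cartEquiv σ hs n)
    have eb : G.s g = M.anchor (σ.base n) := by rw [σ.base.anchor_map]; exact e
    let φ : ∀ n, {x : P // p x = n} ≃ₗ[ℝ] V.Fibre (σ.base n) := fun n =>
      transportLin (V.cartEquiv σ hs n)
    have hb : M.act g (σ.base n) eb = σ.base (N.act g n e) := (σ.base.map_act g n e).symm
    have key : ∀ (x : {x : P // p x = n}) (y : {x : P // p x = N.act g n e}),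
        y.1 = P.act g x.1 (e.trans ((congrArg N.anchor x.2).symm.trans (p.anchor_map x.1))) →
        (φ _ y).1 = (V.actFibre g _ eb (φ n x)).1 := by
      rintro x ⟨y, hy⟩ rfl
      exact σ.top.map_act g x.1 _
    have cast : ∀ {z z' : M} (h : z = z') (v w : V.Fibre z) (v' w' : V.Fibre z'),
        v.1 = v'.1 → w.1 = w'.1 → (v + w).1 = (v' + w').1 := by
      rintro z z' rfl v w v' w' h1 h2
      rw [Subtype.ext h1, Subtype.ext h2]
    have cast' : ∀ {z z' : M} (h : z = z') (v : V.Fibre z) (v' : V.Fibre z') (c : ℝ),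
        v.1 = v'.1 → (c • v).1 = (c • v').1 := by
      rintro z z' rfl v v' c h1
      rw [Subtype.ext h1]
    constructor
    · intro x y
      refine (φ _).injective (Subtype.ext ?_)
      rw [map_add, key (x + y) _ rfl, map_add, map_add]
      exact cast hb _ _ _ _ (key x _ rfl).symm (key y _ rfl).symm
    · intro c x
      refine (φ _).injective (Subtype.ext ?_)
      rw [map_smul, key (c • x) _ rfl, map_smul, map_smul]
      exact cast' hb _ _ c (key x _ rfl).symm
  locally_trivial n := by
    let _ : ∀ n, AddCommGroup {x : P // p x = n} := fun n => (V.cartEquiv σ hs n).addCommGroup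
    let _ : ∀ n, Module ℝ {x : P // p x = n} := fun n => transportModule (V.cartEquiv σ hs n)
    obtain ⟨τ, hτ⟩ := V.exists_triv (σ.base n)
    refine ⟨σ.base ⁻¹' τ.U, τ.isOpen.preimage σ.base.continuous, hτ, τ.n, τ.pullHomeo σ.base
      σ.base.continuous p σ.top σ.closedEmb.isEmbedding σ.comm hs, fun v => rfl, fun y hy => ?_⟩
    exact ((τ.fibre (σ.base y) hy).toLinearMap.comp
      (transportLin (V.cartEquiv σ hs y)).toLinearMap).isLinear

/-- The square of `ofCart`. -/
def ofCartSq : VBSq (V.ofCart σ hs) V where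
  toSq := σ
  surj := hs
  linear n := by
    let _ : ∀ n, AddCommGroup {x : P // p x = n} := fun n => (V.cartEquiv σ hs n).addCommGroup
    let _ : ∀ n, Module ℝ {x : P // p x = n} := fun n => transportModule (V.cartEquiv σ hs n)
    exact (transportLin (V.cartEquiv σ hs n)).toLinearMap.isLinear

end ofCart

/-- The canonical square of the pull-back. -/
def pullSq (V : GVB M) (f : GMap N M) :
    Sq (GSpace.fibFst f V.proj (V.paracompactSpace_fib f)) V.proj where
  base := f
  top := GSpace.fibSnd f V.proj (V.paracompactSpace_fib f)
  comm x := x.2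
  closedEmb := GSpace.isClosedEmbedding_fib

theorem pullSq_surj (V : GVB M) (f : GMap N M) (n : N) (v : V.tot) (h : f n = V.proj v) :
    ∃ x, GSpace.fibFst f V.proj (V.paracompactSpace_fib f) x = n ∧ (V.pullSq f).top x = v :=
  ⟨⟨(n, v), h⟩, rfl, rfl⟩

/-- The pull-back of a vector bundle. -/
def pullBundle (V : GVB M) (f : GMap N M) : GVB N := V.ofCart (V.pullSq f) (V.pullSq_surj f)

def pullBundleSq (V : GVB M) (f : GMap N M) : VBSq (V.pullBundle f) V :=
  V.ofCartSq (V.pullSq f) (V.pullSq_surj f)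

section sum

variable (V₁ V₂ : GVB M)

/-- The total space of a direct sum. -/
def sumTot : GSpace G := GSpace.fib V₁.proj V₂.proj (V₂.paracompactSpace_fib V₁.proj)

def sumFst : GMap (sumTot V₁ V₂) V₁.tot := GSpace.fibFst _ _ _
def sumSnd : GMap (sumTot V₁ V₂) V₂.tot := GSpace.fibSnd _ _ _

theorem sumComm (v : sumTot V₁ V₂) : V₁.proj (sumFst V₁ V₂ v) = V₂.proj (sumSnd V₁ V₂ v) := v.2

def sumProj : GMap (sumTot V₁ V₂) M := V₁.proj.comp (sumFst V₁ V₂)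

def sumEquiv (x : M) : {v : sumTot V₁ V₂ // sumProj V₁ V₂ v = x} ≃ V₁.Fibre x × V₂.Fibre x where
  toFun v := (⟨sumFst V₁ V₂ v.1, v.2⟩, ⟨sumSnd V₁ V₂ v.1, (sumComm V₁ V₂ v.1).symm.trans v.2⟩)
  invFun v := ⟨⟨(v.1.1, v.2.1), v.1.2.trans v.2.2.symm⟩, v.1.2⟩
  left_inv _ := rfl
  right_inv _ := rfl

variable {V₁ V₂} in
def sumHomeo (τ₁ : V₁.Triv) (τ₂ : V₂.Triv) :
    {v : sumTot V₁ V₂ // sumProj V₁ V₂ v ∈ τ₁.U ∩ τ₂.U} ≃ₜ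
      (τ₁.U ∩ τ₂.U : Set M) × ((Fin τ₁.n → ℝ) × (Fin τ₂.n → ℝ)) where
  toFun v := (⟨sumProj V₁ V₂ v.1, v.2⟩, (τ₁.h ⟨sumFst V₁ V₂ v.1, v.2.1⟩).2,
    (τ₂.h ⟨sumSnd V₁ V₂ v.1, by rw [← sumComm]; exact v.2.2⟩).2)
  invFun x := ⟨⟨((τ₁.h.symm (⟨x.1, x.1.2.1⟩, x.2.1)).1, (τ₂.h.symm (⟨x.1, x.1.2.2⟩, x.2.2)).1),
    (τ₁.proj_symm ⟨x.1, x.1.2.1⟩ x.2.1).trans (τ₂.proj_symm ⟨x.1, x.1.2.2⟩ x.2.2).symm⟩, by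
      have : sumProj V₁ V₂ ⟨((τ₁.h.symm (⟨x.1, x.1.2.1⟩, x.2.1)).1,
        (τ₂.h.symm (⟨x.1, x.1.2.2⟩, x.2.2)).1),
        (τ₁.proj_symm ⟨x.1, x.1.2.1⟩ x.2.1).trans (τ₂.proj_symm ⟨x.1, x.1.2.2⟩ x.2.2).symm⟩ = x.1 :=
          τ₁.proj_symm ⟨x.1, x.1.2.1⟩ x.2.1
      rw [this]; exact x.1.2⟩
  left_inv v := by
    refine Subtype.ext (Subtype.ext (Prod.ext ?_ ?_))
    · exact (τ₁.eq_symm ⟨sumFst V₁ V₂ v.1, v.2.1⟩).symm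
    · refine Eq.trans ?_ (τ₂.eq_symm ⟨sumSnd V₁ V₂ v.1, by rw [← sumComm]; exact v.2.2⟩).symm
      have e : (⟨sumProj V₁ V₂ v.1, v.2.2⟩ : τ₂.U) =
        ⟨V₂.proj (sumSnd V₁ V₂ v.1), by rw [← sumComm]; exact v.2.2⟩ := Subtype.ext (sumComm _ _ _)
      simp only [e]
  right_inv x := by
    refine Prod.ext (Subtype.ext (τ₁.proj_symm ⟨x.1, x.1.2.1⟩ x.2.1)) (Prod.ext ?_ ?_)
    · exact (Prod.ext_iff.1 (τ₁.h.apply_symm_apply (⟨x.1, x.1.2.1⟩, x.2.1))).2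
    · exact (Prod.ext_iff.1 (τ₂.h.apply_symm_apply (⟨x.1, x.1.2.2⟩, x.2.2))).2
  continuous_toFun := by
    refine Continuous.prodMk (((sumProj V₁ V₂).continuous.comp continuous_subtype_val).subtype_mk _)
      (Continuous.prodMk ?_ ?_)
    · exact continuous_snd.comp (τ₁.h.continuous.comp
        (((sumFst V₁ V₂).continuous.comp continuous_subtype_val).subtype_mk _))
    · exact continuous_snd.comp (τ₂.h.continuous.comp
        (((sumSnd V₁ V₂).continuous.comp continuous_subtype_val).subtype_mk _))
  continuous_invFun := by
    refine Continuous.subtype_mk (Continuous.subtype_mk (Continuous.prodMk ?_ ?_) _) _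
    · refine continuous_subtype_val.comp (τ₁.h.symm.continuous.comp (Continuous.prodMk ?_ ?_))
      · exact Continuous.subtype_mk (by fun_prop) _
      · fun_prop
    · refine continuous_subtype_val.comp (τ₂.h.symm.continuous.comp (Continuous.prodMk ?_ ?_))
      · exact Continuous.subtype_mk (by fun_prop) _
      · fun_prop

/-- The direct sum of vector bundles. -/
def sum : GVB M where
  tot := sumTot V₁ V₂
  proj := sumProj V₁ V₂
  acg x := (sumEquiv V₁ V₂ x).addCommGroup
  mod x := transportModule (sumEquiv V₁ V₂ x)
  linear_act g x e := by
    let _ : ∀ x, AddCommGroup {v : sumTot V₁ V₂ // sumProj V₁ V₂ v = x} := fun x =>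
      (sumEquiv V₁ V₂ x).addCommGroup
    let _ : ∀ x, Module ℝ {v : sumTot V₁ V₂ // sumProj V₁ V₂ v = x} := fun x =>
      transportModule (sumEquiv V₁ V₂ x)
    let φ : ∀ x, {v : sumTot V₁ V₂ // sumProj V₁ V₂ v = x} ≃ₗ[ℝ] V₁.Fibre x × V₂.Fibre x :=
      fun x => transportLin (sumEquiv V₁ V₂ x)
    exact ((φ (M.act g x e)).symm.toLinearMap.comp
      (((V₁.actFibre g x e).prodMap (V₂.actFibre g x e)).comp (φ x).toLinearMap)).isLinear
  locally_trivial x := by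
    let _ : ∀ x, AddCommGroup {v : sumTot V₁ V₂ // sumProj V₁ V₂ v = x} := fun x =>
      (sumEquiv V₁ V₂ x).addCommGroup
    let _ : ∀ x, Module ℝ {v : sumTot V₁ V₂ // sumProj V₁ V₂ v = x} := fun x =>
      transportModule (sumEquiv V₁ V₂ x)
    obtain ⟨τ₁, h₁⟩ := V₁.exists_triv x
    obtain ⟨τ₂, h₂⟩ := V₂.exists_triv x
    refine ⟨τ₁.U ∩ τ₂.U, τ₁.isOpen.inter τ₂.isOpen, ⟨h₁, h₂⟩, τ₁.n + τ₂.n,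
      (sumHomeo τ₁ τ₂).trans ((Homeomorph.refl _).prodCongr (Fin.appendHomeomorph τ₁.n τ₂.n)),
      fun v => rfl, fun y hy => ?_⟩
    let L := ((τ₁.fibre y hy.1).toLinearMap.prodMap (τ₂.fibre y hy.2).toLinearMap).comp
      (transportLin (sumEquiv V₁ V₂ y)).toLinearMap
    have hL : ∀ (v : {v : sumTot V₁ V₂ // sumProj V₁ V₂ v = y})
        (h : sumProj V₁ V₂ v.1 ∈ τ₁.U ∩ τ₂.U), (sumHomeo τ₁ τ₂ ⟨v.1, h⟩).2 = L v := fun v h => rfl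
    have happ : IsLinearMap ℝ (Fin.appendHomeomorph (X := ℝ) τ₁.n τ₂.n) := by
      constructor
      · intro a b
        funext i
        refine Fin.addCases (fun i => ?_) (fun i => ?_) i <;>
          simp [Fin.appendHomeomorph, Fin.appendEquiv]
      · intro c a
        funext i
        refine Fin.addCases (fun i => ?_) (fun i => ?_) i <;>
          simp [Fin.appendHomeomorph, Fin.appendEquiv]
    exact ((IsLinearMap.mk' _ happ).comp L).isLinear

def sumVBSum : VBSum (sum V₁ V₂) V₁ V₂ where
  fst := sumFst V₁ V₂
  snd := sumSnd V₁ V₂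
  proj_fst _ := rfl
  proj_snd v := (sumComm V₁ V₂ v).symm
  closedEmb := GSpace.isClosedEmbedding_fib
  surj v₁ v₂ h := ⟨⟨(v₁, v₂), h⟩, rfl, rfl⟩
  linear_fst x := by
    let _ : ∀ x, AddCommGroup {v : sumTot V₁ V₂ // sumProj V₁ V₂ v = x} := fun x =>
      (sumEquiv V₁ V₂ x).addCommGroup
    let _ : ∀ x, Module ℝ {v : sumTot V₁ V₂ // sumProj V₁ V₂ v = x} := fun x =>
      transportModule (sumEquiv V₁ V₂ x)
    exact ((LinearMap.fst ℝ _ _).comp (transportLin (sumEquiv V₁ V₂ x)).toLinearMap).isLinear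
  linear_snd x := by
    let _ : ∀ x, AddCommGroup {v : sumTot V₁ V₂ // sumProj V₁ V₂ v = x} := fun x =>
      (sumEquiv V₁ V₂ x).addCommGroup
    let _ : ∀ x, Module ℝ {v : sumTot V₁ V₂ // sumProj V₁ V₂ v = x} := fun x =>
      transportModule (sumEquiv V₁ V₂ x)
    exact ((LinearMap.snd ℝ _ _).comp (transportLin (sumEquiv V₁ V₂ x)).toLinearMap).isLinear

end sum

instance (M : GSpace G) (x : M) : Unique {v : M // GMap.id M v = x} where
  default := ⟨x, rfl⟩
  uniq a := Subtype.ext a.2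

/-- The zero bundle. -/
def zeroBundle (M : GSpace G) : GVB M where
  tot := M
  proj := GMap.id M
  acg x := (Equiv.ofUnique {v : M // GMap.id M v = x} PUnit.{1}).addCommGroup
  mod x := transportModule (Equiv.ofUnique {v : M // GMap.id M v = x} PUnit.{1})
  linear_act g x e := by
    let _ : ∀ x, AddCommGroup {v : M // GMap.id M v = x} := fun x =>
      (Equiv.ofUnique {v : M // GMap.id M v = x} PUnit.{1}).addCommGroup
    let _ : ∀ x, Module ℝ {v : M // GMap.id M v = x} := fun x =>
      transportModule (Equiv.ofUnique {v : M // GMap.id M v = x} PUnit.{1})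
    exact ⟨fun _ _ => Subsingleton.elim _ _, fun _ _ => Subsingleton.elim _ _⟩
  locally_trivial x := by
    let _ : ∀ x, AddCommGroup {v : M // GMap.id M v = x} := fun x =>
      (Equiv.ofUnique {v : M // GMap.id M v = x} PUnit.{1}).addCommGroup
    let _ : ∀ x, Module ℝ {v : M // GMap.id M v = x} := fun x =>
      transportModule (Equiv.ofUnique {v : M // GMap.id M v = x} PUnit.{1})
    exact ⟨univ, isOpen_univ, mem_univ x, 0,
    (Homeomorph.prodUnique _ _).symm, fun _ => rfl, fun y hy =>
      ⟨fun _ _ => Subsingleton.elim _ _, fun _ _ => Subsingleton.elim _ _⟩⟩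

theorem zeroBundle_subsingleton (M : GSpace G) (x : M) : Subsingleton ((zeroBundle M).Fibre x) :=
  inferInstanceAs (Subsingleton {v : M // GMap.id M v = x})

end GVB

end

end NNSCorr

namespace NNSCorr

noncomputable section

variable {G : TopGroupoid.{u}}

/-! ## Morphisms of vector bundles -/

/-- Properness cancels from the left over a Hausdorff space. Closed embeddings of bundle maps are
checked throughout by composing with further coordinates until the composite is a product of known
ones. -/
theorem isClosedEmbedding_of_comp {A B C : Type*} [TopologicalSpace A] [TopologicalSpace B]
    [TopologicalSpace C] [T2Space B] {f : A → B} {g : B → C} (hf : Continuous f)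
    (hg : Continuous g) (h : IsClosedEmbedding fun x => g (f x)) : IsClosedEmbedding f :=
  .of_continuous_injective_isClosedMap hf (fun _ _ e => h.injective (congrArg g e))
    (isProperMap_of_comp_of_t2 (g := g) hf hg h.isProperMap).isClosedMap

section Linear

variable {K N M : GSpace G}

/-- A map between total spaces is fibrewise linear. -/
def GVB.IsLin (V' : GVB N) (V : GVB M) (f : V'.tot → V.tot) : Prop :=
  ∀ (a b : ℝ) (v w : V'.tot) (h : V'.proj v = V'.proj w), ∃ h' : V.proj (f v) = V.proj (f w),
    f (V'.lin a b v w h) = V.lin a b (f v) (f w) h'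

variable {V'' : GVB K} {V' : GVB N} {V : GVB M}

theorem GVB.IsLin.proj_eq {f : V'.tot → V.tot} (hf : V'.IsLin V f) {v w : V'.tot}
    (h : V'.proj v = V'.proj w) : V.proj (f v) = V.proj (f w) := (hf 0 0 v w h).1

theorem GVB.IsLin.map_lin {f : V'.tot → V.tot} (hf : V'.IsLin V f) (a b : ℝ) {v w : V'.tot}
    (h : V'.proj v = V'.proj w) :
    f (V'.lin a b v w h) = V.lin a b (f v) (f w) (hf.proj_eq h) := (hf a b v w h).2

theorem GVB.IsLin.comp {f : V'.tot → V.tot} {g : V''.tot → V'.tot} (hf : V'.IsLin V f)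
    (hg : V''.IsLin V' g) : V''.IsLin V fun x => f (g x) := fun a b _ _ h =>
  ⟨hf.proj_eq (hg.proj_eq h), (congrArg f (hg.map_lin a b h)).trans (hf.map_lin a b _)⟩

/-- `IsLin` speaks only of points of total spaces, so such maps compose without identifying fibres
over points that are merely provably equal. This lemma and the next translate to and from linear
maps of fibres. -/
theorem GVB.IsLin.isLinearMap {f : V'.tot → V.tot} (hf : V'.IsLin V f) {n : N} {m : M}
    (h : ∀ v : V'.Fibre n, V.proj (f v.1) = m) :
    IsLinearMap ℝ (fun v : V'.Fibre n => (⟨f v.1, h v⟩ : V.Fibre m)) := by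
  constructor
  · intro v w
    have e : V'.proj v.1 = V'.proj w.1 := v.2.trans w.2.symm
    refine Subtype.ext ?_
    have h1 := V'.lin_eq 1 1 v w e
    have h2 := V.lin_eq 1 1 (⟨f v.1, h v⟩ : V.Fibre m) ⟨f w.1, h w⟩ (hf.proj_eq e)
    rw [one_smul, one_smul] at h1 h2
    rw [← h2]
    change f (v + w : V'.Fibre n).1 = _
    rw [← h1, hf.map_lin]
  · intro c v
    refine Subtype.ext ?_
    have h1 := V'.lin_eq c 0 v v rfl
    have h2 := V.lin_eq c 0 (⟨f v.1, h v⟩ : V.Fibre m) ⟨f v.1, h v⟩ rfl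
    rw [zero_smul, add_zero] at h1 h2
    rw [← h2]
    change f (c • v : V'.Fibre n).1 = _
    rw [← h1, hf.map_lin]

theorem GVB.isLin_of_isLinearMap {f : V'.tot → V.tot} {m : N → M}
    (h : ∀ n, ∀ v : V'.Fibre n, V.proj (f v.1) = m n)
    (hl : ∀ n, IsLinearMap ℝ (fun v : V'.Fibre n => (⟨f v.1, h n v⟩ : V.Fibre (m n)))) :
    V'.IsLin V f := by
  intro a b v w e
  have hvw : V.proj (f v) = V.proj (f w) :=
    (h _ ⟨v, e⟩).trans (h _ ⟨w, rfl⟩).symm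
  refine ⟨hvw, ?_⟩
  let φ := IsLinearMap.mk' _ (hl (V'.proj w))
  have h1 := congrArg Subtype.val ((φ.map_add (a • ⟨v, e⟩) (b • ⟨w, rfl⟩)).trans
    (congrArg₂ (· + ·) (φ.map_smul a ⟨v, e⟩) (φ.map_smul b ⟨w, rfl⟩)))
  exact h1.trans (V.lin_eq a b (φ ⟨v, e⟩) (φ ⟨w, rfl⟩) hvw).symm

theorem GVB.isLin_id (V : GVB M) : V.IsLin V fun x => x := fun _ _ _ _ h => ⟨h, rfl⟩

end Linear

/-! ### Cartesian squares of vector bundles -/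

section Squares

variable {K N M : GSpace G} {V'' : GVB K} {V' : GVB N} {V : GVB M}

theorem Sq.congr_proj {P N Q M : GSpace G} {p : GMap P N} {q : GMap Q M} (σ : Sq p q) {x y : P}
    (h₁ : p x = p y) (h₂ : σ.top x = σ.top y) : x = y :=
  σ.closedEmb.injective (Prod.ext h₁ h₂)

theorem VBSq.isLin (σ : VBSq V' V) : V'.IsLin V σ.top :=
  GVB.isLin_of_isLinearMap _ σ.linear

/-- A Cartesian square from a fibrewise linear map. -/
def VBSq.ofIsLin (base : GMap N M) (top : GMap V'.tot V.tot)
    (comm : ∀ x, base (V'.proj x) = V.proj (top x))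
    (closedEmb : IsClosedEmbedding fun x => (V'.proj x, top x))
    (surj : ∀ n v, base n = V.proj v → ∃ v', V'.proj v' = n ∧ top v' = v)
    (lin : V'.IsLin V top) : VBSq V' V where
  base := base
  top := top
  comm := comm
  closedEmb := closedEmb
  surj := surj
  linear _ := lin.isLinearMap _

def VBSq.refl (V : GVB M) : VBSq V V :=
  .ofIsLin (GMap.id M) (GMap.id V.tot) (fun _ => rfl)
    (isClosedEmbedding_of_comp (V.proj.continuous.prodMk continuous_id) continuous_snd .id)
    (fun _ v h => ⟨v, h.symm, rfl⟩) V.isLin_id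

def VBSq.comp (σ : VBSq V' V) (ρ : VBSq V'' V') : VBSq V'' V :=
  .ofIsLin (σ.base.comp ρ.base) (σ.top.comp ρ.top)
    (fun x => (congrArg σ.base (ρ.comm x)).trans (σ.comm _))
    (isClosedEmbedding_of_comp (g := fun x : K × V.tot => (x.1, (ρ.base x.1, x.2)))
      (V''.proj.continuous.prodMk (σ.top.comp ρ.top).continuous)
      (continuous_fst.prodMk ((ρ.base.continuous.comp continuous_fst).prodMk continuous_snd)) (by
        have h := (IsClosedEmbedding.id.prodMap σ.closedEmb).comp ρ.closedEmb
        have e : ((Prod.map _root_.id fun x => (V'.proj x, σ.top x)) ∘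
            fun x => (V''.proj x, ρ.top x)) = fun x : V''.tot =>
              (V''.proj x, (ρ.base (V''.proj x), σ.top (ρ.top x))) :=
          funext fun x => Prod.ext rfl (Prod.ext (ρ.comm x).symm rfl)
        rw [e] at h
        exact h))
    (fun k v h => by
      obtain ⟨v', h₁, h₂⟩ := σ.surj (ρ.base k) v h
      obtain ⟨v'', h₃, h₄⟩ := ρ.surj k v' h₁.symm
      exact ⟨v'', h₃, (congrArg σ.top h₄).trans h₂⟩)
    (σ.isLin.comp ρ.isLin)

theorem VBSq.exists_lift (σ : VBSq V' V) {R : GSpace G} (a : GMap R N) (b : GMap R V.tot)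
    (h : ∀ r, σ.base (a r) = V.proj (b r)) (r : R) :
    ∃ v', V'.proj v' = a r ∧ σ.top v' = b r := σ.surj _ _ (h r)

/-- The universal property of a Cartesian square. -/
def VBSq.lift (σ : VBSq V' V) {R : GSpace G} (a : GMap R N) (b : GMap R V.tot)
    (h : ∀ r, σ.base (a r) = V.proj (b r)) : GMap R V'.tot :=
  GMap.ofJoint σ.closedEmb.isEmbedding (fun r => (σ.exists_lift a b h r).choose) a b
    (fun r => (σ.exists_lift a b h r).choose_spec.1) fun r => (σ.exists_lift a b h r).choose_spec.2

@[simp]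
theorem VBSq.proj_lift (σ : VBSq V' V) {R : GSpace G} (a : GMap R N) (b : GMap R V.tot)
    (h : ∀ r, σ.base (a r) = V.proj (b r)) (r : R) : V'.proj (σ.lift a b h r) = a r :=
  (σ.exists_lift a b h r).choose_spec.1

@[simp]
theorem VBSq.top_lift (σ : VBSq V' V) {R : GSpace G} (a : GMap R N) (b : GMap R V.tot)
    (h : ∀ r, σ.base (a r) = V.proj (b r)) (r : R) : σ.top (σ.lift a b h r) = b r :=
  (σ.exists_lift a b h r).choose_spec.2

theorem VBSq.isLin_of_top (σ : VBSq V' V) {V'' : GVB K} {f : V''.tot → V'.tot}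
    (h : ∀ v w, V''.proj v = V''.proj w → V'.proj (f v) = V'.proj (f w))
    (hlin : ∀ a b v w e, V'.proj (f (V''.lin a b v w e)) = V'.proj (f w))
    (hf : V''.IsLin V fun x => σ.top (f x)) : V''.IsLin V' f := fun a b v w e =>
  ⟨h v w e, σ.congr_proj ((hlin a b v w e).trans (V'.proj_lin _ _ _ _ _).symm) (by
    refine (hf.map_lin a b e).trans ?_
    rw [σ.isLin.map_lin])⟩

theorem VBSq.isClosedEmbedding_top (σ : VBSq V' V) (hb : IsClosedEmbedding σ.base) :
    IsClosedEmbedding σ.top := by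
  refine isClosedEmbedding_of_comp (g := fun v => (V.proj v, v)) σ.top.continuous
    (V.proj.continuous.prodMk continuous_id) ?_
  have h := (hb.prodMap IsClosedEmbedding.id).comp σ.closedEmb
  have e : (Prod.map σ.base (_root_.id : V.tot → V.tot) ∘ fun x => (V'.proj x, σ.top x)) =
      fun x => (V.proj (σ.top x), σ.top x) := funext fun x => Prod.ext (σ.comm x) rfl
  rw [e] at h
  exact h

theorem VBSq.range_top (σ : VBSq V' V) : range σ.top = V.proj ⁻¹' range σ.base := by
  ext v
  constructor
  · rintro ⟨x, rfl⟩
    exact ⟨V'.proj x, σ.comm x⟩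
  · rintro ⟨n, hn⟩
    obtain ⟨x, -, hx⟩ := σ.surj n v hn
    exact ⟨x, hx⟩

theorem isHomeomorph_of_isClosedEmbedding {A B : Type*} [TopologicalSpace A] [TopologicalSpace B]
    {f : A → B} (h : IsClosedEmbedding f) (hs : Function.Surjective f) : IsHomeomorph f :=
  isHomeomorph_iff_isEmbedding_surjective.2 ⟨h.isEmbedding, hs⟩

theorem VBSq.isHomeomorph_top (σ : VBSq V' V) (hb : IsHomeomorph σ.base) : IsHomeomorph σ.top := by
  refine isHomeomorph_of_isClosedEmbedding (σ.isClosedEmbedding_top hb.isClosedEmbedding) ?_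
  rw [← range_eq_univ, σ.range_top, hb.surjective.range_eq, preimage_univ]

/-- The inverse of a square over a homeomorphism. -/
def VBSq.symm (σ : VBSq V' V) (hb : IsHomeomorph σ.base) : VBSq V V' :=
  .ofIsLin (σ.base.symm hb) (σ.top.symm (σ.isHomeomorph_top hb))
    (fun x => hb.injective (by rw [GMap.apply_symm, σ.comm, GMap.apply_symm]))
    (isClosedEmbedding_of_comp (V.proj.continuous.prodMk (GMap.continuous _)) continuous_snd
      (GMap.isHomeomorph_symm _ (σ.isHomeomorph_top hb)).isClosedEmbedding)
    (fun m v h => ⟨σ.top v, by rw [← σ.comm, ← h, GMap.apply_symm], GMap.symm_apply _ _ _⟩)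
    (σ.isLin_of_top (fun v w h => hb.injective (by simpa [σ.comm] using h))
      (fun a b v w e => hb.injective (by simp [σ.comm, GVB.proj_lin]))
      (by simpa using V.isLin_id))

/-- The fibres of a Cartesian square. -/
def VBSq.fibreEquiv (σ : VBSq V' V) (n : N) : V'.Fibre n ≃ₗ[ℝ] V.Fibre (σ.base n) :=
  LinearEquiv.ofBijective (IsLinearMap.mk' _ (σ.linear n)) ⟨fun v w h => Subtype.ext
    (σ.congr_proj (v.2.trans w.2.symm) (congrArg Subtype.val h)), fun v => by
      obtain ⟨x, hx, hx'⟩ := σ.surj n v.1 v.2.symm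
      exact ⟨⟨x, hx⟩, Subtype.ext hx'⟩⟩

theorem VBSq.rank_eq (σ : VBSq V' V) (n : N) : V'.rank n = V.rank (σ.base n) :=
  (σ.fibreEquiv n).finrank_eq

end Squares

/-! ### Direct sum decompositions -/

section Sums

variable {N M : GSpace G} {S V₁ V₂ : GVB M}

theorem VBSum.congr_fst (σ : VBSum S V₁ V₂) {x y : S.tot} (h₁ : σ.fst x = σ.fst y)
    (h₂ : σ.snd x = σ.snd y) : x = y := σ.closedEmb.injective (Prod.ext h₁ h₂)

theorem VBSum.isLin_fst (σ : VBSum S V₁ V₂) : S.IsLin V₁ σ.fst :=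
  GVB.isLin_of_isLinearMap _ σ.linear_fst

theorem VBSum.isLin_snd (σ : VBSum S V₁ V₂) : S.IsLin V₂ σ.snd :=
  GVB.isLin_of_isLinearMap _ σ.linear_snd

def VBSum.ofIsLin (fst : GMap S.tot V₁.tot) (snd : GMap S.tot V₂.tot)
    (proj_fst : ∀ v, V₁.proj (fst v) = S.proj v) (proj_snd : ∀ v, V₂.proj (snd v) = S.proj v)
    (closedEmb : IsClosedEmbedding fun v => (fst v, snd v))
    (surj : ∀ v₁ v₂, V₁.proj v₁ = V₂.proj v₂ → ∃ v, fst v = v₁ ∧ snd v = v₂)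
    (lin_fst : S.IsLin V₁ fst) (lin_snd : S.IsLin V₂ snd) : VBSum S V₁ V₂ where
  fst := fst
  snd := snd
  proj_fst := proj_fst
  proj_snd := proj_snd
  closedEmb := closedEmb
  surj := surj
  linear_fst _ := lin_fst.isLinearMap _
  linear_snd _ := lin_snd.isLinearMap _

theorem VBSum.exists_lift (σ : VBSum S V₁ V₂) {R : GSpace G} (a : GMap R V₁.tot)
    (b : GMap R V₂.tot) (h : ∀ r, V₁.proj (a r) = V₂.proj (b r)) (r : R) :
    ∃ v, σ.fst v = a r ∧ σ.snd v = b r := σ.surj _ _ (h r)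

/-- The universal property of a direct sum. -/
def VBSum.lift (σ : VBSum S V₁ V₂) {R : GSpace G} (a : GMap R V₁.tot) (b : GMap R V₂.tot)
    (h : ∀ r, V₁.proj (a r) = V₂.proj (b r)) : GMap R S.tot :=
  GMap.ofJoint σ.closedEmb.isEmbedding (fun r => (σ.exists_lift a b h r).choose) a b
    (fun r => (σ.exists_lift a b h r).choose_spec.1) fun r => (σ.exists_lift a b h r).choose_spec.2

@[simp]
theorem VBSum.fst_lift (σ : VBSum S V₁ V₂) {R : GSpace G} (a : GMap R V₁.tot) (b : GMap R V₂.tot)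
    (h : ∀ r, V₁.proj (a r) = V₂.proj (b r)) (r : R) : σ.fst (σ.lift a b h r) = a r :=
  (σ.exists_lift a b h r).choose_spec.1

@[simp]
theorem VBSum.snd_lift (σ : VBSum S V₁ V₂) {R : GSpace G} (a : GMap R V₁.tot) (b : GMap R V₂.tot)
    (h : ∀ r, V₁.proj (a r) = V₂.proj (b r)) (r : R) : σ.snd (σ.lift a b h r) = b r :=
  (σ.exists_lift a b h r).choose_spec.2

theorem VBSum.proj_lift (σ : VBSum S V₁ V₂) {R : GSpace G} (a : GMap R V₁.tot) (b : GMap R V₂.tot)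
    (h : ∀ r, V₁.proj (a r) = V₂.proj (b r)) (r : R) : S.proj (σ.lift a b h r) = V₁.proj (a r) := by
  rw [← σ.proj_fst, fst_lift]

theorem VBSum.isLin_of_fst_snd (σ : VBSum S V₁ V₂) {V : GVB N} {f : V.tot → S.tot}
    (h₁ : V.IsLin V₁ fun x => σ.fst (f x)) (h₂ : V.IsLin V₂ fun x => σ.snd (f x)) :
    V.IsLin S f := fun a b v w e =>
  ⟨by rw [← σ.proj_fst, ← σ.proj_fst]; exact h₁.proj_eq e, σ.congr_fst
    (by rw [σ.isLin_fst.map_lin]; exact h₁.map_lin a b e)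
    (by rw [σ.isLin_snd.map_lin]; exact h₂.map_lin a b e)⟩

def VBSum.fibreEquiv (σ : VBSum S V₁ V₂) (x : M) : S.Fibre x ≃ₗ[ℝ] V₁.Fibre x × V₂.Fibre x :=
  LinearEquiv.ofBijective ((IsLinearMap.mk' _ (σ.linear_fst x)).prod
    (IsLinearMap.mk' _ (σ.linear_snd x))) ⟨fun v w h => Subtype.ext
    (σ.congr_fst (congrArg (fun x => x.1.1) h) (congrArg (fun x => x.2.1) h)), fun v => by
      obtain ⟨y, hy, hy'⟩ := σ.surj v.1.1 v.2.1 (v.1.2.trans v.2.2.symm)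
      exact ⟨⟨y, by rw [← σ.proj_fst, hy]; exact v.1.2⟩,
        Prod.ext (Subtype.ext hy) (Subtype.ext hy')⟩⟩

theorem VBSum.rank_eq (σ : VBSum S V₁ V₂) (x : M) : S.rank x = V₁.rank x + V₂.rank x := by
  rw [GVB.rank, (σ.fibreEquiv x).finrank_eq, Module.finrank_prod]; rfl

theorem VBSum.mapSq_comm {S' V₁' V₂' : GVB N} (σ' : VBSum S' V₁' V₂')
    (s₁ : VBSq V₁' V₁) (s₂ : VBSq V₂' V₂) (hb : ∀ n, s₁.base n = s₂.base n) (r : S'.tot) :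
    V₁.proj (s₁.top.comp σ'.fst r) = V₂.proj (s₂.top.comp σ'.snd r) := by
  rw [GMap.comp_apply, GMap.comp_apply, ← s₁.comm, ← s₂.comm, σ'.proj_fst, σ'.proj_snd, hb]

/-- Squares of the summands yield a square of the direct sums. -/
def VBSum.mapSq {S' V₁' V₂' : GVB N} (σ' : VBSum S' V₁' V₂') (σ : VBSum S V₁ V₂)
    (s₁ : VBSq V₁' V₁) (s₂ : VBSq V₂' V₂) (hb : ∀ n, s₁.base n = s₂.base n) : VBSq S' S :=
  .ofIsLin s₁.base (σ.lift (s₁.top.comp σ'.fst) (s₂.top.comp σ'.snd)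
    (σ'.mapSq_comm s₁ s₂ hb))
    (fun x => by rw [σ.proj_lift, GMap.comp_apply, ← s₁.comm, σ'.proj_fst])
    (isClosedEmbedding_of_comp
      (g := fun x : N × S.tot => (((x.1, σ.fst x.2), (x.1, σ.snd x.2)) :
        (N × V₁.tot) × (N × V₂.tot)))
      (S'.proj.continuous.prodMk (GMap.continuous _))
      (by have := σ.fst.continuous; have := σ.snd.continuous; fun_prop) (by
        have h := (s₁.closedEmb.prodMap s₂.closedEmb).comp σ'.closedEmb
        have e : (Prod.map (fun x => (V₁'.proj x, s₁.top x)) (fun x => (V₂'.proj x, s₂.top x)) ∘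
            fun v => (σ'.fst v, σ'.snd v)) = fun v => ((S'.proj v, s₁.top (σ'.fst v)),
              (S'.proj v, s₂.top (σ'.snd v))) := funext fun v => by
          simp [σ'.proj_fst, σ'.proj_snd]
        rw [e] at h
        simpa using h))
    (fun n v h => by
      obtain ⟨v₁, h₁, h₁'⟩ := s₁.surj n (σ.fst v) (by rw [σ.proj_fst, h])
      obtain ⟨v₂, h₂, h₂'⟩ := s₂.surj n (σ.snd v) (by rw [σ.proj_snd, ← h, hb])
      obtain ⟨v', h₃, h₄⟩ := σ'.surj v₁ v₂ (h₁.trans h₂.symm)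
      refine ⟨v', by rw [← σ'.proj_fst, h₃, h₁], σ.congr_fst ?_ ?_⟩
      · rw [σ.fst_lift, GMap.comp_apply, h₃, h₁']
      · rw [σ.snd_lift, GMap.comp_apply, h₄, h₂'])
    (σ.isLin_of_fst_snd (by simpa using s₁.isLin.comp σ'.isLin_fst)
      (by simpa using s₂.isLin.comp σ'.isLin_snd))

@[simp]
theorem VBSum.mapSq_fst {S' V₁' V₂' : GVB N} (σ' : VBSum S' V₁' V₂') (σ : VBSum S V₁ V₂)
    (s₁ : VBSq V₁' V₁) (s₂ : VBSq V₂' V₂) (hb : ∀ n, s₁.base n = s₂.base n) (v : S'.tot) :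
    σ.fst ((σ'.mapSq σ s₁ s₂ hb).top v) = s₁.top (σ'.fst v) :=
  σ.fst_lift _ _ (σ'.mapSq_comm s₁ s₂ hb) v

@[simp]
theorem VBSum.mapSq_snd {S' V₁' V₂' : GVB N} (σ' : VBSum S' V₁' V₂') (σ : VBSum S V₁ V₂)
    (s₁ : VBSq V₁' V₁) (s₂ : VBSq V₂' V₂) (hb : ∀ n, s₁.base n = s₂.base n) (v : S'.tot) :
    σ.snd ((σ'.mapSq σ s₁ s₂ hb).top v) = s₂.top (σ'.snd v) :=
  σ.snd_lift _ _ (σ'.mapSq_comm s₁ s₂ hb) v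

theorem VBSum.pull_comm_fst {S' V₁' : GVB N} (σ : VBSum S V₁ V₂) (s : VBSq S' S)
    (s₁ : VBSq V₁' V₁) (h₁ : ∀ n, s₁.base n = s.base n) (r : S'.tot) :
    s₁.base (S'.proj r) = V₁.proj (σ.fst.comp s.top r) := by
  rw [GMap.comp_apply, σ.proj_fst, h₁, s.comm]

theorem VBSum.pull_comm_snd {S' V₂' : GVB N} (σ : VBSum S V₁ V₂) (s : VBSq S' S)
    (s₂ : VBSq V₂' V₂) (h₂ : ∀ n, s₂.base n = s.base n) (r : S'.tot) :
    s₂.base (S'.proj r) = V₂.proj (σ.snd.comp s.top r) := by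
  rw [GMap.comp_apply, σ.proj_snd, h₂, s.comm]

/-- The pull-back of a direct sum decomposition. -/
def VBSum.pull {S' V₁' V₂' : GVB N} (σ : VBSum S V₁ V₂) (s : VBSq S' S)
    (s₁ : VBSq V₁' V₁) (s₂ : VBSq V₂' V₂) (h₁ : ∀ n, s₁.base n = s.base n)
    (h₂ : ∀ n, s₂.base n = s.base n) : VBSum S' V₁' V₂' :=
  .ofIsLin (s₁.lift S'.proj (σ.fst.comp s.top) (σ.pull_comm_fst s s₁ h₁))
    (s₂.lift S'.proj (σ.snd.comp s.top) (σ.pull_comm_snd s s₂ h₂))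
    (fun v => s₁.proj_lift _ _ _ v) (fun v => s₂.proj_lift _ _ _ v)
    (isClosedEmbedding_of_comp
      (g := fun x : V₁'.tot × V₂'.tot => ((V₁'.proj x.1, (s₁.top x.1, s₂.top x.2)) :
        N × V₁.tot × V₂.tot))
      ((GMap.continuous _).prodMk (GMap.continuous _))
      (by
        have := V₁'.proj.continuous; have := s₁.top.continuous; have := s₂.top.continuous
        fun_prop) (by
        have h := (IsClosedEmbedding.id.prodMap σ.closedEmb).comp s.closedEmb
        simp only [VBSq.proj_lift, VBSq.top_lift]
        exact h))
    (fun v₁ v₂ h => by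
      obtain ⟨v, e₁, e₂⟩ := σ.surj (s₁.top v₁) (s₂.top v₂) (by
        rw [← s₁.comm, ← s₂.comm, h, h₁, h₂])
      obtain ⟨v', e₃, e₄⟩ := s.surj (V₁'.proj v₁) v (by rw [← σ.proj_fst, e₁, ← s₁.comm, h₁])
      refine ⟨v', s₁.congr_proj ?_ ?_, s₂.congr_proj ?_ ?_⟩
      · rw [s₁.proj_lift, e₃]
      · rw [s₁.top_lift, GMap.comp_apply, e₄, e₁]
      · rw [s₂.proj_lift, e₃, h]
      · rw [s₂.top_lift, GMap.comp_apply, e₄, e₂])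
    (s₁.isLin_of_top (fun v w h => by simpa using h) (fun a b v w e => by simp [GVB.proj_lin])
      (by simpa using σ.isLin_fst.comp s.isLin))
    (s₂.isLin_of_top (fun v w h => by simpa using h) (fun a b v w e => by simp [GVB.proj_lin])
      (by simpa using σ.isLin_snd.comp s.isLin))

@[simp]
theorem VBSum.top_pull_fst {S' V₁' V₂' : GVB N} (σ : VBSum S V₁ V₂) (s : VBSq S' S)
    (s₁ : VBSq V₁' V₁) (s₂ : VBSq V₂' V₂) (h₁ : ∀ n, s₁.base n = s.base n)
    (h₂ : ∀ n, s₂.base n = s.base n) (v : S'.tot) :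
    s₁.top ((σ.pull s s₁ s₂ h₁ h₂).fst v) = σ.fst (s.top v) :=
  s₁.top_lift _ _ (σ.pull_comm_fst s s₁ h₁) v

@[simp]
theorem VBSum.top_pull_snd {S' V₁' V₂' : GVB N} (σ : VBSum S V₁ V₂) (s : VBSq S' S)
    (s₁ : VBSq V₁' V₁) (s₂ : VBSq V₂' V₂) (h₁ : ∀ n, s₁.base n = s.base n)
    (h₂ : ∀ n, s₂.base n = s.base n) (v : S'.tot) :
    s₂.top ((σ.pull s s₁ s₂ h₁ h₂).snd v) = σ.snd (s.top v) :=
  s₂.top_lift _ _ (σ.pull_comm_snd s s₂ h₂) v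

/-- The summands may be exchanged. -/
def VBSum.swap (σ : VBSum S V₁ V₂) : VBSum S V₂ V₁ where
  fst := σ.snd
  snd := σ.fst
  proj_fst := σ.proj_snd
  proj_snd := σ.proj_fst
  closedEmb := (Homeomorph.prodComm _ _).isClosedEmbedding.comp σ.closedEmb
  surj v₁ v₂ h := (σ.surj v₂ v₁ h.symm).imp fun _ h => ⟨h.2, h.1⟩
  linear_fst := σ.linear_snd
  linear_snd := σ.linear_fst

theorem VBSum.assoc_comm {V₃ V₁₂ : GVB M} (σ : VBSum S V₁₂ V₃) (ρ : VBSum V₁₂ V₁ V₂) (r : S.tot) :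
    V₂.proj (ρ.snd.comp σ.fst r) = V₃.proj (σ.snd r) := by
  rw [GMap.comp_apply, ρ.proj_snd, σ.proj_fst, σ.proj_snd]

/-- Associativity of direct sums. -/
def VBSum.assoc {V₃ V₁₂ V₂₃ : GVB M} (σ : VBSum S V₁₂ V₃) (ρ : VBSum V₁₂ V₁ V₂)
    (θ : VBSum V₂₃ V₂ V₃) : VBSum S V₁ V₂₃ :=
  .ofIsLin (ρ.fst.comp σ.fst) (θ.lift (ρ.snd.comp σ.fst) σ.snd (σ.assoc_comm ρ))
    (fun v => by rw [GMap.comp_apply, ρ.proj_fst, σ.proj_fst])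
    (fun v => by rw [θ.proj_lift, GMap.comp_apply, ρ.proj_snd, σ.proj_fst])
    (isClosedEmbedding_of_comp
      (g := fun x : V₁.tot × V₂₃.tot => (((x.1, θ.fst x.2), θ.snd x.2) :
        (V₁.tot × V₂.tot) × V₃.tot))
      ((GMap.continuous _).prodMk (GMap.continuous _))
      (by have := θ.fst.continuous; have := θ.snd.continuous; fun_prop) (by
        have h := (ρ.closedEmb.prodMap IsClosedEmbedding.id).comp σ.closedEmb
        simp only [VBSum.fst_lift, VBSum.snd_lift]
        exact h))
    (fun v₁ v₂₃ h => by
      obtain ⟨w, e₁, e₂⟩ := ρ.surj v₁ (θ.fst v₂₃) (by rw [h, θ.proj_fst])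
      obtain ⟨v, e₃, e₄⟩ := σ.surj w (θ.snd v₂₃) (by
        rw [← ρ.proj_fst, e₁, h, θ.proj_snd])
      refine ⟨v, by rw [GMap.comp_apply, e₃, e₁], θ.congr_fst ?_ ?_⟩
      · rw [θ.fst_lift, GMap.comp_apply, e₃, e₂]
      · rw [θ.snd_lift, e₄])
    (ρ.isLin_fst.comp σ.isLin_fst)
    (θ.isLin_of_fst_snd (by simpa using ρ.isLin_snd.comp σ.isLin_fst)
      (by simpa using σ.isLin_snd))

@[simp]
theorem VBSum.assoc_fst {V₃ V₁₂ V₂₃ : GVB M} (σ : VBSum S V₁₂ V₃) (ρ : VBSum V₁₂ V₁ V₂)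
    (θ : VBSum V₂₃ V₂ V₃) (v : S.tot) : (σ.assoc ρ θ).fst v = ρ.fst (σ.fst v) := rfl

@[simp]
theorem VBSum.assoc_snd_fst {V₃ V₁₂ V₂₃ : GVB M} (σ : VBSum S V₁₂ V₃) (ρ : VBSum V₁₂ V₁ V₂)
    (θ : VBSum V₂₃ V₂ V₃) (v : S.tot) : θ.fst ((σ.assoc ρ θ).snd v) = ρ.snd (σ.fst v) :=
  θ.fst_lift _ _ (σ.assoc_comm ρ) v

@[simp]
theorem VBSum.assoc_snd_snd {V₃ V₁₂ V₂₃ : GVB M} (σ : VBSum S V₁₂ V₃) (ρ : VBSum V₁₂ V₁ V₂)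
    (θ : VBSum V₂₃ V₂ V₃) (v : S.tot) : θ.snd ((σ.assoc ρ θ).snd v) = σ.snd v :=
  θ.snd_lift _ _ (σ.assoc_comm ρ) v

/-- The total space of a direct sum as a bundle over the total space of the first summand. -/
def VBSum.bundle (σ : VBSum S V₁ V₂) : GVB V₁.tot :=
  V₂.ofCart σ.sq fun v₁ v₂ h => σ.surj v₁ v₂ h

def VBSum.bundleSq (σ : VBSum S V₁ V₂) : VBSq σ.bundle V₂ :=
  V₂.ofCartSq σ.sq fun v₁ v₂ h => σ.surj v₁ v₂ h

end Sums

end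

end NNSCorr

namespace NNSCorr

noncomputable section

variable {G : TopGroupoid.{u}} (F : CohTheory.{u, v} G)

/-! ## Orientations -/

section Classes

theorem CohTheory.pullG_pullG_eq {P N Q M Q' M' R L : GSpace G} {p : GMap P N} {q : GMap Q M}
    {q' : GMap Q' M'} {r : GMap R L} {f : GMap P Q} {g : GMap Q R} {f' : GMap P Q'} {g' : GMap Q' R}
    (hf : Pullable p q f) (hg : Pullable q r g) (hf' : Pullable p q' f') (hg' : Pullable q' r g')
    (h : ∀ x, g (f x) = g' (f' x)) (ξ : F.CohC r) :
    F.pullG hf (F.pullG hg ξ) = F.pullG hf' (F.pullG hg' ξ) :=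
  (F.pullG_comp hf hg (hg.comp hf) (fun _ => rfl) ξ).trans
    (F.pullG_comp hf' hg' (hg.comp hf) h ξ).symm

variable {K N M : GSpace G} {V'' : GVB K} {V' : GVB N} {V : GVB M}

theorem CohTheory.pull_comp (σ : VBSq V' V) (ρ : VBSq V'' V') (τ : F.CohC V.proj) :
    F.pull ρ.toSq (F.pull σ.toSq τ) = F.pull (σ.comp ρ).toSq τ :=
  F.pullG_comp ρ.pullable σ.pullable (σ.comp ρ).pullable (fun _ => rfl) τ

theorem CohTheory.pull_eq_self (σ : VBSq V V) (h : ∀ x, σ.top x = x) (τ : F.CohC V.proj) :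
    F.pull σ.toSq τ = τ := F.pullG_eq_self σ.pullable h τ

variable {S V₁ V₂ : GVB M} {S' V₁' V₂' : GVB N}

theorem VBSum.pullable_top (σ : VBSum S V₁ V₂) (σ' : VBSum S' V₁' V₂') (s : VBSq S' S)
    (s₁ : VBSq V₁' V₁) (h₁ : ∀ v, s₁.top (σ'.fst v) = σ.fst (s.top v)) :
    Pullable σ'.fst σ.fst s.top :=
  pullable_of_embedding (j := s₁.top)
    (isClosedEmbedding_of_comp (g := fun x : V₁'.tot × S.tot => (V₁'.proj x.1, x.2))
      (σ'.fst.continuous.prodMk s.top.continuous)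
      ((V₁'.proj.continuous.comp continuous_fst).prodMk continuous_snd)
      (by simpa only [σ'.proj_fst] using s.closedEmb))
    fun x => (h₁ x).symm

/-- Naturality of products, applied to the square that lies over the map of first summands; the
second factor is a pull-back along two composites that agree. -/
theorem CohTheory.pull_sumClass (σ : VBSum S V₁ V₂) (σ' : VBSum S' V₁' V₂') (s : VBSq S' S)
    (s₁ : VBSq V₁' V₁) (s₂ : VBSq V₂' V₂) (h₁ : ∀ v, s₁.top (σ'.fst v) = σ.fst (s.top v))
    (h₂ : ∀ v, s₂.top (σ'.snd v) = σ.snd (s.top v)) (τ₁ : F.CohC V₁.proj) (τ₂ : F.CohC V₂.proj) :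
    F.pull s.toSq (F.sumClass σ τ₁ τ₂) =
      F.sumClass σ' (F.pull s₁.toSq τ₁) (F.pull s₂.toSq τ₂) := by
  have hp := σ.pullable_top σ' s s₁ h₁
  have hc' : ∀ v, S'.proj v = V₁'.proj (σ'.fst v) := fun v => (σ'.proj_fst v).symm
  refine (F.pullG_thom (hc' := hc') hp s₁.pullable s.pullable (fun x => (h₁ x).symm) _ _).trans ?_
  refine congrArg (fun t => F.thom hc' t (F.pull s₁.toSq τ₁)) ?_
  exact F.pullG_pullG_eq hp σ.sq.pullable σ'.sq.pullable s₂.pullable (fun x => (h₂ x).symm) τ₂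

/-- Associativity of products turns the Thom map of a sum into two successive Thom maps: first for
`V₁`, then for the pull-back of `V₂` to `|V₁|`. -/
theorem CohTheory.thom_sumClass {X : GSpace G} (σ : VBSum S V₁ V₂) (τ₁ : F.CohC V₁.proj)
    (τ₂ : F.CohC V₂.proj) {b : GMap M X} {c₁ : GMap V₁.tot X} {c : GMap S.tot X}
    (h₁ : ∀ x, c₁ x = b (V₁.proj x)) (h : ∀ x, c x = b (S.proj x)) (h₂ : ∀ x, c x = c₁ (σ.fst x))
    (ξ : F.CohC b) : F.thom h (F.sumClass σ τ₁ τ₂) ξ =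
      F.thom h₂ (F.pull σ.sq τ₂) (F.thom h₁ τ₁ ξ) :=
  (F.thom_thom (fun v => (σ.proj_fst v).symm) h₁ h₂ h _ _ _).symm

theorem CohTheory.sumClass_comm (σ : VBSum S V₁ V₂) (τ₁ : F.CohC V₁.proj) {τ₂ : F.CohC V₂.proj}
    (h₂ : F.IsEven τ₂) : F.sumClass σ τ₁ τ₂ = F.sumClass σ.swap τ₂ τ₁ :=
  F.thom_comm _ _ σ.sq.pullable σ.swap.sq.pullable τ₁ h₂

theorem CohTheory.sumClass_assoc {V₃ V₁₂ V₂₃ : GVB M} (σ : VBSum S V₁₂ V₃) (ρ : VBSum V₁₂ V₁ V₂)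
    (θ : VBSum V₂₃ V₂ V₃) (τ₁ : F.CohC V₁.proj) (τ₂ : F.CohC V₂.proj) (τ₃ : F.CohC V₃.proj) :
    F.sumClass σ (F.sumClass ρ τ₁ τ₂) τ₃ =
      F.sumClass (σ.assoc ρ θ) τ₁ (F.sumClass θ τ₂ τ₃) := by
  have h₁ : ∀ v, (σ.assoc ρ θ).fst v = ρ.fst (σ.fst v) := fun _ => rfl
  refine (F.thom_thom h₁ (fun v => (ρ.proj_fst v).symm) (fun v => (σ.proj_fst v).symm)
    (fun v => ((σ.assoc ρ θ).proj_fst v).symm) _ _ _).trans ?_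
  refine congrArg (fun t => F.thom (fun v => ((σ.assoc ρ θ).proj_fst v).symm) t τ₁) ?_
  have hp : Pullable σ.fst θ.fst (σ.assoc ρ θ).snd :=
    pullable_of_embedding (j := ρ.snd)
      (isClosedEmbedding_of_comp (g := fun x : V₁₂.tot × V₂₃.tot => (x.1, θ.snd x.2))
        (σ.fst.continuous.prodMk (GMap.continuous _))
        (continuous_fst.prodMk (θ.snd.continuous.comp continuous_snd))
        (by simpa only [VBSum.assoc_snd_snd] using σ.closedEmb))
      (fun x => σ.assoc_snd_fst ρ θ x)
  refine Eq.trans ?_ (F.pullG_thom (hc' := h₁) hp ρ.sq.pullable (σ.assoc ρ θ).sq.pullable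
    (fun x => σ.assoc_snd_fst ρ θ x) _ _).symm
  refine congrArg (fun t => F.thom h₁ t (F.pull ρ.sq τ₂)) ?_
  exact (F.pullG_comp hp θ.sq.pullable σ.sq.pullable
    (fun x => (σ.assoc_snd_snd ρ θ x).symm) τ₃).symm

end Classes

/-! ### Orientations: degrees, products and two-out-of-three -/

section Orientation

variable {F} {N M : GSpace G} {V' : GVB N} {V : GVB M}

theorem CohTheory.IsOrientation.pull {τ : F.CohC V.proj} (h : F.IsOrientation V τ)
    (σ : VBSq V' V) : F.IsOrientation V' (F.pull σ.toSq τ) := by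
  refine ⟨fun K V'' ρ d hd => ?_, fun K V'' ρ X c => ?_⟩
  · rw [F.pull_comp]
    exact h.1 K V'' (σ.comp ρ) d hd
  · rw [F.pull_comp]
    exact h.2 K V'' (σ.comp ρ) X c

theorem CohTheory.IsOrientation.isDeg {τ : F.CohC V.proj} (h : F.IsOrientation V τ) {d : ℕ}
    (hd : ∀ x, V.rank x = d) : F.IsDeg d τ := by
  have := h.1 M V (.refl V) d hd
  rwa [F.pull_eq_self _ fun _ => rfl] at this

theorem CohTheory.IsOrientation.bijective {τ : F.CohC V.proj} (h : F.IsOrientation V τ)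
    {X : GSpace G} {b : GMap M X} {c : GMap V.tot X} (hc : ∀ x, c x = b (V.proj x)) :
    Function.Bijective (F.thom hc τ) := by
  have := h.2 M V (.refl V) X b
  rw [F.pull_eq_self _ fun _ => rfl] at this
  obtain rfl : c = b.comp V.proj := GMap.ext hc
  exact this

/-- A class vanishes if its restrictions to the parts of the base where `ρ` is constant do. -/
theorem CohTheory.eq_zero_of_base_pieces (n : ℕ) (ρ : M → ℕ) (hρ : Continuous ρ)
    (hi : ∀ g x e, ρ (M.act g x e) = ρ x) (hn : ∀ x, ρ x < n) (ξ : F.CohC V.proj)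
    (h : ∀ d, F.pull (V.pullBundleSq (piece ρ hρ hi {d}).incl).toSq ξ = 0) : ξ = 0 := by
  refine F.cohC_eq_zero_of_embeddings n (fun v => ρ (V.proj v)) (hρ.comp V.proj.continuous)
    (fun g x e => ?_) (fun x => hn _) ξ fun d => ?_
  · rw [V.proj.map_act, hi]
  · have hb : IsClosedEmbedding (piece ρ hρ hi {d}).incl :=
      (piece ρ hρ hi {d}).closed.isClosedEmbedding_subtypeVal
    refine ⟨_, _, _, (V.pullBundleSq (piece ρ hρ hi {d}).incl).top,
      (piece ρ hρ hi {d}).incl, (V.pullBundleSq (piece ρ hρ hi {d}).incl).pullable,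
      VBSq.isClosedEmbedding_top _ hb, ?_, hb.isProperMap, fun x => (Sq.comm _ x).symm, h d⟩
    refine (VBSq.range_top _).trans ?_
    change V.proj ⁻¹' range (Subtype.val : (piece ρ hρ hi {d}).carrier → M) = _
    rw [Subtype.range_val]
    rfl

/-- On the part where the rank is `d` the class has degree `d`, and odd `d` do not occur. Even rank
is what permits reordering of summands without signs. -/
theorem CohTheory.IsOrientation.isEven {τ : F.CohC V.proj} (h : F.IsOrientation V τ) {n : ℕ}
    (hn : ∀ x, V.rank x ≤ n) (he : ∀ x, Even (V.rank x)) : F.IsEven τ := by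
  intro m hm
  refine CohTheory.eq_zero_of_base_pieces (n + 1) V.rank V.continuous_rank V.rank_act
    (fun x => Nat.lt_succ_of_le (hn x)) _ fun d => ?_
  set A := piece V.rank V.continuous_rank V.rank_act {d} with hA
  have hr : ∀ x : A.toGSpace, (V.pullBundle A.incl).rank x = d := fun x =>
    ((V.pullBundleSq A.incl).rank_eq x).trans x.2
  -- For odd `d` the piece is empty, so any number may be declared its rank; `0` differs from the
  -- odd degree `m`.
  obtain ⟨d', hd', hr'⟩ : ∃ d' : ℕ, (d' : ℤ) ≠ m ∧
      ∀ x : A.toGSpace, (V.pullBundle A.incl).rank x = d' := by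
    by_cases hd : Even d
    · refine ⟨d, ?_, hr⟩
      rintro rfl
      exact hm (by exact_mod_cast hd)
    · refine ⟨0, ?_, fun x => (hd ?_).elim⟩
      · rintro rfl
        exact hm (by simp)
      · have : V.rank x.1 = d := x.2
        rw [← this]
        exact he x.1
  have hdeg := (h.pull (V.pullBundleSq A.incl)).isDeg hr'
  have := F.comp_of_isDeg hdeg hd'.symm
  rw [F.pull_eq_pullG, F.comp_pullG] at this
  exact this

variable {S V₁ V₂ : GVB M}

/-- `S` over `|V₁|` is the pull-back of `V₂`, and orientations give Thom isomorphisms after every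
pull-back. -/
theorem CohTheory.bijective_thom_bundle (σ : VBSum S V₁ V₂) {τ₂ : F.CohC V₂.proj}
    (h₂ : F.IsOrientation V₂ τ₂) {X : GSpace G} {b : GMap V₁.tot X} {c : GMap S.tot X}
    (hc : ∀ x, c x = b (σ.fst x)) : Function.Bijective (F.thom hc (F.pull σ.sq τ₂)) :=
  (h₂.pull σ.bundleSq).bijective hc

theorem CohTheory.isDeg_bundle (σ : VBSum S V₁ V₂) {τ₂ : F.CohC V₂.proj}
    (h₂ : F.IsOrientation V₂ τ₂) {d : ℕ} (hd : ∀ x, V₂.rank x = d) :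
    F.IsDeg d (F.pull σ.sq τ₂) :=
  (h₂.pull σ.bundleSq).isDeg fun x => (σ.bundleSq.rank_eq x).trans (hd _)

/-- The degree of a class on a direct sum may be checked where the ranks are constant. -/
theorem CohTheory.isDeg_of_pieces (n : ℕ) (ρ : M → ℕ) (hρ : Continuous ρ)
    (hi : ∀ g x e, ρ (M.act g x e) = ρ x) (hn : ∀ x, ρ x < n) (ξ : F.CohC V.proj) (m : ℤ)
    (h : ∀ d, F.IsDeg m (F.pull (V.pullBundleSq (piece ρ hρ hi {d}).incl).toSq ξ)) :
    F.IsDeg m ξ := by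
  rw [F.isDeg_iff, ← sub_eq_zero]
  refine CohTheory.eq_zero_of_base_pieces n ρ hρ hi hn _ fun d => ?_
  have := h d
  rw [F.isDeg_iff, F.pull_eq_pullG, F.comp_pullG] at this
  rw [map_sub, sub_eq_zero]
  exact this

/-- The product of two orientations is an orientation. -/
theorem CohTheory.IsOrientation.sumClass (σ : VBSum S V₁ V₂) {τ₁ : F.CohC V₁.proj}
    {τ₂ : F.CohC V₂.proj} (h₁ : F.IsOrientation V₁ τ₁) (h₂ : F.IsOrientation V₂ τ₂) :
    F.IsOrientation S (F.sumClass σ τ₁ τ₂) := by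
  refine ⟨fun N S' s d hd => ?_, fun N S' s X c => ?_⟩
  · have hd' : ∀ n, (V₁.pullBundle s.base).rank n + (V₂.pullBundle s.base).rank n = d := fun n => by
      rw [← hd n]
      exact ((σ.pull s (V₁.pullBundleSq s.base) (V₂.pullBundleSq s.base) (fun _ => rfl)
        (fun _ => rfl)).rank_eq n).symm
    -- The pull-back of the sum has constant rank `d`, but its summands need not have constant rank.
    -- On the part where the first has rank `e`, the second has rank `d - e`.
    refine CohTheory.isDeg_of_pieces (d + 1) (V₁.pullBundle s.base).rank (GVB.continuous_rank _)
      (GVB.rank_act _) (fun n => by have := hd' n; omega) _ d fun e => ?_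
    set A := piece (V₁.pullBundle s.base).rank (GVB.continuous_rank _) (GVB.rank_act _) {e} with hA
    rw [F.pull_comp]
    let t := s.comp (S'.pullBundleSq A.incl)
    let t₁ := (V₁.pullBundleSq s.base).comp ((V₁.pullBundle s.base).pullBundleSq A.incl)
    let t₂ := (V₂.pullBundleSq s.base).comp ((V₂.pullBundle s.base).pullBundleSq A.incl)
    have hb : ∀ n, t₁.base n = t.base n := fun _ => rfl
    have hb₂ : ∀ n, t₂.base n = t.base n := fun _ => rfl
    change F.IsDeg d (F.pull t.toSq _)
    rw [F.pull_sumClass σ (σ.pull t t₁ t₂ hb hb₂) t t₁ t₂ (σ.top_pull_fst _ _ _ hb hb₂)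
      (σ.top_pull_snd _ _ _ hb hb₂)]
    have hr₁ : ∀ x : A.toGSpace, ((V₁.pullBundle s.base).pullBundle A.incl).rank x = e := fun x =>
      (((V₁.pullBundle s.base).pullBundleSq A.incl).rank_eq x).trans x.2
    have hr₂ : ∀ x : A.toGSpace, e + ((V₂.pullBundle s.base).pullBundle A.incl).rank x = d := by
      intro x
      have e₁ : (V₁.pullBundle s.base).rank x.1 = e := x.2
      rw [((V₂.pullBundle s.base).pullBundleSq A.incl).rank_eq x, ← e₁]
      exact hd' x.1
    -- If `e > d`, the piece is empty and the splitting `0 + d` is an arbitrary choice.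
    obtain ⟨d₁, d₂, hdd, k₁, k₂⟩ : ∃ d₁ d₂ : ℕ, d₁ + d₂ = d ∧
        (∀ x : A.toGSpace, ((V₁.pullBundle s.base).pullBundle A.incl).rank x = d₁) ∧
        (∀ x : A.toGSpace, ((V₂.pullBundle s.base).pullBundle A.incl).rank x = d₂) := by
      by_cases hed : e ≤ d
      · exact ⟨e, d - e, by omega, hr₁, fun x => by have := hr₂ x; omega⟩
      · exact ⟨0, d, by omega, fun x => by have := hr₂ x; omega, fun x => by have := hr₂ x; omega⟩
    have := F.isDeg_thom (fun v => ((σ.pull t t₁ t₂ hb hb₂).proj_fst v).symm)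
      (F.isDeg_bundle (σ.pull t t₁ t₂ hb hb₂) (h₂.pull t₂) k₂) ((h₁.pull t₁).isDeg k₁)
    rw [← hdd]
    exact_mod_cast this
  · have hb : ∀ n, (V₁.pullBundleSq s.base).base n = s.base n := fun _ => rfl
    have hb₂ : ∀ n, (V₂.pullBundleSq s.base).base n = s.base n := fun _ => rfl
    let σ' := σ.pull s (V₁.pullBundleSq s.base) (V₂.pullBundleSq s.base) hb hb₂
    rw [F.pull_sumClass σ σ' s _ _ (σ.top_pull_fst _ _ _ hb hb₂) (σ.top_pull_snd _ _ _ hb hb₂)]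
    have k₁ := (h₁.pull (V₁.pullBundleSq s.base)).bijective (b := c) (c := c.comp (GVB.proj _))
      (fun _ => rfl)
    have hc : ∀ x, c.comp S'.proj x = c.comp (V₁.pullBundle s.base).proj (σ'.fst x) := fun x =>
      congrArg c (σ'.proj_fst x).symm
    have k₂ := F.bijective_thom_bundle σ' (h₂.pull (V₂.pullBundleSq s.base)) hc
    convert k₂.comp k₁ using 1
    exact funext fun ξ => F.thom_sumClass σ' _ _ (fun _ => rfl) (fun _ => rfl) hc ξ

/-- Orientations have the two-out-of-three property. -/
theorem CohTheory.IsOrientation.exists_complement (σ : VBSum S V₁ V₂) {τ : F.CohC S.proj}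
    {τ₂ : F.CohC V₂.proj} (h : F.IsOrientation S τ) (h₂ : F.IsOrientation V₂ τ₂) {n : ℕ}
    (hn : ∀ x, V₂.rank x ≤ n) :
    ∃ τ₁ : F.CohC V₁.proj, F.IsOrientation V₁ τ₁ ∧ F.sumClass σ τ₁ τ₂ = τ := by
  -- The Thom isomorphism of the pull-back of `V₂` to `|V₁|` allows division by `τ₂`; this
  -- determines `τ₁`.
  obtain ⟨τ₁, hτ₁⟩ := (F.bijective_thom_bundle σ h₂ (b := V₁.proj) (c := S.proj)
    (fun v => (σ.proj_fst v).symm)).2 τ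
  have key : F.sumClass σ τ₁ τ₂ = τ := hτ₁
  refine ⟨τ₁, ⟨fun N V₁' s₁ d hd => ?_, fun N V₁' s₁ X c => ?_⟩, key⟩
  · refine CohTheory.isDeg_of_pieces (n + 1) (V₂.pullBundle s₁.base).rank (GVB.continuous_rank _)
      (GVB.rank_act _) (fun x => by
        have e := (V₂.pullBundleSq s₁.base).rank_eq x
        have := hn (s₁.base x)
        have e' : V₂.rank ((V₂.pullBundleSq s₁.base).base x) = V₂.rank (s₁.base x) := rfl
        omega) _ d fun e => ?_
    set A := piece (V₂.pullBundle s₁.base).rank (GVB.continuous_rank _) (GVB.rank_act _) {e}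
    rw [F.pull_comp]
    let t₁ := s₁.comp (V₁'.pullBundleSq A.incl)
    let t := (S.pullBundleSq s₁.base).comp ((S.pullBundle s₁.base).pullBundleSq A.incl)
    let t₂ := (V₂.pullBundleSq s₁.base).comp ((V₂.pullBundle s₁.base).pullBundleSq A.incl)
    have hb : ∀ n, t₁.base n = t.base n := fun _ => rfl
    have hb₂ : ∀ n, t₂.base n = t.base n := fun _ => rfl
    let σ' := σ.pull t t₁ t₂ hb hb₂
    have hs := F.pull_sumClass σ σ' t t₁ t₂ (σ.top_pull_fst _ _ _ hb hb₂)
      (σ.top_pull_snd _ _ _ hb hb₂) τ₁ τ₂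
    rw [key] at hs
    have k₂ : ∀ x : A.toGSpace, ((V₂.pullBundle s₁.base).pullBundle A.incl).rank x = e := fun x =>
      (((V₂.pullBundle s₁.base).pullBundleSq A.incl).rank_eq x).trans x.2
    have k₁ : ∀ x : A.toGSpace, (V₁'.pullBundle A.incl).rank x = d := fun x =>
      ((V₁'.pullBundleSq A.incl).rank_eq x).trans (hd _)
    have kS : ∀ x : A.toGSpace, ((S.pullBundle s₁.base).pullBundle A.incl).rank x = d + e :=
      fun x => by rw [σ'.rank_eq, k₁, k₂]
    have degS := (h.pull t).isDeg kS
    have deg₂ := F.isDeg_bundle σ' (h₂.pull t₂) k₂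
    change F.IsDeg d (F.pull t₁.toSq τ₁)
    rw [F.isDeg_iff]
    -- Multiplication by `τ₂` is injective and raises degrees by `e`, so the degree of `τ₁` can be
    -- read off from that of the product.
    have inj := (F.bijective_thom_bundle σ' (h₂.pull t₂) (b := (V₁'.pullBundle A.incl).proj)
      (fun v => (σ'.proj_fst v).symm)).1
    apply inj
    have e₁ := F.comp_thom (fun v => (σ'.proj_fst v).symm) deg₂ d (F.pull t₁.toSq τ₁)
    refine e₁.symm.trans (Eq.trans ?_ hs)
    change F.comp ((d : ℤ) + e) (F.sumClass σ' (F.pull t₁.toSq τ₁) (F.pull t₂.toSq τ₂)) = _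
    rw [← hs, ← F.isDeg_iff]
    exact_mod_cast degS
  · have hb : ∀ n, s₁.base n = (S.pullBundleSq s₁.base).base n := fun _ => rfl
    have hb₂ : ∀ n, (V₂.pullBundleSq s₁.base).base n = (S.pullBundleSq s₁.base).base n :=
      fun _ => rfl
    let σ' := σ.pull (S.pullBundleSq s₁.base) s₁ (V₂.pullBundleSq s₁.base) hb hb₂
    have hs := F.pull_sumClass σ σ' _ _ _ (σ.top_pull_fst _ _ _ hb hb₂)
      (σ.top_pull_snd _ _ _ hb hb₂) τ₁ τ₂
    rw [key] at hs
    have hc : ∀ x, c.comp (S.pullBundle s₁.base).proj x = c.comp V₁'.proj (σ'.fst x) := fun x =>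
      congrArg c (σ'.proj_fst x).symm
    have k₂ := F.bijective_thom_bundle σ' (h₂.pull (V₂.pullBundleSq s₁.base)) hc
    have k := (h.pull (S.pullBundleSq s₁.base)).bijective (b := c) (c := c.comp (GVB.proj _))
      (fun _ => rfl)
    rw [hs] at k
    -- The Thom map of the sum is the one of `V₁` followed by the one of `V₂`; the composite and the
    -- second factor are bijective.
    refine (Function.Bijective.of_comp_iff' k₂ _).1 ?_
    convert k using 1
    exact funext fun ξ => (F.thom_sumClass σ' _ _ (fun _ => rfl) (fun _ => rfl) hc ξ).symm

end Orientation

/-! ## Operations on oriented bundles -/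

section OVB

variable {F} {K N M : GSpace G}

/-- The orientation of the pull-back of an oriented bundle. -/
def OVB.ofSq (V : OVB F M) (V' : GVB N) (σ : VBSq V' V.toGVB) : OVB F N where
  toGVB := V'
  orient := F.pull σ.toSq V.orient
  isOrientation := V.isOrientation.pull σ
  bounded := V.bounded.imp fun _ h x => (σ.rank_eq x).trans_le (h _)

def OVB.ofSqOSq (V : OVB F M) (V' : GVB N) (σ : VBSq V' V.toGVB) : OSq (V.ofSq V' σ) V := ⟨σ, rfl⟩

/-- The pull-back of an oriented bundle. -/
def OVB.pull (V : OVB F M) (f : GMap N M) : OVB F N := V.ofSq _ (V.toGVB.pullBundleSq f)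

def OVB.pullSq (V : OVB F M) (f : GMap N M) : OSq (V.pull f) V := V.ofSqOSq _ _

/-- The orientation of a direct sum. -/
def OVB.ofSum {S : GVB M} {V₁ V₂ : OVB F M} (σ : VBSum S V₁.toGVB V₂.toGVB) : OVB F M where
  toGVB := S
  orient := F.sumClass σ V₁.orient V₂.orient
  isOrientation := V₁.isOrientation.sumClass σ V₂.isOrientation
  bounded := by
    obtain ⟨n₁, h₁⟩ := V₁.bounded
    obtain ⟨n₂, h₂⟩ := V₂.bounded
    exact ⟨n₁ + n₂, fun x => (σ.rank_eq x).trans_le (add_le_add (h₁ x) (h₂ x))⟩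

/-- The direct sum of oriented bundles. -/
def OVB.sum (V₁ V₂ : OVB F M) : OVB F M := OVB.ofSum (GVB.sumVBSum V₁.toGVB V₂.toGVB)

def OVB.sumOSum (V₁ V₂ : OVB F M) : OSum (V₁.sum V₂) V₁ V₂ := ⟨GVB.sumVBSum _ _, rfl⟩

def OSq.refl (V : OVB F M) : OSq V V :=
  ⟨VBSq.refl _, (F.pull_eq_self (VBSq.refl _) (fun _ => rfl) _).symm⟩

def OSq.comp {V'' : OVB F K} {V' : OVB F N} {V : OVB F M} (σ : OSq V' V) (ρ : OSq V'' V') :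
    OSq V'' V :=
  ⟨σ.toVBSq.comp ρ.toVBSq, by rw [ρ.orient_eq, σ.orient_eq, F.pull_comp]⟩

def OSq.symm {V' : OVB F N} {V : OVB F M} (σ : OSq V' V) (hb : IsHomeomorph σ.base) : OSq V V' :=
  ⟨σ.toVBSq.symm hb, by
    rw [σ.orient_eq, F.pull_comp, F.pull_eq_self]
    exact fun x => GMap.apply_symm _ _ x⟩

def OSum.mapSq {S V₁ V₂ : OVB F M} {S' V₁' V₂' : OVB F N} (σ' : OSum S' V₁' V₂')
    (σ : OSum S V₁ V₂) (s₁ : OSq V₁' V₁) (s₂ : OSq V₂' V₂) (hb : ∀ n, s₁.base n = s₂.base n) :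
    OSq S' S :=
  ⟨σ'.toVBSum.mapSq σ.toVBSum s₁.toVBSq s₂.toVBSq hb, by
    rw [σ.orient_eq, σ'.orient_eq, s₁.orient_eq, s₂.orient_eq]
    exact (F.pull_sumClass _ _ _ _ _ (fun v => (VBSum.mapSq_fst _ _ _ _ hb v).symm)
      (fun v => (VBSum.mapSq_snd _ _ _ _ hb v).symm) _ _).symm⟩

def OSum.pull {S V₁ V₂ : OVB F M} {S' V₁' V₂' : OVB F N} (σ : OSum S V₁ V₂) (s : OSq S' S)
    (s₁ : OSq V₁' V₁) (s₂ : OSq V₂' V₂) (h₁ : ∀ n, s₁.base n = s.base n)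
    (h₂ : ∀ n, s₂.base n = s.base n) : OSum S' V₁' V₂' :=
  ⟨σ.toVBSum.pull s.toVBSq s₁.toVBSq s₂.toVBSq h₁ h₂, by
    rw [s.orient_eq, σ.orient_eq, s₁.orient_eq, s₂.orient_eq]
    exact F.pull_sumClass _ _ _ _ _ (VBSum.top_pull_fst _ _ _ _ h₁ h₂)
      (VBSum.top_pull_snd _ _ _ _ h₁ h₂) _ _⟩

theorem OVB.isEven (V : OVB F M) (h : ∀ x, Even (V.rank x)) : F.IsEven V.orient := by
  obtain ⟨n, hn⟩ := V.bounded
  exact V.isOrientation.isEven hn h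

def OSum.swap {S V₁ V₂ : OVB F M} (σ : OSum S V₁ V₂) (h : F.IsEven V₂.orient) : OSum S V₂ V₁ :=
  ⟨σ.toVBSum.swap, by rw [σ.orient_eq, F.sumClass_comm _ _ h]⟩

def OSum.assoc {S V₁ V₂ V₃ V₁₂ V₂₃ : OVB F M} (σ : OSum S V₁₂ V₃) (ρ : OSum V₁₂ V₁ V₂)
    (θ : OSum V₂₃ V₂ V₃) : OSum S V₁ V₂₃ :=
  ⟨σ.toVBSum.assoc ρ.toVBSum θ.toVBSum, by
    rw [σ.orient_eq, ρ.orient_eq, θ.orient_eq, F.sumClass_assoc]⟩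

/-- The standard source of even bundles: doubling makes every rank even without any assumption on
the bundle. -/
theorem OSum.isEven_double {V S : OVB F M} (σ : OSum S V V) : F.IsEven S.orient :=
  S.isEven fun x => by rw [σ.rank_eq]; exact Even.add_self _

/-- The anchor of the object space is the identity and has to be preserved. Hence squares of bundles
over the object space always lie over the identity. -/
theorem GMap.base_apply (f : GMap (GSpace.base G) (GSpace.base G)) (z : GSpace.base G) :
    f z = z := f.anchor_map z

theorem GMap.isHomeomorph_base (f : GMap (GSpace.base G) (GSpace.base G)) : IsHomeomorph f := by
  have : (f : GSpace.base G → GSpace.base G) = _root_.id := funext f.base_apply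
  rw [this]
  exact IsHomeomorph.id

/-- The anchor map as a `G`-map. -/
def GMap.anchor (M : GSpace G) : GMap M (GSpace.base G) where
  toFun := M.anchor
  continuous := M.continuous_anchor
  anchor_map _ := rfl
  map_act g x e := M.anchor_act g x e

theorem GMap.eq_anchor (f : GMap M (GSpace.base G)) (x : M) : f x = M.anchor x := f.anchor_map x

/-- The canonical orientation is supported on the whole total space, which makes the projection
proper; trivial fibres make it injective, and the zero section shows surjectivity. -/
theorem OVB.IsZero.isHomeomorph {V : OVB F M} (h : V.IsZero) : IsHomeomorph V.proj := by
  obtain ⟨h, A, hA, -⟩ := h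
  have hp := A.isProperMap hA
  refine isHomeomorph_of_isClosedEmbedding (.of_continuous_injective_isClosedMap hp.continuous
    (fun v w e => ?_) hp.isClosedMap) fun x => ⟨V.zero x, V.proj_zero x⟩
  exact congrArg Subtype.val ((h (V.proj w)).elim ⟨v, e⟩ ⟨w, rfl⟩)

theorem OVB.IsZero.thom_eq {V : OVB F M} (h : V.IsZero) {X : GSpace G} {b : GMap M X}
    {c : GMap V.tot X} (hc : ∀ x, c x = b (V.proj x)) (hp : Pullable c b V.proj) (ξ : F.CohC b) :
    F.thom hc V.orient ξ = F.pullG hp ξ := by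
  obtain ⟨h, A, hA, e⟩ := h
  rw [e]
  exact F.thom_unitClass hc A hA hp ξ

theorem pullable_isHomeomorph {P Q X : GSpace G} {f : GMap P Q} (hf : IsHomeomorph f)
    {p : GMap P X} {q : GMap Q X} (h : ∀ x, p x = q (f x)) : Pullable p q f :=
  (Sq.ofClosed p q f hf.isClosedEmbedding h).pullable

theorem CohTheory.bijective_pullG {P Q X : GSpace G} {f : GMap P Q} (hf : IsHomeomorph f)
    {p : GMap P X} {q : GMap Q X} (h : ∀ x, p x = q (f x)) (hp : Pullable p q f) :
    Function.Bijective (F.pullG hp) := by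
  have hq : Pullable q p (f.symm hf) := pullable_isHomeomorph (f.isHomeomorph_symm hf)
    fun x => by rw [h, GMap.apply_symm]
  refine Function.bijective_iff_has_inverse.2 ⟨F.pullG hq, fun ξ => ?_, fun ξ => ?_⟩
  · exact (F.pullG_comp hq hp (hp.comp hq) (fun _ => rfl) ξ).trans
      (F.pullG_eq_self _ (fun x => GMap.apply_symm f hf x) ξ)
  · exact (F.pullG_comp hp hq (hq.comp hp) (fun _ => rfl) ξ).trans
      (F.pullG_eq_self _ (fun x => GMap.symm_apply f hf x) ξ)

theorem GVB.isProperMap_zeroBundle (M : GSpace G) : IsProperMap (GVB.zeroBundle M).proj :=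
  isProperMap_id

variable (F) in
/-- The zero bundle with its canonical orientation. -/
def OVB.zero (M : GSpace G) : OVB F M where
  toGVB := GVB.zeroBundle M
  orient := F.unitClass (RelCpt.top (GVB.isProperMap_zeroBundle M)) rfl
  isOrientation := by
    have key : ∀ (N : GSpace G) (V' : GVB N) (σ : VBSq V' (GVB.zeroBundle M)),
        IsHomeomorph V'.proj := fun N V' σ => by
      refine isHomeomorph_of_isClosedEmbedding (isClosedEmbedding_of_comp
        (g := fun n => (n, σ.base n)) V'.proj.continuous
        (continuous_id.prodMk σ.base.continuous) ?_) fun n => ?_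
      · have e : (fun x => (V'.proj x, σ.base (V'.proj x))) = fun x => (V'.proj x, σ.top x) :=
          funext fun x => Prod.ext rfl (σ.comm x)
        rw [e]
        exact σ.closedEmb
      · obtain ⟨v, hv, -⟩ := σ.surj n (σ.base n) rfl
        exact ⟨v, hv⟩
    refine ⟨fun N V' σ d hd => ?_, fun N V' σ X c => ?_⟩
    · have hp := (key N V' σ).isProperMap
      have e : F.pull σ.toSq (F.unitClass (RelCpt.top (GVB.isProperMap_zeroBundle M)) rfl) =
        F.unitClass (RelCpt.top hp) rfl := F.pullG_unitClass σ.pullable _ _ _ _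
      rw [e]
      -- Over an empty base the rank condition does not restrict `d`; the class is then zero, which
      -- has every degree.
      rcases isEmpty_or_nonempty N with hN | ⟨⟨n⟩⟩
      · have : F.unitClass (RelCpt.top hp) rfl = 0 := by
          obtain ⟨A, a, ha⟩ := F.exists_of (F.unitClass (RelCpt.top hp) rfl)
          rw [ha, F.eq_zero_of_univ A.compl (fun x => (hN.false (V'.proj x)).elim) a, map_zero]
        rw [this, F.isDeg_iff, map_zero]
      · obtain rfl : d = 0 := by
          rw [← hd n]
          have : Subsingleton (V'.Fibre n) := ⟨fun a b => Subtype.ext ((key N V' σ).injective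
            (a.2.trans b.2.symm))⟩
          exact Module.finrank_zero_of_subsingleton
        exact ⟨RelCpt.top hp, _, F.map_deg _ _ 0 _ (F.one_deg _), rfl⟩
    · have hh := key N V' σ
      have e : F.pull σ.toSq (F.unitClass (RelCpt.top (GVB.isProperMap_zeroBundle M)) rfl) =
        F.unitClass (RelCpt.top hh.isProperMap) rfl := F.pullG_unitClass σ.pullable _ _ _ _
      have hq : Pullable (c.comp V'.proj) c V'.proj := pullable_isHomeomorph hh fun _ => rfl
      convert F.bijective_pullG hh (fun _ => rfl) hq using 1
      funext ξ
      rw [e]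
      exact F.thom_unitClass (fun _ => rfl) _ rfl hq ξ
  bounded := ⟨0, fun x => by
    have := GVB.zeroBundle_subsingleton M x
    exact (Module.finrank_zero_of_subsingleton (R := ℝ)).le⟩

theorem OVB.isZero_zero (M : GSpace G) : (OVB.zero F M).IsZero :=
  ⟨GVB.zeroBundle_subsingleton M, RelCpt.top (GVB.isProperMap_zeroBundle M), rfl, rfl⟩

theorem OVB.isSubtrivial_zero (M : GSpace G) : F.IsSubtrivial (OVB.zero F M).toGVB := by
  refine ⟨OVB.zero F _, GVB.zeroBundle M, GVB.zeroBundle M, ⟨.ofIsLin (GMap.anchor M)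
    (GMap.anchor M) (fun _ => rfl) ?_ (fun n v h => ⟨n, rfl, h⟩) ?_⟩, ⟨.ofIsLin (GMap.id M)
    (GMap.id M) (fun _ => rfl) (fun _ => rfl) ?_ (fun v₁ v₂ h => ⟨v₁, rfl, h⟩) ?_ ?_⟩⟩
  · exact isClosedEmbedding_of_comp (continuous_id.prodMk M.continuous_anchor) continuous_fst .id
  · intro a b v w e
    have e' : M.anchor v = M.anchor w := congrArg M.anchor e
    exact ⟨e', (congrArg M.anchor ((GVB.zeroBundle M).proj_lin a b v w e)).trans
      ((GVB.zeroBundle (GSpace.base G)).proj_lin a b (M.anchor v) (M.anchor w) e').symm⟩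
  · exact isClosedEmbedding_of_comp (continuous_id.prodMk continuous_id) continuous_fst .id
  · exact GVB.isLin_id _
  · exact GVB.isLin_id _

end OVB

end

end NNSCorr

namespace NNSCorr

noncomputable section

variable {G : TopGroupoid.{u}} {F : CohTheory.{u, v} G}

section OSumLemmas

variable {N M : GSpace G} {S V₁ V₂ : OVB F M} {S' V₁' V₂' : OVB F N}

theorem OSum.mapSq_fst (σ' : OSum S' V₁' V₂') (σ : OSum S V₁ V₂) (s₁ : OSq V₁' V₁)
    (s₂ : OSq V₂' V₂) (hb : ∀ n, s₁.base n = s₂.base n) (v : S'.tot) :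
    σ.fst ((σ'.mapSq σ s₁ s₂ hb).top v) = s₁.top (σ'.fst v) := VBSum.mapSq_fst _ _ _ _ hb v

theorem OSum.mapSq_snd (σ' : OSum S' V₁' V₂') (σ : OSum S V₁ V₂) (s₁ : OSq V₁' V₁)
    (s₂ : OSq V₂' V₂) (hb : ∀ n, s₁.base n = s₂.base n) (v : S'.tot) :
    σ.snd ((σ'.mapSq σ s₁ s₂ hb).top v) = s₂.top (σ'.snd v) := VBSum.mapSq_snd _ _ _ _ hb v

theorem OSum.top_pull_fst (σ : OSum S V₁ V₂) (s : OSq S' S) (s₁ : OSq V₁' V₁) (s₂ : OSq V₂' V₂)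
    (h₁ : ∀ n, s₁.base n = s.base n) (h₂ : ∀ n, s₂.base n = s.base n) (v : S'.tot) :
    s₁.top ((σ.pull s s₁ s₂ h₁ h₂).fst v) = σ.fst (s.top v) := VBSum.top_pull_fst _ _ _ _ h₁ h₂ v

theorem OSum.top_pull_snd (σ : OSum S V₁ V₂) (s : OSq S' S) (s₁ : OSq V₁' V₁) (s₂ : OSq V₂' V₂)
    (h₁ : ∀ n, s₁.base n = s.base n) (h₂ : ∀ n, s₂.base n = s.base n) (v : S'.tot) :
    s₂.top ((σ.pull s s₁ s₂ h₁ h₂).snd v) = σ.snd (s.top v) := VBSum.top_pull_snd _ _ _ _ h₁ h₂ v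

end OSumLemmas

/-! ## Factorisation of Cartesian squares -/

section Factor

variable {K N M : GSpace G}

/-- A Cartesian square factors through another one if the map of the base spaces does. -/
def VBSq.factor {V'' : GVB K} {V' : GVB N} {V : GVB M} (α : VBSq V'' V) (β : VBSq V' V)
    (f : GMap K N) (h : ∀ k, β.base (f k) = α.base k) : VBSq V'' V' :=
  have hl : ∀ r, β.base (f.comp V''.proj r) = V.proj (α.top r) := fun r =>
    (h _).trans (α.comm r)
  .ofIsLin f (β.lift (f.comp V''.proj) α.top hl) (fun x => (β.proj_lift _ _ hl x).symm)
    (isClosedEmbedding_of_comp (g := fun x : K × V'.tot => (x.1, β.top x.2))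
      (V''.proj.continuous.prodMk (GMap.continuous _))
      (continuous_fst.prodMk (β.top.continuous.comp continuous_snd))
      (by simpa only [VBSq.top_lift] using α.closedEmb))
    (fun k v' e => by
      obtain ⟨v'', h₁, h₂⟩ := α.surj k (β.top v') (by rw [← h, e, β.comm])
      exact ⟨v'', h₁, β.congr_proj (by rw [β.proj_lift, GMap.comp_apply, h₁, e])
        (by rw [β.top_lift, h₂])⟩)
    (β.isLin_of_top (fun v w e => by rw [β.proj_lift, β.proj_lift]; exact congrArg f e)
      (fun a b v w e => by
        rw [β.proj_lift, β.proj_lift]; exact congrArg f (GVB.proj_lin _ _ _ _ _ _))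
      (by simpa only [VBSq.top_lift] using α.isLin))

theorem VBSq.top_factor {V'' : GVB K} {V' : GVB N} {V : GVB M} (α : VBSq V'' V) (β : VBSq V' V)
    (f : GMap K N) (h : ∀ k, β.base (f k) = α.base k) (v : V''.tot) :
    β.top ((α.factor β f h).top v) = α.top v :=
  β.top_lift _ _ (fun r : V''.tot => (h (V''.proj r)).trans (α.comm r)) v

def OSq.factor {V'' : OVB F K} {V' : OVB F N} {V : OVB F M} (α : OSq V'' V) (β : OSq V' V)
    (f : GMap K N) (h : ∀ k, β.base (f k) = α.base k) : OSq V'' V' :=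
  ⟨α.toVBSq.factor β.toVBSq f h, by
    rw [α.orient_eq, β.orient_eq]
    exact (F.pullG_comp _ _ α.pullable (fun x => (VBSq.top_factor _ _ f h x).symm) _).symm⟩

end Factor

theorem pullable_closedEmb {P Q X : GSpace G} {f : GMap P Q} (hf : IsClosedEmbedding f)
    {p : GMap P X} {q : GMap Q X} (h : ∀ x, p x = q (f x)) : Pullable p q f :=
  (Sq.ofClosed p q f hf h).pullable

theorem GMap.base_eq {P : GSpace G} (f g : GMap P (GSpace.base G)) (x : P) : f x = g x :=
  (f.eq_anchor x).trans (g.eq_anchor x).symm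

/-- Any two `G`-maps to the object space coincide, so pairs of maps into bundles over it are
automatically compatible. -/
theorem base_comm {P : GSpace G} {V₁ V₂ : GVB (GSpace.base G)} {e : GMap P V₁.tot}
    {u : GMap P V₂.tot} (x : P) : V₁.proj (e x) = V₂.proj (u x) :=
  (((V₁.proj.comp e).eq_anchor x)).trans ((V₂.proj.comp u).eq_anchor x).symm

/-! ## Special correspondences without the zero bundle -/

variable (F) in
/-- A special correspondence: an open subset `P` of `|E^Y|` with a map to `X` and a class. -/
structure SC (X Y : GSpace G) where
  E : OVB F (GSpace.base G)
  P : GSpace G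
  b : GMap P X
  e : GMap P E.tot
  y : GMap P Y
  emb : IsOpenEmbedding (toFibProd (E := E.toGVB) e y)
  ξ : F.CohC b

/-- A special bordism with bundle `E`. -/
structure SB (E : OVB F (GSpace.base G)) (X Y : GSpace G) where
  W : GSpace G
  b : GMap W X
  e : GMap W E.tot
  y : GMap W Y
  t : W → unitInterval
  t_act : ∀ g w h, t (W.act g w h) = t w
  emb : IsOpenEmbedding fun w =>
    ((toFibProd (E := E.toGVB) e y w, t w) : FibProd E.toGVB Y × unitInterval)
  ξ : F.CohC b

variable {X Y : GSpace G}

/-- `S` is the part of the special bordism `B` over `j ∈ [0,1]`. -/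
structure SB.End {E : OVB F (GSpace.base G)} (B : SB E X Y) (j : unitInterval) (S : SC F X Y) where
  i : GMap S.P B.W
  closedEmb : IsClosedEmbedding i
  range_eq : range i = B.t ⁻¹' {j}
  b_eq : ∀ x, S.b x = B.b (i x)
  sqE : OSq S.E E
  e_eq : ∀ x, sqE.top (S.e x) = B.e (i x)
  y_eq : ∀ x, S.y x = B.y (i x)
  ξ_eq : ∀ h : Pullable S.b B.b i, S.ξ = F.pullG h B.ξ

/-- Two special correspondences are the two ends of a special bordism. -/
def SC.HBord (S S' : SC F X Y) : Prop :=
  ∃ (E : OVB F (GSpace.base G)) (B : SB E X Y), Nonempty (B.End 0 S) ∧ Nonempty (B.End 1 S')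

/-- An isomorphism of special correspondences. -/
structure SC.Iso (S S' : SC F X Y) where
  i : GMap S.P S'.P
  homeo : IsHomeomorph i
  b_eq : ∀ x, S.b x = S'.b (i x)
  sqE : OSq S.E S'.E
  e_eq : ∀ x, sqE.top (S.e x) = S'.e (i x)
  y_eq : ∀ x, S.y x = S'.y (i x)
  ξ_eq : ∀ h : Pullable S.b S'.b i, S.ξ = F.pullG h S'.ξ

def SC.Iso.refl (S : SC F X Y) : S.Iso S where
  i := GMap.id _
  homeo := IsHomeomorph.id
  b_eq _ := rfl
  sqE := .refl _
  e_eq _ := rfl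
  y_eq _ := rfl
  ξ_eq h := (F.pullG_eq_self h (fun _ => rfl) _).symm

def SB.End.congr {E : OVB F (GSpace.base G)} {B : SB E X Y} {j : unitInterval} {S S' : SC F X Y}
    (ε : B.End j S') (φ : S.Iso S') : B.End j S where
  i := ε.i.comp φ.i
  closedEmb := ε.closedEmb.comp φ.homeo.isClosedEmbedding
  range_eq := by
    rw [← ε.range_eq]
    exact φ.homeo.surjective.range_comp ε.i
  b_eq x := (φ.b_eq x).trans (ε.b_eq _)
  sqE := ε.sqE.comp φ.sqE
  e_eq x := (congrArg ε.sqE.top (φ.e_eq x)).trans (ε.e_eq _)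
  y_eq x := (φ.y_eq x).trans (ε.y_eq _)
  ξ_eq h := by
    have h₁ := pullable_isHomeomorph φ.homeo φ.b_eq
    have h₂ := pullable_closedEmb ε.closedEmb ε.b_eq
    rw [φ.ξ_eq h₁, ε.ξ_eq h₂]
    exact F.pullG_comp h₁ h₂ h (fun _ => rfl) _

/-- The bordism run backwards. -/
def SB.reverse {E : OVB F (GSpace.base G)} (B : SB E X Y) : SB E X Y where
  W := B.W
  b := B.b
  e := B.e
  y := B.y
  t w := unitInterval.symm (B.t w)
  t_act g w h := congrArg _ (B.t_act g w h)
  emb := ((Homeomorph.refl _).prodCongr unitInterval.symmHomeomorph).isOpenEmbedding.comp B.emb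
  ξ := B.ξ

def SB.End.reverse {E : OVB F (GSpace.base G)} {B : SB E X Y} {j : unitInterval} {S : SC F X Y}
    (ε : B.End j S) : B.reverse.End (unitInterval.symm j) S where
  i := ε.i
  closedEmb := ε.closedEmb
  range_eq := ε.range_eq.trans (by
    ext w
    exact unitInterval.symm_inj.symm)
  b_eq := ε.b_eq
  sqE := ε.sqE
  e_eq := ε.e_eq
  y_eq := ε.y_eq
  ξ_eq := ε.ξ_eq

theorem SC.HBord.symm {S S' : SC F X Y} (h : S.HBord S') : S'.HBord S := by
  obtain ⟨E, B, ⟨ε₀⟩, ⟨ε₁⟩⟩ := h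
  exact ⟨E, B.reverse, ⟨by simpa using ε₁.reverse⟩, ⟨by simpa using ε₀.reverse⟩⟩

theorem SC.HBord.congr {S S' T T' : SC F X Y} (h : S.HBord S') (φ : T.Iso S) (φ' : T'.Iso S') :
    T.HBord T' := by
  obtain ⟨E, B, ⟨ε₀⟩, ⟨ε₁⟩⟩ := h
  exact ⟨E, B, ⟨ε₀.congr φ⟩, ⟨ε₁.congr φ'⟩⟩

/-- The product of a `G`-space with the unit interval. -/
def GSpace.prodI (P : GSpace G) : GSpace G where
  carrier := P × unitInterval
  anchor p := P.anchor p.1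
  continuous_anchor := P.continuous_anchor.comp continuous_fst
  act g p e := (P.act g p.1 e, p.2)
  anchor_act g p e := P.anchor_act g p.1 e
  one_act p := Prod.ext (P.one_act p.1) rfl
  mul_act g h p e₁ e₂ := Prod.ext (P.mul_act g h p.1 e₁ e₂) rfl
  continuous_act := by
    refine Continuous.prodMk ?_ (by fun_prop)
    exact P.continuous_act.comp (f := fun p : {p : G.Arr × (P × unitInterval) //
      G.s p.1 = P.anchor p.2.1} => (⟨(p.1.1, p.1.2.1), p.2⟩ :
        {p : G.Arr × P // G.s p.1 = P.anchor p.2})) (by fun_prop)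

def GSpace.prodIFst (P : GSpace G) : GMap P.prodI P where
  toFun p := p.1
  continuous := continuous_fst
  anchor_map _ := rfl
  map_act _ _ _ := rfl

def GSpace.prodIMk (P : GSpace G) (t : unitInterval) : GMap P P.prodI where
  toFun p := (p, t)
  continuous := continuous_id.prodMk continuous_const
  anchor_map _ := rfl
  map_act _ _ _ := rfl

theorem GSpace.isProperMap_prodIFst (P : GSpace G) : IsProperMap P.prodIFst :=
  isProperMap_fst_of_compactSpace

theorem GSpace.isClosedEmbedding_prodIMk (P : GSpace G) (t : unitInterval) :
    IsClosedEmbedding (P.prodIMk t) :=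
  isClosedEmbedding_of_comp (GMap.continuous _) continuous_fst .id

/-- A family of `G`-maps as a `G`-map on the cylinder. -/
def GMap.ofFamily {P Q : GSpace G} (H : unitInterval → GMap P Q)
    (hH : Continuous fun p : P × unitInterval => H p.2 p.1) : GMap P.prodI Q where
  toFun p := H p.2 p.1
  continuous := hH
  anchor_map p := (H p.2).anchor_map p.1
  map_act g p e := (H p.2).map_act g p.1 e

/-- An isotopy of open embeddings yields a special bordism. -/
theorem SC.hbord_of_isotopy (E : OVB F (GSpace.base G)) (P : GSpace G) (b : GMap P X)
    (e : unitInterval → GMap P E.tot) (y : unitInterval → GMap P Y)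
    (emb : IsOpenEmbedding fun p : P × unitInterval =>
      ((toFibProd (E := E.toGVB) (e p.2) (y p.2) p.1, p.2) : FibProd E.toGVB Y × unitInterval))
    (h₀ : IsOpenEmbedding (toFibProd (E := E.toGVB) (e 0) (y 0)))
    (h₁ : IsOpenEmbedding (toFibProd (E := E.toGVB) (e 1) (y 1))) (ξ : F.CohC b) :
    SC.HBord ⟨E, P, b, e 0, y 0, h₀, ξ⟩ ⟨E, P, b, e 1, y 1, h₁, ξ⟩ := by
  have hc := continuous_subtype_val.comp (continuous_fst.comp emb.continuous)
  have hp : Pullable (b.comp P.prodIFst) b P.prodIFst :=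
    pullable_of_isProperMap P.isProperMap_prodIFst (j := GMap.id X) fun _ => rfl
  let B : SB E X Y := {
    W := P.prodI
    b := b.comp P.prodIFst
    e := GMap.ofFamily e (continuous_fst.comp hc)
    y := GMap.ofFamily y (continuous_snd.comp hc)
    t := fun p => p.2
    t_act := fun _ _ _ => rfl
    emb := emb
    ξ := F.pullG hp ξ }
  have key : ∀ j (h : IsOpenEmbedding (toFibProd (E := E.toGVB) (e j) (y j))),
      Nonempty (B.End j ⟨E, P, b, e j, y j, h, ξ⟩) := fun j h => ⟨{
    i := P.prodIMk j
    closedEmb := P.isClosedEmbedding_prodIMk j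
    range_eq := by
      ext p
      exact ⟨fun ⟨x, hx⟩ => congrArg Prod.snd hx.symm, fun hp => ⟨p.1, Prod.ext rfl hp.symm⟩⟩
    b_eq := fun _ => rfl
    sqE := .refl E
    e_eq := fun _ => rfl
    y_eq := fun _ => rfl
    ξ_eq := fun k => ((F.pullG_comp k hp (hp.comp k) (fun _ => rfl) ξ).trans
      (F.pullG_eq_self _ (fun _ => rfl) ξ)).symm }⟩
  exact ⟨E, B, key 0 h₀, key 1 h₁⟩

/-- The constant isotopy gives the cylinder. -/
theorem SC.HBord.refl (S : SC F X Y) : S.HBord S :=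
  SC.hbord_of_isotopy S.E S.P S.b (fun _ => S.e) (fun _ => S.y)
    (S.emb.prodMap IsOpenEmbedding.id) S.emb S.emb S.ξ

theorem SC.Iso.hbord {S S' : SC F X Y} (φ : S.Iso S') : S.HBord S' :=
  (SC.HBord.refl S').congr φ (.refl S')

/-! ## Thom modification of special correspondences -/

/-- `Q` is `P ×_Z |U|`, so its image in `|(E ⊕ U)^Y|` is the full preimage of the image of `P` under
the projection to `|E^Y|`, hence open. The factor `J` covers correspondences (a point) and bordisms
(the interval) at once. -/
theorem isOpenEmbedding_mod {J : Type*} [TopologicalSpace J] {E E' U : GVB (GSpace.base G)}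
    (σ : VBSum E' E U) {P Q : GSpace G} (π : GMap Q P) (w : GMap Q U.tot)
    (hπ : IsEmbedding fun q => (π q, w q))
    (hs : ∀ p v, P.anchor p = U.tot.anchor v → ∃ q, π q = p ∧ w q = v)
    {e : GMap P E.tot} {y : GMap P Y} {t : P → J}
    (emb : IsOpenEmbedding fun p => ((toFibProd e y p, t p) : FibProd E Y × J))
    {e' : GMap Q E'.tot} {y' : GMap Q Y} (h₁ : ∀ q, σ.fst (e' q) = e (π q))
    (h₂ : ∀ q, σ.snd (e' q) = w q) (h₃ : ∀ q, y' q = y (π q)) :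
    IsOpenEmbedding fun q => ((toFibProd e' y' q, t (π q)) : FibProd E' Y × J) := by
  let φ : FibProd E' Y × J → FibProd E Y × J := fun z =>
    (⟨(σ.fst z.1.1.1, z.1.1.2), (σ.fst.anchor_map _).trans z.1.2⟩, z.2)
  have hφ : Continuous φ := by
    have := σ.fst.continuous
    exact (Continuous.subtype_mk (by fun_prop) _).prodMk continuous_snd
  have ht : Continuous t := continuous_snd.comp emb.continuous
  have e₁ : ∀ q, φ (toFibProd e' y' q, t (π q)) = (toFibProd e y (π q), t (π q)) := fun q =>
    Prod.ext (Subtype.ext (Prod.ext (h₁ q) (h₃ q))) rfl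
  refine ⟨?_, ?_⟩
  · refine IsEmbedding.of_comp (g := fun z => (φ z, σ.snd z.1.1.1)) ?_ ?_ ?_
    · refine Continuous.prodMk ?_ (ht.comp π.continuous)
      exact Continuous.subtype_mk (e'.continuous.prodMk y'.continuous) _
    · exact hφ.prodMk (σ.snd.continuous.comp (by fun_prop))
    · have := (emb.isEmbedding.prodMap IsEmbedding.id).comp hπ
      have e₂ : ((fun z => (φ z, σ.snd z.1.1.1)) ∘
          fun q => ((toFibProd e' y' q, t (π q)) : FibProd E' Y × J)) =
          Prod.map (fun p => ((toFibProd e y p, t p) : FibProd E Y × J)) _root_.id ∘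
            fun q => (π q, w q) := funext fun q => Prod.ext (e₁ q) (h₂ q)
      rw [e₂]
      exact this
  · have : range (fun q => ((toFibProd e' y' q, t (π q)) : FibProd E' Y × J)) =
        φ ⁻¹' range (fun p => ((toFibProd e y p, t p) : FibProd E Y × J)) := by
      ext z
      constructor
      · rintro ⟨q, rfl⟩
        exact ⟨π q, (e₁ q).symm⟩
      · rintro ⟨p, hp⟩
        have hp₁ : e p = σ.fst z.1.1.1 := congrArg (fun z => z.1.1.1) hp
        have hp₂ : y p = z.1.1.2 := congrArg (fun z => z.1.1.2) hp
        have hp₃ : t p = z.2 := congrArg (fun z => z.2) hp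
        obtain ⟨q, rfl, hq⟩ := hs p (σ.snd z.1.1.1) (by
          rw [σ.snd.anchor_map, ← σ.fst.anchor_map, ← hp₁, e.anchor_map])
        refine ⟨q, Prod.ext (Subtype.ext (Prod.ext ?_ ?_)) hp₃⟩
        · exact σ.congr_fst ((h₁ q).trans hp₁) ((h₂ q).trans hq)
        · exact (h₃ q).trans hp₂
    rw [this]
    exact emb.isOpen_range.preimage hφ

/-- `S'` is the Thom modification of `S` by the oriented bundle `U` over the object space. -/
structure SC.ModOf (S : SC F X Y) (U : OVB F (GSpace.base G)) (S' : SC F X Y) where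
  UP : OVB F S.P
  sqU : OSq UP U
  i : GMap S'.P UP.tot
  homeo : IsHomeomorph i
  b_eq : ∀ x, S'.b x = S.b (UP.proj (i x))
  sumE : OSum S'.E S.E U
  e_fst : ∀ x, sumE.fst (S'.e x) = S.e (UP.proj (i x))
  e_snd : ∀ x, sumE.snd (S'.e x) = sqU.top (i x)
  y_eq : ∀ x, S'.y x = S.y (UP.proj (i x))
  ξ_eq : ∀ h : Pullable S'.b (S.b.comp UP.proj) i,
    S'.ξ = F.pullG h (F.thom (fun _ => rfl) UP.orient S.ξ)

section ModConstr

variable {P : GSpace G} (U : OVB F (GSpace.base G)) {E : OVB F (GSpace.base G)}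

theorem VBSq.surj_anchor {V' : GVB P} {V : GVB (GSpace.base G)} (σ : VBSq V' V) (p : P) (v : V.tot)
    (h : P.anchor p = V.tot.anchor v) : ∃ q, V'.proj q = p ∧ σ.top q = v :=
  σ.surj p v ((σ.base.eq_anchor p).trans (h.trans (V.proj.eq_anchor v).symm))

/-- The map to `|E ⊕ U|` of a Thom modification. -/
def modE (e : GMap P E.tot) : GMap (U.pull (GMap.anchor P)).tot (E.sum U).tot :=
  (E.sumOSum U).lift (e.comp (OVB.pull U (GMap.anchor P)).proj) (U.pullSq (GMap.anchor P)).top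
    base_comm

theorem modE_fst (e : GMap P E.tot) (x : (U.pull (GMap.anchor P)).tot) :
    (E.sumOSum U).fst (modE U e x) = e ((U.pull (GMap.anchor P)).proj x) :=
  VBSum.fst_lift _ _ _ base_comm x

theorem modE_snd (e : GMap P E.tot) (x : (U.pull (GMap.anchor P)).tot) :
    (E.sumOSum U).snd (modE U e x) = (U.pullSq (GMap.anchor P)).top x :=
  VBSum.snd_lift _ _ _ base_comm x

end ModConstr

/-- The Thom modification of a special correspondence. -/
def SC.mod (S : SC F X Y) (U : OVB F (GSpace.base G)) : SC F X Y where
  E := S.E.sum U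
  P := (U.pull (GMap.anchor S.P)).tot
  b := S.b.comp (OVB.pull U (GMap.anchor S.P)).proj
  e := modE U S.e
  y := S.y.comp (OVB.pull U (GMap.anchor S.P)).proj
  emb := by
    have h := isOpenEmbedding_mod (J := PUnit.{1}) (S.E.sumOSum U).toVBSum
      (OVB.pull U (GMap.anchor S.P)).proj (U.pullSq (GMap.anchor S.P)).top
      (U.pullSq (GMap.anchor S.P)).closedEmb.isEmbedding
      (U.pullSq (GMap.anchor S.P)).surj_anchor (e := S.e) (y := S.y) (t := fun _ => PUnit.unit)
      ((Homeomorph.prodPUnit _).symm.isOpenEmbedding.comp S.emb) (e' := modE U S.e)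
      (y' := S.y.comp (OVB.pull U (GMap.anchor S.P)).proj)
      (modE_fst U _) (modE_snd U _)
      (fun _ => rfl)
    exact (Homeomorph.prodPUnit _).isOpenEmbedding.comp h
  ξ := F.thom (fun _ => rfl) (U.pull (GMap.anchor S.P)).orient S.ξ

def SC.modOf_mod (S : SC F X Y) (U : OVB F (GSpace.base G)) : S.ModOf U (S.mod U) where
  UP := U.pull (GMap.anchor S.P)
  sqU := U.pullSq _
  i := GMap.id _
  homeo := IsHomeomorph.id
  b_eq _ := rfl
  sumE := S.E.sumOSum U
  e_fst := modE_fst U _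
  e_snd := modE_snd U _
  y_eq _ := rfl
  ξ_eq h := (F.pullG_eq_self h (fun _ => rfl) _).symm

/-- The Thom modification of a special bordism. -/
def SB.mod {E : OVB F (GSpace.base G)} (B : SB E X Y) (U : OVB F (GSpace.base G)) :
    SB (E.sum U) X Y where
  W := (U.pull (GMap.anchor B.W)).tot
  b := B.b.comp (OVB.pull U (GMap.anchor B.W)).proj
  e := modE U B.e
  y := B.y.comp (OVB.pull U (GMap.anchor B.W)).proj
  t w := B.t ((OVB.pull U (GMap.anchor B.W)).proj w)
  t_act g w h := by rw [GMap.map_act, B.t_act]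
  emb := isOpenEmbedding_mod (E.sumOSum U).toVBSum
      (OVB.pull U (GMap.anchor B.W)).proj (U.pullSq (GMap.anchor B.W)).top
      (U.pullSq (GMap.anchor B.W)).closedEmb.isEmbedding
      (U.pullSq (GMap.anchor B.W)).surj_anchor (e := B.e) (y := B.y) B.emb (e' := modE U B.e)
      (y' := B.y.comp (OVB.pull U (GMap.anchor B.W)).proj)
      (modE_fst U _) (modE_snd U _)
      (fun _ => rfl)
  ξ := F.thom (fun _ => rfl) (U.pull (GMap.anchor B.W)).orient B.ξ

/-- Thom classes are compatible with squares of oriented bundles over maps over `X`. -/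
theorem CohTheory.pullG_thom_orient {N M : GSpace G} {V' : OVB F N} {V : OVB F M} (s : OSq V' V)
    {b' : GMap N X} {b : GMap M X} (hb : Pullable b' b s.base) {c' : GMap V'.tot X}
    {c : GMap V.tot X} (hc' : ∀ x, c' x = b' (V'.proj x)) (hc : ∀ x, c x = b (V.proj x))
    (h : Pullable c' c s.top) (ξ : F.CohC b) :
    F.pullG h (F.thom hc V.orient ξ) = F.thom hc' V'.orient (F.pullG hb ξ) := by
  rw [s.orient_eq]
  exact F.pullG_thom s.pullable hb h (fun x => (s.comm x).symm) _ _

theorem anchor_base {N M : GSpace G} (α : GMap N (GSpace.base G)) (β : GMap M (GSpace.base G))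
    (f : GMap N M) (n : N) : β (f n) = α n :=
  ((β.comp f).eq_anchor n).trans (α.eq_anchor n).symm

/-- Thom modifications of an end of a special bordism. -/
def SB.End.mod {E : OVB F (GSpace.base G)} {B : SB E X Y} {j : unitInterval} {S S' : SC F X Y}
    (ε : B.End j S) {U : OVB F (GSpace.base G)} (μ : S.ModOf U S') : (B.mod U).End j S' :=
  let s : OSq μ.UP (U.pull (GMap.anchor B.W)) := μ.sqU.factor (U.pullSq _) ε.i (anchor_base _ _ _)
  have hs : IsClosedEmbedding s.top := s.isClosedEmbedding_top ε.closedEmb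
  have hp : ∀ x, (OVB.pull U (GMap.anchor B.W)).proj (s.top x) = ε.i (μ.UP.proj x) := fun x =>
    (s.comm x).symm
  { i := s.top.comp μ.i
    closedEmb := hs.comp μ.homeo.isClosedEmbedding
    range_eq := by
      change range (s.top ∘ μ.i) = (OVB.pull U (GMap.anchor B.W)).proj ⁻¹' (B.t ⁻¹' {j})
      rw [μ.homeo.surjective.range_comp, s.range_top, ← ε.range_eq]
      rfl
    b_eq := fun x => (μ.b_eq x).trans ((ε.b_eq _).trans (congrArg B.b (hp _).symm))
    sqE := μ.sumE.mapSq (E.sumOSum U) ε.sqE (.refl U) (GMap.base_eq _ _)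
    e_eq := fun x => (E.sumOSum U).congr_fst
      (by
        rw [OSum.mapSq_fst, μ.e_fst, ε.e_eq, ← hp]
        exact (modE_fst U B.e _).symm)
      (by
        rw [OSum.mapSq_snd, μ.e_snd]
        exact ((modE_snd U B.e _).trans (VBSq.top_factor _ (U.pullSq (GMap.anchor B.W)).toVBSq ε.i
          (anchor_base _ _ _) _)).symm)
    y_eq := fun x => (μ.y_eq x).trans ((ε.y_eq _).trans (congrArg B.y (hp _).symm))
    ξ_eq := fun h => by
      have hb : Pullable S.b B.b ε.i := pullable_closedEmb ε.closedEmb ε.b_eq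
      have h₁ : Pullable (S.b.comp μ.UP.proj) (B.mod U).b s.top := pullable_closedEmb hs
        fun x => (ε.b_eq _).trans (congrArg B.b (hp x).symm)
      have h₂ : Pullable S'.b (S.b.comp μ.UP.proj) μ.i := pullable_isHomeomorph μ.homeo μ.b_eq
      rw [μ.ξ_eq h₂, ε.ξ_eq hb]
      refine Eq.trans ?_ (F.pullG_comp h₂ h₁ h (fun _ => rfl) _)
      exact congrArg (F.pullG h₂) (F.pullG_thom_orient s hb _ _ h₁ B.ξ).symm }

theorem SC.HBord.mod {S₁ S₂ S₁' S₂' : SC F X Y} (h : S₁.HBord S₂) {U : OVB F (GSpace.base G)}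
    (μ₁ : S₁.ModOf U S₁') (μ₂ : S₂.ModOf U S₂') : S₁'.HBord S₂' := by
  obtain ⟨E, B, ⟨ε₀⟩, ⟨ε₁⟩⟩ := h
  exact ⟨_, B.mod U, ⟨ε₀.mod μ₁⟩, ⟨ε₁.mod μ₂⟩⟩

/-- Iterated Thom modifications. -/
def SC.ModOf.trans {S S' S'' : SC F X Y} {U₁ U₂ U : OVB F (GSpace.base G)} (μ : S.ModOf U₁ S')
    (ν : S'.ModOf U₂ S'') (σ : OSum U U₁ U₂) : S.ModOf U S'' :=
  let π := GMap.anchor S.P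
  have hπ₁ : ∀ x, μ.sqU.base x = (U.pullSq π).base x := fun x => GMap.eq_anchor _ x
  have hπ₂ : ∀ x, (U₂.pullSq π).base x = (U.pullSq π).base x := fun x => rfl
  let σP : OSum (U.pull π) μ.UP (U₂.pull π) := σ.pull (U.pullSq π) μ.sqU (U₂.pullSq π) hπ₁ hπ₂
  have hσ₁ : ∀ v, μ.sqU.top (σP.fst v) = σ.fst ((U.pullSq π).top v) := fun v =>
    σ.top_pull_fst _ _ _ hπ₁ hπ₂ v
  have hσ₂ : ∀ v, (U₂.pullSq π).top (σP.snd v) = σ.snd ((U.pullSq π).top v) := fun v =>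
    σ.top_pull_snd _ _ _ hπ₁ hπ₂ v
  -- The total space of `(U₁ ⊕ U₂)^P` is the pull-back of `U₂` to `|U₁^P|`. As `S'.P` is
  -- homeomorphic to `|U₁^P|`, it is thereby identified with the total space of `ν.UP`.
  let β : VBSq σP.bundle U₂.toGVB := (U₂.pullSq π).toVBSq.comp σP.bundleSq
  let k : VBSq ν.UP.toGVB σP.bundle := ν.sqU.toVBSq.factor β μ.i (anchor_base _ _ _)
  let κ : GMap ν.UP.tot (U.pull π).tot := k.top
  have hk : IsHomeomorph κ := k.isHomeomorph_top μ.homeo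
  have hk₁ : ∀ x, σP.fst (κ x) = μ.i (ν.UP.proj x) := fun x => (k.comm x).symm
  have hk₂ : ∀ x, (U₂.pullSq π).top (σP.snd (κ x)) = ν.sqU.top x := fun x =>
    VBSq.top_factor _ β μ.i (anchor_base _ _ _) x
  have hk₃ : ∀ x, (U.pull π).proj (κ x) = μ.UP.proj (μ.i (ν.UP.proj x)) := fun x =>
    (σP.proj_fst _).symm.trans (congrArg _ (hk₁ x))
  { UP := U.pull π
    sqU := U.pullSq π
    i := κ.comp ν.i
    homeo := hk.comp ν.homeo
    b_eq := fun x => (ν.b_eq x).trans ((μ.b_eq _).trans (congrArg S.b (hk₃ _).symm))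
    sumE := ν.sumE.assoc μ.sumE σ
    e_fst := fun x => (VBSum.assoc_fst _ _ _ _).trans (by
      rw [ν.e_fst, μ.e_fst]; exact congrArg S.e (hk₃ _).symm)
    e_snd := fun x => σ.congr_fst
      ((VBSum.assoc_snd_fst _ _ _ _).trans (by
        rw [ν.e_fst, μ.e_snd, ← hk₁]; exact hσ₁ _))
      ((VBSum.assoc_snd_snd _ _ _ _).trans (by
        rw [ν.e_snd, ← hk₂]; exact hσ₂ _))
    y_eq := fun x => (ν.y_eq x).trans ((μ.y_eq _).trans (congrArg S.y (hk₃ _).symm))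
    ξ_eq := fun h => by
      have h₁ : Pullable S'.b (S.b.comp μ.UP.proj) μ.i := pullable_isHomeomorph μ.homeo μ.b_eq
      have h₂ : Pullable S''.b (S'.b.comp ν.UP.proj) ν.i := pullable_isHomeomorph ν.homeo ν.b_eq
      have h₃ : Pullable (S'.b.comp ν.UP.proj) (S.b.comp (U.pull π).proj) κ :=
        pullable_isHomeomorph hk fun x => (μ.b_eq _).trans (congrArg S.b (hk₃ x).symm)
      rw [ν.ξ_eq h₂, μ.ξ_eq h₁]
      refine Eq.trans ?_ (F.pullG_comp h₂ h₃ h (fun _ => rfl) _)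
      refine congrArg (F.pullG h₂) ?_
      have hc : ∀ x, S.b.comp (U.pull π).proj x = S.b.comp μ.UP.proj (σP.fst x) := fun x =>
        congrArg S.b (σP.proj_fst x).symm
      have e₁ : F.thom (fun _ => rfl) (U.pull π).orient S.ξ =
          F.thom hc (F.pull σP.sq (U₂.pull π).orient) (F.thom (fun _ => rfl) μ.UP.orient S.ξ) := by
        rw [σP.orient_eq]
        exact F.thom_sumClass σP.toVBSum _ _ (fun _ => rfl) (fun _ => rfl) hc _
      have h₄ : Pullable ν.UP.proj σP.fst κ := k.pullable
      have e₂ : F.pullG h₄ (F.pull σP.sq (U₂.pull π).orient) = ν.UP.orient := by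
        rw [ν.sqU.orient_eq, (U₂.pullSq π).orient_eq]
        refine (congrArg (F.pullG h₄) (F.pullG_comp σP.sq.pullable (U₂.pullSq π).pullable
          β.pullable (fun _ => rfl) _)).trans ?_
        exact F.pullG_comp h₄ β.pullable ν.sqU.pullable (fun x => (hk₂ x).symm) _
      refine Eq.trans ?_ (congrArg (F.pullG h₃) e₁).symm
      refine Eq.trans ?_ (F.pullG_thom (hc' := fun _ => rfl) h₄ h₁ h₃ hk₁ _ _).symm
      rw [e₂] }

/-- Thom modifications are unique up to isomorphism. -/
def SC.ModOf.iso {S S₁ S₂ : SC F X Y} {U : OVB F (GSpace.base G)} (μ : S.ModOf U S₁)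
    (ν : S.ModOf U S₂) : S₁.Iso S₂ :=
  let s : OSq μ.UP ν.UP := μ.sqU.factor ν.sqU (GMap.id S.P) (anchor_base _ _ _)
  have hs : IsHomeomorph s.top := s.isHomeomorph_top IsHomeomorph.id
  have hs₁ : ∀ x, ν.UP.proj (s.top x) = μ.UP.proj x := fun x => (s.comm x).symm
  have hs₂ : ∀ x, ν.sqU.top (s.top x) = μ.sqU.top x := fun x =>
    VBSq.top_factor _ ν.sqU.toVBSq (GMap.id S.P) (anchor_base _ _ _) x
  let j := ν.i.symm ν.homeo
  have hj : ∀ x, ν.i (j x) = x := fun x => ν.i.apply_symm ν.homeo x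
  { i := j.comp (s.top.comp μ.i)
    homeo := (ν.i.isHomeomorph_symm ν.homeo).comp (hs.comp μ.homeo)
    b_eq := fun x => by
      rw [GMap.comp_apply, ν.b_eq, hj, GMap.comp_apply, hs₁, μ.b_eq]
    sqE := μ.sumE.mapSq ν.sumE (.refl _) (.refl _) (GMap.base_eq _ _)
    e_eq := fun x => ν.sumE.congr_fst
      (by
        rw [OSum.mapSq_fst, μ.e_fst, ν.e_fst, GMap.comp_apply, hj, GMap.comp_apply, hs₁]; rfl)
      (by
        rw [OSum.mapSq_snd, μ.e_snd, ν.e_snd, GMap.comp_apply, hj, GMap.comp_apply, hs₂]; rfl)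
    y_eq := fun x => by
      rw [GMap.comp_apply, ν.y_eq, hj, GMap.comp_apply, hs₁, μ.y_eq]
    ξ_eq := fun h => by
      have h₁ : Pullable S₁.b (S.b.comp μ.UP.proj) μ.i := pullable_isHomeomorph μ.homeo μ.b_eq
      have h₂ : Pullable S₂.b (S.b.comp ν.UP.proj) ν.i := pullable_isHomeomorph ν.homeo ν.b_eq
      have h₃ : Pullable (S.b.comp μ.UP.proj) (S.b.comp ν.UP.proj) s.top :=
        pullable_isHomeomorph hs fun x => congrArg S.b (hs₁ x).symm
      have hid : Pullable S.b S.b (GMap.id S.P) := pullable_isHomeomorph .id fun _ => rfl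
      rw [μ.ξ_eq h₁, ν.ξ_eq h₂]
      have e := (F.pullG_thom_orient s hid (fun _ => rfl) (fun _ => rfl) h₃ S.ξ).trans
        (congrArg (F.thom (fun _ => rfl) μ.UP.orient) (F.pullG_eq_self hid (fun _ => rfl) S.ξ))
      refine (congrArg (F.pullG h₁) e.symm).trans ?_
      exact F.pullG_pullG_eq h₁ h₃ h h₂ (fun x => (hj _).symm) _ }

end

end NNSCorr

namespace NNSCorr

noncomputable section

variable {G : TopGroupoid.{u}} {F : CohTheory.{u, v} G}

/-! ## Constructions of `G`-maps and `G`-spaces -/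

/-- A `G`-map into an embedded space. -/
def GMap.ofEmb {R P A : GSpace G} {f : GMap P A} (hf : IsEmbedding f) (k : R → P) (a : GMap R A)
    (ha : ∀ r, f (k r) = a r) : GMap R P where
  toFun := k
  continuous := hf.isInducing.continuous_iff.2 (by
    have : f ∘ k = a := funext ha
    rw [this]
    exact a.continuous)
  anchor_map r := by rw [← f.anchor_map, ha, a.anchor_map]
  map_act g r e := hf.injective (by
    rw [f.map_act, ha, a.map_act]
    exact A.act_congr g (ha r).symm _)

/-- An invariant subset as a `G`-space. -/
def GSpace.sub (Z : GSpace G) (A : Set Z) (hi : Z.IsInvariant A) (hp : ParacompactSpace A) :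
    GSpace G where
  carrier := A
  para := hp
  anchor x := Z.anchor x.1
  continuous_anchor := Z.continuous_anchor.comp continuous_subtype_val
  act g x e := ⟨Z.act g x.1 e, hi g x.1 e x.2⟩
  anchor_act g x e := Z.anchor_act g x.1 e
  one_act x := Subtype.ext (Z.one_act x.1)
  mul_act g h x e₁ e₂ := Subtype.ext (Z.mul_act g h x.1 e₁ e₂)
  continuous_act := by
    refine Continuous.subtype_mk ?_ _
    exact Z.continuous_act.comp (f := fun p : {p : G.Arr × A // G.s p.1 = Z.anchor p.2.1} =>
      (⟨(p.1.1, p.1.2.1), p.2⟩ : {p : G.Arr × Z // G.s p.1 = Z.anchor p.2})) (by fun_prop)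

def GSpace.subIncl (Z : GSpace G) (A : Set Z) (hi : Z.IsInvariant A) (hp : ParacompactSpace A) :
    GMap (Z.sub A hi hp) Z where
  toFun x := x.1
  continuous := continuous_subtype_val
  anchor_map _ := rfl
  map_act _ _ _ := rfl

open Classical in
/-- A `G`-map glued from `G`-maps on two closed subsets. -/
def GMap.glue {R T : GSpace G} (A B : ClosedInv R) (hu : ∀ x, x ∈ A.carrier ∨ x ∈ B.carrier)
    (f : GMap A.toGSpace T) (g : GMap B.toGSpace T)
    (h : ∀ x (hA : x ∈ A.carrier) (hB : x ∈ B.carrier), f ⟨x, hA⟩ = g ⟨x, hB⟩) : GMap R T where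
  toFun x := if hA : x ∈ A.carrier then f ⟨x, hA⟩ else g ⟨x, (hu x).resolve_left hA⟩
  continuous := by
    set k : R → T := fun x => if hA : x ∈ A.carrier then f ⟨x, hA⟩
      else g ⟨x, (hu x).resolve_left hA⟩ with hk
    have hA : ContinuousOn k A.carrier := by
      rw [continuousOn_iff_continuous_domRestrict]
      have : A.carrier.domRestrict k = f := funext fun x => by simp [hk]
      rw [this]; exact f.continuous
    have hB : ContinuousOn k B.carrier := by
      rw [continuousOn_iff_continuous_domRestrict]
      have : B.carrier.domRestrict k = g := funext fun x => by
        by_cases hx : x.1 ∈ A.carrier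
        · simpa [hk, hx] using h x.1 hx x.2
        · simp [hk, hx]
      rw [this]; exact g.continuous
    have := hA.union_of_isClosed hB A.closed B.closed
    rwa [(eq_univ_of_forall hu : A.carrier ∪ B.carrier = univ), continuousOn_univ] at this
  anchor_map x := by
    split_ifs with hA
    · exact f.anchor_map ⟨x, hA⟩
    · exact g.anchor_map ⟨x, _⟩
  map_act a x e := by
    by_cases hA : x ∈ A.carrier
    · rw [dif_pos (A.inv a x e hA)]
      refine (f.map_act a ⟨x, hA⟩ e).trans (T.act_congr a ?_ _)
      rw [dif_pos hA]
    · have hB := (hu x).resolve_left hA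
      have e₁ : g ⟨R.act a x e, B.inv a x e hB⟩ = if hA : R.act a x e ∈ A.carrier
          then f ⟨R.act a x e, hA⟩ else g ⟨R.act a x e, (hu _).resolve_left hA⟩ := by
        split_ifs with hA'
        · exact (h _ hA' _).symm
        · rfl
      refine e₁.symm.trans ((g.map_act a ⟨x, hB⟩ e).trans (T.act_congr a ?_ _))
      rw [dif_neg hA]

theorem GMap.glue_left {R T : GSpace G} {A B : ClosedInv R}
    {hu : ∀ x, x ∈ A.carrier ∨ x ∈ B.carrier} {f : GMap A.toGSpace T} {g : GMap B.toGSpace T}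
    {h : ∀ x (hA : x ∈ A.carrier) (hB : x ∈ B.carrier), f ⟨x, hA⟩ = g ⟨x, hB⟩} (x : A.toGSpace) :
    GMap.glue A B hu f g h x.1 = f x := dif_pos x.2

theorem GMap.glue_right {R T : GSpace G} {A B : ClosedInv R}
    {hu : ∀ x, x ∈ A.carrier ∨ x ∈ B.carrier} {f : GMap A.toGSpace T} {g : GMap B.toGSpace T}
    {h : ∀ x (hA : x ∈ A.carrier) (hB : x ∈ B.carrier), f ⟨x, hA⟩ = g ⟨x, hB⟩} (x : B.toGSpace) :
    GMap.glue A B hu f g h x.1 = g x := by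
  by_cases hA : x.1 ∈ A.carrier
  · exact (dif_pos hA).trans (h x.1 hA x.2)
  · exact dif_neg hA

theorem paracompactSpace_fibProd (E : GVB (GSpace.base G)) (Y : GSpace G) :
    ParacompactSpace {x : E.tot × Y // GMap.anchor E.tot x.1 = GMap.anchor Y x.2} := by
  have := E.paracompactSpace_fib (GMap.anchor Y)
  let φ : {x : E.tot × Y // GMap.anchor E.tot x.1 = GMap.anchor Y x.2} ≃ₜ
      {x : Y × E.tot // GMap.anchor Y x.1 = E.proj x.2} :=
    { toFun x := ⟨(x.1.2, x.1.1), x.2.symm.trans (E.proj.eq_anchor _).symm⟩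
      invFun x := ⟨(x.1.2, x.1.1), ((x.2.trans (E.proj.eq_anchor _)).symm)⟩
      left_inv _ := rfl
      right_inv _ := rfl
      continuous_toFun := Continuous.subtype_mk (by fun_prop) _
      continuous_invFun := Continuous.subtype_mk (by fun_prop) _ }
  exact φ.isClosedEmbedding.paracompactSpace

/-- The `G`-space `|E^Y|`. -/
def fibGSpace (E : GVB (GSpace.base G)) (Y : GSpace G) : GSpace G :=
  GSpace.fib (GMap.anchor E.tot) (GMap.anchor Y) (paracompactSpace_fibProd E Y)

/-- The `G`-space `|E^Y| × [0,1]`. -/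
def cyl (E : GVB (GSpace.base G)) (Y : GSpace G) : GSpace G := (fibGSpace E Y).prodI

def cylE (E : GVB (GSpace.base G)) (Y : GSpace G) : GMap (cyl E Y) E.tot :=
  (GSpace.fibFst _ _ (paracompactSpace_fibProd E Y)).comp (fibGSpace E Y).prodIFst

def cylY (E : GVB (GSpace.base G)) (Y : GSpace G) : GMap (cyl E Y) Y :=
  (GSpace.fibSnd _ _ (paracompactSpace_fibProd E Y)).comp (fibGSpace E Y).prodIFst

variable {X Y : GSpace G}

/-- The open embedding of a special bordism as a `G`-map. -/
def SB.j {E : OVB F (GSpace.base G)} (B : SB E X Y) : GMap B.W (cyl E.toGVB Y) where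
  toFun w := (toFibProd (E := E.toGVB) B.e B.y w, B.t w)
  continuous := B.emb.continuous
  anchor_map w := B.e.anchor_map w
  map_act g w h := Prod.ext (Subtype.ext (Prod.ext (B.e.map_act g w h) (B.y.map_act g w h)))
    (B.t_act g w h)

theorem SB.isOpenEmbedding_j {E : OVB F (GSpace.base G)} (B : SB E X Y) : IsOpenEmbedding B.j :=
  B.emb

/-- Reparametrisation of the cylinder. -/
def GSpace.prodIMap (P : GSpace G) (r : unitInterval → unitInterval) (hr : Continuous r) :
    GMap P.prodI P.prodI where
  toFun p := (p.1, r p.2)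
  continuous := continuous_fst.prodMk (hr.comp continuous_snd)
  anchor_map _ := rfl
  map_act _ _ _ := rfl

/-! ## Transformations of the unit interval -/

/-- The function `t ↦ c t + d`, cut off to `[0,1]`. -/
def ramp (c d : ℝ) (t : unitInterval) : unitInterval := projIcc 0 1 zero_le_one (c * t + d)

theorem continuous_ramp (c d : ℝ) : Continuous (ramp c d) :=
  continuous_projIcc.comp (by fun_prop)

theorem ramp_eq_one {c d : ℝ} {t : unitInterval} (h : 1 ≤ c * t + d) : ramp c d t = 1 :=
  projIcc_of_right_le _ h

theorem ramp_eq_zero {c d : ℝ} {t : unitInterval} (h : c * t + d ≤ 0) : ramp c d t = 0 :=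
  projIcc_of_le_left _ h

/-- A deformation of the interval that pushes everything above `3/8`. -/
def squeeze (s t : unitInterval) : unitInterval :=
  projIcc 0 1 zero_le_one (t + s * (max (t : ℝ) (3 / 8) - t))

theorem continuous_squeeze : Continuous fun p : unitInterval × unitInterval => squeeze p.2 p.1 :=
  continuous_projIcc.comp (by fun_prop)

/-- The expression is a convex combination of points of `[0,1]`, so the clamping in the definition
has no effect. -/
theorem squeeze_val (s t : unitInterval) :
    (squeeze s t : ℝ) = t + s * (max (t : ℝ) (3 / 8) - t) := by
  have h : (t : ℝ) + s * (max (t : ℝ) (3 / 8) - t) ∈ Icc (0 : ℝ) 1 := by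
    have h₁ := s.2.1; have h₂ := s.2.2; have h₃ := t.2.1; have h₄ := t.2.2
    have h₅ : (t : ℝ) ≤ max (t : ℝ) (3 / 8) := le_max_left _ _
    have h₆ : max (t : ℝ) (3 / 8) ≤ 1 := max_le h₄ (by norm_num)
    constructor <;> nlinarith
  rw [squeeze, projIcc_of_mem _ h]

theorem squeeze_of_le {s t : unitInterval} (h : 3 / 8 ≤ (t : ℝ)) : squeeze s t = t :=
  Subtype.ext (by rw [squeeze_val, max_eq_left h]; ring)

theorem squeeze_bounds {s t : unitInterval} (h : (t : ℝ) ≤ 3 / 8) :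
    (t : ℝ) ≤ squeeze s t ∧ (squeeze s t : ℝ) ≤ 3 / 8 := by
  rw [squeeze_val, max_eq_right h]
  have h₁ := s.2.1; have h₂ := s.2.2
  constructor <;> nlinarith

theorem squeeze_zero (t : unitInterval) : squeeze 0 t = t :=
  Subtype.ext (by rw [squeeze_val]; simp)

theorem squeeze_one (t : unitInterval) : 3 / 8 ≤ (squeeze 1 t : ℝ) := by
  rw [squeeze_val]; simp

/-! ## Gluing of special bordisms -/

/-- A piece of a glued space is recovered from a point `w` of the given bordism and a height `t`: it
becomes the closed set of all `(w, t)` with `t ∈ C` and `w` at height `r t`. Paracompactness and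
properness of the projection to `L` both follow. -/
theorem isClosedEmbedding_piece {L Q T : Type*} [TopologicalSpace L] [TopologicalSpace Q]
    [TopologicalSpace T] {j : L → Q × unitInterval} (hj : IsEmbedding j)
    {r : unitInterval → unitInterval} (hr : Continuous r) {z : T → Q × unitInterval}
    (hz : IsEmbedding z) {κ : T → L} (hκ : ∀ x, j (κ x) = ((z x).1, r (z x).2))
    {C : Set unitInterval} (hC : IsClosed C) (hCz : ∀ x, (z x).2 ∈ C)
    (hs : ∀ w t, t ∈ C → (j w).2 = r t → ∃ x, z x = ((j w).1, t)) :
    IsClosedEmbedding fun x => (κ x, (z x).2) := by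
  have hzc := hz.continuous
  have hκc : Continuous κ := hj.isInducing.continuous_iff.2 (by
    have : j ∘ κ = fun x => ((z x).1, r (z x).2) := funext hκ
    rw [this]
    fun_prop)
  have hjc := hj.continuous
  refine ⟨?_, ?_⟩
  · refine IsEmbedding.of_comp (g := fun p : L × unitInterval => ((j p.1).1, p.2))
      (hκc.prodMk (continuous_snd.comp hzc)) (by fun_prop) ?_
    have : ((fun p : L × unitInterval => ((j p.1).1, p.2)) ∘ fun x => (κ x, (z x).2)) = z :=
      funext fun x => Prod.ext (by simp [hκ]) rfl
    rw [this]
    exact hz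
  · have : range (fun x => (κ x, (z x).2)) = {p | p.2 ∈ C ∧ (j p.1).2 = r p.2} := by
      ext ⟨w, t⟩
      constructor
      · rintro ⟨x, hx⟩
        obtain ⟨rfl, rfl⟩ := Prod.ext_iff.1 hx
        exact ⟨hCz x, by simp [hκ]⟩
      · rintro ⟨h₁, h₂⟩
        obtain ⟨x, hx⟩ := hs w t h₁ h₂
        refine ⟨x, Prod.ext (hj.injective ?_) (Prod.ext_iff.1 hx).2⟩
        change j (κ x) = j w
        rw [hκ, hx]
        exact Prod.ext rfl h₂.symm
    rw [this]
    exact (hC.preimage continuous_snd).inter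
      (isClosed_eq (by fun_prop) (hr.comp continuous_snd))

theorem CohTheory.exists_trans_eq {M X : GSpace G} {b : GMap M X} (A B : RelCpt b)
    (x : F.coh M A.compl) (y : F.coh M B.compl) (h : F.of A x = F.of B y) :
    ∃ (C : RelCpt b) (hA : A ≤ C) (hB : B ≤ C), F.trans A C hA x = F.trans B C hB y := by
  have h' : F.of (A.sup B) (F.trans A _ (RelCpt.le_sup_left A B) x -
      F.trans B _ (RelCpt.le_sup_right A B) y) = 0 := by
    rw [map_sub, F.of_trans, F.of_trans, h, sub_self]
  obtain ⟨C, hC, e⟩ := F.of_eq_zero _ _ h'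
  refine ⟨C, (RelCpt.le_sup_left A B).trans hC, (RelCpt.le_sup_right A B).trans hC, ?_⟩
  rw [map_sub, sub_eq_zero] at e
  exact (F.map_eq_map_map (hf := RelCpt.compl_mono hC) x (fun _ => rfl)).trans
    (e.trans (F.map_eq_map_map (hf := RelCpt.compl_mono hC) y (fun _ => rfl)).symm)

/-! ### Joining two special bordisms: the space -/

variable (F X Y) in
/-- Two special bordisms with a common end. -/
structure GlueData where
  E : OVB F (GSpace.base G)
  B₁ : SB E X Y
  B₂ : SB E X Y
  S : SC F X Y
  ε₁ : B₁.End 1 S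
  ε₂ : B₂.End 0 S
  sqE_eq : ∀ v, ε₁.sqE.top v = ε₂.sqE.top v

namespace GlueData

variable (D : GlueData F X Y)

/-- The cylinder in which the gluing takes place. -/
abbrev Z : GSpace G := cyl D.E.toGVB Y

/-- The first bordism is compressed into heights `[0, 1/4]` and the second into `[3/4, 1]`. In
between both functions are constant, `1` and `0` respectively, which inserts a cylinder over the
common end. -/
def r₁ : unitInterval → unitInterval := ramp 4 0
def r₂ : unitInterval → unitInterval := ramp 4 (-3)

theorem continuous_r₁ : Continuous r₁ := continuous_ramp _ _
theorem continuous_r₂ : Continuous r₂ := continuous_ramp _ _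

theorem r₁_eq_one {t : unitInterval} (h : 1 / 4 ≤ (t : ℝ)) : r₁ t = 1 := ramp_eq_one (by linarith)
theorem r₂_eq_zero {t : unitInterval} (h : (t : ℝ) ≤ 3 / 4) : r₂ t = 0 := ramp_eq_zero (by linarith)
theorem r₁_zero : r₁ 0 = 0 := ramp_eq_zero (by simp)
theorem r₂_one : r₂ 1 = 1 := ramp_eq_one (by norm_num)

def ρ₁ : GMap D.Z D.Z := (fibGSpace D.E.toGVB Y).prodIMap r₁ continuous_r₁
def ρ₂ : GMap D.Z D.Z := (fibGSpace D.E.toGVB Y).prodIMap r₂ continuous_r₂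

/-- The position of the common end. -/
def mid : GMap D.S.P D.Z := D.B₁.j.comp D.ε₁.i

theorem t_ε₁ (s : D.S.P) : D.B₁.t (D.ε₁.i s) = 1 := by
  have : D.ε₁.i s ∈ D.B₁.t ⁻¹' {1} := by rw [← D.ε₁.range_eq]; exact ⟨s, rfl⟩
  exact this

theorem t_ε₂ (s : D.S.P) : D.B₂.t (D.ε₂.i s) = 0 := by
  have : D.ε₂.i s ∈ D.B₂.t ⁻¹' {0} := by rw [← D.ε₂.range_eq]; exact ⟨s, rfl⟩
  exact this

theorem mid_snd (s : D.S.P) : (D.mid s).2 = 1 := D.t_ε₁ s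

/-- The common end sits at height `1` in the first bordism and at height `0` in the second, over the
same points of `|E^Y|`. Agreement of the two squares `sqE` is used here. -/
theorem j_ε₂ (s : D.S.P) : D.B₂.j (D.ε₂.i s) = ((D.mid s).1, 0) :=
  Prod.ext (Subtype.ext (Prod.ext (by
      change D.B₂.e (D.ε₂.i s) = D.B₁.e (D.ε₁.i s)
      rw [← D.ε₁.e_eq, ← D.ε₂.e_eq, D.sqE_eq]) (by
      change D.B₂.y (D.ε₂.i s) = D.B₁.y (D.ε₁.i s)
      rw [← D.ε₁.y_eq, ← D.ε₂.y_eq]))) (D.t_ε₂ s)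

theorem ρ₁_eq {z : D.Z} (h : 1 / 4 ≤ (z.2 : ℝ)) : D.ρ₁ z = (z.1, 1) :=
  Prod.ext rfl (r₁_eq_one h)

theorem ρ₂_eq {z : D.Z} (h : (z.2 : ℝ) ≤ 3 / 4) : D.ρ₂ z = (z.1, 0) :=
  Prod.ext rfl (r₂_eq_zero h)

theorem isEmbedding_mid : IsEmbedding D.mid :=
  D.B₁.isOpenEmbedding_j.isEmbedding.comp D.ε₁.closedEmb.isEmbedding

/-- From height `1/4` on, `ρ₁` lands at height `1`, where the first bordism consists of the common
end only. -/
theorem exists_mid₁ {z : D.Z} (h : 1 / 4 ≤ (z.2 : ℝ)) {w : D.B₁.W} (hw : D.B₁.j w = D.ρ₁ z) :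
    ∃ s, D.ε₁.i s = w ∧ (D.mid s).1 = z.1 := by
  rw [D.ρ₁_eq h] at hw
  have : w ∈ range D.ε₁.i := by rw [D.ε₁.range_eq]; exact congrArg Prod.snd hw
  obtain ⟨s, rfl⟩ := this
  exact ⟨s, rfl, (Prod.ext_iff.1 hw).1⟩

theorem exists_mid₂ {z : D.Z} (h : (z.2 : ℝ) ≤ 3 / 4) {w : D.B₂.W} (hw : D.B₂.j w = D.ρ₂ z) :
    ∃ s, D.ε₂.i s = w ∧ (D.mid s).1 = z.1 := by
  rw [D.ρ₂_eq h] at hw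
  have : w ∈ range D.ε₂.i := by rw [D.ε₂.range_eq]; exact congrArg Prod.snd hw
  obtain ⟨s, rfl⟩ := this
  refine ⟨s, rfl, ?_⟩
  rw [D.j_ε₂] at hw
  exact (Prod.ext_iff.1 hw).1

theorem ρ₁_mid {z : D.Z} (h : 1 / 4 ≤ (z.2 : ℝ)) {s : D.S.P} (hs : (D.mid s).1 = z.1) :
    D.B₁.j (D.ε₁.i s) = D.ρ₁ z := by
  rw [D.ρ₁_eq h]
  exact Prod.ext hs (D.mid_snd s)

theorem ρ₂_mid {z : D.Z} (h : (z.2 : ℝ) ≤ 3 / 4) {s : D.S.P} (hs : (D.mid s).1 = z.1) :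
    D.B₂.j (D.ε₂.i s) = D.ρ₂ z := by
  rw [D.ρ₂_eq h, D.j_ε₂, hs]

/-- The glued space. -/
def O : Set D.Z := {z | ((z.2 : ℝ) < 3 / 4 ∧ ∃ w, D.B₁.j w = D.ρ₁ z) ∨
  (1 / 4 < (z.2 : ℝ) ∧ ∃ w, D.B₂.j w = D.ρ₂ z)}

theorem continuous_height : Continuous fun z : D.Z => (z.2 : ℝ) :=
  continuous_subtype_val.comp continuous_snd

/-- No collars are needed: the images of both bordisms are open in the whole cylinder, ends
included, and preimages under `ρ₁` and `ρ₂` stay open. -/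
theorem isOpen_O : IsOpen D.O := by
  refine IsOpen.union (IsOpen.inter ?_ ?_) (IsOpen.inter ?_ ?_)
  · exact isOpen_Iio.preimage D.continuous_height
  · exact D.B₁.isOpenEmbedding_j.isOpen_range.preimage D.ρ₁.continuous
  · exact isOpen_Ioi.preimage D.continuous_height
  · exact D.B₂.isOpenEmbedding_j.isOpen_range.preimage D.ρ₂.continuous

theorem exists_act {W R : GSpace G} {j : GMap W R} {ρ : GMap D.Z R} {N : Set W}
    (hN : W.IsInvariant N) (g : G.Arr) (z : D.Z) (e : G.s g = D.Z.anchor z)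
    (h : ∃ w ∈ N, j w = ρ z) : ∃ w ∈ N, j w = ρ (D.Z.act g z e) := by
  obtain ⟨w, hwN, hw⟩ := h
  have ew : G.s g = W.anchor w := by rw [← j.anchor_map, hw, ρ.anchor_map]; exact e
  refine ⟨W.act g w ew, hN g w ew hwN, ?_⟩
  rw [j.map_act, ρ.map_act]
  exact R.act_congr g hw _

theorem isInvariant_O : D.Z.IsInvariant D.O := by
  intro g z e h
  refine h.imp (fun h => ⟨h.1, ?_⟩) (fun h => ⟨h.1, ?_⟩)
  · obtain ⟨w, hw⟩ := h.2
    obtain ⟨w', -, hw'⟩ := D.exists_act (N := univ) (fun _ _ _ _ => mem_univ _) g z e ⟨w, mem_univ _, hw⟩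
    exact ⟨w', hw'⟩
  · obtain ⟨w, hw⟩ := h.2
    obtain ⟨w', -, hw'⟩ := D.exists_act (N := univ) (fun _ _ _ _ => mem_univ _) g z e ⟨w, mem_univ _, hw⟩
    exact ⟨w', hw'⟩

/-- Between heights `1/4` and `3/4` both conditions in the definition of `O` say that the point lies
over the common end, so either one implies the other. -/
theorem exists_left {z : D.Z} (hz : z ∈ D.O) (h : (z.2 : ℝ) ≤ 3 / 4) : ∃ w, D.B₁.j w = D.ρ₁ z := by
  obtain ⟨_, h⟩ | ⟨h', w, hw⟩ := hz
  · exact h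
  · obtain ⟨s, -, hs⟩ := D.exists_mid₂ h hw
    exact ⟨_, D.ρ₁_mid h'.le hs⟩

theorem exists_right {z : D.Z} (hz : z ∈ D.O) (h : 1 / 4 ≤ (z.2 : ℝ)) :
    ∃ w, D.B₂.j w = D.ρ₂ z := by
  obtain ⟨h', w, hw⟩ | ⟨_, h⟩ := hz
  · obtain ⟨s, -, hs⟩ := D.exists_mid₁ h hw
    exact ⟨_, D.ρ₂_mid h'.le hs⟩
  · exact h

theorem mem_O_of_left {z : D.Z} (h : (z.2 : ℝ) ≤ 3 / 4) {w : D.B₁.W} (hw : D.B₁.j w = D.ρ₁ z) :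
    z ∈ D.O := by
  rcases lt_or_ge (z.2 : ℝ) (3 / 4) with h' | h'
  · exact Or.inl ⟨h', w, hw⟩
  · obtain ⟨s, -, hs⟩ := D.exists_mid₁ (by linarith) hw
    exact Or.inr ⟨by linarith, _, D.ρ₂_mid h hs⟩

theorem mem_O_of_right {z : D.Z} (h : 1 / 4 ≤ (z.2 : ℝ)) {w : D.B₂.W} (hw : D.B₂.j w = D.ρ₂ z) :
    z ∈ D.O := by
  rcases lt_or_ge (1 / 4) (z.2 : ℝ) with h' | h'
  · exact Or.inr ⟨h', w, hw⟩
  · obtain ⟨s, -, hs⟩ := D.exists_mid₂ (by linarith) hw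
    exact Or.inl ⟨by linarith, _, D.ρ₁_mid h hs⟩

theorem exists_mid {z : D.Z} (hz : z ∈ D.O) (h : 1 / 4 ≤ (z.2 : ℝ)) (h' : (z.2 : ℝ) ≤ 3 / 4) :
    ∃ s, (D.mid s).1 = z.1 := by
  obtain ⟨w, hw⟩ := D.exists_left hz h'
  obtain ⟨s, -, hs⟩ := D.exists_mid₁ h hw
  exact ⟨s, hs⟩

theorem mem_O_of_mid {z : D.Z} (h : 1 / 4 ≤ (z.2 : ℝ)) (h' : (z.2 : ℝ) ≤ 3 / 4) {s : D.S.P}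
    (hs : (D.mid s).1 = z.1) : z ∈ D.O := D.mem_O_of_left h' (D.ρ₁_mid h hs)

/-- The closed intervals over which the pieces live. -/
def lowI : Set unitInterval := {t | (t : ℝ) ≤ 3 / 4}
def highI : Set unitInterval := {t | 1 / 4 ≤ (t : ℝ)}

theorem isClosed_lowI : IsClosed lowI := isClosed_le continuous_subtype_val continuous_const
theorem isClosed_highI : IsClosed highI := isClosed_le continuous_const continuous_subtype_val

theorem isClosedEmbedding_left {T : Type*} [TopologicalSpace T] {z : T → D.Z}
    (hz : IsEmbedding z) {κ : T → D.B₁.W} (hκ : ∀ x, D.B₁.j (κ x) = D.ρ₁ (z x))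
    (hC : ∀ x, ((z x).2 : ℝ) ≤ 3 / 4)
    (hs : ∀ z' ∈ D.O, (z'.2 : ℝ) ≤ 3 / 4 → ∃ x, z x = z') :
    IsClosedEmbedding fun x => (κ x, (z x).2) :=
  isClosedEmbedding_piece D.B₁.isOpenEmbedding_j.isEmbedding continuous_r₁ hz hκ
    isClosed_lowI hC fun w t ht hw =>
      have h : D.B₁.j w = D.ρ₁ ((D.B₁.j w).1, t) := Prod.ext rfl hw
      hs _ (D.mem_O_of_left ht h) ht

theorem isClosedEmbedding_right {T : Type*} [TopologicalSpace T] {z : T → D.Z}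
    (hz : IsEmbedding z) {κ : T → D.B₂.W} (hκ : ∀ x, D.B₂.j (κ x) = D.ρ₂ (z x))
    (hC : ∀ x, 1 / 4 ≤ ((z x).2 : ℝ))
    (hs : ∀ z' ∈ D.O, 1 / 4 ≤ (z'.2 : ℝ) → ∃ x, z x = z') :
    IsClosedEmbedding fun x => (κ x, (z x).2) :=
  isClosedEmbedding_piece D.B₂.isOpenEmbedding_j.isEmbedding continuous_r₂ hz hκ
    isClosed_highI hC fun w t ht hw =>
      have h : D.B₂.j w = D.ρ₂ ((D.B₂.j w).1, t) := Prod.ext rfl hw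
      hs _ (D.mem_O_of_right ht h) ht

theorem isClosedEmbedding_mid {T : Type*} [TopologicalSpace T] {z : T → D.Z}
    (hz : IsEmbedding z) {κ : T → D.S.P} (hκ : ∀ x, (D.mid (κ x)).1 = (z x).1)
    (hC : ∀ x, 1 / 4 ≤ ((z x).2 : ℝ) ∧ ((z x).2 : ℝ) ≤ 3 / 4)
    (hs : ∀ z' ∈ D.O, 1 / 4 ≤ (z'.2 : ℝ) → (z'.2 : ℝ) ≤ 3 / 4 → ∃ x, z x = z') :
    IsClosedEmbedding fun x => (κ x, (z x).2) :=
  isClosedEmbedding_piece (r := fun _ => 1) D.isEmbedding_mid continuous_const hz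
    (fun x => Prod.ext (hκ x) (D.mid_snd _)) (isClosed_highI.inter isClosed_lowI) hC
    fun w t ht _ => hs _ (D.mem_O_of_mid (z := ((D.mid w).1, t)) ht.1 ht.2 rfl) ht.1 ht.2

/-- The parts below `3/4` and above `1/4` are closed subsets of `B₁.W × [0,1]` and `B₂.W × [0,1]`,
and they cover. -/
theorem paracompactSpace_O : ParacompactSpace D.O := by
  let A : Set D.O := {z | (z.1.2 : ℝ) ≤ 3 / 4}
  let B : Set D.O := {z | 1 / 4 ≤ (z.1.2 : ℝ)}
  have hc : Continuous fun z : D.O => (z.1.2 : ℝ) := D.continuous_height.comp continuous_subtype_val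
  have : ParacompactSpace A := by
    have h : ∀ z : A, ∃ w, D.B₁.j w = D.ρ₁ z.1.1 := fun z => D.exists_left z.1.2 z.2
    exact (D.isClosedEmbedding_left (z := fun z : A => z.1.1)
      (IsEmbedding.subtypeVal.comp IsEmbedding.subtypeVal)
      (κ := fun z => (h z).choose) (fun z => (h z).choose_spec) (fun z => z.2)
      (fun z hz h => ⟨⟨⟨z, hz⟩, h⟩, rfl⟩)).paracompactSpace
  have : ParacompactSpace B := by
    have h : ∀ z : B, ∃ w, D.B₂.j w = D.ρ₂ z.1.1 := fun z => D.exists_right z.1.2 z.2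
    exact (D.isClosedEmbedding_right (z := fun z : B => z.1.1)
      (IsEmbedding.subtypeVal.comp IsEmbedding.subtypeVal)
      (κ := fun z => (h z).choose) (fun z => (h z).choose_spec) (fun z => z.2)
      (fun z hz h => ⟨⟨⟨z, hz⟩, h⟩, rfl⟩)).paracompactSpace
  refine paracompactSpace_of_union (A := A) (B := B) (isClosed_le hc continuous_const)
    (isClosed_le continuous_const hc) (eq_univ_of_forall fun z => ?_)
  rcases le_total (z.1.2 : ℝ) (1 / 2) with h | h
  · exact Or.inl (h.trans (by norm_num))
  · exact Or.inr (le_trans (by norm_num) h)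

end GlueData

end

end NNSCorr

namespace NNSCorr

noncomputable section

variable {G : TopGroupoid.{u}} {F : CohTheory.{u, v} G} {X Y : GSpace G}

/-! ### Joining two special bordisms: map, class and ends -/

/-- An open invariant subset of a closed subset is relatively compact if it is contained in a set
that is relatively compact in the closed subset. -/
def RelCpt.ofPiece {M : GSpace G} {b : GMap M X} (C : ClosedInv M) (A : RelCpt (b.comp C.incl))
    (U : Set M) (ho : IsOpen U) (hi : M.IsInvariant U)
    (h : ∀ x ∈ U, ∃ hC : x ∈ C.carrier, (⟨x, hC⟩ : C.toGSpace) ∈ A.carrier) : RelCpt b :=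
  .ofSubset U ho hi (Subtype.val '' closure A.carrier)
    (C.closed.isClosedEmbedding_subtypeVal.isClosedMap _ (isClosed_closure (X := C.toGSpace)))
    (fun x hx => ⟨⟨x, (h x hx).1⟩, subset_closure (h x hx).2, rfl⟩) (by
      have hk : ∀ x : (Subtype.val '' closure A.carrier : Set M), ∃ hC : x.1 ∈ C.carrier,
          (⟨x.1, hC⟩ : C.toGSpace) ∈ closure A.carrier := by
        rintro ⟨x, ⟨y, hy, rfl⟩⟩
        exact ⟨y.2, hy⟩
      let k : (Subtype.val '' closure A.carrier : Set M) ≃ₜ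
          {x : C.toGSpace // x ∈ closure A.carrier} :=
        { toFun x := ⟨⟨x.1, (hk x).1⟩, (hk x).2⟩
          invFun x := ⟨x.1.1, x.1, x.2, rfl⟩
          left_inv _ := rfl
          right_inv _ := rfl
          continuous_toFun := Continuous.subtype_mk (X := C.toGSpace)
            (Continuous.subtype_mk continuous_subtype_val _) _
          continuous_invFun := Continuous.subtype_mk
            (C.incl.continuous.comp continuous_subtype_val) _ }
      exact A.proper.comp k.isProperMap)

/-- A class that is pulled back from `W` on a closed subset. -/
theorem CohTheory.pullG_piece {M W T : GSpace G} {b : GMap M X} {c : GMap W X} {d : GMap T X}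
    (C : ClosedInv M) (κ : GMap C.toGSpace W) (N : RelCpt c) (a : F.coh W N.compl) (P : RelCpt b)
    (ξ : F.coh M P.compl) (hκ : MapsTo κ (P.compl.preimage C.incl).carrier N.compl.carrier)
    (hξ : F.res C P.compl ξ = F.map κ hκ a) (i : GMap T C.toGSpace) (ε : GMap T W)
    (hε : ∀ x, κ (i x) = ε x) (h : Pullable d b (C.incl.comp i)) (h' : Pullable d c ε) :
    F.pullG h (F.of P ξ) = F.pullG h' (F.of N a) := by
  have hs : MapsTo (GMap.id T) (P.pre h).compl.carrier (N.pre h').compl.carrier := fun x hx => by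
    have := hκ (show i x ∈ (P.compl.preimage C.incl).carrier from hx)
    rwa [hε] at this
  rw [F.pullG_of, F.pullG_of, ← F.of_map_id _ (P.pre h) hs]
  have hi : MapsTo i (P.pre h).compl.carrier (P.compl.preimage C.incl).carrier := fun _ hx => hx
  refine congrArg _ (Eq.trans (b := F.map i hi (F.res C P.compl ξ)) ?_ ?_)
  · exact F.map_eq_map_map _ fun _ => rfl
  · rw [hξ]
    exact F.map_map_eq _ hε

namespace GlueData

variable (D : GlueData F X Y)

/-- The glued space as a `G`-space. -/
def OG : GSpace G := D.Z.sub D.O D.isInvariant_O D.paracompactSpace_O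

def ι : GMap D.OG D.Z := D.Z.subIncl D.O D.isInvariant_O D.paracompactSpace_O

def ht (z : D.OG) : ℝ := (D.ι z).2

theorem continuous_ht : Continuous D.ht := D.continuous_height.comp D.ι.continuous

/-- The part of the glued space over heights in a closed set. -/
def part (C : Set ℝ) (hC : IsClosed C) : ClosedInv D.OG :=
  ⟨D.ht ⁻¹' C, hC.preimage D.continuous_ht, fun _ _ _ h => h⟩

abbrev L : ClosedInv D.OG := D.part (Iic (3 / 4)) isClosed_Iic
abbrev R : ClosedInv D.OG := D.part (Ici (1 / 4)) isClosed_Ici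
abbrev C : ClosedInv D.OG := D.part (Icc (1 / 4) (3 / 4)) isClosed_Icc

/-- The lift of `ρ₁` through the embedding `B₁.j`. Continuity and equivariance of the chosen points
are inherited from `ρ₁`. -/
def κ₁ : GMap D.L.toGSpace D.B₁.W :=
  .ofEmb D.B₁.isOpenEmbedding_j.isEmbedding (fun z => (D.exists_left z.1.2 z.2).choose)
    (D.ρ₁.comp (D.ι.comp D.L.incl)) fun z => (D.exists_left z.1.2 z.2).choose_spec

theorem j_κ₁ (z : D.L.toGSpace) : D.B₁.j (D.κ₁ z) = D.ρ₁ (D.ι z.1) :=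
  (D.exists_left z.1.2 z.2).choose_spec

def κ₂ : GMap D.R.toGSpace D.B₂.W :=
  .ofEmb D.B₂.isOpenEmbedding_j.isEmbedding (fun z => (D.exists_right z.1.2 z.2).choose)
    (D.ρ₂.comp (D.ι.comp D.R.incl)) fun z => (D.exists_right z.1.2 z.2).choose_spec

theorem j_κ₂ (z : D.R.toGSpace) : D.B₂.j (D.κ₂ z) = D.ρ₂ (D.ι z.1) :=
  (D.exists_right z.1.2 z.2).choose_spec

theorem mid_choose (z : D.C.toGSpace) :
    D.mid (D.exists_mid z.1.2 z.2.1 z.2.2).choose = D.ρ₁ (D.ι z.1) :=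
  D.ρ₁_mid z.2.1 (D.exists_mid z.1.2 z.2.1 z.2.2).choose_spec

def κ : GMap D.C.toGSpace D.S.P :=
  .ofEmb D.isEmbedding_mid (fun z => (D.exists_mid z.1.2 z.2.1 z.2.2).choose)
    (D.ρ₁.comp (D.ι.comp D.C.incl)) D.mid_choose

theorem mid_κ (z : D.C.toGSpace) : (D.mid (D.κ z)).1 = (D.ι z.1).1 :=
  (D.exists_mid z.1.2 z.2.1 z.2.2).choose_spec

theorem κ₁_eq (z : D.OG) (hC : z ∈ D.C.carrier) (hL : z ∈ D.L.carrier) :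
    D.κ₁ ⟨z, hL⟩ = D.ε₁.i (D.κ ⟨z, hC⟩) :=
  D.B₁.isOpenEmbedding_j.injective ((D.j_κ₁ _).trans (D.ρ₁_mid hC.1 (D.mid_κ ⟨z, hC⟩)).symm)

theorem κ₂_eq (z : D.OG) (hC : z ∈ D.C.carrier) (hR : z ∈ D.R.carrier) :
    D.κ₂ ⟨z, hR⟩ = D.ε₂.i (D.κ ⟨z, hC⟩) :=
  D.B₂.isOpenEmbedding_j.injective ((D.j_κ₂ _).trans (D.ρ₂_mid hC.2 (D.mid_κ ⟨z, hC⟩)).symm)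

theorem isEmbedding_part (P : ClosedInv D.OG) : IsEmbedding fun z : P.toGSpace => D.ι z.1 :=
  (IsEmbedding.subtypeVal (p := (· ∈ D.O))).comp (IsEmbedding.subtypeVal (X := D.OG) (p := (· ∈ P.carrier)))

/-- A closed embedding into `B₁.W × [0,1]` followed by the projection along a compact factor.
Properness is what permits pulling back classes and supports along `κ₁`. -/
theorem isProperMap_κ₁ : IsProperMap D.κ₁ :=
  (isProperMap_fst_of_compactSpace (Y := unitInterval)).comp (D.isClosedEmbedding_left
    (D.isEmbedding_part D.L) D.j_κ₁ (fun z => z.2)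
    fun z hz h => ⟨⟨⟨z, hz⟩, h⟩, rfl⟩).isProperMap

theorem isProperMap_κ₂ : IsProperMap D.κ₂ :=
  (isProperMap_fst_of_compactSpace (Y := unitInterval)).comp (D.isClosedEmbedding_right
    (D.isEmbedding_part D.R) D.j_κ₂ (fun z => z.2)
    fun z hz h => ⟨⟨⟨z, hz⟩, h⟩, rfl⟩).isProperMap

theorem isProperMap_κ : IsProperMap D.κ :=
  (isProperMap_fst_of_compactSpace (Y := unitInterval)).comp (D.isClosedEmbedding_mid
    (D.isEmbedding_part D.C) D.mid_κ (fun z => z.2)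
    fun z hz h h' => ⟨⟨⟨z, hz⟩, h, h'⟩, rfl⟩).isProperMap

def b : GMap D.OG X :=
  .glue D.L D.R (fun z => (le_total (D.ht z) (1 / 2)).imp (fun h => h.trans (by norm_num))
    fun h => le_trans (by norm_num) h) (D.B₁.b.comp D.κ₁) (D.B₂.b.comp D.κ₂) fun z hL hR =>
      (congrArg D.B₁.b (D.κ₁_eq z ⟨hR, hL⟩ hL)).trans ((D.ε₁.b_eq _).symm.trans
        ((D.ε₂.b_eq _).trans (congrArg D.B₂.b (D.κ₂_eq z ⟨hR, hL⟩ hR)).symm))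

theorem b_left (z : D.L.toGSpace) : D.b z.1 = D.B₁.b (D.κ₁ z) := GMap.glue_left z
theorem b_right (z : D.R.toGSpace) : D.b z.1 = D.B₂.b (D.κ₂ z) := GMap.glue_right z
theorem b_mid (z : D.C.toGSpace) : D.b z.1 = D.S.b (D.κ z) :=
  (D.b_left ⟨z.1, z.2.2⟩).trans ((congrArg D.B₁.b (D.κ₁_eq _ z.2 _)).trans (D.ε₁.b_eq _).symm)

theorem pullable_κ₁ : Pullable (D.b.comp D.L.incl) D.B₁.b D.κ₁ :=
  pullable_of_isProperMap D.isProperMap_κ₁ (j := GMap.id X) fun z => (D.b_left z).symm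
theorem pullable_κ₂ : Pullable (D.b.comp D.R.incl) D.B₂.b D.κ₂ :=
  pullable_of_isProperMap D.isProperMap_κ₂ (j := GMap.id X) fun z => (D.b_right z).symm
theorem pullable_κ : Pullable (D.b.comp D.C.incl) D.S.b D.κ :=
  pullable_of_isProperMap D.isProperMap_κ (j := GMap.id X) fun z => (D.b_mid z).symm

/-- Preimages under `κ₁` are open only in the lower part; cutting at heights strictly below `3/4`
yields an open subset of the glued space. -/
def supp₁ (N : RelCpt D.B₁.b) : RelCpt D.b :=
  .ofPiece D.L (N.pre D.pullable_κ₁)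
    (D.ht ⁻¹' Iio (3 / 4) ∩ {z | ∃ w ∈ N.carrier, D.B₁.j w = D.ρ₁ (D.ι z)})
    ((isOpen_Iio.preimage D.continuous_ht).inter
      ((D.B₁.isOpenEmbedding_j.isOpenMap _ N.isOpen).preimage
        (D.ρ₁.comp D.ι).continuous))
    (fun g z e h => ⟨h.1, D.exists_act N.inv g (D.ι z) e h.2⟩)
    fun z ⟨h, _, hw, e⟩ =>
      have hC : z ∈ D.L.carrier := le_of_lt (a := D.ht z) (b := 3 / 4) h
      ⟨hC, show D.κ₁ ⟨z, hC⟩ ∈ N.carrier from mem_of_eq_of_mem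
        (D.B₁.isOpenEmbedding_j.injective ((D.j_κ₁ ⟨z, hC⟩).trans e.symm)) hw⟩

def supp₂ (N : RelCpt D.B₂.b) : RelCpt D.b :=
  .ofPiece D.R (N.pre D.pullable_κ₂)
    (D.ht ⁻¹' Ioi (1 / 4) ∩ {z | ∃ w ∈ N.carrier, D.B₂.j w = D.ρ₂ (D.ι z)})
    ((isOpen_Ioi.preimage D.continuous_ht).inter
      ((D.B₂.isOpenEmbedding_j.isOpenMap _ N.isOpen).preimage
        (D.ρ₂.comp D.ι).continuous))
    (fun g z e h => ⟨h.1, D.exists_act N.inv g (D.ι z) e h.2⟩)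
    fun z ⟨h, _, hw, e⟩ =>
      have hC : z ∈ D.R.carrier := le_of_lt (a := 1 / 4) (b := D.ht z) h
      ⟨hC, show D.κ₂ ⟨z, hC⟩ ∈ N.carrier from mem_of_eq_of_mem
        (D.B₂.isOpenEmbedding_j.injective ((D.j_κ₂ ⟨z, hC⟩).trans e.symm)) hw⟩

/-- The common end has the subspace topology from `B₁.W`, so `N` is the trace of an open set there,
whose image is open in the cylinder. -/
theorem isOpen_mid {N : Set D.S.P} (hN : IsOpen N) :
    IsOpen (D.ht ⁻¹' Ioo (1 / 4) (3 / 4) ∩ {z | ∃ s ∈ N, (D.mid s).1 = (D.ι z).1}) := by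
  obtain ⟨N', hN', rfl⟩ := D.ε₁.closedEmb.isInducing.isOpen_iff.1 hN
  have : (D.ht ⁻¹' Ioo (1 / 4) (3 / 4) ∩ {z | ∃ s ∈ D.ε₁.i ⁻¹' N', (D.mid s).1 = (D.ι z).1}) =
      D.ht ⁻¹' Ioo (1 / 4) (3 / 4) ∩ (D.ρ₁.comp D.ι) ⁻¹' (D.B₁.j '' N') := by
    ext z
    refine and_congr_right fun h => ⟨fun ⟨s, hs, e⟩ => ⟨_, hs, D.ρ₁_mid h.1.le e⟩,
      fun ⟨w, hw, e⟩ => ?_⟩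
    obtain ⟨s, rfl, hs⟩ := D.exists_mid₁ h.1.le e
    exact ⟨s, hw, hs⟩
  rw [this]
  exact (isOpen_Ioo.preimage D.continuous_ht).inter
    ((D.B₁.isOpenEmbedding_j.isOpenMap _ hN').preimage (D.ρ₁.comp D.ι).continuous)

theorem κ_eq (z : D.C.toGSpace) {s : D.S.P} (h : (D.mid s).1 = (D.ι z.1).1) : D.κ z = s :=
  D.isEmbedding_mid.injective (Prod.ext ((D.mid_κ z).trans h.symm)
    ((D.mid_snd _).trans (D.mid_snd _).symm))

/-- The classes of the two bordisms agree on the common end only after their supports are enlarged;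
the enlarged support is spread over the middle part. -/
def supp (N : RelCpt D.S.b) : RelCpt D.b :=
  .ofPiece D.C (N.pre D.pullable_κ)
    (D.ht ⁻¹' Ioo (1 / 4) (3 / 4) ∩ {z | ∃ s ∈ N.carrier, (D.mid s).1 = (D.ι z).1})
    (D.isOpen_mid N.isOpen)
    (fun g z e ⟨h, s, hs, e'⟩ => ⟨h, by
      have es : G.s g = D.S.P.anchor s := by
        rw [← D.mid.anchor_map]
        exact e.trans (congrArg (fibGSpace D.E.toGVB Y).anchor e').symm
      refine ⟨D.S.P.act g s es, N.inv g s es hs, ?_⟩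
      rw [D.mid.map_act]
      exact GSpace.act_congr _ g e' _⟩)
    fun z ⟨h, s, hs, e⟩ =>
      have hC : z ∈ D.C.carrier := ⟨h.1.le, h.2.le⟩
      ⟨hC, show D.κ ⟨z, hC⟩ ∈ N.carrier from mem_of_eq_of_mem (D.κ_eq ⟨z, hC⟩ e) hs⟩

theorem mem_supp₁ {N : RelCpt D.B₁.b} {z : D.L.toGSpace} (h : D.ht z.1 < 3 / 4)
    (hz : D.κ₁ z ∈ N.carrier) : z.1 ∈ (D.supp₁ N).carrier := ⟨h, _, hz, D.j_κ₁ z⟩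

theorem mem_supp₂ {N : RelCpt D.B₂.b} {z : D.R.toGSpace} (h : 1 / 4 < D.ht z.1)
    (hz : D.κ₂ z ∈ N.carrier) : z.1 ∈ (D.supp₂ N).carrier := ⟨h, _, hz, D.j_κ₂ z⟩

/-- In the middle part, the supports only depend on the projection to `|E^Y|`. -/
theorem mem_supp_iff {N₁ : RelCpt D.B₁.b} {N₂ : RelCpt D.B₂.b} {N : RelCpt D.S.b}
    (h₁ : ∀ s, D.ε₁.i s ∈ N₁.carrier → s ∈ N.carrier)
    (h₂ : ∀ s, D.ε₂.i s ∈ N₂.carrier → s ∈ N.carrier) (z : D.OG) (h : 1 / 4 < D.ht z)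
    (h' : D.ht z < 3 / 4) :
    z ∈ (((D.supp₁ N₁).sup (D.supp₂ N₂)).sup (D.supp N)).carrier ↔
      ∃ s ∈ N.carrier, (D.mid s).1 = (D.ι z).1 := by
  refine ⟨?_, fun hz => Or.inr ⟨⟨h, h'⟩, hz⟩⟩
  rintro ((⟨-, w, hw, e⟩ | ⟨-, w, hw, e⟩) | ⟨-, hz⟩)
  · obtain ⟨s, rfl, hs⟩ := D.exists_mid₁ h.le e
    exact ⟨s, h₁ s hw, hs⟩
  · obtain ⟨s, rfl, hs⟩ := D.exists_mid₂ h'.le e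
    exact ⟨s, h₂ s hw, hs⟩
  · exact hz

/-- Mayer–Vietoris needs overlapping pieces: `LB` and `RB` meet in heights `[3/8, 5/8]`, well inside
the constant part, and `KB` leaves a margin down to `5/16` in which the height may be moved. -/
abbrev LB : ClosedInv D.OG := D.part (Iic (5 / 8)) isClosed_Iic
abbrev RB : ClosedInv D.OG := D.part (Ici (3 / 8)) isClosed_Ici
abbrev KB : ClosedInv D.OG := D.part (Ici (5 / 16)) isClosed_Ici

theorem lb_le (z : D.LB.toGSpace) : z.1 ∈ D.L.carrier :=
  le_trans (b := (5 / 8 : ℝ)) z.2 (by norm_num)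
theorem rb_le (z : D.RB.toGSpace) : z.1 ∈ D.R.carrier :=
  le_trans (b := (3 / 8 : ℝ)) (by norm_num) z.2

def κL : GMap D.LB.toGSpace D.B₁.W := D.κ₁.comp (D.L.cod D.LB.incl D.lb_le)
def κR : GMap D.RB.toGSpace D.B₂.W := D.κ₂.comp (D.R.cod D.RB.incl D.rb_le)

/-- The deformation changes heights only between `5/16` and `3/8`, where the glued space is a
product over the common end. -/
theorem mem_O_squeeze (s : unitInterval) (z : D.KB.toGSpace) :
    ((D.ι z.1).1, squeeze s (D.ι z.1).2) ∈ D.O := by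
  rcases le_total (3 / 8) (D.ht z.1) with h | h
  · rw [squeeze_of_le h]
    exact z.1.2
  · have hz : 5 / 16 ≤ D.ht z.1 := z.2
    have hb := squeeze_bounds (s := s) h
    obtain ⟨m, hm⟩ := D.exists_mid z.1.2 (le_trans (by norm_num) hz) (le_trans h (by norm_num))
    exact D.mem_O_of_mid (le_trans (by norm_num) (hz.trans hb.1)) (hb.2.trans (by norm_num)) hm

theorem squeeze_mem_KB (s : unitInterval) (z : D.KB.toGSpace) :
    5 / 16 ≤ (squeeze s (D.ι z.1).2 : ℝ) := by
  rcases le_total (3 / 8) (D.ht z.1) with h | h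
  · rw [squeeze_of_le h]
    exact z.2
  · exact le_trans (show 5 / 16 ≤ D.ht z.1 from z.2) (squeeze_bounds h).1

/-- The deformation of the upper part of the glued space. -/
def defo (s : unitInterval) : GMap D.KB.toGSpace D.KB.toGSpace where
  toFun z := ⟨⟨((D.ι z.1).1, squeeze s (D.ι z.1).2), D.mem_O_squeeze s z⟩, D.squeeze_mem_KB s z⟩
  continuous := by
    refine Continuous.subtype_mk (X := D.OG) (Continuous.subtype_mk (X := D.Z) ?_ _) _
    have h : Continuous fun z : D.KB.toGSpace => D.ι z.1 :=
      D.ι.continuous.comp D.KB.incl.continuous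
    exact (continuous_fst.comp h).prodMk
      (continuous_squeeze.comp ((continuous_snd.comp h).prodMk continuous_const))
  anchor_map _ := rfl
  map_act _ _ _ := rfl

theorem continuous_defo :
    Continuous fun x : D.KB.toGSpace × unitInterval => D.defo x.2 x.1 := by
  refine Continuous.subtype_mk (X := D.OG) (Continuous.subtype_mk (X := D.Z) ?_ _) _
  have h : Continuous fun x : D.KB.toGSpace × unitInterval => D.ι x.1.1 :=
    D.ι.continuous.comp (D.KB.incl.continuous.comp continuous_fst)
  exact (continuous_fst.comp h).prodMk
    (continuous_squeeze.comp ((continuous_snd.comp h).prodMk continuous_snd))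

theorem defo_eq (s : unitInterval) (z : D.KB.toGSpace)
    (h : squeeze s (D.ι z.1).2 = (D.ι z.1).2) : D.defo s z = z :=
  Subtype.ext (Subtype.ext (Prod.ext rfl h))

/-- The classes pulled back to the two pieces agree on the overlap, where both come from the common
end. The Mayer–Vietoris gluing applies because, near the overlap, space and support are products
with an interval. -/
theorem exists_class (N₁ : RelCpt D.B₁.b) (a₁ : F.coh D.B₁.W N₁.compl) (N₂ : RelCpt D.B₂.b)
    (a₂ : F.coh D.B₂.W N₂.compl) (e₁ : D.B₁.ξ = F.of N₁ a₁) (e₂ : D.B₂.ξ = F.of N₂ a₂) :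
    ∃ (P : RelCpt D.b) (c : F.coh D.OG P.compl)
      (hL : MapsTo D.κL (P.compl.preimage D.LB.incl).carrier N₁.compl.carrier)
      (hR : MapsTo D.κR (P.compl.preimage D.RB.incl).carrier N₂.compl.carrier),
      F.res D.LB P.compl c = F.map D.κL hL a₁ ∧ F.res D.RB P.compl c = F.map D.κR hR a₂ := by
  have p₁ := pullable_closedEmb D.ε₁.closedEmb D.ε₁.b_eq
  have p₂ := pullable_closedEmb D.ε₂.closedEmb D.ε₂.b_eq
  have e : F.pullG p₁ (F.of N₁ a₁) = F.pullG p₂ (F.of N₂ a₂) := by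
    rw [← e₁, ← e₂, ← D.ε₁.ξ_eq, ← D.ε₂.ξ_eq]
  rw [F.pullG_of, F.pullG_of] at e
  -- Equality of the restrictions to the common end in the limit is realised on one support `N`.
  obtain ⟨N, h₁, h₂, e⟩ := F.exists_trans_eq _ _ _ _ e
  let P := ((D.supp₁ N₁).sup (D.supp₂ N₂)).sup (D.supp N)
  have hP := D.mem_supp_iff (N₁ := N₁) (N₂ := N₂) (N := N) (fun s h => h₁ h) (fun s h => h₂ h)
  have hL : MapsTo D.κL (P.compl.preimage D.LB.incl).carrier N₁.compl.carrier :=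
    fun z hz h => hz (Or.inl (Or.inl (D.mem_supp₁ (lt_of_le_of_lt
      (show D.ht z.1 ≤ 5 / 8 from z.2) (by norm_num)) h)))
  have hR : MapsTo D.κR (P.compl.preimage D.RB.incl).carrier N₂.compl.carrier :=
    fun z hz h => hz (Or.inl (Or.inr (D.mem_supp₂ (lt_of_lt_of_le (by norm_num)
      (show 3 / 8 ≤ D.ht z.1 from z.2)) h)))
  have hc := D.continuous_ht
  have hLR : ∀ z : (D.LB.inter D.RB).toGSpace, z.1 ∈ D.C.carrier := fun z =>
    ⟨D.rb_le ⟨z.1, z.2.2⟩, D.lb_le ⟨z.1, z.2.1⟩⟩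
  let κM : GMap (D.LB.inter D.RB).toGSpace D.S.P := D.κ.comp (D.C.cod (D.LB.inter D.RB).incl hLR)
  have hκM : MapsTo κM (P.compl.preimage (D.LB.inter D.RB).incl).carrier N.compl.carrier :=
    fun z hz h => hz (Or.inr ⟨⟨lt_of_lt_of_le (by norm_num) (show 3 / 8 ≤ D.ht z.1 from z.2.2),
      lt_of_le_of_lt (show D.ht z.1 ≤ 5 / 8 from z.2.1) (by norm_num)⟩, _, h, D.mid_κ _⟩)
  have t₁ : F.map κM hκM (F.trans _ N h₁ (F.map D.ε₁.i (N₁.mapsTo_pre p₁) a₁)) =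
      F.map (B := N₁.compl) (D.ε₁.i.comp κM) (fun z hz h => hκM hz (h₁ h)) a₁ := by
    unfold CohTheory.trans
    rw [F.map_map]
    exact F.map_map _ D.ε₁.i _ (N₁.mapsTo_pre p₁) a₁
  have t₂ : F.map κM hκM (F.trans _ N h₂ (F.map D.ε₂.i (N₂.mapsTo_pre p₂) a₂)) =
      F.map (B := N₂.compl) (D.ε₂.i.comp κM) (fun z hz h => hκM hz (h₂ h)) a₂ := by
    unfold CohTheory.trans
    rw [F.map_map]
    exact F.map_map _ D.ε₂.i _ (N₂.mapsTo_pre p₂) a₂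
  obtain ⟨c, h⟩ := F.exists_glue D.LB D.RB P.compl D.KB
    (by
      refine (closure_minimal (t := D.ht ⁻¹' Ici (5 / 8)) (fun z hz => ?_)
        (isClosed_Ici.preimage hc)).trans
        (Subset.trans ?_ (interior_maximal (t := D.ht ⁻¹' Ioi (3 / 8)) ?_
          (isOpen_Ioi.preimage hc)))
      · exact le_of_not_ge (show ¬ D.ht z ≤ 5 / 8 from hz)
      · exact fun z hz => lt_of_lt_of_le (by norm_num) (show 5 / 8 ≤ D.ht z from hz)
      · exact fun z hz => le_of_lt (show 3 / 8 < D.ht z from hz))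
    (by
      refine Subset.trans ?_ (interior_maximal (t := D.ht ⁻¹' Ioi (5 / 16)) ?_
          (isOpen_Ioi.preimage hc))
      · exact fun z hz => lt_of_lt_of_le (by norm_num) (show 3 / 8 ≤ D.ht z from hz)
      · exact fun z hz => le_of_lt (show 5 / 16 < D.ht z from hz))
    D.defo D.continuous_defo (fun z => D.defo_eq 0 z (squeeze_zero _)) (fun z => squeeze_one _)
    (fun s z hz => D.defo_eq s z (squeeze_of_le hz))
    -- Below `3/8` the point is in the middle part, where membership in `P` depends only on its
    -- image in `|E^Y|`; changing its height keeps it in the complement.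
    (fun s z hz => by
      rcases le_total (3 / 8) (D.ht z.1) with h | h
      · rw [D.defo_eq s z (squeeze_of_le h)]
        exact hz
      · have hz' : 5 / 16 ≤ D.ht z.1 := z.2
        have hb := squeeze_bounds (s := s) h
        intro hz₁
        refine hz ((hP z.1 (lt_of_lt_of_le (by norm_num) hz')
          (lt_of_le_of_lt h (by norm_num))).2 ?_)
        exact (hP (D.defo s z).1 (lt_of_lt_of_le (by norm_num) (hz'.trans hb.1))
          (lt_of_le_of_lt hb.2 (by norm_num))).1 hz₁)
    (fun s z hz => by
      rcases le_total (3 / 8) (D.ht z.1) with h | h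
      · rw [D.defo_eq s z (squeeze_of_le h)]
        exact hz
      · exact le_trans (squeeze_bounds (s := s) h).2 (by norm_num))
    (F.map D.κL hL a₁) (F.map D.κR hR a₂) (fun _ h => h) (fun _ h => h)
    (by
      refine Eq.trans ?_ ((congrArg (F.map κM hκM) e).trans ?_)
      · exact (F.map_map _ _ _ _ a₁).trans ((F.map_congr (g := D.ε₁.i.comp κM)
          (fun z => D.κ₁_eq z.1 (hLR z) (D.lb_le ⟨z.1, z.2.1⟩)) _ a₁).trans t₁.symm)
      · exact ((F.map_map _ _ _ _ a₂).trans ((F.map_congr (g := D.ε₂.i.comp κM)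
          (fun z => D.κ₂_eq z.1 (hLR z) (D.rb_le ⟨z.1, z.2.2⟩)) _ a₂).trans t₂.symm)).symm)
  exact ⟨P, c, hL, hR, h⟩

/-- The special bordism on the glued space. -/
def glued (ξ : F.CohC D.b) : SB D.E X Y where
  W := D.OG
  b := D.b
  e := (cylE D.E.toGVB Y).comp D.ι
  y := (cylY D.E.toGVB Y).comp D.ι
  t z := (D.ι z).2
  t_act _ _ _ := rfl
  emb := D.isOpen_O.isOpenEmbedding_subtypeVal
  ξ := ξ

/-- An end of one of the bordisms is an end of the glued bordism. -/
def gluedEnd (ξ : F.CohC D.b) {B : SB D.E X Y} {j : unitInterval} {T : SC F X Y} (ε : B.End j T)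
    (C : ClosedInv D.OG) (κ : GMap C.toGSpace B.W) (ρ : GMap D.Z D.Z)
    (hρ : ∀ q, ρ (q, j) = (q, j)) (hC : ∀ z : D.OG, (D.ι z).2 = j → z ∈ C.carrier)
    (hO : ∀ z : D.Z, z.2 = j → ∀ w, B.j w = ρ z → z ∈ D.O)
    (hκ : ∀ z, B.j (κ z) = ρ (D.ι z.1)) (hb : ∀ z, D.b z.1 = B.b (κ z))
    (hξ : ∀ (i : GMap T.P C.toGSpace), (∀ x, κ (i x) = ε.i x) →
      ∀ (h : Pullable T.b D.b (C.incl.comp i)) (h' : Pullable T.b B.b ε.i),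
      F.pullG h ξ = F.pullG h' B.ξ) : (D.glued ξ).End j T :=
  have ht : ∀ x, (B.j (ε.i x)).2 = j := fun x => by
    have : ε.i x ∈ B.t ⁻¹' {j} := by rw [← ε.range_eq]; exact ⟨x, rfl⟩
    exact this
  have hρ' : ∀ z : D.Z, z.2 = j → ρ z = z := fun z hz => by
    obtain ⟨q, t⟩ := z
    obtain rfl : t = j := hz
    exact hρ q
  have hmem : ∀ x, B.j (ε.i x) ∈ D.O := fun x => hO _ (ht x) _ (hρ' _ (ht x)).symm
  let i₀ : GMap T.P D.OG :=
    .ofEmb (f := D.ι) IsEmbedding.subtypeVal (fun x => ⟨B.j (ε.i x), hmem x⟩) (B.j.comp ε.i)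
      fun _ => rfl
  let i : GMap T.P C.toGSpace := C.cod i₀ fun x => hC _ (ht x)
  have hi : ∀ x, κ (i x) = ε.i x := fun x => B.isOpenEmbedding_j.injective
    ((hκ _).trans (hρ' _ (ht x)))
  have hemb : IsClosedEmbedding i := isClosedEmbedding_of_comp i.continuous κ.continuous
    (by simpa only [hi] using ε.closedEmb)
  have hcl : IsClosedEmbedding (C.incl.comp i) := C.closed.isClosedEmbedding_subtypeVal.comp hemb
  have hbi : ∀ x, T.b x = D.b (C.incl.comp i x) := fun x =>
    (ε.b_eq x).trans ((congrArg B.b (hi x)).symm.trans (hb (i x)).symm)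
  { i := C.incl.comp i
    closedEmb := hcl
    range_eq := by
      ext z
      constructor
      · rintro ⟨x, rfl⟩
        exact ht x
      · intro hz
        have hz' : (D.ι z).2 = j := hz
        have e : B.j (κ ⟨z, hC z hz⟩) = D.ι z := (hκ _).trans (hρ' _ hz)
        have : κ ⟨z, hC z hz⟩ ∈ range ε.i := by
          rw [ε.range_eq]
          exact (congrArg Prod.snd e).trans hz'
        obtain ⟨x, hx⟩ := this
        exact ⟨x, Subtype.ext ((congrArg B.j hx).trans e)⟩
    b_eq := hbi
    sqE := ε.sqE
    e_eq := ε.e_eq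
    y_eq := ε.y_eq
    ξ_eq := fun h => by
      have h' := pullable_closedEmb ε.closedEmb ε.b_eq
      rw [ε.ξ_eq h']
      exact (hξ i hi h h').symm }

theorem hbord {S₁ S₂ : SC F X Y} (η₁ : D.B₁.End 0 S₁) (η₂ : D.B₂.End 1 S₂) : S₁.HBord S₂ := by
  obtain ⟨N₁, a₁, e₁⟩ := F.exists_of D.B₁.ξ
  obtain ⟨N₂, a₂, e₂⟩ := F.exists_of D.B₂.ξ
  obtain ⟨P, c, hL, hR, hcL, hcR⟩ := D.exists_class N₁ a₁ N₂ a₂ e₁ e₂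
  refine ⟨D.E, D.glued (F.of P c), ⟨D.gluedEnd _ η₁ D.LB D.κL D.ρ₁ ?_ ?_ ?_ ?_ ?_ ?_⟩,
    ⟨D.gluedEnd _ η₂ D.RB D.κR D.ρ₂ ?_ ?_ ?_ ?_ ?_ ?_⟩⟩
  · exact fun q => Prod.ext rfl r₁_zero
  · intro z hz
    change ((D.ι z).2 : ℝ) ≤ 5 / 8
    rw [hz]; norm_num
  · intro z hz w hw
    exact D.mem_O_of_left (by rw [hz]; norm_num) hw
  · exact fun z => D.j_κ₁ _
  · exact fun z => D.b_left ⟨z.1, D.lb_le z⟩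
  · intro i hi h h'
    rw [e₁]
    exact F.pullG_piece D.LB D.κL N₁ a₁ P c hL hcL i η₁.i hi h h'
  · exact fun q => Prod.ext rfl r₂_one
  · intro z hz
    change 3 / 8 ≤ ((D.ι z).2 : ℝ)
    rw [hz]; norm_num
  · intro z hz w hw
    exact D.mem_O_of_right (by rw [hz]; norm_num) hw
  · exact fun z => D.j_κ₂ _
  · exact fun z => D.b_right ⟨z.1, D.rb_le z⟩
  · intro i hi h h'
    rw [e₂]
    exact F.pullG_piece D.RB D.κR N₂ a₂ P c hR hcR i η₂.i hi h h'

end GlueData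

/-! ### Transitivity of special bordism -/

/-- Change of the bundle of a special bordism along an isomorphism. -/
def SB.changeE {E E' : OVB F (GSpace.base G)} (B : SB E X Y) (s : OSq E E') : SB E' X Y where
  W := B.W
  b := B.b
  e := s.top.comp B.e
  y := B.y
  t := B.t
  t_act := B.t_act
  emb := by
    have hs : IsHomeomorph s.top := s.isHomeomorph_top (GMap.isHomeomorph_base _)
    let k := hs.homeomorph
    have hk : ∀ p : FibProd E'.toGVB Y, E.tot.anchor (k.symm p.1.1) = Y.anchor p.1.2 := fun p => by
      rw [← p.2, ← s.top.anchor_map]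
      exact congrArg E'.tot.anchor (k.apply_symm_apply _)
    let φ : FibProd E.toGVB Y ≃ₜ FibProd E'.toGVB Y :=
      { toFun p := ⟨(k p.1.1, p.1.2), (s.top.anchor_map _).trans p.2⟩
        invFun p := ⟨(k.symm p.1.1, p.1.2), hk p⟩
        left_inv p := Subtype.ext (Prod.ext (k.symm_apply_apply _) rfl)
        right_inv p := Subtype.ext (Prod.ext (k.apply_symm_apply _) rfl)
        continuous_toFun := Continuous.subtype_mk (by fun_prop) _
        continuous_invFun := Continuous.subtype_mk (by fun_prop) hk }
    exact (φ.prodCongr (.refl _)).isOpenEmbedding.comp B.emb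
  ξ := B.ξ

def SB.End.changeE {E E' : OVB F (GSpace.base G)} {B : SB E X Y} {j : unitInterval} {S : SC F X Y}
    (ε : B.End j S) (s : OSq E E') : (B.changeE s).End j S where
  i := ε.i
  closedEmb := ε.closedEmb
  range_eq := ε.range_eq
  b_eq := ε.b_eq
  sqE := s.comp ε.sqE
  e_eq x := congrArg s.top (ε.e_eq x)
  y_eq := ε.y_eq
  ξ_eq := ε.ξ_eq

/-- The two bordisms may use different bundles over the object space; both are identified with the
bundle of the common end. After transport along this identification they can be joined. -/
theorem SC.HBord.trans {S₁ S₂ S₃ : SC F X Y} (h : S₁.HBord S₂) (h' : S₂.HBord S₃) :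
    S₁.HBord S₃ := by
  obtain ⟨E₁, B₁, ⟨η₁⟩, ⟨ε₁⟩⟩ := h
  obtain ⟨E₂, B₂, ⟨ε₂⟩, ⟨η₂⟩⟩ := h'
  let s : OSq E₁ E₂ := ε₂.sqE.comp (ε₁.sqE.symm (GMap.isHomeomorph_base _))
  let D : GlueData F X Y := {
    E := E₂
    B₁ := B₁.changeE s
    B₂ := B₂
    S := S₂
    ε₁ := ε₁.changeE s
    ε₂ := ε₂
    sqE_eq := fun v => congrArg ε₂.sqE.top (GMap.symm_apply _ _ v) }
  exact D.hbord (η₁.changeE s) η₂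

end

end NNSCorr

namespace NNSCorr

noncomputable section

variable {G : TopGroupoid.{u}} {F : CohTheory.{u, v} G} {X Y : GSpace G}

/-! ## Stable bordism of special correspondences -/

def OSum.swapLeft {M : GSpace G} {S V₁ V₂ : OVB F M} (σ : OSum S V₁ V₂)
    (h : F.IsEven V₁.orient) : OSum S V₂ V₁ :=
  ⟨σ.toVBSum.swap, σ.orient_eq.trans (F.sumClass_comm σ.toVBSum.swap V₂.orient h).symm⟩

/-- Two special correspondences have specially bordant Thom modifications. -/
def SC.Approx (S S' : SC F X Y) : Prop :=
  ∃ (U U' : OVB F (GSpace.base G)) (T T' : SC F X Y),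
    Nonempty (S.ModOf U T) ∧ Nonempty (S'.ModOf U' T') ∧ T.HBord T'

/-- Thom modification of both ends by the zero bundle suffices. -/
theorem SC.HBord.approx {S S' : SC F X Y} (h : S.HBord S') : S.Approx S' :=
  ⟨OVB.zero F _, OVB.zero F _, _, _, ⟨S.modOf_mod _⟩, ⟨S'.modOf_mod _⟩,
    h.mod (S.modOf_mod _) (S'.modOf_mod _)⟩

theorem SC.Approx.refl (S : SC F X Y) : S.Approx S := (SC.HBord.refl S).approx

theorem SC.Approx.symm {S S' : SC F X Y} (h : S.Approx S') : S'.Approx S := by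
  obtain ⟨U, U', T, T', h, h', hT⟩ := h
  exact ⟨U', U, T', T, h', h, hT.symm⟩

/-- Modifying once more by the zero bundle on both sides gives literally the same special
correspondence. -/
theorem SC.ModOf.approx {S S' : SC F X Y} {U : OVB F (GSpace.base G)} (μ : S.ModOf U S') :
    S.Approx S' :=
  ⟨U.sum (OVB.zero F _), OVB.zero F _, _, _, ⟨μ.trans (S'.modOf_mod _) (OVB.sumOSum _ _)⟩,
    ⟨S'.modOf_mod _⟩, SC.HBord.refl _⟩

/-- Two Thom modifications of the middle correspondence `S₂`, by `U` and by `U'`, have a common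
further modification; modifying the given bordisms accordingly makes them composable. -/
theorem SC.Approx.trans {S₁ S₂ S₃ : SC F X Y} (h : S₁.Approx S₂) (h' : S₂.Approx S₃) :
    S₁.Approx S₃ := by
  obtain ⟨U₁, U, T₁, T, ⟨μ₁⟩, ⟨μ⟩, h⟩ := h
  obtain ⟨U', U₃, T', T₃, ⟨ν⟩, ⟨ν₃⟩, h'⟩ := h'
  -- `W = (U ⊕ U) ⊕ (U' ⊕ U')` is both `U ⊕ A` and `U' ⊕ B`. The second decomposition moves `U' ⊕
  -- U'` to the front, which costs no sign because a doubled bundle is even.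
  let A := U.sum (U'.sum U')
  let B := U'.sum (U.sum U)
  let W := (U.sum U).sum (U'.sum U')
  have σ : OSum W (U.sum U) (U'.sum U') := OVB.sumOSum _ _
  have σ₁ : OSum W U A := σ.assoc (OVB.sumOSum _ _) (OVB.sumOSum _ _)
  have σ₂ : OSum W U' B := (σ.swap (OVB.sumOSum U' U').isEven_double).assoc (OVB.sumOSum _ _)
    (OVB.sumOSum _ _)
  have φ : (T.mod A).Iso (T'.mod B) :=
    (μ.trans (T.modOf_mod A) σ₁).iso (ν.trans (T'.modOf_mod B) σ₂)
  exact ⟨U₁.sum A, U₃.sum B, T₁.mod A, T₃.mod B,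
    ⟨μ₁.trans (T₁.modOf_mod A) (OVB.sumOSum _ _)⟩, ⟨ν₃.trans (T₃.modOf_mod B) (OVB.sumOSum _ _)⟩,
    ((h.mod (T₁.modOf_mod A) (T.modOf_mod A)).trans φ.hbord).trans
      (h'.mod (T'.modOf_mod B) (T₃.modOf_mod B))⟩

/-! ## The special correspondence of a correspondence -/

/-- The maps `c` and `c'` are only pointwise equal, so the two groups differ formally; pull-back
along the identity mediates. -/
theorem CohTheory.pullG_id_thom {P Q : GSpace G} {p : GMap P Q} {b : GMap Q X} {c c' : GMap P X}
    (hc : ∀ x, c x = b (p x)) (hc' : ∀ x, c' x = b (p x)) (h : Pullable c' c (GMap.id P))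
    (t : F.CohC p) (ξ : F.CohC b) : F.pullG h (F.thom hc t ξ) = F.thom hc' t ξ := by
  have h₁ : Pullable p p (GMap.id P) := pullable_isHomeomorph .id fun _ => rfl
  have h₂ : Pullable b b (GMap.id Q) := pullable_isHomeomorph .id fun _ => rfl
  have e := F.pullG_thom (hc := hc) (hc' := hc') h₁ h₂ h (fun _ => rfl) t ξ
  rwa [F.pullG_eq_self h₁ fun _ => rfl, F.pullG_eq_self h₂ fun _ => rfl] at e

/-- The special correspondence with middle space `|V|`. -/
def Corr.spec (Ψ : Corr F X Y) : SC F X Y where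
  E := Ψ.f.E
  P := Ψ.f.V.tot
  b := Ψ.b.comp Ψ.f.V.proj
  e := Ψ.f.emb.toE
  y := Ψ.f.emb.toY
  emb := Ψ.f.emb.isOpenEmbedding
  ξ := F.thom (fun _ => rfl) Ψ.f.V.orient Ψ.ξ

def Corr.Iso.spec {Ψ Ψ' : Corr F X Y} (φ : Ψ.Iso Ψ') : Ψ.spec.Iso Ψ'.spec where
  i := φ.sqV.top
  homeo := φ.sqV.isHomeomorph_top (by rw [φ.sqV_base]; exact φ.homeo)
  b_eq x := (φ.b_eq _).trans (congrArg Ψ'.b (by rw [← φ.sqV_base]; exact φ.sqV.comm x))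
  sqE := φ.sqE
  e_eq := φ.emb_E
  y_eq := φ.emb_Y
  ξ_eq h := by
    have hb : Pullable Ψ.b Ψ'.b φ.sqV.base := by
      rw [φ.sqV_base]
      exact pullable_isHomeomorph φ.homeo φ.b_eq
    refine Eq.trans ?_ (F.pullG_thom_orient φ.sqV hb (fun _ => rfl) (fun _ => rfl) h Ψ'.ξ).symm
    refine congrArg (F.thom (fun _ => rfl) Ψ.f.V.orient) (φ.ξ_eq.trans ?_)
    exact F.pullG_congr _ _ (fun x => by rw [φ.sqV_base]; rfl) _

/-- The total space of `V ⊕ E₊^M` is the pull-back of `E₊` to `|V|`, and its Thom map is that of `V`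
followed by that of `E₊`. -/
theorem NNSMap.Lifting.modOf {M : GSpace G} {b : GMap M X} {f f' : NNSMap F M Y}
    (l : f.Lifting f') (ξ : F.CohC b) :
    Nonempty ((⟨M, b, f, ξ⟩ : Corr F X Y).spec.ModOf l.Eplus (⟨M, b, f', ξ⟩ : Corr F X Y).spec) :=
  have hp : ∀ x, f'.V.proj x = f.V.proj (l.sumV.fst x) := fun x => (l.sumV.proj_fst x).symm
  ⟨{ UP := l.T.ofSq l.sumV.bundle l.sumV.bundleSq
     sqU := l.sqT.comp (l.T.ofSqOSq _ _)
     i := GMap.id _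
     homeo := IsHomeomorph.id
     b_eq := fun x => congrArg b (hp x)
     sumE := l.sumE
     e_fst := l.emb_fst
     e_snd := l.emb_snd
     y_eq := l.emb_Y
     ξ_eq := fun h => by
      have hc : ∀ x, b.comp f'.V.proj x = b.comp f.V.proj (l.sumV.fst x) := fun x =>
        congrArg b (hp x)
      have h₁ : F.thom (fun _ => rfl) f'.V.orient ξ = F.thom hc
          (F.pull l.sumV.sq l.T.orient) (F.thom (fun _ => rfl) f.V.orient ξ) := by
        rw [l.sumV.orient_eq]
        exact F.thom_sumClass l.sumV.toVBSum _ _ (fun _ => rfl) (fun _ => rfl) hc ξ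
      exact h₁.trans (F.pullG_id_thom (fun _ => rfl) hc h _ _).symm }⟩

/-- The special bordism with middle space `|V|`. -/
def Bordism.spec (B : Bordism F X Y) : SB B.E X Y where
  W := B.V.tot
  b := B.b.comp B.V.proj
  e := B.toE
  y := B.toY
  t := B.toI
  t_act := B.toI_act
  emb := B.isOpenEmbedding
  ξ := F.thom (fun _ => rfl) B.V.orient B.ξ

/-- The condition on boundaries says that `|V|` meets height `j` exactly over the boundary of `W`,
so the restriction of `V` to the boundary is an end of `|V|`. -/
def Bordism.Restricts.spec {B : Bordism F X Y} {S : Set B.W} {Ψ : Corr F X Y}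
    (ρ : B.Restricts S Ψ) (j : unitInterval) (hS : ∀ v, B.toI v = j ↔ B.V.proj v ∈ S) :
    B.spec.End j Ψ.spec where
  i := ρ.sqV.top
  closedEmb := ρ.sqV.isClosedEmbedding_top (by rw [ρ.sqV_base]; exact ρ.closedEmb)
  range_eq := by
    refine ρ.sqV.range_top.trans ?_
    rw [ρ.sqV_base, ρ.range_eq]
    ext v
    exact (hS v).symm
  b_eq x := (ρ.b_eq _).trans (congrArg B.b (by rw [← ρ.sqV_base]; exact ρ.sqV.comm x))
  sqE := ρ.sqE
  e_eq := ρ.emb_E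
  y_eq := ρ.emb_Y
  ξ_eq h := by
    have hb : Pullable Ψ.b B.b ρ.sqV.base := by
      rw [ρ.sqV_base]
      exact pullable_closedEmb ρ.closedEmb ρ.b_eq
    refine Eq.trans ?_ (F.pullG_thom_orient ρ.sqV hb (fun _ => rfl) (fun _ => rfl) h B.ξ).symm
    refine congrArg (F.thom (fun _ => rfl) Ψ.f.V.orient) (ρ.ξ_eq.trans ?_)
    exact F.pullG_congr _ _ (fun x => by rw [ρ.sqV_base]; rfl) _

/-- The total space of `π^*C ⊕ π^*V` over `|U|` is `U ⊕ C ⊕ V = T ⊕ V`, which over `|V|` is the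
pull-back of `E₂`. Evenness of `E₂` allows `T` and `E₂` to be moved behind `V` and `E`. -/
theorem Corr.ThomMod.modOf {Ψ Ψ' : Corr F X Y} (m : Ψ.ThomMod Ψ') :
    Nonempty (Ψ.spec.ModOf m.E₂ Ψ'.spec) := by
  have hE₂ : F.IsEven m.E₂.orient := m.E₂.isEven m.even
  have hT : F.IsEven m.T.orient := m.T.isEven fun x => by rw [m.sqT.rank_eq]; exact m.even _
  let V := Ψ.f.V
  let Q := m.T.sum V
  let σ : OSum Q m.T V := OVB.sumOSum _ _
  let σ' : OSum Q V m.T := σ.swapLeft hT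
  have hbase : ∀ x, m.U.proj (m.i x) = m.sqC.base x := fun x => by rw [m.sqC_base]; rfl
  -- As a bundle over `|U|`, `T = U ⊕ C` is the pull-back of `C`; thus the total space of `π^*C` is
  -- `|T|`.
  let k : VBSq m.piC.toGVB m.sumT.bundle := m.sqC.toVBSq.factor m.sumT.bundleSq m.i hbase
  let κ : GMap m.piC.tot m.T.tot := k.top
  have hκ : IsHomeomorph κ := k.isHomeomorph_top m.homeo
  have hκ₁ : ∀ x, m.sumT.fst (κ x) = m.i (m.piC.proj x) := fun x => (k.comm x).symm
  have hκ₂ : ∀ x, m.sumT.snd (κ x) = m.sqC.top x := fun x =>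
    m.sqC.toVBSq.top_factor m.sumT.bundleSq m.i hbase x
  have hκ₃ : ∀ x, m.T.proj (κ x) = m.U.proj (m.i (m.piC.proj x)) := fun x => by
    rw [← m.sumT.proj_fst, hκ₁]
  let α : VBSq m.sumV.bundle V.toGVB := m.sqV.toVBSq.comp m.sumV.bundleSq
  have hbase' : ∀ x, σ.bundleSq.base (κ x) = α.base x := fun x => by
    refine (hκ₃ x).trans ?_
    change _ = m.sqV.base (m.piC.proj x)
    rw [m.sqV_base]
    rfl
  -- In the same way `π^*C ⊕ π^*V` over `|π^*C| = |T|` is the pull-back of `V`, with total space `|T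
  -- ⊕ V|`.
  let l : VBSq m.sumV.bundle σ.bundle := α.factor σ.bundleSq κ hbase'
  let i' : GMap Ψ'.f.V.tot Q.tot := l.top
  have hi' : IsHomeomorph i' := l.isHomeomorph_top hκ
  have hi₁ : ∀ x, σ.fst (i' x) = κ (m.sumV.fst x) := fun x => (l.comm x).symm
  have hi₂ : ∀ x, σ.snd (i' x) = m.sqV.top (m.sumV.snd x) := fun x =>
    α.top_factor σ.bundleSq κ hbase' x
  have hVb : ∀ x, V.proj (m.sqV.top (m.sumV.snd x)) = m.U.proj (m.i (Ψ'.f.V.proj x)) := fun x => by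
    have := m.sqV.comm (m.sumV.snd x)
    rw [m.sqV_base] at this
    rw [← m.sumV.proj_snd]
    exact this.symm
  have hb : ∀ x, Ψ'.b (Ψ'.f.V.proj x) = Ψ.b (Q.proj (i' x)) := fun x => by
    rw [m.b_eq, ← σ.proj_snd, hi₂, hVb]
    rfl
  refine ⟨{
    UP := m.T.ofSq σ'.bundle σ'.bundleSq
    sqU := m.sqT.comp (m.T.ofSqOSq _ _)
    i := i'
    homeo := hi'
    b_eq := fun x => (hb x).trans (congrArg Ψ.b (σ.proj_snd _).symm)
    sumE := m.sumE.swapLeft hE₂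
    e_fst := fun x => (m.emb_snd x).trans (congrArg Ψ.f.emb.toE (hi₂ x).symm)
    e_snd := fun x => m.emb_fst x (σ.fst (i' x))
      ((congrArg m.sumT.fst (hi₁ x)).trans ((hκ₁ _).trans (congrArg m.i (m.sumV.proj_fst x))))
      ((congrArg m.sumT.snd (hi₁ x)).trans (hκ₂ _))
    y_eq := fun x => (m.emb_Y x).trans (congrArg Ψ.f.emb.toY (hi₂ x).symm)
    ξ_eq := fun h => ?_ }⟩
  have c₁ : ∀ x, Ψ.b.comp Q.proj x = Ψ.b.comp m.T.proj (σ.fst x) := fun x =>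
    congrArg Ψ.b (σ.proj_fst x).symm
  have c₂ : ∀ x, Ψ.b.comp m.T.proj x = Ψ.b.comp m.U.proj (m.sumT.fst x) := fun x =>
    congrArg Ψ.b (m.sumT.proj_fst x).symm
  have c₃ : ∀ x, Ψ.b.comp Q.proj x = Ψ.b.comp V.proj (σ'.fst x) := fun x =>
    congrArg Ψ.b (σ'.proj_fst x).symm
  have c₄ : ∀ x, Ψ'.b.comp Ψ'.f.V.proj x = Ψ'.b.comp m.piC.proj (m.sumV.fst x) := fun x =>
    congrArg Ψ'.b (m.sumV.proj_fst x).symm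
  -- The class on `|T ⊕ V|` is computed twice. Applying the Thom maps of `U`, `C`, `V` in this order
  -- gives the class of `Ψ'.spec`; applying those of `V` and then `T` gives the Thom modification of
  -- `Ψ.spec`.
  have hQ₁ : F.thom (fun _ => rfl) Q.orient Ψ.ξ = F.thom c₁ (F.pull σ.sq V.orient)
      (F.thom c₂ (F.pull m.sumT.sq m.C.orient) (F.thom (fun _ => rfl) m.U.orient Ψ.ξ)) := by
    rw [σ.orient_eq]
    refine (F.thom_sumClass σ.toVBSum _ _ (fun _ => rfl) (fun _ => rfl) c₁ Ψ.ξ).trans ?_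
    rw [m.sumT.orient_eq]
    exact congrArg _ (F.thom_sumClass m.sumT.toVBSum _ _ (fun _ => rfl) (fun _ => rfl) c₂ Ψ.ξ)
  have hQ₂ : F.thom (fun _ => rfl) Q.orient Ψ.ξ = F.thom c₃ (F.pull σ'.sq m.T.orient)
      (F.thom (fun _ => rfl) V.orient Ψ.ξ) := by
    rw [σ'.orient_eq]
    exact F.thom_sumClass σ'.toVBSum _ _ (fun _ => rfl) (fun _ => rfl) c₃ Ψ.ξ
  have hV' : F.thom (fun _ => rfl) Ψ'.f.V.orient Ψ'.ξ =
      F.thom c₄ (F.pull m.sumV.sq m.piV.orient) (F.thom (fun _ => rfl) m.piC.orient Ψ'.ξ) := by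
    rw [m.sumV.orient_eq]
    exact F.thom_sumClass m.sumV.toVBSum _ _ (fun _ => rfl) (fun _ => rfl) c₄ Ψ'.ξ
  have p₁ : Pullable Ψ'.b (Ψ.b.comp m.U.proj) m.i := pullable_isHomeomorph m.homeo m.b_eq
  have p₂ : Pullable (Ψ'.b.comp m.piC.proj) (Ψ.b.comp m.T.proj) κ :=
    pullable_isHomeomorph hκ fun x => (m.b_eq _).trans (congrArg Ψ.b (hκ₃ x).symm)
  have p₃ : Pullable (Ψ'.b.comp Ψ'.f.V.proj) (Ψ.b.comp Q.proj) i' := pullable_isHomeomorph hi' hb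
  have q₁ : Pullable m.piC.proj m.sumT.fst κ := k.pullable
  have q₂ : Pullable m.sumV.fst σ.fst i' := l.pullable
  have e₁ : F.pullG q₁ (F.pull m.sumT.sq m.C.orient) = m.piC.orient := by
    rw [m.sqC.orient_eq]
    exact F.pullG_comp q₁ m.sumT.sq.pullable m.sqC.pullable (fun x => (hκ₂ x).symm) _
  have e₂ : F.pullG q₂ (F.pull σ.sq V.orient) = F.pull m.sumV.sq m.piV.orient := by
    rw [m.sqV.orient_eq]
    exact F.pullG_pullG_eq q₂ σ.sq.pullable m.sumV.sq.pullable m.sqV.pullable hi₂ _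
  have key : F.thom (fun _ => rfl) Ψ'.f.V.orient Ψ'.ξ =
      F.pullG p₃ (F.thom (fun _ => rfl) Q.orient Ψ.ξ) := by
    rw [hQ₁, hV']
    refine Eq.trans ?_ (F.pullG_thom (hc' := c₄) q₂ p₂ p₃ hi₁ _ _).symm
    refine congrArg₂ (fun t x => F.thom c₄ t x) e₂.symm ?_
    refine Eq.trans ?_ (F.pullG_thom (hc' := fun _ => rfl) q₁ p₁ p₂ hκ₁ _ _).symm
    exact congrArg₂ (fun t x => F.thom (fun _ => rfl) t x) e₁.symm m.ξ_eq
  refine key.trans ?_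
  have pid : Pullable ((Ψ.b.comp V.proj).comp σ'.fst) (Ψ.b.comp Q.proj) (GMap.id Q.tot) :=
    pullable_isHomeomorph .id fun x => (c₃ x).symm
  rw [hQ₂]
  refine Eq.trans ?_ (congrArg (F.pullG h) (F.pullG_id_thom c₃ (fun _ => rfl) pid _ _))
  exact (F.pullG_comp h pid p₃ (fun _ => rfl) _).symm

/-- Each elementary relation is translated on `|V|`: an isotopy of `f̂` and a bordism become special
bordisms, and the remaining moves are isomorphisms or Thom modifications by bundles over the object
space. -/
theorem Corr.Step.approx {Ψ Ψ' : Corr F X Y} (h : Ψ.Step Ψ') : Ψ.spec.Approx Ψ'.spec := by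
  cases h with
  | iso h => exact h.elim fun φ => φ.spec.hbord.approx
  | isotopy M b V hV E f₀ f₁ h ξ =>
    obtain ⟨H, rfl, rfl, hH⟩ := h
    exact (SC.hbord_of_isotopy E V.tot (b.comp V.proj) (fun t => (H t).toE) (fun t => (H t).toY) hH
      (H 0).isOpenEmbedding (H 1).isOpenEmbedding (F.thom (fun _ => rfl) V.orient ξ)).approx
  | lifting M b f f' h ξ => exact h.elim fun l => (l.modOf ξ).elim fun μ => μ.approx
  | bordism h =>
    obtain ⟨B, ⟨ρ₀⟩, ⟨ρ₁⟩⟩ := h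
    exact SC.HBord.approx ⟨B.E, B.spec, ⟨ρ₀.spec 0 B.toI_eq_zero⟩, ⟨ρ₁.spec 1 B.toI_eq_one⟩⟩
  | thom h => exact h.elim fun m => m.modOf.elim fun μ => μ.approx

theorem Corr.Equivalent.approx {Ψ Ψ' : Corr F X Y} (h : Ψ.Equivalent Ψ') :
    Ψ.spec.Approx Ψ'.spec := by
  induction h with
  | rel _ _ h => exact h.approx
  | refl _ => exact .refl _
  | symm _ _ _ ih => exact ih.symm
  | trans _ _ _ _ _ ih ih' => exact ih.trans ih'

end

end NNSCorr

namespace NNSCorr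

noncomputable section

variable {G : TopGroupoid.{u}} {F : CohTheory.{u, v} G} {X Y : GSpace G}

/-! ## The antipodal map and rotations -/

section Rotation

variable {M : GSpace G}

/-- The antipodal map of a vector bundle. -/
def GVB.neg (V : GVB M) : GMap V.tot V.tot :=
  V.linMap (-1) 0 (GMap.id _) (GMap.id _) fun _ => rfl

theorem GVB.neg_eq (V : GVB M) {x : M} (v : V.Fibre x) : V.neg v.1 = (-v : V.Fibre x).1 :=
  (V.lin_eq (-1) 0 v v rfl).trans (congrArg Subtype.val (by simp))

theorem GVB.proj_neg (V : GVB M) (v : V.tot) : V.proj (V.neg v) = V.proj v := V.proj_lin _ _ _ _ _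

theorem GVB.neg_neg (V : GVB M) (v : V.tot) : V.neg (V.neg v) = v := by
  have h := V.neg_eq (x := V.proj v) ⟨v, rfl⟩
  rw [h, V.neg_eq, _root_.neg_neg]

theorem GVB.neg_eq_lin (V : GVB M) (v w : V.tot) (h : V.proj v = V.proj w) :
    V.neg v = V.lin (-1) 0 v w h := by
  refine (V.neg_eq (x := V.proj w) ⟨v, h⟩).trans
    (Eq.trans (congrArg Subtype.val ?_) (V.lin_eq (-1) 0 (x := V.proj w) ⟨v, h⟩ ⟨w, rfl⟩ h).symm)
  simp

theorem GVB.isLin_neg (V : GVB M) : V.IsLin V V.neg := fun a b v w h => by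
  refine ⟨by rw [V.proj_neg, V.proj_neg, h], ?_⟩
  let v' : V.Fibre (V.proj w) := ⟨v, h⟩
  let w' : V.Fibre (V.proj w) := ⟨w, rfl⟩
  have e₁ : V.neg (V.lin a b v w h) = (-(a • v' + b • w')).1 := V.neg_eq (a • v' + b • w')
  have e₂ : V.neg v = (-v').1 := V.neg_eq v'
  have e₃ : V.neg w = (-w').1 := V.neg_eq w'
  have e₄ : V.proj (-v').1 = V.proj (-w').1 := (-v').2.trans (-w').2.symm
  refine e₁.trans (Eq.trans ?_ ((V.lin_congr e₄ rfl rfl e₂.symm e₃.symm)))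
  refine Eq.trans (congrArg Subtype.val ?_) (V.lin_eq a b (-v') (-w') e₄).symm
  rw [smul_neg, smul_neg]
  abel

theorem GVB.isHomeomorph_neg (V : GVB M) : IsHomeomorph V.neg :=
  isHomeomorph_of_inverse V.neg.continuous V.neg.continuous V.neg_neg V.neg_neg

variable {R T C V : GVB M}

/-- The decomposition `T = V ⊕ C` obtained from `T = C ⊕ V` by a sign change on `V`. -/
def VBSum.negSwap (σ : VBSum T C V) : VBSum T V C :=
  .ofIsLin (V.neg.comp σ.snd) σ.fst (fun v => (V.proj_neg _).trans (σ.proj_snd v)) σ.proj_fst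
    ((V.isHomeomorph_neg.isClosedEmbedding.prodMap .id).comp σ.swap.closedEmb)
    (fun v c h => by
      obtain ⟨t, h₁, h₂⟩ := σ.surj c (V.neg v) (by rw [V.proj_neg, h])
      exact ⟨t, by rw [GMap.comp_apply, h₂, V.neg_neg], h₁⟩)
    (V.isLin_neg.comp σ.isLin_snd) σ.isLin_fst

variable (σ : VBSum T C V) (ρ : VBSum R T V)

theorem proj_rot_aux (r : R.tot) : V.proj (σ.snd (ρ.fst r)) = V.proj (ρ.snd r) :=
  (σ.proj_snd _).trans ((ρ.proj_fst r).trans (ρ.proj_snd r).symm)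

theorem proj_rot_aux₁ (k s : ℝ) (r : R.tot) : C.proj ((σ.fst.comp ρ.fst) r) =
    V.proj (V.linMap k s (σ.snd.comp ρ.fst) ρ.snd (proj_rot_aux σ ρ) r) :=
  (σ.proj_fst _).trans ((ρ.proj_fst r).trans ((ρ.proj_snd r).symm.trans (V.proj_lin _ _ _ _ _).symm))

/-- The rotation of `R = C ⊕ V ⊕ V` in the last two summands. -/
def rotT (k s : ℝ) : GMap R.tot T.tot :=
  σ.lift (σ.fst.comp ρ.fst) (V.linMap k s (σ.snd.comp ρ.fst) ρ.snd (proj_rot_aux σ ρ))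
    (proj_rot_aux₁ σ ρ k s)

theorem fst_rotT (k s : ℝ) (r : R.tot) : σ.fst (rotT σ ρ k s r) = σ.fst (ρ.fst r) :=
  σ.fst_lift _ _ (proj_rot_aux₁ σ ρ k s) r

theorem snd_rotT (k s : ℝ) (r : R.tot) :
    σ.snd (rotT σ ρ k s r) = V.lin k s (σ.snd (ρ.fst r)) (ρ.snd r) (proj_rot_aux σ ρ r) :=
  σ.snd_lift _ _ (proj_rot_aux₁ σ ρ k s) r

theorem proj_rot_aux₂ (k s : ℝ) (r : R.tot) : T.proj (rotT σ ρ k s r) =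
    V.proj (V.linMap (-s) k (σ.snd.comp ρ.fst) ρ.snd (proj_rot_aux σ ρ) r) := by
  rw [← σ.proj_fst, fst_rotT, σ.proj_fst, ρ.proj_fst, ← ρ.proj_snd]
  exact (V.proj_lin _ _ _ _ _).symm

/-- The rotation of `R = C ⊕ V ⊕ V` in the last two summands. -/
def rot (k s : ℝ) : GMap R.tot R.tot :=
  ρ.lift (rotT σ ρ k s) (V.linMap (-s) k (σ.snd.comp ρ.fst) ρ.snd (proj_rot_aux σ ρ))
    (proj_rot_aux₂ σ ρ k s)

theorem fst_rot (k s : ℝ) (r : R.tot) : ρ.fst (rot σ ρ k s r) = rotT σ ρ k s r :=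
  ρ.fst_lift _ _ (proj_rot_aux₂ σ ρ k s) r

theorem snd_rot (k s : ℝ) (r : R.tot) :
    ρ.snd (rot σ ρ k s r) = V.lin (-s) k (σ.snd (ρ.fst r)) (ρ.snd r) (proj_rot_aux σ ρ r) :=
  ρ.snd_lift _ _ (proj_rot_aux₂ σ ρ k s) r

theorem proj_rot (k s : ℝ) (r : R.tot) : R.proj (rot σ ρ k s r) = R.proj r := by
  rw [← ρ.proj_snd, snd_rot, V.proj_lin, ρ.proj_snd]

theorem rot_ext {r r' : R.tot} (h₁ : σ.fst (ρ.fst r) = σ.fst (ρ.fst r'))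
    (h₂ : σ.snd (ρ.fst r) = σ.snd (ρ.fst r')) (h₃ : ρ.snd r = ρ.snd r') : r = r' :=
  ρ.congr_fst (σ.congr_fst h₁ h₂) h₃

theorem rot_one_zero (r : R.tot) : rot σ ρ 1 0 r = r := by
  refine rot_ext σ ρ ?_ ?_ ?_
  · rw [fst_rot, fst_rotT]
  · rw [fst_rot, snd_rotT, V.lin_one_zero]
  · rw [snd_rot]
    exact (V.lin_congr _ neg_zero rfl rfl rfl).trans (V.lin_zero_one _ _ _)

/-- Coefficient matrices multiply to the identity because `k² + s² = 1`. -/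
theorem rot_rot {k s : ℝ} (h : k ^ 2 + s ^ 2 = 1) (r : R.tot) :
    rot σ ρ k (-s) (rot σ ρ k s r) = r := by
  have e₁ : σ.snd (ρ.fst (rot σ ρ k s r)) = _ := (congrArg σ.snd (fst_rot σ ρ k s r)).trans
    (snd_rotT σ ρ k s r)
  have e₂ := snd_rot σ ρ k s r
  have hp := proj_rot_aux σ ρ (rot σ ρ k s r)
  have hp' : V.proj (V.lin k s (σ.snd (ρ.fst r)) (ρ.snd r) (proj_rot_aux σ ρ r)) =
    V.proj (V.lin (-s) k (σ.snd (ρ.fst r)) (ρ.snd r) (proj_rot_aux σ ρ r)) := by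
    rw [V.proj_lin, V.proj_lin]
  refine rot_ext σ ρ ?_ ?_ ?_
  · rw [fst_rot, fst_rotT, fst_rot, fst_rotT]
  · rw [fst_rot, snd_rotT]
    refine (V.lin_congr hp rfl rfl e₁ e₂).trans ((V.lin_lin _ _ _ _ _ _ _ _ _ hp').trans ?_)
    refine (V.lin_congr _ (a' := 1) (b' := 0) ?_ ?_ rfl rfl).trans (V.lin_one_zero _ _ _)
    · linarith
    · ring
  · rw [snd_rot]
    refine (V.lin_congr hp rfl rfl e₁ e₂).trans ((V.lin_lin _ _ _ _ _ _ _ _ _ hp').trans ?_)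
    refine (V.lin_congr _ (a' := 0) (b' := 1) ?_ ?_ rfl rfl).trans (V.lin_zero_one _ _ _)
    · ring
    · linarith

theorem continuous_rot {S : Type*} [TopologicalSpace S] {k s : S → ℝ} (hk : Continuous k)
    (hs : Continuous s) : Continuous fun x : R.tot × S => rot σ ρ (k x.2) (s x.2) x.1 := by
  have h₁ : Continuous fun x : R.tot × S => σ.snd (ρ.fst x.1) :=
    σ.snd.continuous.comp (ρ.fst.continuous.comp continuous_fst)
  have h₂ : Continuous fun x : R.tot × S => ρ.snd x.1 := ρ.snd.continuous.comp continuous_fst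
  refine ρ.closedEmb.isInducing.continuous_iff.2 (Continuous.prodMk
    (σ.closedEmb.isInducing.continuous_iff.2 (Continuous.prodMk ?_ ?_)) ?_)
  · simp only [fst_rot, fst_rotT]
    exact σ.fst.continuous.comp (ρ.fst.continuous.comp continuous_fst)
  · simp only [fst_rot, snd_rotT]
    exact V.continuous_lin (hk.comp continuous_snd) (hs.comp continuous_snd) h₁ h₂ _
  · simp only [snd_rot]
    exact V.continuous_lin (hs.comp continuous_snd).neg (hk.comp continuous_snd) h₁ h₂ _

theorem rot_rot' {k s : ℝ} (h : k ^ 2 + s ^ 2 = 1) (r : R.tot) :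
    rot σ ρ k s (rot σ ρ k (-s) r) = r := by
  have := rot_rot σ ρ (k := k) (s := -s) (by rw [neg_sq, h]) r
  rwa [_root_.neg_neg] at this

theorem isHomeomorph_rot {k s : ℝ} (h : k ^ 2 + s ^ 2 = 1) : IsHomeomorph (rot σ ρ k s) :=
  isHomeomorph_of_inverse (rot σ ρ k s).continuous (rot σ ρ k (-s)).continuous (rot_rot σ ρ h) (rot_rot' σ ρ h)

/-- The quarter turn. -/
def turnCos (t : unitInterval) : ℝ := Real.cos (Real.pi / 2 * t)
def turnSin (t : unitInterval) : ℝ := Real.sin (Real.pi / 2 * t)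

theorem continuous_turnCos : Continuous turnCos := Real.continuous_cos.comp (by fun_prop)
theorem continuous_turnSin : Continuous turnSin := Real.continuous_sin.comp (by fun_prop)
theorem turn_sq (t : unitInterval) : turnCos t ^ 2 + turnSin t ^ 2 = 1 := Real.cos_sq_add_sin_sq _
theorem turnCos_zero : turnCos 0 = 1 := by simp [turnCos]
theorem turnSin_zero : turnSin 0 = 0 := by simp [turnSin]
theorem turnCos_one : turnCos 1 = 0 := by simp [turnCos]
theorem turnSin_one : turnSin 1 = 1 := by simp [turnSin]

theorem fst_assoc_negSwap (r : R.tot) :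
    (ρ.assoc σ.negSwap σ).fst r = V.neg (σ.snd (ρ.fst r)) := rfl

/-- The quarter turn sends `(c, v, w)` in `C ⊕ V ⊕ V` to `(c, w, -v)`, which are the coordinates of
the regrouping through `negSwap`. -/
theorem rotT_zero_one (r : R.tot) : rotT σ ρ 0 1 r = (ρ.assoc σ.negSwap σ).snd r := by
  refine σ.congr_fst ?_ ?_
  · rw [fst_rotT]
    exact (ρ.assoc_snd_fst σ.negSwap σ r).symm
  · rw [snd_rotT, V.lin_zero_one]
    exact (ρ.assoc_snd_snd σ.negSwap σ r).symm

theorem snd_rot_zero_one (r : R.tot) :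
    ρ.snd (rot σ ρ 0 1 r) = (ρ.assoc σ.negSwap σ).fst r := by
  rw [snd_rot, fst_assoc_negSwap]
  exact (V.neg_eq_lin _ _ _).symm

/-- If the product of `τC` and `τV` is even, then the sign from the permutation of the factors is
the one of the antipodal map of `V`. -/
theorem CohTheory.sumClass_negSwap {τC : F.CohC C.proj} {τV : F.CohC V.proj}
    (hV : F.IsOrientation V τV) (he : F.IsEven (F.sumClass σ τC τV)) :
    F.sumClass σ.negSwap τV τC = F.sumClass σ τC τV := by
  -- A further factor `τV` may be multiplied on, since it cancels by the Thom isomorphism. This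
  -- provides the second copy of `V` needed to rotate.
  let ρ : VBSum (T.sum V) T V := GVB.sumVBSum T V
  let σ' := ρ.assoc σ.negSwap σ
  refine (F.bijective_thom_bundle ρ hV (b := T.proj) (c := (T.sum V).proj)
    fun v => (ρ.proj_fst v).symm).1 ?_
  change F.sumClass ρ (F.sumClass σ.negSwap τV τC) τV = F.sumClass ρ (F.sumClass σ τC τV) τV
  -- Evenness of `τ = τC · τV` moves it behind `τV`. Both sides are now products `τV · τ`, for two
  -- decompositions of `C ⊕ V ⊕ V` as `V ⊕ T`.
  have e₁ : F.sumClass ρ (F.sumClass σ τC τV) τV =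
      F.sumClass ρ.swap τV (F.sumClass σ τC τV) := (F.sumClass_comm ρ.swap τV he).symm
  rw [F.sumClass_assoc ρ σ.negSwap σ, e₁]
  generalize F.sumClass σ τC τV = τ
  have hb : ∀ x, (VBSq.refl V).base x = (VBSq.refl T).base x := fun _ => rfl
  -- The automorphism of `C ⊕ V ⊕ V` that carries one decomposition to the other. It is the quarter
  -- turn, which is joined to the identity by rotations over the base, so it acts trivially on
  -- classes.
  let φ := σ'.mapSq ρ.swap (.refl V) (.refl T) hb
  have hφ₁ : ∀ r, ρ.snd (φ.top r) = σ'.fst r := fun r => VBSum.mapSq_fst σ' ρ.swap _ _ hb r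
  have hφ₂ : ∀ r, ρ.fst (φ.top r) = σ'.snd r := fun r => VBSum.mapSq_snd σ' ρ.swap _ _ hb r
  have e₂ := F.pull_sumClass ρ.swap σ' φ (.refl V) (.refl T) (fun r => (hφ₁ r).symm)
    (fun r => (hφ₂ r).symm) τV τ
  rw [F.pull_eq_self (.refl V) fun _ => rfl, F.pull_eq_self (.refl T) fun _ => rfl] at e₂
  refine e₂.symm.trans ?_
  have hh : ∀ t, IsHomeomorph (rot σ ρ (turnCos t) (turnSin t)) := fun t =>
    isHomeomorph_rot σ ρ (turn_sq t)
  have hp : ∀ t, Pullable (T.sum V).proj (T.sum V).proj (rot σ ρ (turnCos t) (turnSin t)) :=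
    fun t => pullable_isHomeomorph (hh t) fun x => (proj_rot σ ρ _ _ x).symm
  have e₃ := F.pullG_isotopy (fun t => rot σ ρ (turnCos t) (turnSin t))
    (fun t => rot σ ρ (turnCos t) (-turnSin t))
    (continuous_rot σ ρ continuous_turnCos continuous_turnSin)
    (continuous_rot σ ρ continuous_turnCos continuous_turnSin.neg)
    (fun t => rot_rot σ ρ (turn_sq t)) (fun t => proj_rot σ ρ _ _) (hp 0) (hp 1)
    (F.sumClass ρ.swap τV τ)
  rw [F.pullG_eq_self (hp 0) fun x => by
    simp only [turnCos_zero, turnSin_zero, rot_one_zero]] at e₃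
  refine Eq.trans ?_ e₃.symm
  refine F.pullG_congr φ.pullable (hp 1) (fun r => ?_) _
  simp only [turnCos_one, turnSin_one]
  refine ρ.congr_fst ?_ ?_
  · rw [hφ₂, fst_rot, rotT_zero_one]
  · rw [hφ₁, snd_rot_zero_one]

end Rotation

end

end NNSCorr

namespace NNSCorr

noncomputable section

variable {G : TopGroupoid.{u}} {F : CohTheory.{u, v} G} {X Y : GSpace G}

/-! ## Zero bundles -/

section Zero

variable {N M : GSpace G}

theorem OVB.IsZero.isEven {V : OVB F M} (h : V.IsZero) : F.IsEven V.orient :=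
  V.isEven fun x => by
    have := h.1 x
    have e : V.rank x = 0 := Module.finrank_zero_of_subsingleton
    rw [e]
    exact Even.zero

/-- A map of zero bundles. -/
def OVB.IsZero.osq {V' : OVB F N} {V : OVB F M} (h' : V'.IsZero) (h : V.IsZero) (f : GMap N M) :
    OSq V' V :=
  let s : VBSq V'.toGVB V.toGVB := .ofIsLin f
    ((V.proj.symm h.isHomeomorph).comp (f.comp V'.proj))
    (fun v => (GMap.apply_symm _ _ _).symm)
    (isClosedEmbedding_of_comp (V'.proj.continuous.prodMk (GMap.continuous _)) continuous_fst
      h'.isHomeomorph.isClosedEmbedding)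
    (fun n v e => by
      obtain ⟨v', rfl⟩ := h'.isHomeomorph.surjective n
      exact ⟨v', rfl, h.isHomeomorph.injective ((GMap.apply_symm _ _ _).trans e)⟩)
    (fun a b v w e => by
      have e' := congrArg ((V.proj.symm h.isHomeomorph).comp f) e
      refine ⟨congrArg V.proj e', h.isHomeomorph.injective ?_⟩
      rw [V.proj_lin]
      exact congrArg (fun x => V.proj ((V.proj.symm h.isHomeomorph).comp f x)) (V'.proj_lin a b v w e))
  ⟨s, by
    obtain ⟨-, A', hA', e'⟩ := h'
    obtain ⟨-, A, hA, e⟩ := h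
    rw [e, e']
    exact (F.pullG_unitClass s.pullable A hA A' hA').symm⟩

/-- A bundle as the sum of the zero bundle and itself. -/
def OVB.IsZero.osum {V₀ : OVB F M} (h : V₀.IsZero) (V : OVB F M) : OSum V V₀ V :=
  let σ : VBSum V.toGVB V₀.toGVB V.toGVB := .ofIsLin
    ((V₀.proj.symm h.isHomeomorph).comp V.proj) (GMap.id _)
    (fun v => GMap.apply_symm _ _ _) (fun _ => rfl)
    (isClosedEmbedding_of_comp ((GMap.continuous _).prodMk continuous_id) continuous_snd .id)
    (fun v₁ v₂ e => ⟨v₂, h.isHomeomorph.injective ((GMap.apply_symm _ _ _).trans e.symm), rfl⟩)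
    (fun a b v w e => by
      have e' := congrArg (V₀.proj.symm h.isHomeomorph) e
      refine ⟨congrArg V₀.proj e', h.isHomeomorph.injective ?_⟩
      rw [V₀.proj_lin]
      exact congrArg (fun x => V₀.proj (V₀.proj.symm h.isHomeomorph x)) (V.proj_lin a b v w e))
    (GVB.isLin_id _)
  ⟨σ, by
    have he := h.isEven
    refine Eq.trans ?_ (F.sumClass_comm σ.swap V.orient he)
    obtain ⟨-, A, hA, e⟩ := h
    have hp : Pullable V.proj V.proj σ.swap.fst := pullable_isHomeomorph (f := GMap.id V.tot) .id
      fun _ => rfl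
    have e₁ : F.pull σ.swap.sq V₀.orient = F.unitClass (A.pre σ.swap.sq.pullable)
        (by change _ ⁻¹' A.carrier = univ; rw [hA, preimage_univ]) := by
      rw [e]
      exact F.pullG_unitClass _ A hA _ _
    have e₂ : F.sumClass σ.swap V.orient V₀.orient = F.pullG hp V.orient := by
      unfold CohTheory.sumClass
      rw [e₁]
      exact F.thom_unitClass _ _ _ hp V.orient
    exact (e₂.trans (F.pullG_eq_self hp (fun _ => rfl) _)).symm⟩

theorem OVB.isSubtrivial_of_osq {V : OVB F M} {E : OVB F (GSpace.base G)} (s : OSq V E) :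
    F.IsSubtrivial V.toGVB :=
  ⟨E, V.toGVB, (OVB.zero F M).toGVB, ⟨s.toVBSq⟩, ⟨((OVB.isZero_zero M).osum V).toVBSum.swap⟩⟩

end Zero

/-! ## Special correspondences and bordisms as correspondences and bordisms -/

def SC.toCorr (S : SC F X Y) : Corr F X Y where
  M := S.P
  b := S.b
  f := ⟨OVB.zero F S.P, OVB.isSubtrivial_zero _, S.E, ⟨S.e, S.y, S.emb⟩⟩
  ξ := S.ξ

theorem SC.isSpecial_toCorr (S : SC F X Y) : S.toCorr.IsSpecial := OVB.isZero_zero _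

def SB.toBordism {E : OVB F (GSpace.base G)} (B : SB E X Y) : Bordism F X Y where
  W := B.W
  b := B.b
  V := OVB.zero F B.W
  subtrivial := OVB.isSubtrivial_zero _
  E := E
  toE := B.e
  toY := B.y
  toI := B.t
  toI_act := B.t_act
  isOpenEmbedding := B.emb
  bd₀ := B.t ⁻¹' {0}
  bd₁ := B.t ⁻¹' {1}
  toI_eq_zero _ := Iff.rfl
  toI_eq_one _ := Iff.rfl
  ξ := B.ξ

def SB.End.restricts {E : OVB F (GSpace.base G)} {B : SB E X Y} {j : unitInterval} {S : SC F X Y}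
    (ε : B.End j S) : B.toBordism.Restricts (B.t ⁻¹' {j}) S.toCorr :=
  let s : OSq (OVB.zero F S.P) (OVB.zero F B.W) := (OVB.isZero_zero _).osq (OVB.isZero_zero _) ε.i
  have hs : ∀ x, s.top x = ε.i x := fun x => (s.comm x).symm
  { i := ε.i
    closedEmb := ε.closedEmb
    range_eq := ε.range_eq
    b_eq := ε.b_eq
    sqV := s
    sqV_base := rfl
    sqE := ε.sqE
    emb_E := fun x => (ε.e_eq x).trans (congrArg B.e (hs x).symm)
    emb_Y := fun x => (ε.y_eq x).trans (congrArg B.y (hs x).symm)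
    ξ_eq := ε.ξ_eq _ }

theorem SC.HBord.speciallyBordant {S S' : SC F X Y} (h : S.HBord S') :
    S.toCorr.SpeciallyBordant S'.toCorr := by
  obtain ⟨E, B, ⟨ε₀⟩, ⟨ε₁⟩⟩ := h
  exact ⟨B.toBordism, OVB.isZero_zero _, ⟨ε₀.restricts⟩, ⟨ε₁.restricts⟩⟩

/-- Thom modifications of `spec Ψ` are Thom modifications of the special correspondence `Ψ`. -/
def SC.ModOf.specialThomMod {Ψ : Corr F X Y} (hΨ : Ψ.IsSpecial) {U : OVB F (GSpace.base G)}
    {T : SC F X Y} (μ : Ψ.spec.ModOf U T) : Ψ.SpecialThomMod U T.toCorr :=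
  let π := GMap.anchor Ψ.M
  let p : GMap Ψ.spec.P Ψ.M := Ψ.f.V.proj
  have hp : IsHomeomorph p := OVB.IsZero.isHomeomorph hΨ
  let s : OSq μ.UP (U.pull π) := μ.sqU.factor (U.pullSq π) p (anchor_base _ _ _)
  have hs : IsHomeomorph s.top := s.isHomeomorph_top hp
  have hs₁ : ∀ x, (U.pull π).proj (s.top x) = p (μ.UP.proj x) := fun x => (s.comm x).symm
  have hs₂ : ∀ x, (U.pullSq π).top (s.top x) = μ.sqU.top x := fun x =>
    VBSq.top_factor _ (U.pullSq π).toVBSq p (anchor_base _ _ _) x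
  have hv : ∀ (x : T.P) (v : Ψ.f.V.tot),
      Ψ.f.V.proj v = (U.pull π).proj (s.top (μ.i x)) → μ.UP.proj (μ.i x) = v := fun x v e =>
    hp.injective ((hs₁ (μ.i x)).symm.trans e.symm)
  { special := T.isSpecial_toCorr
    UM := U.pull π
    sqU := U.pullSq π
    i := s.top.comp μ.i
    homeo := hs.comp μ.homeo
    b_eq := fun x => (μ.b_eq x).trans (congrArg Ψ.b (hs₁ _).symm)
    sumE := μ.sumE
    emb_fst := fun x v e => (μ.e_fst x).trans (congrArg Ψ.f.emb.toE (hv x v e))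
    emb_snd := fun x => (μ.e_snd x).trans (hs₂ _).symm
    emb_Y := fun x v e => (μ.y_eq x).trans (congrArg Ψ.f.emb.toY (hv x v e))
    ξ_eq := by
      have h₁ : Pullable T.b (Ψ.spec.b.comp μ.UP.proj) μ.i := pullable_isHomeomorph μ.homeo μ.b_eq
      have h₂ : Pullable Ψ.spec.b Ψ.b p := pullable_isHomeomorph hp fun _ => rfl
      have h₃ : Pullable (Ψ.spec.b.comp μ.UP.proj) (Ψ.b.comp (U.pull π).proj) s.top :=
        pullable_isHomeomorph hs fun x => congrArg Ψ.b (hs₁ x).symm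
      have h₄ : Pullable T.b (Ψ.b.comp (U.pull π).proj) (s.top.comp μ.i) := h₃.comp h₁
      have e₁ : Ψ.spec.ξ = F.pullG h₂ Ψ.ξ := OVB.IsZero.thom_eq hΨ (fun _ => rfl) h₂ Ψ.ξ
      have e₂ := F.pullG_thom_orient s h₂ (fun _ => rfl) (fun _ => rfl) h₃ Ψ.ξ
      refine (μ.ξ_eq h₁).trans ?_
      rw [e₁]
      exact (congrArg (F.pullG h₁) e₂.symm).trans (F.pullG_comp h₁ h₃ h₄ (fun _ => rfl) _) }

end

end NNSCorr

namespace NNSCorr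

noncomputable section

variable {G : TopGroupoid.{u}} {F : CohTheory.{u, v} G} {X Y : GSpace G}

/-! ## Every correspondence is equivalent to a special one -/

/-- Every subtrivial oriented bundle has an oriented complement in an even bundle that is pulled
back from the object space. -/
theorem CohTheory.IsSubtrivial.exists_complement {M : GSpace G} {V : OVB F M}
    (h : F.IsSubtrivial V.toGVB) : ∃ (E₂ : OVB F (GSpace.base G)) (T C : OVB F M),
      (∀ z, Even (Module.finrank ℝ (E₂.Fibre z))) ∧ Nonempty (OSq T E₂) ∧ Nonempty (OSum T C V) := by
  obtain ⟨E₀, T₀, W, ⟨s₀⟩, ⟨σ₀⟩⟩ := h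
  -- Doubling makes the rank even. If `V ⊕ W = T₀` is the given decomposition, then `T₀ ⊕ T₀ = V ⊕
  -- (W ⊕ T₀)`, and `W ⊕ T₀` is oriented by two-out-of-three.
  let E₂ := E₀.sum E₀
  let T := E₂.pull (GMap.anchor M)
  let sqT : OSq T E₂ := E₂.pullSq _
  let δ : VBSum T.toGVB T₀ T₀ :=
    (E₀.sumOSum E₀).toVBSum.pull sqT.toVBSq s₀ s₀ (GMap.base_eq _ _) (GMap.base_eq _ _)
  let σ : VBSum T.toGVB (W.sum T₀) V.toGVB := (δ.assoc σ₀ (GVB.sumVBSum W T₀)).swap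
  obtain ⟨n, hn⟩ := V.bounded
  obtain ⟨τ, hτ, e⟩ := T.isOrientation.exists_complement σ V.isOrientation hn
  refine ⟨E₂, T, ⟨W.sum T₀, τ, hτ, ?_⟩, fun z => ?_, ⟨sqT⟩, ⟨⟨σ, e.symm⟩⟩⟩
  · obtain ⟨m, hm⟩ := T.bounded
    refine ⟨m, fun x => le_trans ?_ (hm x)⟩
    exact (Nat.le_add_right _ _).trans_eq (σ.rank_eq x).symm
  · have : E₂.rank z = E₀.rank z + E₀.rank z := (E₀.sumOSum E₀).rank_eq z
    change Even (E₂.rank z)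
    rw [this]
    exact Even.add_self _

/-! ### Rotating a Thom modification into a lifting -/

section Specialise

variable (Ψ : Corr F X Y) {E₂ : OVB F (GSpace.base G)} {T C : OVB F Ψ.M}
  (even : ∀ z, Even (Module.finrank ℝ (E₂.Fibre z))) (sqT : OSq T E₂) (σ : OSum T C Ψ.f.V)

/-- The direct sum `T ⊕ V = C ⊕ V ⊕ V`. -/
def sumR (T : OVB F Ψ.M) : OSum (T.sum Ψ.f.V) T Ψ.f.V := OVB.sumOSum _ _

/-- In coordinates `(c, v, w)` on `C ⊕ V ⊕ V`, the last copy of `V` goes through `f̂` and `(c, v)`,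
as a point of `T`, goes to `E₂`. -/
def specE : GMap (T.sum Ψ.f.V).tot (Ψ.f.E.sum E₂).tot :=
  (Ψ.f.E.sumOSum E₂).lift (Ψ.f.emb.toE.comp (sumR Ψ T).snd) (sqT.top.comp (sumR Ψ T).fst) base_comm

def specY (T : OVB F Ψ.M) : GMap (T.sum Ψ.f.V).tot Y := Ψ.f.emb.toY.comp (sumR Ψ T).snd

theorem specE_fst (r : (T.sum Ψ.f.V).tot) :
    (Ψ.f.E.sumOSum E₂).fst (specE Ψ sqT r) = Ψ.f.emb.toE ((sumR Ψ T).snd r) :=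
  VBSum.fst_lift _ _ _ base_comm r

theorem specE_snd (r : (T.sum Ψ.f.V).tot) :
    (Ψ.f.E.sumOSum E₂).snd (specE Ψ sqT r) = sqT.top ((sumR Ψ T).fst r) :=
  VBSum.snd_lift _ _ _ base_comm r

theorem isOpenEmbedding_specE :
    IsOpenEmbedding (toFibProd (E := (Ψ.f.E.sum E₂).toGVB) (specE Ψ sqT) (specY Ψ T)) := by
  let β : VBSq (sumR Ψ T).toVBSum.swap.bundle E₂.toGVB :=
    sqT.toVBSq.comp (sumR Ψ T).toVBSum.swap.bundleSq
  have h := isOpenEmbedding_mod (J := PUnit.{1}) (Ψ.f.E.sumOSum E₂).toVBSum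
    (sumR Ψ T).snd (sqT.top.comp (sumR Ψ T).fst) β.closedEmb.isEmbedding β.surj_anchor
    (e := Ψ.f.emb.toE) (y := Ψ.f.emb.toY) (t := fun _ => PUnit.unit)
    ((Homeomorph.prodPUnit _).symm.isOpenEmbedding.comp Ψ.f.emb.isOpenEmbedding)
    (e' := specE Ψ sqT) (y' := specY Ψ T) (specE_fst Ψ sqT) (specE_snd Ψ sqT) (fun _ => rfl)
  exact (Homeomorph.prodPUnit _).isOpenEmbedding.comp h

/-- The bundle over `|V|` with total space `|C ⊕ V ⊕ V|`. -/
def specV : OVB F Ψ.f.V.tot :=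
  T.ofSq ((sumR Ψ T).toVBSum.assoc σ.negSwap σ.toVBSum).bundle
    ((sumR Ψ T).toVBSum.assoc σ.negSwap σ.toVBSum).bundleSq

/-- The point `(c, v, w)` lies over `-v` in `|V|` and has the fibre coordinate `(c, w)` in `T`. The
sign is chosen so that the quarter turn puts base point and fibre coordinate in the places required
by a lifting. -/
def specVSq : OSq (specV Ψ σ) T := T.ofSqOSq _ _

theorem specVSq_fst (r : (T.sum Ψ.f.V).tot) :
    σ.fst ((specVSq Ψ σ).top r) = σ.fst ((sumR Ψ T).fst r) :=
  VBSum.assoc_snd_fst _ σ.negSwap σ.toVBSum r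

theorem specVSq_snd (r : (T.sum Ψ.f.V).tot) :
    σ.snd ((specVSq Ψ σ).top r) = (sumR Ψ T).snd r :=
  VBSum.assoc_snd_snd _ σ.negSwap σ.toVBSum r

def specRot (t : unitInterval) : GMap (T.sum Ψ.f.V).tot (T.sum Ψ.f.V).tot :=
  rot σ.toVBSum (sumR Ψ T).toVBSum (turnCos t) (turnSin t)

theorem specRot_zero (r : (T.sum Ψ.f.V).tot) : specRot Ψ σ 0 r = r := by
  unfold specRot
  rw [turnCos_zero, turnSin_zero]
  exact rot_one_zero _ _ r

/-- The family of open embeddings obtained by rotation. -/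
def specEmb (t : unitInterval) : OpenEmb (specV Ψ σ).toGVB (Ψ.f.E.sum E₂).toGVB Y where
  toE := (specE Ψ sqT).comp (specRot Ψ σ t)
  toY := (specY Ψ T).comp (specRot Ψ σ t)
  isOpenEmbedding := (isOpenEmbedding_specE Ψ sqT).comp
    (isHomeomorph_rot σ.toVBSum (sumR Ψ T).toVBSum (turn_sq t)).isOpenEmbedding

theorem isotopic_specEmb : (specEmb Ψ sqT σ 0).Isotopic (specEmb Ψ sqT σ 1) := by
  refine ⟨specEmb Ψ sqT σ, rfl, rfl, ?_⟩
  let σ₀ := σ.toVBSum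
  let ρ₀ := (sumR Ψ T).toVBSum
  let k : (T.sum Ψ.f.V).tot × unitInterval ≃ₜ (T.sum Ψ.f.V).tot × unitInterval :=
    { toFun x := (rot σ₀ ρ₀ (turnCos x.2) (turnSin x.2) x.1, x.2)
      invFun x := (rot σ₀ ρ₀ (turnCos x.2) (-turnSin x.2) x.1, x.2)
      left_inv x := Prod.ext (rot_rot σ₀ ρ₀ (turn_sq x.2) x.1) rfl
      right_inv x := Prod.ext (rot_rot' σ₀ ρ₀ (turn_sq x.2) x.1) rfl
      continuous_toFun :=
        (continuous_rot σ₀ ρ₀ continuous_turnCos continuous_turnSin).prodMk continuous_snd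
      continuous_invFun :=
        (continuous_rot σ₀ ρ₀ continuous_turnCos continuous_turnSin.neg).prodMk continuous_snd }
  exact ((isOpenEmbedding_specE Ψ sqT).prodMap .id).comp k.isOpenEmbedding

theorem specEmb_zero_toE (r : (T.sum Ψ.f.V).tot) : (specEmb Ψ sqT σ 0).toE r = specE Ψ sqT r :=
  congrArg (specE Ψ sqT) (specRot_zero Ψ σ r)

theorem specEmb_zero_toY (r : (T.sum Ψ.f.V).tot) : (specEmb Ψ sqT σ 0).toY r = specY Ψ T r :=
  congrArg (specY Ψ T) (specRot_zero Ψ σ r)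

/-- After the quarter turn `T` carries the fibre coordinate; by the next lemma, the argument of `f̂`
is then the base point. -/
theorem fst_rot_one (r : (T.sum Ψ.f.V).tot) :
    (sumR Ψ T).fst (specRot Ψ σ 1 r) =
      (specVSq Ψ σ).top r := by
  unfold specRot
  rw [turnCos_one, turnSin_one, fst_rot, rotT_zero_one]
  rfl

theorem snd_rot_one (r : (T.sum Ψ.f.V).tot) :
    (sumR Ψ T).snd (specRot Ψ σ 1 r) =
      (specV Ψ σ).proj r := by
  unfold specRot
  rw [turnCos_one, turnSin_one, snd_rot_zero_one]
  rfl

/-- The correspondences on `|V|` that interpolate between the Thom modification along `V` and a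
lifting of the special correspondence. -/
def specCorr (t : unitInterval) : Corr F X Y where
  M := Ψ.f.V.tot
  b := Ψ.b.comp Ψ.f.V.proj
  f := ⟨specV Ψ σ, OVB.isSubtrivial_of_osq (sqT.comp (specVSq Ψ σ)), Ψ.f.E.sum E₂,
    specEmb Ψ sqT σ t⟩
  ξ := F.thom (fun _ => rfl) Ψ.f.V.orient Ψ.ξ

/-- At time `0` the copy of `V` fed into `f̂` is a fibre coordinate, as in a composite with `π_V`.
The complement is taken in the form `negSwap`; its orientation is correct by
`CohTheory.sumClass_negSwap`. -/
def thomMod_specCorr : Ψ.ThomMod (specCorr Ψ sqT σ 0) :=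
  let V := Ψ.f.V
  have he : F.IsEven T.orient := T.isEven fun x => (sqT.rank_eq x).symm ▸ even _
  let σn : OSum T V C := ⟨σ.negSwap, by
    rw [F.sumClass_negSwap σ.toVBSum V.isOrientation (by rw [← σ.orient_eq]; exact he),
      σ.orient_eq]⟩
  let piC := C.pull V.proj
  let piV := V.pull V.proj
  have hb₁ : ∀ x, (C.pullSq V.proj).base x = (specVSq Ψ σ).base x := fun _ => rfl
  have hb₂ : ∀ x, (V.pullSq V.proj).base x = (specVSq Ψ σ).base x := fun _ => rfl
  let sumV : OSum (specV Ψ σ) piC piV := σ.pull (specVSq Ψ σ) (C.pullSq _) (V.pullSq _) hb₁ hb₂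
  have h₁ : ∀ r, (C.pullSq V.proj).top (sumV.fst r) = σ.fst ((sumR Ψ T).fst r) := fun r =>
    (σ.top_pull_fst (specVSq Ψ σ) (C.pullSq _) (V.pullSq _) hb₁ hb₂ r).trans (specVSq_fst Ψ σ r)
  have h₂ : ∀ r, (V.pullSq V.proj).top (sumV.snd r) = (sumR Ψ T).snd r := fun r =>
    (σ.top_pull_snd (specVSq Ψ σ) (C.pullSq _) (V.pullSq _) hb₁ hb₂ r).trans (specVSq_snd Ψ σ r)
  { U := V
    C := C
    T := T
    E₂ := E₂
    even := even
    sqT := sqT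
    sumT := σn
    i := GMap.id _
    homeo := IsHomeomorph.id
    b_eq := fun _ => rfl
    piC := piC
    piV := piV
    sqC := C.pullSq _
    sqC_base := rfl
    sqV := V.pullSq _
    sqV_base := rfl
    sumV := sumV
    sumE := (Ψ.f.E.sumOSum E₂).swap (E₂.isEven even)
    emb_fst := fun r t ht₁ ht₂ => by
      have e : t = (sumR Ψ T).fst r := σ.negSwap.congr_fst ht₁ (ht₂.trans (h₁ r))
      refine (congrArg (Ψ.f.E.sumOSum E₂).snd (specEmb_zero_toE Ψ sqT σ r)).trans ?_
      exact (specE_snd Ψ sqT r).trans (congrArg sqT.top e.symm)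
    emb_snd := fun r => (congrArg (Ψ.f.E.sumOSum E₂).fst (specEmb_zero_toE Ψ sqT σ r)).trans
      ((specE_fst Ψ sqT r).trans (congrArg Ψ.f.emb.toE (h₂ r).symm))
    emb_Y := fun r => (specEmb_zero_toY Ψ sqT σ r).trans (congrArg Ψ.f.emb.toY (h₂ r).symm)
    ξ_eq := (F.pullG_eq_self _ (fun _ => rfl) _).symm }

/-- At time `1` only the base point enters `f̂` and the fibre is sent to `E₂`, so the normal bundle
is that of a lifting of the zero bundle on `|V|`. -/
def lifting_specCorr : Ψ.spec.toCorr.f.Lifting (specCorr Ψ sqT σ 1).f where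
  Eplus := E₂
  T := specV Ψ σ
  sqT := sqT.comp (specVSq Ψ σ)
  sumV := (OVB.isZero_zero _).osum _
  sumE := Ψ.f.E.sumOSum E₂
  emb_fst r := (specE_fst Ψ sqT _).trans (congrArg Ψ.f.emb.toE ((snd_rot_one Ψ σ r).trans
    (((OVB.isZero_zero _).osum (specV Ψ σ)).proj_fst r).symm))
  emb_snd r := (specE_snd Ψ sqT _).trans (congrArg sqT.top (fst_rot_one Ψ σ r))
  emb_Y r := congrArg Ψ.f.emb.toY ((snd_rot_one Ψ σ r).trans
    (((OVB.isZero_zero _).osum (specV Ψ σ)).proj_fst r).symm)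

end Specialise

/-- Three moves: Thom modification along `V`, the rotation isotopy, and removal of a lifting along
`E₂`. -/
theorem Corr.equivalent_spec (Ψ : Corr F X Y) : Ψ.Equivalent Ψ.spec.toCorr := by
  obtain ⟨E₂, T, C, even, ⟨sqT⟩, ⟨σ⟩⟩ := Ψ.f.subtrivial.exists_complement
  refine .trans _ (specCorr Ψ sqT σ 0) _ (.rel _ _ (.thom ⟨thomMod_specCorr Ψ even sqT σ⟩))
    (.trans _ (specCorr Ψ sqT σ 1) _ (.rel _ _ ?_) (.symm _ _ (.rel _ _ ?_)))
  · exact .isotopy _ _ _ _ _ _ _ (isotopic_specEmb Ψ sqT σ) _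
  · exact .lifting _ _ _ _ ⟨lifting_specCorr Ψ sqT σ⟩ _

/-! ## Special Thom modifications -/

/-- A special correspondence is equivalent to its Thom modifications. -/
theorem Corr.SpecialThomMod.equivalent {Ψ Θ : Corr F X Y} {U : OVB F (GSpace.base G)}
    (hΨ : Ψ.IsSpecial) (m : Ψ.SpecialThomMod U Θ) : Ψ.Equivalent Θ := by
  have hΘ : IsHomeomorph Θ.f.V.proj := OVB.IsZero.isHomeomorph m.special
  let j : GMap Θ.f.V.tot m.UM.tot := m.i.comp Θ.f.V.proj
  have hj : IsHomeomorph j := m.homeo.comp hΘ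
  let j' := j.symm hj
  have hj' : ∀ w, m.i (Θ.f.V.proj (j' w)) = w := fun w => j.apply_symm hj w
  have hj'' : ∀ v, j' (j v) = v := fun v => j.symm_apply hj v
  let σ : OSum m.UM Ψ.f.V m.UM := OVB.IsZero.osum hΨ m.UM
  -- The forward map of the lifting of `Ψ` along `U`: the bundle is `U^M`, and the embedding is that
  -- of `Θ`, transported along `|V_Θ| ≅ Θ.M ≅ |U^M|`.
  let f' : NNSMap F Ψ.M Y := {
    V := m.UM
    subtrivial := OVB.isSubtrivial_of_osq m.sqU
    E := Θ.f.E
    emb := ⟨Θ.f.emb.toE.comp j', Θ.f.emb.toY.comp j',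
      Θ.f.emb.isOpenEmbedding.comp (j.isHomeomorph_symm hj).isOpenEmbedding⟩ }
  have hσ : ∀ w, Ψ.f.V.proj (σ.fst w) = m.UM.proj (m.i (Θ.f.V.proj (j' w))) := fun w => by
    rw [hj', σ.proj_fst]
  let l : Ψ.f.Lifting f' := {
    Eplus := U
    T := m.UM
    sqT := m.sqU
    sumV := σ
    sumE := m.sumE
    emb_fst := fun w => m.emb_fst (j' w) (σ.fst w) (hσ w)
    emb_snd := fun w => (m.emb_snd (j' w)).trans (congrArg m.sqU.top (hj' w))
    emb_Y := fun w => m.emb_Y (j' w) (σ.fst w) (hσ w) }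
  let Ψ₁ : Corr F X Y := ⟨Ψ.M, Ψ.b, f', Ψ.ξ⟩
  let s : OSq Θ.f.V (OVB.zero F m.UM.tot) := OVB.IsZero.osq m.special (OVB.isZero_zero _) m.i
  have hs : ∀ v, j' (s.top v) = v := fun v =>
    (congrArg j' (s.comm v).symm).trans (hj'' v)
  -- The special correspondence of the lifting has middle space `|U^M|` and the class `τ(ξ)`, which
  -- is the description of `Θ`.
  let φ : Θ.Iso Ψ₁.spec.toCorr := {
    i := m.i
    homeo := m.homeo
    b_eq := m.b_eq
    sqV := s
    sqV_base := rfl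
    sqE := .refl _
    emb_E := fun v => (congrArg Θ.f.emb.toE (hs v)).symm
    emb_Y := fun v => (congrArg Θ.f.emb.toY (hs v)).symm
    ξ_eq := m.ξ_eq }
  exact .trans _ Ψ₁ _ (.rel _ _ (.lifting _ _ _ _ ⟨l⟩ _))
    (.trans _ _ _ Ψ₁.equivalent_spec (.symm _ _ (.rel _ _ (.iso ⟨φ⟩))))

/-- Forwards, `spec Ψ` differs from a special `Ψ` only by the homeomorphic projection of its zero
bundle, so the Thom modifications found for `spec` serve for `Ψ` itself. Backwards, a special
bordism is in particular a bordism. -/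
theorem Corr.equivalent_iff {Ψ₁ Ψ₂ : Corr F X Y} (h₁ : Ψ₁.IsSpecial) (h₂ : Ψ₂.IsSpecial) :
    Ψ₁.Equivalent Ψ₂ ↔ ∃ (U₁ U₂ : OVB F (GSpace.base G)) (Θ₁ Θ₂ : Corr F X Y),
      Nonempty (Ψ₁.SpecialThomMod U₁ Θ₁) ∧ Nonempty (Ψ₂.SpecialThomMod U₂ Θ₂) ∧
      Θ₁.SpeciallyBordant Θ₂ := by
  constructor
  · intro h
    obtain ⟨U₁, U₂, T₁, T₂, ⟨μ₁⟩, ⟨μ₂⟩, hT⟩ := h.approx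
    exact ⟨U₁, U₂, _, _, ⟨μ₁.specialThomMod h₁⟩, ⟨μ₂.specialThomMod h₂⟩, hT.speciallyBordant⟩
  · rintro ⟨U₁, U₂, Θ₁, Θ₂, ⟨m₁⟩, ⟨m₂⟩, B, -, hB⟩
    exact .trans _ _ _ (m₁.equivalent h₁)
      (.trans _ _ _ (.rel _ _ (.bordism ⟨B, hB⟩)) (.symm _ _ (m₂.equivalent h₂)))

end

end NNSCorr

theorem mainTheorem6 (G : NNSCorr.TopGroupoid.{u}) (hG : G.NumerablyProper)
    (F : NNSCorr.CohTheory.{u, v} G) (X Y : NNSCorr.GSpace G) :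
    (∀ Ψ : NNSCorr.Corr F X Y, ∃ Ψ' : NNSCorr.Corr F X Y, Ψ'.IsSpecial ∧ Ψ.Equivalent Ψ') ∧
    (∀ Ψ₁ Ψ₂ : NNSCorr.Corr F X Y, Ψ₁.IsSpecial → Ψ₂.IsSpecial →
      (Ψ₁.Equivalent Ψ₂ ↔
        ∃ (U₁ U₂ : NNSCorr.OVB F (NNSCorr.GSpace.base G)) (Θ₁ Θ₂ : NNSCorr.Corr F X Y),
          Nonempty (Ψ₁.SpecialThomMod U₁ Θ₁) ∧ Nonempty (Ψ₂.SpecialThomMod U₂ Θ₂) ∧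
          Θ₁.SpeciallyBordant Θ₂)) := by
  exact ⟨fun Ψ => ⟨Ψ.spec.toCorr, Ψ.spec.isSpecial_toCorr, Ψ.equivalent_spec⟩,
    fun _ _ h₁ h₂ => NNSCorr.Corr.equivalent_iff h₁ h₂⟩
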